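/- Fix $Q,n\in\mathbb N$ and write $\mathcal A_Q(\mathbb R^{n})$ for the space of unordered $Q$-tuples $S=\sum_{i=1}^Q[\![P_i]\!]$ of points of $\mathbb R^{n}$, with $\mathcal G(S,T)=\min_\sigma(\sum_i|P_i-R_{\sigma(i)}|^2)^{1/2}$ for $T=\sum_i[\![R_i]\!]$, $\boldsymbol\eta(S)=\frac1Q\sum_iP_i$, $|S|=(\sum_i|P_i|^2)^{1/2}$, and $S\ominus p=\sum_i[\![P_i-p]\!]$. Let $\mathscr A_Q(\mathbb R^{n})$ be the space of special $Q$-points, that is, of pairs $(S,\varepsilon)$ with $S\in\mathcal A_Q(\mathbb R^{n})$ and $\varepsilon\in\{1,-1\}$, where $(Q[\![p]\!],1)$ and $(Q[\![p]\!],-1)$ are identified for every $p$, with the distance $$\mathcal G_s((S,\varepsilon),(T,\delta))=\begin{cases}\mathcal G(S,T)&\text{if }\varepsilon=\delta,\\ \bigl(|S\ominus\boldsymbol\eta(S)|^2+|T\ominus\boldsymbol\eta(T)|^2+Q|\boldsymbol\eta(S)-\boldsymbol\eta(T)|^2\bigr)^{1/2}&\text{if }\varepsilon\ne\delta.\end{cases}$$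 A map $u$ from an open set $\Omega\subset\mathbb R^2$ to $\mathscr A_Q(\mathbb R^{n})$ is in $W^{1,2}(\Omega)$ if there are $\varphi_1,\varphi_2\in L^2(\Omega)$ such that, for all $T\in\mathscr A_Q(\mathbb R^{n})$, the function $\mathcal G_s(u,T)$ is in $W^{1,2}(\Omega)$ and $|\partial_j\mathcal G_s(u,T)|\le\varphi_j$ a.e.; the smallest such $\varphi_j$ are denoted by $|\partial_ju|$, and $\mathrm{Dir}(u,\Omega)=\int_\Omega(|\partial_1u|^2+|\partial_2u|^2)$. A map $u:\mathbb R^2\to\mathscr A_Q(\mathbb R^{n})$ is a Dir-minimizer if, for every bounded open $\Omega$, it is in $W^{1,2}(\Omega)$ and $\mathrm{Dir}(u,\Omega)\le\mathrm{Dir}(w,\Omega)$ for all $w\in W^{1,2}(\Omega)$ that agree with $u$ a.e. outside a compact subset of $\Omega$. For a map $v=(S(\cdot),\varepsilon(\cdot))$ let $\Omega^\pm$ be the set of points $x$ at which $\varepsilon(x)=\pm1$ and $S(x)$ is not of the form $Q[\![p]\!]$; let $v^\pm=S$ on $\Omega^\pm$ and $v^\pm=Q[\![\boldsymbol\eta\circ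 v]\!]$ elsewhere. A point $x$ is regular for $v$ if in a neighborhood $B$ of $x$ one has $v=(\sum_i[\![v_i]\!],\varepsilon)$ for a constant $\varepsilon$ and analytic $v_1,\dots,v_Q:B\to\mathbb R^{n}$ such that, for all $i,j$, either $v_i\equiv v_j$ on $B$ or $v_i(y)\ne v_j(y)$ for every $y\in B$; $\mathrm{Sing}(v)$ is the set of all points that are not regular. **Theorem.** Let $\alpha\in\mathbb R$, and let $u:\mathbb R^2\to\mathscr A_Q(\mathbb R^{n})$ be a Dir-minimizer that is nontrivial (not a.e. equal to $Q[\![0]\!]$), with $\boldsymbol\eta\circ u=0$ a.e., and radially $\alpha$-homogeneous: writing $u=(S,\varepsilon)$, for every $r>0$ one has $u(rx)=(r^\alpha S(x),\varepsilon(x))$ for a.e. $x$, where $c\sum_i[\![P_i]\!]=\sum_i[\![cP_i]\!]$. Then $u$ has a continuous representative $v$. If for $v$ both regions $\Omega^+$ and $\Omega^-$ are nonempty, then $\alpha$ is a positive integer, and $|v^+|-|v^-|$ is an $\alpha$-homogeneous harmonic polynomial on $\mathbb R^2$ whose nodal set (zero set) is $\mathrm{Sing}(v)$. -/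

import Mathlib

open MeasureTheory Set Filter Topology
open scoped ContDiff ENNReal

noncomputable section

/-! ### Unordered `Q`-tuples -/

/-- The space `𝒜_Q(ℝⁿ)` of `Q`-points: unordered `Q`-tuples `∑ᵢ ⟦Pᵢ⟧` of vectors of `ℝⁿ`. -/
abbrev QPoint (Q n : ℕ) : Type := Sym (EuclideanSpace ℝ (Fin n)) Q

namespace QPoint

variable {Q n : ℕ}

/-- The `Q`-point `∑ᵢ ⟦xᵢ⟧`. -/
def ofTuple (x : Fin Q → EuclideanSpace ℝ (Fin n)) : QPoint Q n :=
  ⟨Finset.univ.val.map x, by simp⟩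

/-- The `Q`-point `Q⟦p⟧`. -/
def diag (Q : ℕ) {n : ℕ} (p : EuclideanSpace ℝ (Fin n)) : QPoint Q n :=
  Sym.replicate Q p

/-- The barycenter `η(S) = Q⁻¹ ∑ᵢ Pᵢ` of `S = ∑ᵢ ⟦Pᵢ⟧`. -/
def center (S : QPoint Q n) : EuclideanSpace ℝ (Fin n) :=
  (Q : ℝ)⁻¹ • (S : Multiset (EuclideanSpace ℝ (Fin n))).sum

/-- `|S| = (∑ᵢ |Pᵢ|²)^{1/2}` for `S = ∑ᵢ ⟦Pᵢ⟧`. -/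
def size (S : QPoint Q n) : ℝ :=
  √((S : Multiset (EuclideanSpace ℝ (Fin n))).map (fun p => ‖p‖ ^ 2)).sum

/-- The `Q`-point `c S = ∑ᵢ ⟦c Pᵢ⟧`. -/
def scale (c : ℝ) (S : QPoint Q n) : QPoint Q n := Sym.map (fun p => c • p) S

/-- The translated `Q`-point `S ⊖ p = ∑ᵢ ⟦Pᵢ - p⟧`. -/
def translate (S : QPoint Q n) (p : EuclideanSpace ℝ (Fin n)) : QPoint Q n :=
  Sym.map (fun a => a - p) S

/-- The distance `𝒢(S, T)`: the minimum of `(∑ᵢ |xᵢ - yᵢ|²)^{1/2}` over all orderings `x` of `S`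
and `y` of `T`. -/
def dist (S T : QPoint Q n) : ℝ :=
  sInf {d : ℝ | ∃ x y : Fin Q → EuclideanSpace ℝ (Fin n),
    ofTuple x = S ∧ ofTuple y = T ∧ d = √(∑ i, ‖x i - y i‖ ^ 2)}

end QPoint

/-! ### Special `Q`-points -/

/-- `(S, ε)` and `(T, δ)` are identified when they are equal, and when `S = T = Q⟦p⟧` for
some `p` (whatever the signs are). -/
def specialSetoid (Q n : ℕ) : Setoid (QPoint Q n × ℤˣ) where
  r a b := a.1 = b.1 ∧ (a.2 = b.2 ∨ ∃ p, a.1 = QPoint.diag Q p)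
  iseqv :=
    { refl := fun _ => ⟨rfl, Or.inl rfl⟩
      symm := by
        rintro ⟨S, ε⟩ ⟨T, δ⟩ ⟨h, h'⟩
        simp only at h h'
        subst h
        exact ⟨rfl, h'.imp Eq.symm id⟩
      trans := by
        rintro ⟨S, ε⟩ ⟨T, δ⟩ ⟨U, γ⟩ ⟨h, h'⟩ ⟨k, k'⟩
        simp only at h h' k k'
        subst h
        subst k
        refine ⟨rfl, ?_⟩
        rcases h' with h' | h'
        · rcases k' with k' | k'
          · exact Or.inl (h'.trans k')
          · exact Or.inr k'
        · exact Or.inr h' }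

/-- The space of special `Q`-points of `ℝⁿ`: two copies of `𝒜_Q(ℝⁿ)`, labelled by a sign
`+1` or `-1`, glued along the `Q`-points of the form `Q⟦p⟧`. -/
def SpecialQPoint (Q n : ℕ) : Type := Quotient (specialSetoid Q n)

namespace SpecialQPoint

variable {Q n : ℕ}

/-- The special `Q`-point represented by `(S, ε)`. -/
def mk (S : QPoint Q n) (ε : ℤˣ) : SpecialQPoint Q n := Quotient.mk (specialSetoid Q n) (S, ε)

/-- The underlying `Q`-point `S` of `(S, ε)`. -/
def toQPoint (A : SpecialQPoint Q n) : QPoint Q n :=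
  Quotient.lift Prod.fst (fun _ _ (h : _ ∧ _) => h.1) A

/-- The barycenter `η(A)`. -/
def center (A : SpecialQPoint Q n) : EuclideanSpace ℝ (Fin n) := A.toQPoint.center

/-- The origin `Q⟦0⟧` (for which the sign is immaterial). -/
def origin (Q n : ℕ) : SpecialQPoint Q n := mk (QPoint.diag Q 0) 1

/-- `A` has a representative with sign `ε`. -/
def HasSign (A : SpecialQPoint Q n) (ε : ℤˣ) : Prop := ∃ S, A = mk S ε

/-- `A = (S, ε)` is not of the form `Q⟦p⟧` and its sign is `ε`. -/
def IsProper (A : SpecialQPoint Q n) (ε : ℤˣ) : Prop :=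
  A.HasSign ε ∧ ∀ p, A.toQPoint ≠ QPoint.diag Q p

open Classical in
/-- The part of sign `ε` of `A`: it is `S` if `A = (S, ε)`, and `Q⟦η(A)⟧` otherwise. -/
def part (ε : ℤˣ) (A : SpecialQPoint Q n) : QPoint Q n :=
  if A.HasSign ε then A.toQPoint else QPoint.diag Q A.center

/-- The special `Q`-point `c (S, ε) = (c S, ε)`. -/
def scale (c : ℝ) (A : SpecialQPoint Q n) : SpecialQPoint Q n :=
  Quotient.map' (s₁ := specialSetoid Q n) (s₂ := specialSetoid Q n)
    (fun a => (QPoint.scale c a.1, a.2))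
    (by
      rintro ⟨S, ε⟩ ⟨T, δ⟩ ⟨h, h'⟩
      simp only at h h'
      subst h
      refine ⟨rfl, h'.imp id ?_⟩
      rintro ⟨p, rfl⟩
      refine ⟨c • p, ?_⟩
      simp only [QPoint.scale, QPoint.diag]
      apply Sym.ext
      rw [Sym.coe_map, Sym.coe_replicate, Sym.coe_replicate, Multiset.map_replicate]) A

open Classical in
/-- The distance on special `Q`-points: `𝒢(S, T)` between `(S, ε)` and `(T, ε)`, and
`(|S ⊖ η(S)|² + |T ⊖ η(T)|² + Q |η(S) - η(T)|²)^{1/2}` between `(S, ε)` and `(T, -ε)`. -/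
def dist (A B : SpecialQPoint Q n) : ℝ :=
  if ∃ ε, A.HasSign ε ∧ B.HasSign ε then QPoint.dist A.toQPoint B.toQPoint
  else √((A.toQPoint.translate A.center).size ^ 2 + (B.toQPoint.translate B.center).size ^ 2
    + (Q : ℝ) * ‖A.center - B.center‖ ^ 2)

end SpecialQPoint

/-! ### Sobolev maps, Dirichlet energy, minimizers -/

/-- On the open set `Ω`, the function `g` is the weak `j`-th partial derivative of `f`. -/
def HasWeakPartial {m : ℕ} (Ω : Set (EuclideanSpace ℝ (Fin m))) (j : Fin m)
    (f g : EuclideanSpace ℝ (Fin m) → ℝ) : Prop :=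
  LocallyIntegrableOn f Ω ∧ LocallyIntegrableOn g Ω ∧
    ∀ ψ : EuclideanSpace ℝ (Fin m) → ℝ, ContDiff ℝ ∞ ψ → HasCompactSupport ψ → tsupport ψ ⊆ Ω →
      ∫ x in Ω, f x * fderiv ℝ ψ x (EuclideanSpace.single j 1) = -∫ x in Ω, g x * ψ x

namespace SpecialQMap

variable {Q m n : ℕ}

/-- `φ` shows that `u` belongs to `W^{1,2}(Ω)`: all functions `x ↦ 𝒢_s(u(x), T)` are in
`W^{1,2}(Ω)`, and the `φ j` are square integrable functions, independent of `T`, which bound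
their `j`-th partial derivatives. -/
def IsGradientBound (u : EuclideanSpace ℝ (Fin m) → SpecialQPoint Q n)
    (Ω : Set (EuclideanSpace ℝ (Fin m))) (φ : Fin m → EuclideanSpace ℝ (Fin m) → ℝ) : Prop :=
  (∀ j, MemLp (φ j) 2 (volume.restrict Ω)) ∧
    ∀ T : SpecialQPoint Q n, MemLp (fun x => (u x).dist T) 2 (volume.restrict Ω) ∧
      ∀ j, ∃ g, HasWeakPartial Ω j (fun x => (u x).dist T) g ∧
        ∀ᵐ x ∂volume.restrict Ω, |g x| ≤ φ j x

/-- The Sobolev space `W^{1,2}(Ω)` of special `Q`-valued maps. -/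
def MemW12 (u : EuclideanSpace ℝ (Fin m) → SpecialQPoint Q n)
    (Ω : Set (EuclideanSpace ℝ (Fin m))) : Prop :=
  ∃ φ, IsGradientBound u Ω φ

/-- The Dirichlet energy `∫_Ω ∑ⱼ |∂ⱼu|²`, where the `|∂ⱼu|` are the smallest functions that
satisfy `IsGradientBound`; it is therefore the least value of `∫_Ω ∑ⱼ φⱼ²`. It is infinite
if `u` is not in `W^{1,2}(Ω)`. -/
def energy (u : EuclideanSpace ℝ (Fin m) → SpecialQPoint Q n)
    (Ω : Set (EuclideanSpace ℝ (Fin m))) : ℝ≥0∞ :=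
  ⨅ (φ : Fin m → EuclideanSpace ℝ (Fin m) → ℝ) (_ : IsGradientBound u Ω φ),
    ∑ j, ∫⁻ x in Ω, ENNReal.ofReal (φ j x ^ 2)

/-- `u` is a Dir-minimizer on the whole space: it is in `W^{1,2}(Ω)` for every bounded open set
`Ω`, and there its energy does not exceed the energy of any `w ∈ W^{1,2}(Ω)` which agrees with
`u` near the boundary of `Ω`. -/
def IsDirMinimizer (u : EuclideanSpace ℝ (Fin m) → SpecialQPoint Q n) : Prop :=
  ∀ Ω : Set (EuclideanSpace ℝ (Fin m)), IsOpen Ω → Bornology.IsBounded Ω →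
    MemW12 u Ω ∧
      ∀ w : EuclideanSpace ℝ (Fin m) → SpecialQPoint Q n, MemW12 w Ω →
        (∃ K, IsCompact K ∧ K ⊆ Ω ∧ ∀ᵐ x, x ∈ Ω \ K → w x = u x) →
          energy u Ω ≤ energy w Ω

/-- `u` is radially `α`-homogeneous: `u(r x) = r^α u(x)` for every `r > 0` (as for all Sobolev
maps, up to a null set of `x`). -/
def IsRadiallyHomogeneous (u : EuclideanSpace ℝ (Fin m) → SpecialQPoint Q n) (α : ℝ) : Prop :=
  ∀ r : ℝ, 0 < r → ∀ᵐ x, u (r • x) = (u x).scale (r ^ α)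

/-- Continuity with respect to the distance of special `Q`-points. -/
def IsContinuous (u : EuclideanSpace ℝ (Fin m) → SpecialQPoint Q n) : Prop :=
  ∀ x, Tendsto (fun y => (u y).dist (u x)) (𝓝 x) (𝓝 0)

/-- The positive region (`ε = 1`) and the negative region (`ε = -1`) of `u`: the set of points
where `u` has the sign `ε` and is not of the form `Q⟦p⟧`. -/
def region (u : EuclideanSpace ℝ (Fin m) → SpecialQPoint Q n) (ε : ℤˣ) :
    Set (EuclideanSpace ℝ (Fin m)) :=
  {x | (u x).IsProper ε}

/-- `x` is a regular point of `u`: in a neighborhood `B` of `x`, the map `u` has a constant sign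
and consists of `Q` analytic sheets, any two of which are identical or disjoint over `B`. -/
def IsRegularPoint (u : EuclideanSpace ℝ (Fin m) → SpecialQPoint Q n)
    (x : EuclideanSpace ℝ (Fin m)) : Prop :=
  ∃ B : Set (EuclideanSpace ℝ (Fin m)), IsOpen B ∧ x ∈ B ∧
    ∃ (ε : ℤˣ) (f : Fin Q → EuclideanSpace ℝ (Fin m) → EuclideanSpace ℝ (Fin n)),
      (∀ i, AnalyticOnNhd ℝ (f i) B) ∧
      (∀ y ∈ B, u y = SpecialQPoint.mk (QPoint.ofTuple fun i => f i y) ε) ∧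
      ∀ i j, (∀ y ∈ B, f i y = f j y) ∨ (∀ y ∈ B, f i y ≠ f j y)

/-- The singular set `Sing(u)`: the complement of the set of regular points. -/
def singularSet (u : EuclideanSpace ℝ (Fin m) → SpecialQPoint Q n) :
    Set (EuclideanSpace ℝ (Fin m)) :=
  {x | ¬ IsRegularPoint u x}

end SpecialQMap

end

/-! The distance of special `Q`-points obeys a law of cosines (`SpecialQPoint.dist_scale_sq`), so
the space is a metric cone with apex `Q⟦0⟧`. A homogeneous map is then `(t, θ) ↦ exp (α t) · g θ` in
logarithmic polar coordinates, for a curve `g` on the circle. These coordinates are conformal, and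
the energy density becomes `exp (2αt) (α² |g|² + s²)`, where `s` is the metric speed of `g`.

The energy is defined through weak derivatives of distance functions, and two comparisons make it
computable. A competitor with an explicit metric speed has at most the expected energy
(`PlaneChart.exists_gradientBound`, by integration by parts in a chart). The homogeneous map has at
least the expected energy (`IsGradientBound.lintegral_polar_le`, by difference quotients and Fatou).
Gradient bounds integrated along rotations show that almost every circle carries a curve of
integrable speed; homogeneity turns one such circle into the whole map (`exists_polar_slice`).
Finite energy near the origin excludes `α < 0` and forces a constant map when `α = 0`
(`exists_representative`).

Let `α > 0` and `h = |g|²`. Multiplying the map by `1 + τξ` gives the weak equation `h'' = 2s² -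
2α²h` (`outer_variation`). Shearing the angle gives that `α²h + s²` is a constant `K`
(`inner_variation`). Together `h'' = 2K - 4α²h`. If both regions are nonempty, the signed size `|g⁺|
- |g⁻|` is continuous along the circle and changes sign, so `g` vanishes at some `c`. Since `h ≥ 0`,
also `h'(c) = 0`, and the equation leaves only `h = (K/α²) sin² (α(θ - c))`. Consequently `s² = K
cos² (α(θ - c))`, that is, `s` is the absolute rate of change of `|g|`. A curve in a cone with this
property moves along a ray, so between consecutive zeros `g` is a fixed `Q`-point of size one times
`β |sin (α(θ - c))|` (`exists_arc`).

Consecutive arcs carry opposite signs (`not_same_sign`). If two of them had the same sign, both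
would lie in a single copy of the space of `Q`-points. Since the barycenters vanish, their
directions can be ordered as tuples `x`, `y` with nonnegative inner product. Near the common zero
the map is `φ⁻ x + φ⁺ y` with `φ` harmonic, and adding `τξ` to both coefficients changes the energy
to first order by a nonzero multiple of the jump of the normal derivative of `|φ|`, contrary to
minimality. Between opposite signs there is no such competitor.

As `g` is `2π`-periodic, `2α` is an integer, namely the number of arcs. Alternation of signs makes
that number even, so `α = k` is an integer (`exists_sectors`). The signed size is now `± β r^k sin
(k(θ - c)) = Im (w z^k)`, a homogeneous harmonic polynomial. Where it does not vanish, the sheets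
are fixed vectors times this polynomial up to sign, hence analytic and pairwise equal or disjoint.
At a zero a regular neighborhood would have a constant sign, while the polynomial changes sign
there. -/

noncomputable section

/-! ### Orderings and the polarized distance of `Q`-points -/

namespace QPoint

variable {Q n : ℕ}

theorem exists_ofTuple (S : QPoint Q n) : ∃ x, ofTuple x = S := by
  obtain ⟨m, hm⟩ := S
  induction m using Quotient.inductionOn with
  | h l =>
    simp only [Multiset.quot_mk_to_coe, Multiset.coe_card] at hm
    subst hm
    refine ⟨l.get, Subtype.ext ?_⟩
    simp only [ofTuple, Fin.univ_def, Multiset.map_coe, Multiset.quot_mk_to_coe]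
    rw [List.map_get_finRange]

theorem coe_ofTuple (x : Fin Q → EuclideanSpace ℝ (Fin n)) :
    ((ofTuple x : QPoint Q n) : Multiset (EuclideanSpace ℝ (Fin n))) = Finset.univ.val.map x := rfl

theorem ofTuple_comp (x : Fin Q → EuclideanSpace ℝ (Fin n)) (σ : Equiv.Perm (Fin Q)) :
    ofTuple (fun i => x (σ i)) = ofTuple x := by
  refine Subtype.ext ?_
  change Finset.univ.val.map (x ∘ σ) = Finset.univ.val.map x
  rw [← Multiset.map_map]
  congr 1
  exact congrArg Finset.val (Finset.map_univ_equiv σ)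

theorem ofTuple_eq_iff {x y : Fin Q → EuclideanSpace ℝ (Fin n)} :
    ofTuple x = ofTuple y ↔ ∃ σ : Equiv.Perm (Fin Q), ∀ i, x i = y (σ i) := by
  constructor
  · intro h
    have hc : ∀ v, Fintype.card {i // x i = v} = Fintype.card {i // y i = v} := by
      classical
      intro v
      have h1 := congrArg (Multiset.count v) (congrArg Subtype.val h)
      simp only [ofTuple, Multiset.count_map] at h1
      rw [Fintype.card_subtype, Fintype.card_subtype]
      simpa [Finset.card, eq_comm] using h1
    let e : ∀ v, {i // x i = v} ≃ {i // y i = v} := fun v => Fintype.equivOfCardEq (hc v)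
    exact ⟨Equiv.ofFiberEquiv e, fun i => (Equiv.ofFiberEquiv_map e i).symm⟩
  · rintro ⟨σ, hσ⟩
    rw [show x = fun i => y (σ i) from funext hσ, ofTuple_comp]

theorem ofTuple_const (p : EuclideanSpace ℝ (Fin n)) : ofTuple (fun _ => p) = diag Q p := by
  refine Subtype.ext ?_
  simp [ofTuple, diag, Sym.replicate]

theorem center_ofTuple (x : Fin Q → EuclideanSpace ℝ (Fin n)) :
    (ofTuple x).center = (Q : ℝ)⁻¹ • ∑ i, x i := rfl

theorem size_ofTuple (x : Fin Q → EuclideanSpace ℝ (Fin n)) :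
    (ofTuple x).size = √(∑ i, ‖x i‖ ^ 2) := by
  simp only [size, coe_ofTuple, Multiset.map_map]
  rfl

theorem scale_ofTuple (c : ℝ) (x : Fin Q → EuclideanSpace ℝ (Fin n)) :
    scale c (ofTuple x) = ofTuple fun i => c • x i := by
  refine Subtype.ext ?_
  simp only [scale, ofTuple, Sym.map, Multiset.map_map]
  rfl

theorem translate_ofTuple (x : Fin Q → EuclideanSpace ℝ (Fin n)) (p : EuclideanSpace ℝ (Fin n)) :
    translate (ofTuple x) p = ofTuple fun i => x i - p := by
  refine Subtype.ext ?_
  simp only [translate, ofTuple, Sym.map, Multiset.map_map]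
  rfl

theorem size_nonneg (S : QPoint Q n) : 0 ≤ S.size := Real.sqrt_nonneg _

/-- Only the relative permutation of the two orderings matters. The set of candidate distances is
therefore finite, and the infimum in the definition is a minimum. -/
theorem dist_set_eq (x y : Fin Q → EuclideanSpace ℝ (Fin n)) :
    {d : ℝ | ∃ x' y' : Fin Q → EuclideanSpace ℝ (Fin n),
      ofTuple x' = ofTuple x ∧ ofTuple y' = ofTuple y ∧ d = √(∑ i, ‖x' i - y' i‖ ^ 2)}
      = range fun σ : Equiv.Perm (Fin Q) => √(∑ i, ‖x i - y (σ i)‖ ^ 2) := by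
  ext d
  constructor
  · rintro ⟨x', y', hx, hy, rfl⟩
    obtain ⟨σ, hσ⟩ := ofTuple_eq_iff.1 hx
    obtain ⟨τ, hτ⟩ := ofTuple_eq_iff.1 hy
    refine ⟨σ.symm.trans τ, ?_⟩
    simp only [hσ, hτ]
    congr 1
    rw [← Equiv.sum_comp σ]
    simp
  · rintro ⟨σ, rfl⟩
    exact ⟨x, fun i => y (σ i), rfl, ofTuple_comp y σ, rfl⟩

theorem dist_ofTuple_le (x y : Fin Q → EuclideanSpace ℝ (Fin n)) (σ : Equiv.Perm (Fin Q)) :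
    (ofTuple x).dist (ofTuple y) ≤ √(∑ i, ‖x i - y (σ i)‖ ^ 2) := by
  rw [dist, dist_set_eq]
  exact csInf_le (Set.finite_range _).bddBelow (mem_range_self σ)

theorem exists_dist_ofTuple (x y : Fin Q → EuclideanSpace ℝ (Fin n)) :
    ∃ σ : Equiv.Perm (Fin Q), (ofTuple x).dist (ofTuple y) = √(∑ i, ‖x i - y (σ i)‖ ^ 2) := by
  rw [dist, dist_set_eq]
  obtain ⟨σ, hσ⟩ := (range_nonempty _).csInf_mem
    (Set.finite_range fun σ : Equiv.Perm (Fin Q) => √(∑ i, ‖x i - y (σ i)‖ ^ 2))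
  exact ⟨σ, hσ.symm⟩

theorem dist_nonneg (S T : QPoint Q n) : 0 ≤ S.dist T := by
  obtain ⟨x, rfl⟩ := exists_ofTuple S
  obtain ⟨y, rfl⟩ := exists_ofTuple T
  obtain ⟨σ, hσ⟩ := exists_dist_ofTuple x y
  rw [hσ]
  positivity

theorem sqrt_sum_norm_sq (x : Fin Q → EuclideanSpace ℝ (Fin n)) :
    √(∑ i, ‖x i‖ ^ 2) = ‖(WithLp.toLp 2 x : PiLp 2 fun _ : Fin Q => EuclideanSpace ℝ (Fin n))‖ := by
  rw [PiLp.norm_eq_of_L2]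

/-- Compose the two optimal permutations and apply the triangle inequality of the `ℓ²` product. -/
theorem dist_triangle (S T U : QPoint Q n) : S.dist U ≤ S.dist T + T.dist U := by
  obtain ⟨x, rfl⟩ := exists_ofTuple S
  obtain ⟨y, rfl⟩ := exists_ofTuple T
  obtain ⟨z, rfl⟩ := exists_ofTuple U
  obtain ⟨σ, hσ⟩ := exists_dist_ofTuple x y
  obtain ⟨τ, hτ⟩ := exists_dist_ofTuple y z
  rw [hσ, hτ]
  refine (dist_ofTuple_le x z (σ.trans τ)).trans ?_
  rw [← Equiv.sum_comp σ (fun i => ‖y i - z (τ i)‖ ^ 2)]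
  rw [sqrt_sum_norm_sq fun i => x i - z ((σ.trans τ) i), sqrt_sum_norm_sq fun i => x i - y (σ i),
    sqrt_sum_norm_sq fun i => y (σ i) - z (τ (σ i))]
  refine le_trans (le_of_eq ?_) (norm_add_le _ _)
  congr 1
  ext i
  simp

theorem dist_comm (S T : QPoint Q n) : S.dist T = T.dist S := by
  unfold dist
  congr 1
  ext d
  constructor
  · rintro ⟨x, y, hx, hy, rfl⟩
    exact ⟨y, x, hy, hx, by simp only [norm_sub_rev]⟩
  · rintro ⟨x, y, hx, hy, rfl⟩
    exact ⟨y, x, hy, hx, by simp only [norm_sub_rev]⟩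

theorem eq_of_dist_eq_zero {S T : QPoint Q n} (h : S.dist T = 0) : S = T := by
  obtain ⟨x, rfl⟩ := exists_ofTuple S
  obtain ⟨y, rfl⟩ := exists_ofTuple T
  obtain ⟨σ, hσ⟩ := exists_dist_ofTuple x y
  rw [h, sqrt_sum_norm_sq fun i => x i - y (σ i)] at hσ
  have := (norm_eq_zero.1 hσ.symm)
  refine ofTuple_eq_iff.2 ⟨σ, fun i => ?_⟩
  have := congrArg (fun v => v.ofLp i) this
  simpa [sub_eq_zero] using this

theorem dist_self (S : QPoint Q n) : S.dist S = 0 := by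
  obtain ⟨x, rfl⟩ := exists_ofTuple S
  refine le_antisymm ?_ (dist_nonneg _ _)
  simpa using dist_ofTuple_le x x 1

theorem size_sq_ofTuple (x : Fin Q → EuclideanSpace ℝ (Fin n)) :
    (ofTuple x).size ^ 2 = ∑ i, ‖x i‖ ^ 2 := by
  rw [size_ofTuple, Real.sq_sqrt (by positivity)]

theorem nsmul_center (x : Fin Q → EuclideanSpace ℝ (Fin n)) :
    (Q : ℝ) • (ofTuple x).center = ∑ i, x i := by
  rw [center_ofTuple]
  rcases Nat.eq_zero_or_pos Q with rfl | hQ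
  · simp
  · rw [smul_smul, mul_inv_cancel₀ (by positivity), one_smul]

theorem size_sq_translate_center (S : QPoint Q n) :
    (S.translate S.center).size ^ 2 = S.size ^ 2 - Q * ‖S.center‖ ^ 2 := by
  obtain ⟨x, rfl⟩ := exists_ofTuple S
  rw [translate_ofTuple, size_sq_ofTuple, size_sq_ofTuple]
  simp only [norm_sub_sq_real, Finset.sum_add_distrib, Finset.sum_sub_distrib, ← Finset.mul_sum,
    ← sum_inner, ← nsmul_center, real_inner_smul_left, real_inner_self_eq_norm_sq]
  simp
  ring

/-- The square of the distance is the minimum of explicit quadratic expressions. -/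
theorem exists_dist_sq_ofTuple (x y : Fin Q → EuclideanSpace ℝ (Fin n)) :
    ∃ σ : Equiv.Perm (Fin Q),
      (ofTuple x).dist (ofTuple y) ^ 2 = (ofTuple x).size ^ 2 + (ofTuple y).size ^ 2
        - 2 * ∑ i, inner ℝ (x i) (y (σ i)) ∧
      ∀ τ : Equiv.Perm (Fin Q), ∑ i, inner ℝ (x i) (y (τ i)) ≤ ∑ i, inner ℝ (x i) (y (σ i)) := by
  have key : ∀ σ : Equiv.Perm (Fin Q), (√(∑ i, ‖x i - y (σ i)‖ ^ 2)) ^ 2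
      = (ofTuple x).size ^ 2 + (ofTuple y).size ^ 2 - 2 * ∑ i, inner ℝ (x i) (y (σ i)) := by
    intro σ
    rw [Real.sq_sqrt (by positivity), size_sq_ofTuple, size_sq_ofTuple,
      ← Equiv.sum_comp σ (fun i => ‖y i‖ ^ 2), Finset.mul_sum, ← Finset.sum_add_distrib,
      ← Finset.sum_sub_distrib]
    refine Finset.sum_congr rfl fun i _ => ?_
    rw [norm_sub_sq_real]
    ring
  obtain ⟨σ, hσ⟩ := exists_dist_ofTuple x y
  refine ⟨σ, by rw [hσ, key], fun τ => ?_⟩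
  have h1 := pow_le_pow_left₀ (dist_nonneg _ _) (dist_ofTuple_le x y τ) 2
  rw [hσ, key, key] at h1
  linarith

/-- The polarization `(|S|² + |T|² - 𝒢(S, T)²) / 2` of the distance. -/
def pairing (S T : QPoint Q n) : ℝ := (S.size ^ 2 + T.size ^ 2 - S.dist T ^ 2) / 2

theorem exists_pairing_ofTuple (x y : Fin Q → EuclideanSpace ℝ (Fin n)) :
    ∃ σ : Equiv.Perm (Fin Q), pairing (ofTuple x) (ofTuple y) = ∑ i, inner ℝ (x i) (y (σ i)) ∧
      ∀ τ : Equiv.Perm (Fin Q), ∑ i, inner ℝ (x i) (y (τ i)) ≤ ∑ i, inner ℝ (x i) (y (σ i)) := by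
  obtain ⟨σ, h1, h2⟩ := exists_dist_sq_ofTuple x y
  refine ⟨σ, ?_, h2⟩
  rw [pairing, h1]
  ring

/-- The pairing is the maximum over matchings of bilinear expressions, so it is homogeneous of
degree one in each variable for nonnegative factors. This is the source of the cone structure. -/
theorem pairing_scale (S T : QPoint Q n) {a b : ℝ} (ha : 0 ≤ a) (hb : 0 ≤ b) :
    pairing (scale a S) (scale b T) = a * b * pairing S T := by
  obtain ⟨x, rfl⟩ := exists_ofTuple S
  obtain ⟨y, rfl⟩ := exists_ofTuple T
  rw [scale_ofTuple, scale_ofTuple]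
  obtain ⟨σ, h1, h2⟩ := exists_pairing_ofTuple x y
  obtain ⟨τ, h3, h4⟩ := exists_pairing_ofTuple (fun i => a • x i) (fun i => b • y i)
  have e : ∀ σ : Equiv.Perm (Fin Q), ∑ i, inner ℝ (a • x i) (b • y (σ i))
      = a * b * ∑ i, inner ℝ (x i) (y (σ i)) := fun σ => by
    rw [Finset.mul_sum]
    refine Finset.sum_congr rfl fun i _ => ?_
    rw [real_inner_smul_left, real_inner_smul_right]
    ring
  rw [h1, h3]
  refine le_antisymm ?_ ?_
  · rw [e]
    exact mul_le_mul_of_nonneg_left (h2 τ) (mul_nonneg ha hb)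
  · rw [← e]
    exact h4 σ

theorem size_scale (S : QPoint Q n) {a : ℝ} (ha : 0 ≤ a) : (scale a S).size = a * S.size := by
  obtain ⟨x, rfl⟩ := exists_ofTuple S
  rw [scale_ofTuple, size_ofTuple, size_ofTuple]
  simp only [norm_smul, mul_pow, ← Finset.mul_sum]
  rw [Real.sqrt_mul (by positivity), Real.sqrt_sq (by positivity), Real.norm_of_nonneg ha]

theorem center_scale (S : QPoint Q n) (a : ℝ) : (scale a S).center = a • S.center := by
  obtain ⟨x, rfl⟩ := exists_ofTuple S
  rw [scale_ofTuple, center_ofTuple, center_ofTuple, ← Finset.smul_sum, smul_comm]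

theorem center_diag_smul (p : EuclideanSpace ℝ (Fin n)) :
    (Q : ℝ) • (diag Q p).center = (Q : ℝ) • p := by
  rw [← ofTuple_const, nsmul_center]
  simp [Nat.cast_smul_eq_nsmul]

theorem size_sq_diag (p : EuclideanSpace ℝ (Fin n)) : (diag Q p).size ^ 2 = Q * ‖p‖ ^ 2 := by
  rw [← ofTuple_const, size_sq_ofTuple]
  simp

theorem pairing_diag (S : QPoint Q n) (p : EuclideanSpace ℝ (Fin n)) :
    pairing S (diag Q p) = Q * inner ℝ S.center p := by
  obtain ⟨x, rfl⟩ := exists_ofTuple S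
  rw [← ofTuple_const]
  obtain ⟨σ, h, -⟩ := exists_pairing_ofTuple x fun _ => p
  rw [h, ← sum_inner, ← nsmul_center, real_inner_smul_left]

theorem dist_sq_eq (S T : QPoint Q n) :
    S.dist T ^ 2 = S.size ^ 2 + T.size ^ 2 - 2 * pairing S T := by
  rw [pairing]
  ring

/-- The pairing of the centered parts is controlled by the product of their sizes. -/
theorem abs_pairing_sub_le (S T : QPoint Q n) :
    |pairing S T - Q * inner ℝ S.center T.center|
      ≤ (S.translate S.center).size * (T.translate T.center).size := by
  obtain ⟨x, rfl⟩ := exists_ofTuple S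
  obtain ⟨y, rfl⟩ := exists_ofTuple T
  obtain ⟨σ, h, -⟩ := exists_pairing_ofTuple x y
  set p := (ofTuple x).center
  set q := (ofTuple y).center
  have e : ∑ i, inner ℝ (x i) (y (σ i)) - Q * inner ℝ p q
      = ∑ i, inner ℝ (x i - p) (y (σ i) - q) := by
    have h1 : ∑ i, x i = (Q : ℝ) • p := (nsmul_center x).symm
    have h2 : ∑ i, y (σ i) = (Q : ℝ) • q := by rw [Equiv.sum_comp σ y]; exact (nsmul_center y).symm
    simp only [inner_sub_left, inner_sub_right, Finset.sum_sub_distrib, ← sum_inner, ← inner_sum,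
      h1, h2, real_inner_smul_left, real_inner_smul_right]
    simp only [Finset.sum_const, Finset.card_univ, Fintype.card_fin, ← Nat.cast_smul_eq_nsmul ℝ,
      real_inner_smul_left]
    ring
  rw [h, e, translate_ofTuple, translate_ofTuple, size_ofTuple, size_ofTuple,
    ← Equiv.sum_comp σ (fun i => ‖y i - q‖ ^ 2), sqrt_sum_norm_sq fun i => x i - p,
    sqrt_sum_norm_sq fun i => y (σ i) - q]
  refine le_trans (le_of_eq ?_) (abs_real_inner_le_norm _ _)
  simp [PiLp.inner_apply]

theorem eq_diag_center_of_size_translate_eq_zero {S : QPoint Q n}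
    (h : (S.translate S.center).size = 0) : S = diag Q S.center := by
  obtain ⟨x, rfl⟩ := exists_ofTuple S
  have h2 := size_sq_ofTuple fun i => x i - (ofTuple x).center
  rw [← translate_ofTuple, h, zero_pow two_ne_zero] at h2
  have h3 := (Finset.sum_eq_zero_iff_of_nonneg fun i _ => by positivity).1 h2.symm
  rw [← ofTuple_const]
  congr 1
  funext i
  have := h3 i (Finset.mem_univ i)
  simpa [sub_eq_zero] using this

end QPoint

/-! ### The metric on special `Q`-points and its cone structure -/

theorem sqrt_add_sq_le {x y z x' y' z' a b c : ℝ} (ha : |a| ≤ |x + x'|) (hb : |b| ≤ |y + y'|)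
    (hc : |c| ≤ |z + z'|) :
    √(a ^ 2 + b ^ 2 + c ^ 2) ≤ √(x ^ 2 + y ^ 2 + z ^ 2) + √(x' ^ 2 + y' ^ 2 + z' ^ 2) := by
  have h := norm_add_le (!₂[x, y, z] : EuclideanSpace ℝ (Fin 3)) !₂[x', y', z']
  simp only [EuclideanSpace.norm_eq, Fin.sum_univ_three, PiLp.add_apply, Real.norm_eq_abs,
    sq_abs] at h
  refine le_trans (Real.sqrt_le_sqrt ?_) h
  have := sq_le_sq.2 ha
  have := sq_le_sq.2 hb
  have := sq_le_sq.2 hc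
  simp
  linarith

namespace SpecialQPoint

variable {Q n : ℕ}

theorem exists_mk (A : SpecialQPoint Q n) : ∃ S ε, mk S ε = A := by
  induction A using Quotient.inductionOn with
  | h a => exact ⟨a.1, a.2, rfl⟩

@[simp] theorem toQPoint_mk (S : QPoint Q n) (ε : ℤˣ) : (mk S ε).toQPoint = S := rfl

@[simp] theorem center_mk (S : QPoint Q n) (ε : ℤˣ) : (mk S ε).center = S.center := rfl

theorem mk_eq_mk_iff {S T : QPoint Q n} {ε δ : ℤˣ} :
    mk S ε = mk T δ ↔ S = T ∧ (ε = δ ∨ ∃ p, S = QPoint.diag Q p) :=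
  Quotient.eq (r := specialSetoid Q n)

@[simp] theorem scale_mk (c : ℝ) (S : QPoint Q n) (ε : ℤˣ) :
    (mk S ε).scale c = mk (S.scale c) ε := rfl

theorem hasSign_mk {S : QPoint Q n} {ε δ : ℤˣ} :
    (mk S ε).HasSign δ ↔ ε = δ ∨ ∃ p, S = QPoint.diag Q p := by
  constructor
  · rintro ⟨T, hT⟩
    exact (mk_eq_mk_iff.1 hT).2
  · rintro h
    exact ⟨S, mk_eq_mk_iff.2 ⟨rfl, h⟩⟩

/-- The distance between opposite signs, as a function of the two `Q`-points. -/
def oppDist (S T : QPoint Q n) : ℝ :=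
  √((S.translate S.center).size ^ 2 + (T.translate T.center).size ^ 2
    + (Q : ℝ) * ‖S.center - T.center‖ ^ 2)

theorem oppDist_sq (S T : QPoint Q n) :
    oppDist S T ^ 2 = S.size ^ 2 + T.size ^ 2 - 2 * (Q * inner ℝ S.center T.center) := by
  rw [oppDist, Real.sq_sqrt (by positivity), QPoint.size_sq_translate_center,
    QPoint.size_sq_translate_center, norm_sub_sq_real]
  ring

/-- The two formulas for the distance agree on `Q⟦p⟧`, the set along which the copies are glued.
Hence the distance may be computed from any choice of signs of the representatives. -/
theorem dist_diag_eq_oppDist (S : QPoint Q n) (p : EuclideanSpace ℝ (Fin n)) :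
    S.dist (QPoint.diag Q p) = oppDist S (QPoint.diag Q p) := by
  have h0 : 0 ≤ oppDist S (QPoint.diag Q p) := Real.sqrt_nonneg _
  rw [← sq_eq_sq₀ (QPoint.dist_nonneg _ _) h0, oppDist_sq, QPoint.dist_sq_eq,
    QPoint.pairing_diag, ← real_inner_smul_right S.center p,
    ← real_inner_smul_right S.center (QPoint.diag Q p).center, QPoint.center_diag_smul]

theorem oppDist_comm (S T : QPoint Q n) : oppDist S T = oppDist T S := by
  rw [oppDist, oppDist, norm_sub_rev, add_comm (_ ^ 2)]

theorem dist_mk_self (S T : QPoint Q n) (ε : ℤˣ) : (mk S ε).dist (mk T ε) = S.dist T :=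
  if_pos ⟨ε, ⟨S, rfl⟩, ⟨T, rfl⟩⟩

theorem dist_mk_of_ne (S T : QPoint Q n) {ε δ : ℤˣ} (h : ε ≠ δ) :
    (mk S ε).dist (mk T δ) = oppDist S T := by
  by_cases hc : ∃ γ, (mk S ε).HasSign γ ∧ (mk T δ).HasSign γ
  · refine (if_pos hc).trans ?_
    obtain ⟨γ, h1, h2⟩ := hc
    rw [toQPoint_mk, toQPoint_mk]
    rcases hasSign_mk.1 h1 with h1 | ⟨p, rfl⟩
    · rcases hasSign_mk.1 h2 with h2 | ⟨p, rfl⟩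
      · exact absurd (h1.trans h2.symm) h
      · exact dist_diag_eq_oppDist _ _
    · rw [QPoint.dist_comm, oppDist_comm]
      exact dist_diag_eq_oppDist _ _
  · exact if_neg hc

theorem dist_comm' (A B : SpecialQPoint Q n) : A.dist B = B.dist A := by
  obtain ⟨S, ε, rfl⟩ := exists_mk A
  obtain ⟨T, δ, rfl⟩ := exists_mk B
  by_cases h : ε = δ
  · subst h
    rw [dist_mk_self, dist_mk_self, QPoint.dist_comm]
  · rw [dist_mk_of_ne _ _ h, dist_mk_of_ne _ _ (Ne.symm h), oppDist_comm]

theorem dist_sq_sub (S T : QPoint Q n) :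
    S.dist T ^ 2 - Q * ‖S.center - T.center‖ ^ 2 = (S.translate S.center).size ^ 2
      + (T.translate T.center).size ^ 2
      - 2 * (QPoint.pairing S T - Q * inner ℝ S.center T.center) := by
  rw [QPoint.dist_sq_eq, QPoint.size_sq_translate_center, QPoint.size_sq_translate_center,
    norm_sub_sq_real]
  ring

/-- The Q-point `S` is replaced by the planar data (size of the centered part, scaled barycenter).
The Cauchy-Schwarz bound for the centered pairing says that the first datum is 1-Lipschitz jointly
with the second, and the claim reduces to Minkowski's inequality in `ℝ³`. -/
theorem oppDist_triangle (S T U : QPoint Q n) : oppDist S U ≤ S.dist T + oppDist T U := by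
  set a := (S.translate S.center).size
  set b := (T.translate T.center).size
  set c := (U.translate U.center).size
  have h1 : √((a - b) ^ 2 + 0 ^ 2 + (√Q * ‖S.center - T.center‖) ^ 2) ≤ S.dist T := by
    rw [← Real.sqrt_sq (QPoint.dist_nonneg S T)]
    refine Real.sqrt_le_sqrt ?_
    rw [mul_pow, Real.sq_sqrt (by positivity)]
    have := dist_sq_sub S T
    have := (abs_le.1 (QPoint.abs_pairing_sub_le S T)).2
    nlinarith
  have h2 : oppDist T U = √(b ^ 2 + c ^ 2 + (√Q * ‖T.center - U.center‖) ^ 2) := by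
    rw [mul_pow, Real.sq_sqrt (by positivity)]
    rfl
  have h3 : oppDist S U = √(a ^ 2 + c ^ 2 + (√Q * ‖S.center - U.center‖) ^ 2) := by
    rw [mul_pow, Real.sq_sqrt (by positivity)]
    rfl
  rw [h2, h3]
  refine le_trans (sqrt_add_sq_le (le_of_eq ?_) (le_of_eq ?_) ?_) (add_le_add_left h1 _)
  · simp
  · simp
  · rw [abs_of_nonneg (by positivity), abs_of_nonneg (by positivity), ← mul_add]
    exact mul_le_mul_of_nonneg_left (norm_sub_le_norm_sub_add_norm_sub _ _ _) (by positivity)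

/-- Here the centered size of `T` enters with the opposite sign in the second vector, so that it
cancels in the sum. What remains, `a + c`, bounds the distance of the centered parts of `S` and `U`.
-/
theorem dist_le_oppDist_add (S T U : QPoint Q n) : S.dist U ≤ oppDist S T + oppDist T U := by
  set a := (S.translate S.center).size with ha
  set b := (T.translate T.center).size
  set c := (U.translate U.center).size with hc
  have h1 : S.dist U ≤ √((a + c) ^ 2 + 0 ^ 2 + (√Q * ‖S.center - U.center‖) ^ 2) := by
    rw [← Real.sqrt_sq (QPoint.dist_nonneg S U)]
    refine Real.sqrt_le_sqrt ?_
    rw [mul_pow, Real.sq_sqrt (by positivity)]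
    have := dist_sq_sub S U
    have := (abs_le.1 (QPoint.abs_pairing_sub_le S U)).1
    nlinarith
  have h2 : oppDist T U = √(c ^ 2 + (-b) ^ 2 + (√Q * ‖T.center - U.center‖) ^ 2) := by
    rw [mul_pow, Real.sq_sqrt (by positivity), neg_sq, add_comm (c ^ 2)]
    rfl
  have h3 : oppDist S T = √(a ^ 2 + b ^ 2 + (√Q * ‖S.center - T.center‖) ^ 2) := by
    rw [mul_pow, Real.sq_sqrt (by positivity)]
    rfl
  rw [h2, h3]
  refine h1.trans (sqrt_add_sq_le le_rfl (le_of_eq ?_) ?_)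
  · simp
  · rw [abs_of_nonneg (by positivity), abs_of_nonneg (by positivity), ← mul_add]
    exact mul_le_mul_of_nonneg_left (norm_sub_le_norm_sub_add_norm_sub _ _ _) (by positivity)

theorem eq_of_ne_of_ne {a b c : ℤˣ} (h : a ≠ b) (h' : b ≠ c) : a = c := by
  rcases Int.units_eq_one_or a with rfl | rfl <;> rcases Int.units_eq_one_or b with rfl | rfl <;>
    rcases Int.units_eq_one_or c with rfl | rfl <;> simp_all

theorem dist_triangle' (A B C : SpecialQPoint Q n) : A.dist C ≤ A.dist B + B.dist C := by
  obtain ⟨S, ε, rfl⟩ := exists_mk A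
  obtain ⟨T, δ, rfl⟩ := exists_mk B
  obtain ⟨U, γ, rfl⟩ := exists_mk C
  by_cases h1 : ε = δ
  · subst h1
    by_cases h2 : ε = γ
    · subst h2
      simp only [dist_mk_self]
      exact QPoint.dist_triangle _ _ _
    · rw [dist_mk_self, dist_mk_of_ne _ _ h2, dist_mk_of_ne _ _ h2]
      exact oppDist_triangle _ _ _
  · by_cases h2 : δ = γ
    · subst h2
      rw [dist_mk_self, dist_mk_of_ne _ _ h1, dist_mk_of_ne _ _ h1, oppDist_comm S U,
        oppDist_comm S T, QPoint.dist_comm T U, add_comm]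
      exact oppDist_triangle _ _ _
    · obtain rfl := eq_of_ne_of_ne h1 h2
      rw [dist_mk_self, dist_mk_of_ne _ _ h1, dist_mk_of_ne _ _ h2]
      exact dist_le_oppDist_add _ _ _

theorem eq_of_dist_eq_zero' {A B : SpecialQPoint Q n} (h : A.dist B = 0) : A = B := by
  obtain ⟨S, ε, rfl⟩ := exists_mk A
  obtain ⟨T, δ, rfl⟩ := exists_mk B
  by_cases h1 : ε = δ
  · subst h1
    rw [dist_mk_self] at h
    rw [QPoint.eq_of_dist_eq_zero h]
  · rw [dist_mk_of_ne _ _ h1] at h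
    have h2 : (S.translate S.center).size ^ 2 + (T.translate T.center).size ^ 2
        + (Q : ℝ) * ‖S.center - T.center‖ ^ 2 = 0 := by
      have := congrArg (fun x => x ^ 2) h
      simpa [oppDist, Real.sq_sqrt (show 0 ≤ (S.translate S.center).size ^ 2
        + (T.translate T.center).size ^ 2 + (Q : ℝ) * ‖S.center - T.center‖ ^ 2 by positivity)]
        using this
    have hq : 0 ≤ (Q : ℝ) * ‖S.center - T.center‖ ^ 2 := by positivity
    have h3 : (S.translate S.center).size = 0 := by
      nlinarith [sq_nonneg (S.translate S.center).size, sq_nonneg (T.translate T.center).size]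
    have h4 : (T.translate T.center).size = 0 := by
      nlinarith [sq_nonneg (S.translate S.center).size, sq_nonneg (T.translate T.center).size]
    have h5 : (Q : ℝ) * ‖S.center - T.center‖ ^ 2 = 0 := by
      rw [h3, h4] at h2
      simpa using h2
    have h6 := QPoint.eq_diag_center_of_size_translate_eq_zero h3
    have h7 := QPoint.eq_diag_center_of_size_translate_eq_zero h4
    refine mk_eq_mk_iff.2 ⟨?_, Or.inr ⟨_, h6⟩⟩
    rcases Nat.eq_zero_or_pos Q with rfl | hQ
    · exact Subsingleton.elim _ _
    · have hQ' : (Q : ℝ) ≠ 0 := by positivity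
      have h8 : S.center = T.center := by
        simpa [hQ', sub_eq_zero] using h5
      rw [h6, h7, h8]

instance : MetricSpace (SpecialQPoint Q n) where
  dist A B := A.dist B
  dist_self A := by
    obtain ⟨S, ε, rfl⟩ := exists_mk A
    exact (dist_mk_self S S ε).trans (QPoint.dist_self S)
  dist_comm := dist_comm'
  dist_triangle := dist_triangle'
  eq_of_dist_eq_zero := eq_of_dist_eq_zero'

theorem dist_eq (A B : SpecialQPoint Q n) : A.dist B = Dist.dist A B := rfl

/-- The size `|A|`. -/
def size (A : SpecialQPoint Q n) : ℝ := A.toQPoint.size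

theorem size_nonneg (A : SpecialQPoint Q n) : 0 ≤ A.size := QPoint.size_nonneg _

theorem mk_diag (p : EuclideanSpace ℝ (Fin n)) (ε δ : ℤˣ) :
    mk (QPoint.diag Q p) ε = mk (QPoint.diag Q p) δ := mk_eq_mk_iff.2 ⟨rfl, Or.inr ⟨p, rfl⟩⟩

theorem dist_origin (A : SpecialQPoint Q n) : Dist.dist A (origin Q n) = A.size := by
  obtain ⟨S, ε, rfl⟩ := exists_mk A
  rw [origin, mk_diag 0 1 ε, ← dist_eq, dist_mk_self, size, toQPoint_mk,
    ← sq_eq_sq₀ (QPoint.dist_nonneg _ _) (QPoint.size_nonneg _), QPoint.dist_sq_eq,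
    QPoint.pairing_diag, QPoint.size_sq_diag]
  simp

/-- The polarization of the distance. -/
def pairing (A B : SpecialQPoint Q n) : ℝ := (A.size ^ 2 + B.size ^ 2 - Dist.dist A B ^ 2) / 2

theorem dist_sq_eq (A B : SpecialQPoint Q n) :
    Dist.dist A B ^ 2 = A.size ^ 2 + B.size ^ 2 - 2 * pairing A B := by
  rw [pairing]
  ring

theorem pairing_mk_self (S T : QPoint Q n) (ε : ℤˣ) :
    pairing (mk S ε) (mk T ε) = QPoint.pairing S T := by
  rw [pairing, ← dist_eq, dist_mk_self]
  rfl

theorem pairing_mk_of_ne (S T : QPoint Q n) {ε δ : ℤˣ} (h : ε ≠ δ) :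
    pairing (mk S ε) (mk T δ) = Q * inner ℝ S.center T.center := by
  rw [pairing, ← dist_eq, dist_mk_of_ne _ _ h, oppDist_sq]
  simp only [size, toQPoint_mk]
  ring

theorem size_scale (A : SpecialQPoint Q n) {c : ℝ} (hc : 0 ≤ c) :
    (A.scale c).size = c * A.size := by
  obtain ⟨S, ε, rfl⟩ := exists_mk A
  exact QPoint.size_scale S hc

theorem center_scale (A : SpecialQPoint Q n) (c : ℝ) : (A.scale c).center = c • A.center := by
  obtain ⟨S, ε, rfl⟩ := exists_mk A
  exact QPoint.center_scale S c

theorem pairing_scale (A B : SpecialQPoint Q n) {a b : ℝ} (ha : 0 ≤ a) (hb : 0 ≤ b) :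
    pairing (A.scale a) (B.scale b) = a * b * pairing A B := by
  obtain ⟨S, ε, rfl⟩ := exists_mk A
  obtain ⟨T, δ, rfl⟩ := exists_mk B
  rw [scale_mk, scale_mk]
  by_cases h : ε = δ
  · subst h
    rw [pairing_mk_self, pairing_mk_self, QPoint.pairing_scale _ _ ha hb]
  · rw [pairing_mk_of_ne _ _ h, pairing_mk_of_ne _ _ h, QPoint.center_scale, QPoint.center_scale,
      real_inner_smul_left, real_inner_smul_right]
    ring

/-- The law of cosines that makes the space of special `Q`-points a metric cone. -/
theorem dist_scale_sq (A B : SpecialQPoint Q n) {a b : ℝ} (ha : 0 ≤ a) (hb : 0 ≤ b) :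
    Dist.dist (A.scale a) (B.scale b) ^ 2 = (a * A.size - b * B.size) ^ 2
      + a * b * (Dist.dist A B ^ 2 - (A.size - B.size) ^ 2) := by
  rw [dist_sq_eq, dist_sq_eq A B, pairing_scale _ _ ha hb, size_scale _ ha, size_scale _ hb]
  ring

theorem scale_scale (A : SpecialQPoint Q n) (a b : ℝ) :
    (A.scale a).scale b = A.scale (b * a) := by
  obtain ⟨S, ε, rfl⟩ := exists_mk A
  obtain ⟨x, rfl⟩ := QPoint.exists_ofTuple S
  simp only [scale_mk, QPoint.scale_ofTuple, smul_smul]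

@[simp] theorem scale_one (A : SpecialQPoint Q n) : A.scale 1 = A := by
  obtain ⟨S, ε, rfl⟩ := exists_mk A
  obtain ⟨x, rfl⟩ := QPoint.exists_ofTuple S
  simp only [scale_mk, QPoint.scale_ofTuple, one_smul]

theorem dist_scale_self (A B : SpecialQPoint Q n) {a : ℝ} (ha : 0 ≤ a) :
    Dist.dist (A.scale a) (B.scale a) = a * Dist.dist A B := by
  rw [← sq_eq_sq₀ dist_nonneg (by positivity), dist_scale_sq _ _ ha ha]
  ring

theorem dist_scale_left (A : SpecialQPoint Q n) {a b : ℝ} (ha : 0 ≤ a) (hb : 0 ≤ b) :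
    Dist.dist (A.scale a) (A.scale b) = |a - b| * A.size := by
  rw [← sq_eq_sq₀ dist_nonneg (mul_nonneg (abs_nonneg _) A.size_nonneg), dist_scale_sq _ _ ha hb,
    mul_pow, sq_abs]
  simp
  ring

theorem size_eq_zero_iff (A : SpecialQPoint Q n) : A.size = 0 ↔ A = origin Q n := by
  rw [← dist_origin, dist_eq_zero]

theorem abs_size_sub_le (A B : SpecialQPoint Q n) : |A.size - B.size| ≤ Dist.dist A B := by
  rw [← dist_origin, ← dist_origin]
  exact abs_dist_sub_le _ _ _

theorem dist_mk_ofTuple_le (x y : Fin Q → EuclideanSpace ℝ (Fin n)) (ε : ℤˣ) :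
    Dist.dist (mk (QPoint.ofTuple x) ε) (mk (QPoint.ofTuple y) ε) ≤ √(∑ i, ‖x i - y i‖ ^ 2) := by
  rw [← dist_eq, dist_mk_self]
  exact QPoint.dist_ofTuple_le x y 1

theorem isometryTuple_continuous (ε : ℤˣ) : Continuous
    fun x : PiLp 2 fun _ : Fin Q => EuclideanSpace ℝ (Fin n) => mk (QPoint.ofTuple x.ofLp) ε := by
  refine (LipschitzWith.of_dist_le_mul (K := 1) fun x y => ?_).continuous
  refine (dist_mk_ofTuple_le _ _ ε).trans ?_
  rw [NNReal.coe_one, one_mul, _root_.dist_eq_norm, PiLp.norm_eq_of_L2]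
  rfl

theorem size_mk_ofTuple (x : PiLp 2 fun _ : Fin Q => EuclideanSpace ℝ (Fin n)) (ε : ℤˣ) :
    (mk (QPoint.ofTuple x.ofLp) ε).size = ‖x‖ := by
  rw [size, toQPoint_mk, QPoint.size_ofTuple, PiLp.norm_eq_of_L2]

/-- A closed ball lies in the union of the images of two closed Euclidean balls, one for each sign.
Completeness and separability, which the theory of curves needs, follow. -/
instance : ProperSpace (SpecialQPoint Q n) := by
  refine ⟨fun A r => ?_⟩
  let K := Metric.closedBall (0 : PiLp 2 fun _ : Fin Q => EuclideanSpace ℝ (Fin n)) (r + A.size)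
  have hK : IsCompact K := isCompact_closedBall _ _
  refine IsCompact.of_isClosed_subset ((hK.image (isometryTuple_continuous 1)).union
    (hK.image (isometryTuple_continuous (-1)))) Metric.isClosed_closedBall fun B hB => ?_
  obtain ⟨S, ε, rfl⟩ := exists_mk B
  obtain ⟨x, rfl⟩ := QPoint.exists_ofTuple S
  have hx : (WithLp.toLp 2 x : PiLp 2 fun _ : Fin Q => EuclideanSpace ℝ (Fin n)) ∈ K := by
    rw [mem_closedBall_zero_iff, ← size_mk_ofTuple _ ε]
    have h1 := abs_size_sub_le (mk (QPoint.ofTuple x) ε) A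
    have h2 := (abs_le.1 h1).2
    have h3 := Metric.mem_closedBall.1 hB
    simp only
    linarith
  rcases Int.units_eq_one_or ε with rfl | rfl
  · exact Or.inl ⟨_, hx, rfl⟩
  · exact Or.inr ⟨_, hx, rfl⟩

instance : MeasurableSpace (SpecialQPoint Q n) := borel _

instance : BorelSpace (SpecialQPoint Q n) := ⟨rfl⟩

instance : Nonempty (SpecialQPoint Q n) := ⟨origin Q n⟩

end SpecialQPoint

/-! ### Curves with an integrable speed bound, and their metric derivative -/

theorem absolutelyContinuousOnInterval_of_dist_le {Y Z : Type*} [PseudoMetricSpace Y]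
    [PseudoMetricSpace Z] {F : ℝ → Y} {M : ℝ → Z} {a b : ℝ}
    (hM : AbsolutelyContinuousOnInterval M a b)
    (h : ∀ x ∈ uIcc a b, ∀ y ∈ uIcc a b, dist (F x) (F y) ≤ dist (M x) (M y)) :
    AbsolutelyContinuousOnInterval F a b := by
  unfold AbsolutelyContinuousOnInterval at hM ⊢
  refine tendsto_of_tendsto_of_tendsto_of_le_of_le' tendsto_const_nhds hM
    (Eventually.of_forall fun E => Finset.sum_nonneg fun _ _ => dist_nonneg) ?_
  filter_upwards [mem_inf_of_right (mem_principal_self _)] with E hE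
  exact Finset.sum_le_sum fun i hi => h _ (hE.1 i hi).1 _ (hE.1 i hi).2

/-- The metric speed of the curve `g` is bounded by the locally integrable function `m`. -/
structure IsSpeedBound {X : Type*} [MetricSpace X] (g : ℝ → X) (m : ℝ → ℝ) : Prop where
  locallyIntegrable : LocallyIntegrable m
  nonneg : ∀ x, 0 ≤ m x
  dist_le : ∀ a b, a ≤ b → dist (g a) (g b) ≤ ∫ x in a..b, m x

namespace IsSpeedBound

variable {X : Type*} [MetricSpace X] {g : ℝ → X} {m : ℝ → ℝ}

theorem intervalIntegrable (h : IsSpeedBound g m) (a b : ℝ) : IntervalIntegrable m volume a b :=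
  intervalIntegrable_iff.2
    ((h.locallyIntegrable.integrableOn_isCompact isCompact_uIcc).mono_set uIoc_subset_uIcc)

theorem dist_le_abs (h : IsSpeedBound g m) (a b : ℝ) :
    dist (g a) (g b) ≤ |∫ x in a..b, m x| := by
  rcases le_total a b with hab | hab
  · exact (h.dist_le a b hab).trans (le_abs_self _)
  · rw [dist_comm, intervalIntegral.integral_symm, abs_neg]
    exact (h.dist_le b a hab).trans (le_abs_self _)

theorem dist_le_dist (h : IsSpeedBound g m) (c a b : ℝ) :
    dist (g a) (g b) ≤ dist (∫ x in c..a, m x) (∫ x in c..b, m x) := by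
  rw [Real.dist_eq, abs_sub_comm, intervalIntegral.integral_interval_sub_left
    (h.intervalIntegrable _ _) (h.intervalIntegrable _ _)]
  exact h.dist_le_abs a b

theorem absolutelyContinuousOnInterval (h : IsSpeedBound g m) (a b : ℝ) :
    AbsolutelyContinuousOnInterval g a b :=
  absolutelyContinuousOnInterval_of_dist_le
    ((h.intervalIntegrable a b).absolutelyContinuousOnInterval_intervalIntegral left_mem_uIcc)
    fun x _ y _ => h.dist_le_dist a x y

theorem continuous (h : IsSpeedBound g m) : Continuous g := by
  refine continuous_iff_continuousAt.2 fun x => tendsto_iff_dist_tendsto_zero.2 ?_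
  have h1 : Continuous fun y => dist (∫ t in x..y, m t) (∫ t in x..x, m t) :=
    (intervalIntegral.continuous_primitive h.intervalIntegrable x).dist continuous_const
  refine squeeze_zero (fun _ => dist_nonneg) (fun y => h.dist_le_dist x y x) ?_
  simpa using h1.tendsto x

theorem comp_lipschitz {Y : Type*} [MetricSpace Y] (h : IsSpeedBound g m) {f : X → Y}
    (hf : ∀ x y, dist (f x) (f y) ≤ dist x y) : IsSpeedBound (fun t => f (g t)) m :=
  ⟨h.locallyIntegrable, h.nonneg, fun a b hab => (hf _ _).trans (h.dist_le a b hab)⟩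

theorem dist_right (h : IsSpeedBound g m) (T : X) : IsSpeedBound (fun t => dist (g t) T) m :=
  h.comp_lipschitz (f := fun A => dist A T) fun x y => abs_dist_sub_le x y T

theorem ae_differentiableAt {f : ℝ → ℝ} (h : IsSpeedBound f m) :
    ∀ᵐ x, DifferentiableAt ℝ f x := by
  have : ∀ k : ℕ, ∀ᵐ x, x ∈ uIcc (-k : ℝ) k → DifferentiableAt ℝ f x := fun k =>
    (h.absolutelyContinuousOnInterval _ _).ae_differentiableAt
  filter_upwards [ae_all_iff.2 this] with x hx
  obtain ⟨k, hk⟩ := exists_nat_ge |x|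
  refine hx k ?_
  rw [uIcc_of_le (by have := abs_nonneg x; linarith)]
  exact abs_le.1 hk

theorem tendsto_integral_div {x : ℝ} (hx : HasDerivAt (fun y => ∫ t in x..y, m t) (m x) x)
    (h0 : 0 ≤ m x) :
    Tendsto (fun k => |∫ t in x..(x + k), m t| / |k|) (𝓝[≠] 0) (𝓝 (m x)) := by
  have := hx.tendsto_slope_zero.abs
  rw [abs_of_nonneg h0] at this
  refine this.congr fun k => ?_
  simp [abs_mul, abs_inv, div_eq_inv_mul]

theorem abs_deriv_le {f : ℝ → ℝ} {x : ℝ} (h : IsSpeedBound f m)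
    (hx : HasDerivAt (fun y => ∫ t in x..y, m t) (m x) x) (hf : DifferentiableAt ℝ f x) :
    |deriv f x| ≤ m x := by
  have h1 := hf.hasDerivAt.tendsto_slope_zero.abs
  refine le_of_tendsto_of_tendsto h1 (tendsto_integral_div hx (h.nonneg x)) ?_
  refine Eventually.of_forall fun k => ?_
  simp only [smul_eq_mul, abs_mul, abs_inv]
  rw [inv_mul_eq_div]
  refine div_le_div_of_nonneg_right ?_ (abs_nonneg k)
  have := h.dist_le_abs x (x + k)
  rwa [dist_comm, Real.dist_eq] at this

theorem ae_abs_deriv_le {f : ℝ → ℝ} (h : IsSpeedBound f m) : ∀ᵐ x, |deriv f x| ≤ m x := by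
  filter_upwards [h.ae_differentiableAt, LocallyIntegrable.ae_hasDerivAt_integral h.locallyIntegrable] with x h1 h2
  exact h.abs_deriv_le (h2 x) h1

end IsSpeedBound

/-- Choose `T k` close to `x`: then `dist y (T k)` is almost `dist x y`. Countably many distance
functions thus control the metric, which allows null sets to be collected. -/
theorem dist_le_of_forall_denseRange {X ι : Type*} [MetricSpace X] {T : ι → X}
    (hT : DenseRange T) {x y : X} {C : ℝ} (h : ∀ k, |dist x (T k) - dist y (T k)| ≤ C) :
    dist x y ≤ C := by
  refine le_of_forall_pos_le_add fun ε hε => ?_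
  obtain ⟨k, hk⟩ := hT.exists_dist_lt x (half_pos hε)
  have h1 := (abs_le.1 (h k)).1
  have h2 := dist_triangle x (T k) y
  have h3 := dist_comm (T k) y
  linarith

/-- A curve with integrable speed has a metric derivative almost everywhere. -/
theorem IsSpeedBound.exists_metric_speed {X : Type*} [MetricSpace X]
    [TopologicalSpace.SeparableSpace X] {g : ℝ → X} {m : ℝ → ℝ} (h : IsSpeedBound g m) :
    ∃ s : ℝ → ℝ, Measurable s ∧ IsSpeedBound g s ∧ (∀ᵐ x, s x ≤ m x) ∧
      ∀ᵐ x, Tendsto (fun k => dist (g (x + k)) (g x) / |k|) (𝓝[≠] 0) (𝓝 (s x)) := by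
  have : Nonempty X := ⟨g 0⟩
  let T := TopologicalSpace.denseSeq X
  have hT : DenseRange T := TopologicalSpace.denseRange_denseSeq X
  let d : ℕ → ℝ → ℝ := fun k t => dist (g t) (T k)
  have hd : ∀ k, IsSpeedBound (d k) m := fun k => h.dist_right (T k)
  -- The metric speed is the supremum of the derivatives of the distances to countably many dense
  -- points. Each of these distance functions is absolutely continuous.
  let s : ℝ → ℝ := fun t => ⨆ k, |deriv (d k) t|
  have hs_meas : Measurable s := Measurable.iSup fun k => (measurable_deriv (d k)).norm
  have hs0 : ∀ x, 0 ≤ s x := fun x => Real.iSup_nonneg fun k => abs_nonneg _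
  have hbd : ∀ᵐ x, ∀ k, |deriv (d k) x| ≤ m x := ae_all_iff.2 fun k => (hd k).ae_abs_deriv_le
  have hsm : ∀ᵐ x, s x ≤ m x := by
    filter_upwards [hbd] with x hx using ciSup_le hx
  have hks : ∀ᵐ x, ∀ k, |deriv (d k) x| ≤ s x := by
    filter_upwards [hbd] with x hx k
    exact le_ciSup (f := fun k => |deriv (d k) x|) ⟨m x, by rintro _ ⟨k, rfl⟩; exact hx k⟩ k
  have hs_int : LocallyIntegrable s := by
    refine h.locallyIntegrable.mono hs_meas.aestronglyMeasurable ?_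
    filter_upwards [hsm] with x hx
    rw [Real.norm_of_nonneg (hs0 x), Real.norm_of_nonneg (h.nonneg x)]
    exact hx
  have hs_iv : ∀ a b, IntervalIntegrable s volume a b := fun a b => intervalIntegrable_iff.2
    ((hs_int.integrableOn_isCompact isCompact_uIcc).mono_set uIoc_subset_uIcc)
  have hsb : IsSpeedBound g s := by
    refine ⟨hs_int, hs0, fun a b hab => dist_le_of_forall_denseRange hT fun k => ?_⟩
    have h1 : dist (g a) (T k) - dist (g b) (T k) = -∫ x in a..b, deriv (d k) x := by
      rw [((hd k).absolutelyContinuousOnInterval a b).integral_deriv_eq_sub]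
      ring
    rw [h1, abs_neg]
    refine (intervalIntegral.abs_integral_le_integral_abs hab).trans ?_
    refine intervalIntegral.integral_mono_ae hab ?_ (hs_iv a b) ?_
    · exact ((hd k).absolutelyContinuousOnInterval a b).intervalIntegrable_deriv.norm
    · filter_upwards [hks] with x hx using hx k
  refine ⟨s, hs_meas, hsb, hsm, ?_⟩
  filter_upwards [hks, LocallyIntegrable.ae_hasDerivAt_integral hs_int, ae_all_iff.2 fun k =>
    (hd k).ae_differentiableAt] with x h1 h2 h3
  have hup := IsSpeedBound.tendsto_integral_div (h2 x) (hs0 x)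
  -- From below, a single distance function whose derivative exceeds `a` suffices. From above, `s`
  -- is itself a speed bound and is the derivative of its integral at almost every point.
  refine tendsto_order.2 ⟨fun a ha => ?_, fun a ha => ?_⟩
  · obtain ⟨k, hk⟩ := exists_lt_of_lt_ciSup ha
    have h4 := (h3 k).hasDerivAt.tendsto_slope_zero.abs
    filter_upwards [h4.eventually (lt_mem_nhds hk)] with t ht
    refine ht.trans_le ?_
    simp only [smul_eq_mul, abs_mul, abs_inv]
    rw [inv_mul_eq_div]
    gcongr
    exact abs_dist_sub_le _ _ _
  · filter_upwards [hup.eventually (gt_mem_nhds ha)] with t ht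
    refine lt_of_le_of_lt ?_ ht
    gcongr
    rw [dist_comm]
    exact hsb.dist_le_abs _ _

/-! ### Functions on an interval with vanishing weak derivative -/

theorem exists_Icc_of_isCompact_subset_Ioo {K : Set ℝ} {p q : ℝ} (hK : IsCompact K)
    (h : K ⊆ Ioo p q) (hpq : p < q) : ∃ p' q', p < p' ∧ p' ≤ q' ∧ q' < q ∧ K ⊆ Icc p' q' := by
  rcases K.eq_empty_or_nonempty with rfl | hne
  · exact ⟨(p + q) / 2, (p + q) / 2, by linarith, le_rfl, by linarith, empty_subset _⟩
  · have h1 := h (hK.sInf_mem hne)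
    have h2 := h (hK.sSup_mem hne)
    refine ⟨sInf K, sSup K, h1.1, csInf_le_csSup hne hK.bddBelow hK.bddAbove, h2.2, fun x hx => ?_⟩
    exact ⟨csInf_le hK.bddBelow hx, le_csSup hK.bddAbove hx⟩

/-- The du Bois-Reymond lemma. -/
theorem exists_ae_eq_const_of_integral_mul_deriv_eq_zero {f : ℝ → ℝ} {p q : ℝ} (hpq : p < q)
    (hf : IntegrableOn f (Ioo p q))
    (h : ∀ ζ : ℝ → ℝ, ContDiff ℝ ∞ ζ → HasCompactSupport ζ → tsupport ζ ⊆ Ioo p q →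
      ∫ x in Ioo p q, f x * deriv ζ x = 0) :
    ∃ c, ∀ᵐ x, x ∈ Ioo p q → f x = c := by
  -- a bump function of integral one
  obtain ⟨w, hw, hwc, hws, hw1⟩ : ∃ w : ℝ → ℝ, ContDiff ℝ ∞ w ∧ HasCompactSupport w ∧
      tsupport w ⊆ Ioo p q ∧ ∫ x, w x = 1 := by
    let B : ContDiffBump ((p + q) / 2) := ⟨(q - p) / 8, (q - p) / 4, by linarith, by linarith⟩
    refine ⟨B.normed volume, B.contDiff_normed, B.hasCompactSupport_normed, ?_, B.integral_normed⟩
    rw [B.tsupport_normed_eq, Real.closedBall_eq_Icc]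
    intro x hx
    simp only [B, mem_Icc] at hx
    constructor <;> linarith [hx.1, hx.2]
  set c := ∫ x in Ioo p q, f x * w x with hc
  refine ⟨c, ?_⟩
  have hbd : ∀ κ : ℝ → ℝ, ContDiff ℝ ∞ κ → HasCompactSupport κ →
      IntegrableOn (fun x => f x * κ x) (Ioo p q) := fun κ hκ hκc => by
    obtain ⟨C, hC⟩ := hκc.exists_bound_of_continuous hκ.continuous
    exact hf.mul_bdd hκ.continuous.aestronglyMeasurable (Eventually.of_forall hC)
  -- A test function of mean zero is the derivative of a test function: its primitive from `p`
  -- vanishes again beyond the support.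
  have key : ∀ κ : ℝ → ℝ, ContDiff ℝ ∞ κ → HasCompactSupport κ → tsupport κ ⊆ Ioo p q →
      ∫ x, κ x = 0 → ∫ x in Ioo p q, f x * κ x = 0 := by
    intro κ hκ hκc hκs hκ0
    obtain ⟨p', q', hp, hpq', hq, hK⟩ := exists_Icc_of_isCompact_subset_Ioo hκc hκs hpq
    let ζ : ℝ → ℝ := fun x => ∫ t in p..x, κ t
    have hd : ∀ x, HasDerivAt ζ (κ x) x := fun x =>
      intervalIntegral.integral_hasDerivAt_right (hκ.continuous.intervalIntegrable _ _)
        (hκ.continuous.stronglyMeasurableAtFilter _ _) hκ.continuous.continuousAt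
    have hdz : deriv ζ = κ := funext fun x => (hd x).deriv
    have hκz : ∀ x, x ∉ Icc p' q' → κ x = 0 := fun x hx =>
      image_eq_zero_of_notMem_tsupport fun hx' => hx (hK hx')
    have hz : ∀ x, x ∉ Icc p' q' → ζ x = 0 := by
      intro x hx
      rcases lt_or_ge x p' with hx1 | hx1
      · refine intervalIntegral.integral_zero_ae (Eventually.of_forall fun t ht => hκz t ?_)
        intro ht'
        rcases uIoc_subset_uIcc ht with ⟨_, h3⟩
        exact absurd (ht'.1.trans h3) (not_le.2 (max_lt hp hx1))
      · have hx2 : q' < x := lt_of_not_ge fun h' => hx ⟨hx1, h'⟩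
        have h3 : ∫ t, κ t = ∫ t in p..x, κ t := by
          rw [intervalIntegral.integral_of_le (by linarith)]
          refine (setIntegral_eq_integral_of_forall_compl_eq_zero fun t ht => hκz t fun ht' => ?_).symm
          exact ht ⟨by linarith [ht'.1], by linarith [ht'.2]⟩
        exact h3.symm.trans hκ0
    have hsupp : tsupport ζ ⊆ Icc p' q' :=
      closure_minimal (fun x hx => by_contra fun h' => hx (hz x h')) isClosed_Icc
    have := h ζ (contDiff_infty_iff_deriv.2 ⟨fun x => (hd x).differentiableAt, hdz ▸ hκ⟩)
      (isCompact_Icc.of_isClosed_subset (isClosed_tsupport _) hsupp)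
      (hsupp.trans fun x hx => ⟨by linarith [hx.1], by linarith [hx.2]⟩)
    rwa [hdz] at this
  have hfc : LocallyIntegrableOn (fun x => f x - c) (Ioo p q) :=
    (hf.sub (integrableOn_const (by simp))).locallyIntegrableOn
  have := isOpen_Ioo.ae_eq_zero_of_integral_contDiff_smul_eq_zero hfc fun η hη hηc hηs => ?_
  · filter_upwards [this] with x hx hx'
    exact sub_eq_zero.1 (hx hx')
  · have hset : ∀ F : ℝ → ℝ, ∫ x, η x • F x = ∫ x in Ioo p q, η x • F x := fun F => by
      refine (setIntegral_eq_integral_of_forall_compl_eq_zero fun t ht => ?_).symm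
      rw [image_eq_zero_of_notMem_tsupport fun hx' => ht (hηs hx'), zero_smul]
    set I := ∫ x, η x
    have hηi : Integrable η := hη.continuous.integrable_of_hasCompactSupport hηc
    have hwi : Integrable w := hw.continuous.integrable_of_hasCompactSupport hwc
    -- Subtracting a multiple of the fixed bump removes the mean of an arbitrary test function.
    have h1 := key (fun x => η x - I * w x) (hη.sub (contDiff_const.mul hw))
      (hηc.sub hwc.mul_left) ((tsupport_sub _ _).trans (union_subset hηs
        ((tsupport_mul_subset_right).trans hws))) (by
        rw [integral_sub hηi (hwi.const_mul _), integral_const_mul, hw1]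
        simp [I])
    have h2 : ∫ x in Ioo p q, f x * (η x - I * w x)
        = (∫ x in Ioo p q, f x * η x) - I * c := by
      rw [hc, ← integral_const_mul, ← integral_sub (hbd η hη hηc) ((hbd w hw hwc).const_mul I)]
      refine integral_congr_ae (Eventually.of_forall fun x => ?_)
      simp only
      ring
    have h3 : I = ∫ x in Ioo p q, η x := by simpa using hset fun _ => 1
    rw [hset, ← sub_eq_zero.2 (h1.symm.trans h2).symm]
    have h4 : ∫ x in Ioo p q, η x • (f x - c)
        = (∫ x in Ioo p q, f x * η x) - (∫ x in Ioo p q, η x) * c := by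
      rw [← integral_mul_const, ← integral_sub (hbd η hη hηc) (hηi.integrableOn.mul_const c)]
      refine integral_congr_ae (Eventually.of_forall fun x => ?_)
      simp only [smul_eq_mul]
      ring
    rw [h4, ← h3, ← h2, h1, sub_zero]

/-! ### Calculus on the parameter plane -/

/-- The derivative of `F` in the first variable. -/
def partialFst (F : ℝ × ℝ → ℝ) (p : ℝ × ℝ) : ℝ := fderiv ℝ F p (1, 0)

/-- The derivative of `F` in the second variable. -/
def partialSnd (F : ℝ × ℝ → ℝ) (p : ℝ × ℝ) : ℝ := fderiv ℝ F p (0, 1)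

theorem hasDerivAt_fst {F : ℝ × ℝ → ℝ} {p : ℝ × ℝ} (h : DifferentiableAt ℝ F p) :
    HasDerivAt (fun t => F (t, p.2)) (partialFst F p) p.1 :=
  h.hasFDerivAt.comp_hasDerivAt (f := fun t => (t, p.2)) p.1
    ((hasDerivAt_id p.1).prodMk (hasDerivAt_const p.1 p.2))

theorem hasDerivAt_snd {F : ℝ × ℝ → ℝ} {p : ℝ × ℝ} (h : DifferentiableAt ℝ F p) :
    HasDerivAt (fun y => F (p.1, y)) (partialSnd F p) p.2 :=
  h.hasFDerivAt.comp_hasDerivAt (f := fun y => (p.1, y)) p.2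
    ((hasDerivAt_const p.2 p.1).prodMk (hasDerivAt_id p.2))

theorem fderiv_apply_eq_partial (F : ℝ × ℝ → ℝ) (p v : ℝ × ℝ) :
    fderiv ℝ F p v = partialFst F p * v.1 + partialSnd F p * v.2 := by
  have : v = v.1 • ((1, 0) : ℝ × ℝ) + v.2 • ((0, 1) : ℝ × ℝ) := by ext <;> simp
  conv_lhs => rw [this]
  rw [map_add, map_smul, map_smul, smul_eq_mul, smul_eq_mul, partialFst, partialSnd, mul_comm,
    mul_comm v.2]

theorem contDiff_partialFst {F : ℝ × ℝ → ℝ} {k : ℕ∞} (h : ContDiff ℝ (k + 1) F) :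
    ContDiff ℝ k (partialFst F) :=
  (h.fderiv_right (m := k) le_rfl).clm_apply contDiff_const

theorem contDiff_partialSnd {F : ℝ × ℝ → ℝ} {k : ℕ∞} (h : ContDiff ℝ (k + 1) F) :
    ContDiff ℝ k (partialSnd F) :=
  (h.fderiv_right (m := k) le_rfl).clm_apply contDiff_const

theorem partial_comm {F : ℝ × ℝ → ℝ} (h : ContDiff ℝ 2 F) (p : ℝ × ℝ) :
    partialFst (partialSnd F) p = partialSnd (partialFst F) p := by
  have hd : DifferentiableAt ℝ (fderiv ℝ F) p :=
    (h.fderiv_right (m := 1) (by norm_num)).differentiable one_ne_zero p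
  have e : ∀ v w : ℝ × ℝ, fderiv ℝ (fun q => fderiv ℝ F q v) p w = fderiv ℝ (fderiv ℝ F) p w v := by
    intro v w
    rw [fderiv_clm_apply hd (differentiableAt_const v)]
    simp
  have hs : IsSymmSndFDerivAt ℝ F p := h.contDiffAt.isSymmSndFDerivAt (by simp)
  exact (e (0, 1) (1, 0)).trans ((hs (1, 0) (0, 1)).trans (e (1, 0) (0, 1)).symm)

/-! ### Change of variables from the parameter plane to the Euclidean plane -/

/-- The measurable equivalence between `ℝ × ℝ` and the Euclidean plane. -/
def planeEquiv : ℝ × ℝ ≃ᵐ EuclideanSpace ℝ (Fin 2) :=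
  MeasurableEquiv.finTwoArrow.symm.trans (MeasurableEquiv.toLp 2 (Fin 2 → ℝ))

theorem planeEquiv_apply (p : ℝ × ℝ) : planeEquiv p = !₂[p.1, p.2] := by
  ext i
  fin_cases i <;> rfl

theorem measurePreserving_planeEquiv : MeasurePreserving planeEquiv :=
  (volume_preserving_finTwoArrow ℝ).symm.trans (EuclideanSpace.volume_preserving_symm_measurableEquiv_toLp (Fin 2)).symm

/-- The map into the plane with components `P` and `R`. -/
def planeMap (P R : ℝ × ℝ → ℝ) (p : ℝ × ℝ) : EuclideanSpace ℝ (Fin 2) := !₂[P p, R p]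

/-- The Jacobian determinant of `planeMap P P'`. -/
def jac (P P' : ℝ × ℝ → ℝ) (p : ℝ × ℝ) : ℝ :=
  partialFst P p * partialSnd P' p - partialSnd P p * partialFst P' p

theorem det_prod_eq_jac (P P' : ℝ × ℝ → ℝ) (p : ℝ × ℝ) :
    ((fderiv ℝ P p).prod (fderiv ℝ P' p)).det = jac P P' p := by
  rw [ContinuousLinearMap.det, ← LinearMap.det_toMatrix (Module.Basis.finTwoProd ℝ)]
  rw [Matrix.det_fin_two]
  simp only [LinearMap.toMatrix_apply, jac, partialFst, partialSnd]
  simp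

section ChangeOfVariables

variable {P P' : ℝ × ℝ → ℝ} {R : Set (ℝ × ℝ)}

theorem planeMap_eq (P P' : ℝ × ℝ → ℝ) : planeMap P P' = planeEquiv ∘ fun p => (P p, P' p) :=
  funext fun p => (planeEquiv_apply (P p, P' p)).symm

theorem lintegral_planeMap_image (hP : Differentiable ℝ P) (hP' : Differentiable ℝ P')
    (hR : MeasurableSet R) (hinj : InjOn (planeMap P P') R)
    (G : EuclideanSpace ℝ (Fin 2) → ℝ≥0∞) :
    ∫⁻ x in planeMap P P' '' R, G x
      = ∫⁻ p in R, ENNReal.ofReal |jac P P' p| * G (planeMap P P' p) := by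
  rw [planeMap_eq] at hinj ⊢
  rw [image_comp, ← measurePreserving_planeEquiv.setLIntegral_comp_emb
    planeEquiv.measurableEmbedding, lintegral_image_eq_lintegral_abs_det_fderiv_mul volume hR
    (fun p _ => ((hP p).hasFDerivAt.prodMk (hP' p).hasFDerivAt).hasFDerivWithinAt)
    (InjOn.of_comp hinj)]
  simp only [det_prod_eq_jac, Function.comp_apply]

theorem integral_planeMap_image (hP : Differentiable ℝ P) (hP' : Differentiable ℝ P')
    (hR : MeasurableSet R) (hinj : InjOn (planeMap P P') R) (G : EuclideanSpace ℝ (Fin 2) → ℝ) :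
    ∫ x in planeMap P P' '' R, G x = ∫ p in R, |jac P P' p| * G (planeMap P P' p) := by
  rw [planeMap_eq] at hinj ⊢
  rw [image_comp, measurePreserving_planeEquiv.setIntegral_image_emb
    planeEquiv.measurableEmbedding, integral_image_eq_integral_abs_det_fderiv_smul volume hR
    (fun p _ => ((hP p).hasFDerivAt.prodMk (hP' p).hasFDerivAt).hasFDerivWithinAt)
    (InjOn.of_comp hinj)]
  simp only [det_prod_eq_jac, Function.comp_apply, smul_eq_mul]

theorem integrableOn_planeMap_image (hP : Differentiable ℝ P) (hP' : Differentiable ℝ P')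
    (hR : MeasurableSet R) (hinj : InjOn (planeMap P P') R) (G : EuclideanSpace ℝ (Fin 2) → ℝ) :
    IntegrableOn G (planeMap P P' '' R)
      ↔ IntegrableOn (fun p => |jac P P' p| * G (planeMap P P' p)) R := by
  rw [planeMap_eq] at hinj ⊢
  rw [image_comp, measurePreserving_planeEquiv.integrableOn_image
    planeEquiv.measurableEmbedding, integrableOn_image_iff_integrableOn_abs_det_fderiv_smul volume hR
    (fun p _ => ((hP p).hasFDerivAt.prodMk (hP' p).hasFDerivAt).hasFDerivWithinAt)
    (InjOn.of_comp hinj)]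
  simp only [det_prod_eq_jac, Function.comp_apply, smul_eq_mul]

end ChangeOfVariables

/-! ### Integration by parts on a rectangle -/

theorem integral_mul_deriv_eq_neg {F κ : ℝ → ℝ} {a b : ℝ} (hab : a ≤ b)
    (hF : AbsolutelyContinuousOnInterval F a b) (hκ : ContDiff ℝ 1 κ) (ha : κ a = 0)
    (hb : κ b = 0) :
    ∫ x in Ioo a b, F x * deriv κ x = -∫ x in Ioo a b, deriv F x * κ x := by
  rw [← integral_Ioc_eq_integral_Ioo, ← integral_Ioc_eq_integral_Ioo,
    ← intervalIntegral.integral_of_le hab, ← intervalIntegral.integral_of_le hab,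
    hF.integral_mul_deriv_eq_deriv_mul hκ.contDiffOn.absolutelyContinuousOnInterval, ha, hb]
  ring

/-- A continuous function on the closed rectangle which is Lipschitz in the first variable, and
absolutely continuous with a uniform bound in the second. -/
structure IsRectRegular {X : Type*} [MetricSpace X] (W : ℝ × ℝ → X) (a b c d C : ℝ) (m : ℝ → ℝ) :
    Prop where
  continuous : Continuous W
  lip : ∀ t ∈ Icc a b, ∀ t' ∈ Icc a b, ∀ y ∈ Icc c d, dist (W (t, y)) (W (t', y)) ≤ C * |t - t'|
  speed : ∀ t ∈ Icc a b, ∀ y ∈ Icc c d, ∀ y' ∈ Icc c d, y ≤ y' →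
    dist (W (t, y)) (W (t, y')) ≤ ∫ x in y..y', m x
  nonneg : 0 ≤ C
  intg : LocallyIntegrable m
  m_nonneg : ∀ y, 0 ≤ m y

namespace IsRectRegular

variable {a b c d C : ℝ} {m : ℝ → ℝ}

theorem dist_right {X : Type*} [MetricSpace X] {W : ℝ × ℝ → X} (h : IsRectRegular W a b c d C m)
    (T : X) : IsRectRegular (fun p => dist (W p) T) a b c d C m where
  continuous := h.continuous.dist continuous_const
  lip t ht t' ht' y hy := (abs_dist_sub_le _ _ _).trans (h.lip t ht t' ht' y hy)
  speed t ht y hy y' hy' hyy := (abs_dist_sub_le _ _ _).trans (h.speed t ht y hy y' hy' hyy)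
  nonneg := h.nonneg
  intg := h.intg
  m_nonneg := h.m_nonneg

variable {F : ℝ × ℝ → ℝ}

theorem ac_fst (h : IsRectRegular F a b c d C m) (hab : a ≤ b) {y : ℝ} (hy : y ∈ Icc c d) :
    AbsolutelyContinuousOnInterval (fun t => F (t, y)) a b := by
  refine LipschitzOnWith.absolutelyContinuousOnInterval (K := C.toNNReal) ?_
  refine LipschitzOnWith.of_dist_le_mul fun t ht t' ht' => ?_
  rw [uIcc_of_le hab] at ht ht'
  rw [Real.coe_toNNReal _ h.nonneg]
  exact h.lip t ht t' ht' y hy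

theorem intervalIntegrable (h : IsRectRegular F a b c d C m) (x y : ℝ) :
    IntervalIntegrable m volume x y :=
  intervalIntegrable_iff.2 ((h.intg.integrableOn_isCompact isCompact_uIcc).mono_set
    uIoc_subset_uIcc)

theorem speed_abs (h : IsRectRegular F a b c d C m) {t y y' : ℝ} (ht : t ∈ Icc a b)
    (hy : y ∈ Icc c d) (hy' : y' ∈ Icc c d) :
    dist (F (t, y)) (F (t, y')) ≤ |∫ x in y..y', m x| := by
  rcases le_total y y' with hab | hab
  · exact (h.speed t ht y hy y' hy' hab).trans (le_abs_self _)
  · rw [dist_comm, intervalIntegral.integral_symm, abs_neg]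
    exact (h.speed t ht y' hy' y hy hab).trans (le_abs_self _)

theorem ac_snd (h : IsRectRegular F a b c d C m) (hcd : c ≤ d) {t : ℝ} (ht : t ∈ Icc a b) :
    AbsolutelyContinuousOnInterval (fun y => F (t, y)) c d := by
  refine absolutelyContinuousOnInterval_of_dist_le
    ((h.intervalIntegrable c d).absolutelyContinuousOnInterval_intervalIntegral left_mem_uIcc)
    fun x hx y hy => ?_
  rw [uIcc_of_le hcd] at hx hy
  rw [Real.dist_eq (∫ v in c..x, m v), abs_sub_comm, intervalIntegral.integral_interval_sub_left
    (h.intervalIntegrable _ _) (h.intervalIntegrable _ _)]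
  exact h.speed_abs ht hx hy

/-- The classical derivative in the first variable. -/
def dFst (F : ℝ × ℝ → ℝ) (p : ℝ × ℝ) : ℝ := deriv (fun t => F (t, p.2)) p.1

/-- The classical derivative in the second variable. -/
def dSnd (F : ℝ × ℝ → ℝ) (p : ℝ × ℝ) : ℝ := deriv (fun y => F (p.1, y)) p.2

theorem measurable_dSnd (hF : Continuous F) : Measurable (dSnd F) :=
  measurable_deriv_with_param (f := fun t y => F (t, y)) (by exact hF)

theorem measurable_dFst (hF : Continuous F) : Measurable (dFst F) :=
  (measurable_deriv_with_param (f := fun y t => F (t, y)) (by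
    exact hF.comp continuous_swap)).comp measurable_swap

theorem abs_dFst_le (h : IsRectRegular F a b c d C m) {p : ℝ × ℝ} (hp : p ∈ Ioo a b ×ˢ Ioo c d) :
    |dFst F p| ≤ C := by
  by_cases hd : DifferentiableAt ℝ (fun t => F (t, p.2)) p.1
  · have h1 := hd.hasDerivAt.tendsto_slope_zero.abs
    refine le_of_tendsto h1 ?_
    have h2 : ∀ᶠ k in 𝓝[≠] (0 : ℝ), p.1 + k ∈ Ioo a b := by
      have : Tendsto (fun k => p.1 + k) (𝓝[≠] (0 : ℝ)) (𝓝 p.1) := by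
        refine Tendsto.mono_left ?_ nhdsWithin_le_nhds
        have : Continuous fun k => p.1 + k := by fun_prop
        simpa using this.tendsto 0
      exact this.eventually (isOpen_Ioo.mem_nhds hp.1)
    filter_upwards [h2, self_mem_nhdsWithin] with k hk hk0
    have hk0' : 0 < |k| := abs_pos.2 hk0
    simp only [smul_eq_mul, abs_mul, abs_inv]
    rw [inv_mul_le_iff₀ hk0', mul_comm]
    have := h.lip _ (Ioo_subset_Icc_self hk) _ (Ioo_subset_Icc_self hp.1) _
      (Ioo_subset_Icc_self hp.2)
    simpa [Real.dist_eq] using this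
  · rw [dFst, deriv_zero_of_not_differentiableAt hd, abs_zero]
    exact h.nonneg

theorem ae_abs_dSnd_le (h : IsRectRegular F a b c d C m) {t : ℝ} (ht : t ∈ Ioo a b) :
    ∀ᵐ y, y ∈ Ioo c d → |dSnd F (t, y)| ≤ m y := by
  filter_upwards [LocallyIntegrable.ae_hasDerivAt_integral h.intg] with y hy hyI
  by_cases hd : DifferentiableAt ℝ (fun y => F (t, y)) y
  · have h1 := hd.hasDerivAt.tendsto_slope_zero.abs
    refine le_of_tendsto_of_tendsto h1 (IsSpeedBound.tendsto_integral_div (hy y) (h.m_nonneg y)) ?_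
    have h2 : ∀ᶠ k in 𝓝[≠] (0 : ℝ), y + k ∈ Ioo c d := by
      have : Tendsto (fun k => y + k) (𝓝[≠] (0 : ℝ)) (𝓝 y) := by
        refine Tendsto.mono_left ?_ nhdsWithin_le_nhds
        have : Continuous fun k => y + k := by fun_prop
        simpa using this.tendsto 0
      exact this.eventually (isOpen_Ioo.mem_nhds hyI)
    filter_upwards [h2] with k hk
    simp only [smul_eq_mul, abs_mul, abs_inv]
    rw [inv_mul_eq_div]
    refine div_le_div_of_nonneg_right ?_ (abs_nonneg k)
    have := h.speed_abs (Ioo_subset_Icc_self ht) (Ioo_subset_Icc_self hyI) (Ioo_subset_Icc_self hk)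
    rwa [dist_comm, Real.dist_eq] at this
  · rw [dSnd, deriv_zero_of_not_differentiableAt hd, abs_zero]
    exact h.m_nonneg y

theorem integrableOn_dFst (h : IsRectRegular F a b c d C m) :
    IntegrableOn (dFst F) (Ioo a b ×ˢ Ioo c d) := by
  refine Integrable.mono' (g := fun _ => C) (integrableOn_const (by
    rw [Measure.volume_eq_prod, Measure.prod_prod]; simp [ENNReal.mul_eq_top]))
    (measurable_dFst h.continuous).aestronglyMeasurable ?_
  filter_upwards [ae_restrict_mem (measurableSet_Ioo.prod measurableSet_Ioo)] with p hp
  exact h.abs_dFst_le hp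

theorem ae_abs_dSnd_le_prod (h : IsRectRegular F a b c d C m) :
    ∀ᵐ p ∂(volume : Measure (ℝ × ℝ)).restrict (Ioo a b ×ˢ Ioo c d), |dSnd F p| ≤ m p.2 := by
  obtain ⟨m', hm', hmm⟩ := h.intg.aestronglyMeasurable
  have h2 : ∀ᵐ p : ℝ × ℝ, m p.2 = m' p.2 := by
    rw [Measure.volume_eq_prod]
    exact Measure.quasiMeasurePreserving_snd.ae hmm
  have h1 : ∀ᵐ p : ℝ × ℝ, p ∈ Ioo a b ×ˢ Ioo c d → |dSnd F p| ≤ m' p.2 := by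
    rw [Measure.volume_eq_prod, Measure.ae_prod_iff_ae_ae]
    · refine Eventually.of_forall fun t => ?_
      by_cases ht : t ∈ Ioo a b
      · filter_upwards [h.ae_abs_dSnd_le ht, hmm] with y hy hy2 hp
        rw [← hy2]
        exact hy hp.2
      · exact Eventually.of_forall fun y hp => absurd hp.1 ht
    · exact ((measurableSet_Ioo.prod measurableSet_Ioo).mem.imp (measurableSet_le
        (measurable_dSnd h.continuous).norm (hm'.measurable.comp measurable_snd)).mem).setOf
  rw [ae_restrict_iff' (measurableSet_Ioo.prod measurableSet_Ioo)]
  filter_upwards [h1, h2] with p h1 h2 hp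
  rw [h2]
  exact h1 hp

theorem integrableOn_snd {m : ℝ → ℝ} (hm : LocallyIntegrable m) :
    IntegrableOn (fun p : ℝ × ℝ => m p.2) (Ioo a b ×ˢ Ioo c d) := by
  have h1 : IntegrableOn m (Ioo c d) :=
    (hm.integrableOn_isCompact isCompact_Icc).mono_set Ioo_subset_Icc_self
  have h2 : Integrable (fun _ : ℝ => (1 : ℝ)) (volume.restrict (Ioo a b)) :=
    integrableOn_const (by simp)
  rw [IntegrableOn, Measure.volume_eq_prod, ← Measure.prod_restrict]
  simpa using h2.mul_prod h1

theorem integrableOn_dSnd (h : IsRectRegular F a b c d C m) :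
    IntegrableOn (dSnd F) (Ioo a b ×ˢ Ioo c d) :=
  (integrableOn_snd h.intg).mono' (measurable_dSnd h.continuous).aestronglyMeasurable
    h.ae_abs_dSnd_le_prod

theorem integrableOn_mul_continuous {f κ : ℝ × ℝ → ℝ} (hf : IntegrableOn f (Ioo a b ×ˢ Ioo c d))
    (hκ : Continuous κ) : IntegrableOn (fun p => f p * κ p) (Ioo a b ×ˢ Ioo c d) := by
  obtain ⟨K, hK⟩ := ((isCompact_Icc (a := a) (b := b)).prod
    (isCompact_Icc (a := c) (b := d))).exists_bound_of_continuousOn hκ.continuousOn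
  refine hf.mul_bdd (c := K) hκ.aestronglyMeasurable ?_
  filter_upwards [ae_restrict_mem (measurableSet_Ioo.prod measurableSet_Ioo)] with p hp
  exact hK p ⟨Ioo_subset_Icc_self hp.1, Ioo_subset_Icc_self hp.2⟩

theorem integrableOn_continuous {κ : ℝ × ℝ → ℝ} (hκ : Continuous κ) :
    IntegrableOn κ (Ioo a b ×ˢ Ioo c d) :=
  (hκ.continuousOn.integrableOn_compact (isCompact_Icc.prod isCompact_Icc)).mono_set
    (prod_mono Ioo_subset_Icc_self Ioo_subset_Icc_self)

theorem integral_mul_partialFst (h : IsRectRegular F a b c d C m) (hab : a ≤ b) {κ : ℝ × ℝ → ℝ}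
    (hκ : ContDiff ℝ 1 κ) (h0 : ∀ y ∈ Icc c d, κ (a, y) = 0 ∧ κ (b, y) = 0) :
    ∫ p in Ioo a b ×ˢ Ioo c d, F p * partialFst κ p
      = -∫ p in Ioo a b ×ˢ Ioo c d, dFst F p * κ p := by
  have hκ' : Continuous (partialFst κ) := (contDiff_partialFst (k := 0) (by simpa using hκ)).continuous
  rw [Measure.volume_eq_prod, ← Measure.prod_restrict, integral_prod_symm, integral_prod_symm,
    ← integral_neg]
  rotate_left
  · rw [Measure.prod_restrict, ← Measure.volume_eq_prod]
    exact integrableOn_mul_continuous h.integrableOn_dFst hκ.continuous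
  · rw [Measure.prod_restrict, ← Measure.volume_eq_prod]
    exact integrableOn_continuous (h.continuous.mul hκ')
  refine setIntegral_congr_fun measurableSet_Ioo fun y hy => ?_
  have h1 : ∀ t, partialFst κ (t, y) = deriv (fun t => κ (t, y)) t := fun t =>
    (hasDerivAt_fst (p := (t, y)) (hκ.differentiable one_ne_zero _)).deriv.symm
  simp only [h1]
  exact integral_mul_deriv_eq_neg hab (h.ac_fst hab (Ioo_subset_Icc_self hy))
    (hκ.comp (contDiff_id.prodMk contDiff_const)) (h0 y (Ioo_subset_Icc_self hy)).1
    (h0 y (Ioo_subset_Icc_self hy)).2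

theorem integral_mul_partialSnd (h : IsRectRegular F a b c d C m) (hcd : c ≤ d) {κ : ℝ × ℝ → ℝ}
    (hκ : ContDiff ℝ 1 κ) (h0 : ∀ t ∈ Icc a b, κ (t, c) = 0 ∧ κ (t, d) = 0) :
    ∫ p in Ioo a b ×ˢ Ioo c d, F p * partialSnd κ p
      = -∫ p in Ioo a b ×ˢ Ioo c d, dSnd F p * κ p := by
  have hκ' : Continuous (partialSnd κ) := (contDiff_partialSnd (k := 0) (by simpa using hκ)).continuous
  rw [Measure.volume_eq_prod, ← Measure.prod_restrict, integral_prod, integral_prod,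
    ← integral_neg]
  rotate_left
  · rw [Measure.prod_restrict, ← Measure.volume_eq_prod]
    exact integrableOn_mul_continuous h.integrableOn_dSnd hκ.continuous
  · rw [Measure.prod_restrict, ← Measure.volume_eq_prod]
    exact integrableOn_continuous (h.continuous.mul hκ')
  refine setIntegral_congr_fun measurableSet_Ioo fun t ht => ?_
  have h1 : ∀ y, partialSnd κ (t, y) = deriv (fun y => κ (t, y)) y := fun y =>
    (hasDerivAt_snd (p := (t, y)) (hκ.differentiable one_ne_zero _)).deriv.symm
  simp only [h1]
  exact integral_mul_deriv_eq_neg hcd (h.ac_snd hcd (Ioo_subset_Icc_self ht))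
    (hκ.comp (contDiff_const.prodMk contDiff_id)) (h0 t (Ioo_subset_Icc_self ht)).1
    (h0 t (Ioo_subset_Icc_self ht)).2

/-- Integration by parts against the (divergence free) rotated gradient of `B`. -/
theorem integral_mul_rot (h : IsRectRegular F a b c d C m) (hab : a ≤ b) (hcd : c ≤ d)
    {κ B : ℝ × ℝ → ℝ} (hκ : ContDiff ℝ 1 κ) (hB : ContDiff ℝ 2 B)
    (h0 : ∀ p ∈ Icc a b ×ˢ Icc c d, p ∉ Ioo a b ×ˢ Ioo c d → κ p = 0) :
    ∫ p in Ioo a b ×ˢ Ioo c d, F p *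
        (partialFst κ p * partialSnd B p - partialSnd κ p * partialFst B p)
      = -∫ p in Ioo a b ×ˢ Ioo c d, (dFst F p * partialSnd B p - dSnd F p * partialFst B p) * κ p := by
  have hB1 : ContDiff ℝ 1 (partialFst B) := contDiff_partialFst (k := 1) (by exact_mod_cast hB)
  have hB2 : ContDiff ℝ 1 (partialSnd B) := contDiff_partialSnd (k := 1) (by exact_mod_cast hB)
  have d1 := hκ.differentiable one_ne_zero
  have d2 := hB1.differentiable one_ne_zero
  have d3 := hB2.differentiable one_ne_zero
  have e1 : ∀ p, partialFst (fun p => κ p * partialSnd B p) p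
      = partialFst κ p * partialSnd B p + κ p * partialFst (partialSnd B) p := fun p => by
    rw [partialFst, fderiv_fun_mul (d1 p) (d3 p)]
    simp [partialFst]
    ring
  have e2 : ∀ p, partialSnd (fun p => κ p * partialFst B p) p
      = partialSnd κ p * partialFst B p + κ p * partialSnd (partialFst B) p := fun p => by
    rw [partialSnd, fderiv_fun_mul (d1 p) (d2 p)]
    simp [partialSnd]
    ring
  have c1 : ContDiff ℝ 1 (fun p => κ p * partialSnd B p) := hκ.mul hB2
  have c2 : ContDiff ℝ 1 (fun p => κ p * partialFst B p) := hκ.mul hB1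
  have k1 := h.integral_mul_partialFst hab c1 (fun y hy => by
    constructor
    · rw [h0 (a, y) ⟨⟨le_rfl, hab⟩, hy⟩ (fun hp => lt_irrefl a hp.1.1), zero_mul]
    · rw [h0 (b, y) ⟨⟨hab, le_rfl⟩, hy⟩ (fun hp => lt_irrefl b hp.1.2), zero_mul])
  have k2 := h.integral_mul_partialSnd hcd c2 (fun t ht => by
    constructor
    · rw [h0 (t, c) ⟨ht, ⟨le_rfl, hcd⟩⟩ (fun hp => lt_irrefl c hp.2.1), zero_mul]
    · rw [h0 (t, d) ⟨ht, ⟨hcd, le_rfl⟩⟩ (fun hp => lt_irrefl d hp.2.2), zero_mul])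
  have p1 : Continuous (partialFst fun p => κ p * partialSnd B p) :=
    (contDiff_partialFst (k := 0) (by simpa using c1)).continuous
  have p2 : Continuous (partialSnd fun p => κ p * partialFst B p) :=
    (contDiff_partialSnd (k := 0) (by simpa using c2)).continuous
  -- The rotated gradient of `B` is divergence free: the mixed second derivatives of `B` produced by
  -- the two product rules cancel.
  have l1 : ∀ p, F p * (partialFst κ p * partialSnd B p - partialSnd κ p * partialFst B p)
      = F p * partialFst (fun p => κ p * partialSnd B p) p
        - F p * partialSnd (fun p => κ p * partialFst B p) p := fun p => by
    rw [e1, e2, partial_comm hB]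
    ring
  have l2 : ∀ p, (dFst F p * partialSnd B p - dSnd F p * partialFst B p) * κ p
      = dFst F p * (κ p * partialSnd B p) - dSnd F p * (κ p * partialFst B p) := fun p => by ring
  simp only [l1, l2]
  have i1 : IntegrableOn (fun p => F p * partialFst (fun p => κ p * partialSnd B p) p)
      (Ioo a b ×ˢ Ioo c d) := integrableOn_continuous (h.continuous.mul p1)
  have i2 : IntegrableOn (fun p => F p * partialSnd (fun p => κ p * partialFst B p) p)
      (Ioo a b ×ˢ Ioo c d) := integrableOn_continuous (h.continuous.mul p2)
  rw [integral_sub i1 i2, k1, k2,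
    integral_sub (integrableOn_mul_continuous h.integrableOn_dFst c1.continuous)
    (integrableOn_mul_continuous h.integrableOn_dSnd c2.continuous)]
  ring

end IsRectRegular

/-! ### Charts of the plane, and an upper bound for the energy in coordinates -/

theorem planeMap_eq_smul (P P' : ℝ × ℝ → ℝ) (p : ℝ × ℝ) : planeMap P P' p =
    P p • EuclideanSpace.single (0 : Fin 2) (1 : ℝ) + P' p • EuclideanSpace.single 1 1 := by
  ext i
  fin_cases i <;> simp [planeMap]

theorem contDiff_planeMap {P P' : ℝ × ℝ → ℝ} {k : WithTop ℕ∞} (hP : ContDiff ℝ k P)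
    (hP' : ContDiff ℝ k P') : ContDiff ℝ k (planeMap P P') := by
  rw [show planeMap P P' = fun p => P p • EuclideanSpace.single (0 : Fin 2) (1 : ℝ)
    + P' p • EuclideanSpace.single 1 1 from funext (planeMap_eq_smul P P')]
  fun_prop

theorem fderiv_planeMap {P P' : ℝ × ℝ → ℝ} {p : ℝ × ℝ} (hP : DifferentiableAt ℝ P p)
    (hP' : DifferentiableAt ℝ P' p) (v : ℝ × ℝ) : fderiv ℝ (planeMap P P') p v =
      fderiv ℝ P p v • EuclideanSpace.single (0 : Fin 2) (1 : ℝ)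
        + fderiv ℝ P' p v • EuclideanSpace.single 1 1 := by
  rw [show planeMap P P' = fun p => P p • EuclideanSpace.single (0 : Fin 2) (1 : ℝ)
    + P' p • EuclideanSpace.single 1 1 from funext (planeMap_eq_smul P P')]
  have := ((hP.hasFDerivAt.smul_const (EuclideanSpace.single (0 : Fin 2) (1 : ℝ))).fun_add
    (hP'.hasFDerivAt.smul_const (EuclideanSpace.single (1 : Fin 2) (1 : ℝ)))).fderiv
  rw [this]
  rfl

/-- Smooth coordinates `planeMap P P'` on the open set `Ω`, parametrized by an open rectangle. -/
structure PlaneChart (P P' : ℝ × ℝ → ℝ) (a b c d : ℝ) (Ω : Set (EuclideanSpace ℝ (Fin 2))) :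
    Prop where
  contDiff_fst : ContDiff ℝ 2 P
  contDiff_snd : ContDiff ℝ 2 P'
  injOn : InjOn (planeMap P P') (Ioo a b ×ˢ Ioo c d)
  jac_pos : ∀ p ∈ Icc a b ×ˢ Icc c d, 0 < jac P P' p
  image_eq : planeMap P P' '' (Ioo a b ×ˢ Ioo c d) = Ω
  isOpen : IsOpen Ω
  boundary : ∀ p ∈ Icc a b ×ˢ Icc c d, p ∉ Ioo a b ×ˢ Ioo c d → planeMap P P' p ∉ Ω
  fst_lt : a < b
  snd_lt : c < d

namespace PlaneChart

variable {P P' : ℝ × ℝ → ℝ} {a b c d : ℝ} {Ω : Set (EuclideanSpace ℝ (Fin 2))}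

theorem measurableSet_rect (a b c d : ℝ) : MeasurableSet (Ioo a b ×ˢ Ioo c d) :=
  measurableSet_Ioo.prod measurableSet_Ioo

theorem rect_subset {a b c d : ℝ} {p : ℝ × ℝ} (hp : p ∈ Ioo a b ×ˢ Ioo c d) :
    p ∈ Icc a b ×ˢ Icc c d := ⟨Ioo_subset_Icc_self hp.1, Ioo_subset_Icc_self hp.2⟩

theorem differentiable_fst (h : PlaneChart P P' a b c d Ω) : Differentiable ℝ P :=
  h.contDiff_fst.differentiable two_ne_zero

theorem differentiable_snd (h : PlaneChart P P' a b c d Ω) : Differentiable ℝ P' :=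
  h.contDiff_snd.differentiable two_ne_zero

theorem isBounded (h : PlaneChart P P' a b c d Ω) : Bornology.IsBounded Ω := by
  have hK : IsCompact (planeMap P P' '' (Icc a b ×ˢ Icc c d)) :=
    (isCompact_Icc.prod isCompact_Icc).image
      (contDiff_planeMap h.contDiff_fst h.contDiff_snd).continuous
  refine hK.isBounded.subset ?_
  rw [← h.image_eq]
  exact image_mono fun p hp => rect_subset hp

theorem lintegral_eq (h : PlaneChart P P' a b c d Ω) (G : EuclideanSpace ℝ (Fin 2) → ℝ≥0∞) :
    ∫⁻ x in Ω, G x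
      = ∫⁻ p in Ioo a b ×ˢ Ioo c d, ENNReal.ofReal (jac P P' p) * G (planeMap P P' p) := by
  rw [← h.image_eq, lintegral_planeMap_image h.differentiable_fst h.differentiable_snd
    (measurableSet_rect a b c d) h.injOn]
  refine setLIntegral_congr_fun (measurableSet_rect a b c d) fun p hp => ?_
  rw [abs_of_pos (h.jac_pos p (rect_subset hp))]

theorem integral_eq (h : PlaneChart P P' a b c d Ω) (G : EuclideanSpace ℝ (Fin 2) → ℝ) :
    ∫ x in Ω, G x = ∫ p in Ioo a b ×ˢ Ioo c d, jac P P' p * G (planeMap P P' p) := by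
  rw [← h.image_eq, integral_planeMap_image h.differentiable_fst h.differentiable_snd
    (measurableSet_rect a b c d) h.injOn]
  refine setIntegral_congr_fun (measurableSet_rect a b c d) fun p hp => ?_
  rw [abs_of_pos (h.jac_pos p (rect_subset hp))]

theorem integrableOn_iff (h : PlaneChart P P' a b c d Ω) (G : EuclideanSpace ℝ (Fin 2) → ℝ) :
    IntegrableOn G Ω ↔ IntegrableOn (fun p => jac P P' p * G (planeMap P P' p))
      (Ioo a b ×ˢ Ioo c d) := by
  rw [← h.image_eq, integrableOn_planeMap_image h.differentiable_fst h.differentiable_snd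
    (measurableSet_rect a b c d) h.injOn]
  refine integrableOn_congr_fun (fun p hp => ?_) (measurableSet_rect a b c d)
  rw [abs_of_pos (h.jac_pos p (rect_subset hp))]

/-- Differentiable maps between spaces of equal dimension send null sets to null sets. -/
theorem ae_image (h : PlaneChart P P' a b c d Ω) {p : EuclideanSpace ℝ (Fin 2) → Prop}
    (hp : ∀ᵐ q ∂(volume : Measure (ℝ × ℝ)).restrict (Ioo a b ×ˢ Ioo c d), p (planeMap P P' q)) :
    ∀ᵐ x ∂volume.restrict Ω, p x := by
  rw [ae_restrict_iff' (measurableSet_rect a b c d)] at hp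
  rw [ae_restrict_iff' h.isOpen.measurableSet]
  set N := {q | ¬(q ∈ Ioo a b ×ˢ Ioo c d → p (planeMap P P' q))} with hN
  have h1 : volume ((fun q => (P q, P' q)) '' N) = 0 :=
    addHaar_image_eq_zero_of_differentiableOn_of_addHaar_eq_zero volume
      (fun q _ => ((h.differentiable_fst q).prodMk (h.differentiable_snd q)).differentiableWithinAt)
      hp
  refine measure_mono_null ?_ (show volume (planeMap P P' '' N) = 0 from ?_)
  · intro x hx
    simp only [mem_compl_iff, mem_ofPred_eq, Classical.not_imp] at hx
    obtain ⟨q, hq, rfl⟩ := h.image_eq.symm ▸ hx.1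
    exact ⟨q, fun h' => hx.2 (h' hq), rfl⟩
  · rw [planeMap_eq, image_comp, MeasurableEquiv.image_eq_preimage_symm,
      measurePreserving_planeEquiv.symm.measure_preimage_emb
        planeEquiv.symm.measurableEmbedding]
    exact h1

/-- The change of variables for the indicator of a null set gives an integral zero over the
rectangle, and the positive Jacobian can be dropped from it. -/
theorem ae_comp (h : PlaneChart P P' a b c d Ω) {p : EuclideanSpace ℝ (Fin 2) → Prop}
    (hp : ∀ᵐ x ∂volume.restrict Ω, p x) :
    ∀ᵐ q ∂(volume : Measure (ℝ × ℝ)).restrict (Ioo a b ×ˢ Ioo c d), p (planeMap P P' q) := by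
  obtain ⟨N, hN1, hN2, hN3⟩ := exists_measurable_superset_of_null hp
  have h1 : ∫⁻ x in Ω, N.indicator 1 x = 0 := by
    rw [lintegral_indicator_one hN2, hN3]
  rw [h.lintegral_eq] at h1
  have hm : Measurable fun q => ENNReal.ofReal (jac P P' q) * N.indicator 1 (planeMap P P' q) := by
    have hc := (contDiff_planeMap h.contDiff_fst h.contDiff_snd).continuous.measurable
    have hj : Measurable (jac P P') := by
      unfold jac partialFst partialSnd
      have := measurable_fderiv_apply_const ℝ P ((1, 0) : ℝ × ℝ)
      have := measurable_fderiv_apply_const ℝ P ((0, 1) : ℝ × ℝ)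
      have := measurable_fderiv_apply_const ℝ P' ((1, 0) : ℝ × ℝ)
      have := measurable_fderiv_apply_const ℝ P' ((0, 1) : ℝ × ℝ)
      fun_prop
    exact hj.ennreal_ofReal.mul ((measurable_one.indicator hN2).comp hc)
  rw [lintegral_eq_zero_iff hm] at h1
  filter_upwards [h1, ae_restrict_mem (measurableSet_rect a b c d)] with q hq hqR
  by_contra hcon
  have h2 : planeMap P P' q ∈ N := hN1 hcon
  have h3 := h.jac_pos q (rect_subset hqR)
  simp [h2, h3.not_ge] at hq

/-- The function on `Ω` with the expression `G` in the coordinates. -/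
def push (P P' : ℝ × ℝ → ℝ) (a b c d : ℝ) (G : ℝ × ℝ → ℝ) (x : EuclideanSpace ℝ (Fin 2)) : ℝ :=
  G (Function.invFunOn (planeMap P P') (Ioo a b ×ˢ Ioo c d) x)

theorem push_planeMap (h : PlaneChart P P' a b c d Ω) (G : ℝ × ℝ → ℝ) {p : ℝ × ℝ}
    (hp : p ∈ Ioo a b ×ˢ Ioo c d) : push P P' a b c d G (planeMap P P' p) = G p := by
  unfold push
  rw [h.injOn.leftInvOn_invFunOn hp]

theorem continuous_jac (h : PlaneChart P P' a b c d Ω) : Continuous (jac P P') := by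
  have h1 := (contDiff_partialFst (k := 1) (F := P) (by exact_mod_cast h.contDiff_fst)).continuous
  have h2 := (contDiff_partialSnd (k := 1) (F := P) (by exact_mod_cast h.contDiff_fst)).continuous
  have h3 := (contDiff_partialFst (k := 1) (F := P') (by exact_mod_cast h.contDiff_snd)).continuous
  have h4 := (contDiff_partialSnd (k := 1) (F := P') (by exact_mod_cast h.contDiff_snd)).continuous
  unfold jac
  fun_prop

theorem exists_jac_bounds (h : PlaneChart P P' a b c d Ω) :
    ∃ δ > 0, ∀ p ∈ Icc a b ×ˢ Icc c d, δ ≤ jac P P' p := by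
  have hne : (Icc a b ×ˢ Icc c d).Nonempty :=
    ⟨(a, c), ⟨le_rfl, h.fst_lt.le⟩, ⟨le_rfl, h.snd_lt.le⟩⟩
  obtain ⟨p, hp, hmin⟩ := (isCompact_Icc.prod isCompact_Icc).exists_isMinOn hne
    h.continuous_jac.continuousOn
  exact ⟨_, h.jac_pos p hp, fun q hq => hmin hq⟩

theorem integrableOn_push (h : PlaneChart P P' a b c d Ω) {G : ℝ × ℝ → ℝ}
    (hG : IntegrableOn G (Ioo a b ×ˢ Ioo c d)) : IntegrableOn (push P P' a b c d G) Ω := by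
  rw [h.integrableOn_iff]
  refine (integrableOn_congr_fun (fun p hp => ?_) (measurableSet_rect a b c d)).1
    (IsRectRegular.integrableOn_mul_continuous hG h.continuous_jac)
  rw [h.push_planeMap G hp, mul_comm]

/-- The rotated components of the coordinates. -/
def rotComp (P P' : ℝ × ℝ → ℝ) : Fin 2 → ℝ × ℝ → ℝ := ![P', fun p => -P p]

theorem contDiff_rotComp (h : PlaneChart P P' a b c d Ω) (j : Fin 2) :
    ContDiff ℝ 2 (rotComp P P' j) := by
  fin_cases j
  · exact h.contDiff_snd
  · exact h.contDiff_fst.neg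

/-- Cramer's rule for the chain rule of `η ∘ planeMap P P'`. After multiplication by the Jacobian, a
Cartesian partial derivative takes the form to which `integral_mul_rot` applies. -/
theorem jac_mul_fderiv (h : PlaneChart P P' a b c d Ω) {η : EuclideanSpace ℝ (Fin 2) → ℝ}
    (hη : Differentiable ℝ η) (j : Fin 2) (p : ℝ × ℝ) :
    jac P P' p * fderiv ℝ η (planeMap P P' p) (EuclideanSpace.single j 1)
      = partialFst (fun p => η (planeMap P P' p)) p * partialSnd (rotComp P P' j) p
        - partialSnd (fun p => η (planeMap P P' p)) p * partialFst (rotComp P P' j) p := by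
  have hd : DifferentiableAt ℝ (planeMap P P') p :=
    (contDiff_planeMap h.contDiff_fst h.contDiff_snd).differentiable two_ne_zero p
  have e : ∀ v, fderiv ℝ (fun p => η (planeMap P P' p)) p v
      = fderiv ℝ P p v * fderiv ℝ η (planeMap P P' p) (EuclideanSpace.single 0 1)
        + fderiv ℝ P' p v * fderiv ℝ η (planeMap P P' p) (EuclideanSpace.single 1 1) := by
    intro v
    rw [fderiv_fun_comp p (hη _) hd, ContinuousLinearMap.comp_apply,
      fderiv_planeMap (h.differentiable_fst p) (h.differentiable_snd p), map_add, map_smul,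
      map_smul, smul_eq_mul, smul_eq_mul]
  have hneg : ∀ v, fderiv ℝ (fun p => -P p) p v = -fderiv ℝ P p v := fun v => by
    rw [fderiv_fun_neg]
    rfl
  unfold partialFst partialSnd
  rw [e, e]
  fin_cases j
  · simp only [rotComp, jac, partialFst, partialSnd, Fin.zero_eta, Matrix.cons_val_zero]
    ring
  · simp only [rotComp, jac, partialFst, partialSnd, Fin.mk_one, Matrix.cons_val_one,
      Matrix.cons_val_fin_one, hneg]
    ring

/-- The coordinate expression of the partial derivatives of a function `F`. -/
def chartGrad (P P' F : ℝ × ℝ → ℝ) (j : Fin 2) (p : ℝ × ℝ) : ℝ :=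
  (IsRectRegular.dFst F p * partialSnd (rotComp P P' j) p
    - IsRectRegular.dSnd F p * partialFst (rotComp P P' j) p) / jac P P' p

theorem integrableOn_div_jac (h : PlaneChart P P' a b c d Ω) {G : ℝ × ℝ → ℝ}
    (hG : IntegrableOn G (Ioo a b ×ˢ Ioo c d)) :
    IntegrableOn (fun p => G p / jac P P' p) (Ioo a b ×ˢ Ioo c d) := by
  obtain ⟨δ, hδ, hδ2⟩ := h.exists_jac_bounds
  simp only [div_eq_mul_inv]
  refine hG.mul_bdd (c := δ⁻¹) (h.continuous_jac.measurable.inv).aestronglyMeasurable ?_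
  filter_upwards [ae_restrict_mem (measurableSet_rect a b c d)] with p hp
  have := hδ2 p (rect_subset hp)
  rw [norm_inv, Real.norm_of_nonneg (hδ.le.trans this)]
  gcongr

theorem continuous_partialFst_rotComp (h : PlaneChart P P' a b c d Ω) (j : Fin 2) :
    Continuous (partialFst (rotComp P P' j)) :=
  (contDiff_partialFst (k := 1) (by exact_mod_cast h.contDiff_rotComp j)).continuous

theorem continuous_partialSnd_rotComp (h : PlaneChart P P' a b c d Ω) (j : Fin 2) :
    Continuous (partialSnd (rotComp P P' j)) :=
  (contDiff_partialSnd (k := 1) (by exact_mod_cast h.contDiff_rotComp j)).continuous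

theorem integrableOn_chartGrad (h : PlaneChart P P' a b c d Ω) {F : ℝ × ℝ → ℝ} {C : ℝ}
    {m : ℝ → ℝ} (hF : IsRectRegular F a b c d C m) (j : Fin 2) :
    IntegrableOn (chartGrad P P' F j) (Ioo a b ×ˢ Ioo c d) :=
  h.integrableOn_div_jac ((IsRectRegular.integrableOn_mul_continuous hF.integrableOn_dFst
    (h.continuous_partialSnd_rotComp j)).sub (IsRectRegular.integrableOn_mul_continuous
      hF.integrableOn_dSnd (h.continuous_partialFst_rotComp j)))

/-- Pull the test integral back to the rectangle, where `F` is regular enough for integration by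
parts. The test function vanishes on the edges because the edges are mapped outside `Ω`. -/
theorem hasWeakPartial (h : PlaneChart P P' a b c d Ω) {F : ℝ × ℝ → ℝ} {C : ℝ} {m : ℝ → ℝ}
    (hF : IsRectRegular F a b c d C m) {f : EuclideanSpace ℝ (Fin 2) → ℝ}
    (hf : ∀ p ∈ Ioo a b ×ˢ Ioo c d, f (planeMap P P' p) = F p) (j : Fin 2) :
    HasWeakPartial Ω j f (push P P' a b c d (chartGrad P P' F j)) := by
  refine ⟨IntegrableOn.locallyIntegrableOn ?_,
    (h.integrableOn_push (h.integrableOn_chartGrad hF j)).locallyIntegrableOn, ?_⟩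
  · rw [h.integrableOn_iff]
    refine (integrableOn_congr_fun (fun p hp => ?_) (measurableSet_rect a b c d)).1
      (IsRectRegular.integrableOn_continuous (hF.continuous.mul h.continuous_jac))
    rw [hf p hp, mul_comm]
    rfl
  · intro η hη hηc hηs
    rw [h.integral_eq, h.integral_eq]
    have hκ : ContDiff ℝ 1 fun p => η (planeMap P P' p) :=
      (hη.of_le (by exact_mod_cast le_top)).comp ((contDiff_planeMap h.contDiff_fst h.contDiff_snd).of_le (by norm_num))
    have := hF.integral_mul_rot h.fst_lt.le h.snd_lt.le hκ (h.contDiff_rotComp j)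
      (fun p hp hp' => image_eq_zero_of_notMem_tsupport fun hx => h.boundary p hp hp' (hηs hx))
    refine Eq.trans ?_ (this.trans ?_)
    · refine setIntegral_congr_fun (measurableSet_rect a b c d) fun p hp => ?_
      rw [← h.jac_mul_fderiv (hη.differentiable (by simp)) j p, hf p hp]
      ring
    · refine congrArg Neg.neg (setIntegral_congr_fun (measurableSet_rect a b c d) fun p hp => ?_)
      rw [h.push_planeMap _ hp, chartGrad]
      have := (h.jac_pos p (rect_subset hp)).ne'
      field_simp

/-- If the metric speed of `W` in the direction `ν` is controlled by the quadratic form with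
coefficients `qa`, `qb`, `qc`, then its energy is controlled by the trace of the quadratic form. -/
theorem exists_gradientBound (h : PlaneChart P P' a b c d Ω) {Q n : ℕ}
    {W : ℝ × ℝ → SpecialQPoint Q n} {w : EuclideanSpace ℝ (Fin 2) → SpecialQPoint Q n}
    (hw : ∀ p ∈ Ioo a b ×ˢ Ioo c d, w (planeMap P P' p) = W p) {C : ℝ} {m : ℝ → ℝ}
    (hW : IsRectRegular W a b c d C m) {qa qb qc : ℝ × ℝ → ℝ}
    (ha : IntegrableOn qa (Ioo a b ×ˢ Ioo c d)) (hb : IntegrableOn qb (Ioo a b ×ˢ Ioo c d))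
    (hc : IntegrableOn qc (Ioo a b ×ˢ Ioo c d))
    (hspeed : ∀ T, ∀ᵐ p ∂(volume : Measure (ℝ × ℝ)).restrict (Ioo a b ×ˢ Ioo c d), ∀ v v' : ℝ,
      (IsRectRegular.dFst (fun p => dist (W p) T) p * v
        + IsRectRegular.dSnd (fun p => dist (W p) T) p * v') ^ 2
        ≤ qa p * v ^ 2 + 2 * qb p * v * v' + qc p * v' ^ 2) :
    ∃ φ, SpecialQMap.IsGradientBound w Ω φ ∧ ∃ I : ℝ, 0 ≤ I ∧
      ∑ j, ∫⁻ x in Ω, ENNReal.ofReal (φ j x ^ 2) = ENNReal.ofReal I ∧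
      I = ∫ p in Ioo a b ×ˢ Ioo c d, (qa p * (partialSnd P p ^ 2 + partialSnd P' p ^ 2)
          - 2 * qb p * (partialFst P p * partialSnd P p + partialFst P' p * partialSnd P' p)
          + qc p * (partialFst P p ^ 2 + partialFst P' p ^ 2)) / jac P P' p := by
  -- The quadratic form evaluated at the coordinate expression of the `j`-th Cartesian unit vector,
  -- which is the vector of derivatives of `rotComp P P' j`, rotated and divided by the Jacobian.
  let A : Fin 2 → ℝ × ℝ → ℝ := fun j p => (qa p * partialSnd (rotComp P P' j) p ^ 2
    - 2 * qb p * (partialFst (rotComp P P' j) p * partialSnd (rotComp P P' j) p)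
    + qc p * partialFst (rotComp P P' j) p ^ 2) / jac P P' p / jac P P' p
  have hspeed' : ∀ T, ∀ᵐ p ∂(volume : Measure (ℝ × ℝ)).restrict (Ioo a b ×ˢ Ioo c d), ∀ j,
      (chartGrad P P' (fun p => dist (W p) T) j p) ^ 2 ≤ A j p := by
    intro T
    filter_upwards [hspeed T, ae_restrict_mem (measurableSet_rect a b c d)] with p hp hpR j
    have hJ := (h.jac_pos p (rect_subset hpR)).ne'
    have := hp (partialSnd (rotComp P P' j) p / jac P P' p)
      (-partialFst (rotComp P P' j) p / jac P P' p)
    refine le_trans (le_of_eq ?_) (this.trans (le_of_eq ?_))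
    · rw [chartGrad]
      ring
    · simp only [A]
      field_simp
      ring
  have hA0 : ∀ᵐ p ∂(volume : Measure (ℝ × ℝ)).restrict (Ioo a b ×ˢ Ioo c d), ∀ j, 0 ≤ A j p := by
    filter_upwards [hspeed' (SpecialQPoint.origin Q n)] with p hp j
    exact (sq_nonneg _).trans (hp j)
  have hAi : ∀ j, IntegrableOn (A j) (Ioo a b ×ˢ Ioo c d) := by
    intro j
    have c1 := h.continuous_partialFst_rotComp j
    have c2 := h.continuous_partialSnd_rotComp j
    refine h.integrableOn_div_jac (h.integrableOn_div_jac (((IsRectRegular.integrableOn_mul_continuous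
      ha (c2.pow 2)).sub (IsRectRegular.integrableOn_mul_continuous
      (hb.const_mul 2) (c1.mul c2))).add (IsRectRegular.integrableOn_mul_continuous hc (c1.pow 2))))
  have hsqrt : ∀ j, IntegrableOn (fun p => √(A j p)) (Ioo a b ×ˢ Ioo c d) := by
    intro j
    -- Since `√x ≤ 1 + |x|`, this integrable function dominates the square root.
    have h1 : IntegrableOn (fun p => 1 + |A j p|) (Ioo a b ×ˢ Ioo c d) :=
      (IsRectRegular.integrableOn_continuous continuous_const).add (hAi j).norm
    refine h1.mono' ((hAi j).aestronglyMeasurable.aemeasurable.sqrt).aestronglyMeasurable ?_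
    refine Eventually.of_forall fun p => ?_
    rw [Real.norm_of_nonneg (Real.sqrt_nonneg _)]
    refine Real.sqrt_le_iff.2 ⟨by positivity, ?_⟩
    nlinarith [le_abs_self (A j p), abs_nonneg (A j p), sq_nonneg (A j p), sq_abs (A j p)]
  let φ : Fin 2 → EuclideanSpace ℝ (Fin 2) → ℝ := fun j => push P P' a b c d fun p => √(A j p)
  have hφi : ∀ j, IntegrableOn (φ j) Ω := fun j => h.integrableOn_push (hsqrt j)
  have hφ2 : ∀ j, ∀ x, φ j x ^ 2 = push P P' a b c d (fun p => √(A j p) ^ 2) x := fun j x => rfl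
  have hsq : ∀ j, IntegrableOn (fun p => √(A j p) ^ 2) (Ioo a b ×ˢ Ioo c d) := fun j => by
    refine (hAi j).congr ?_
    filter_upwards [hA0] with p hp
    rw [Real.sq_sqrt (hp j)]
  refine ⟨φ, ⟨fun j => ?_, fun T => ⟨?_, fun j => ?_⟩⟩,
    ∑ j, ∫ p in Ioo a b ×ˢ Ioo c d, A j p * jac P P' p, ?_⟩
  · rw [memLp_two_iff_integrable_sq (hφi j).aestronglyMeasurable]
    simp only [hφ2]
    exact h.integrableOn_push (hsq j)
  · have hF := hW.dist_right T
    have hm : IntegrableOn (fun x => (w x).dist T) Ω :=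
      (h.integrableOn_iff _).2 ((integrableOn_congr_fun (fun p hp => by
        rw [hw p hp, mul_comm, SpecialQPoint.dist_eq]
        rfl) (measurableSet_rect a b c d)).1
        (IsRectRegular.integrableOn_continuous (hF.continuous.mul h.continuous_jac)))
    rw [memLp_two_iff_integrable_sq hm.aestronglyMeasurable]
    refine (h.integrableOn_iff _).2 ((integrableOn_congr_fun (fun p hp => by
        rw [hw p hp, mul_comm, SpecialQPoint.dist_eq]
        rfl) (measurableSet_rect a b c d)).1
        (IsRectRegular.integrableOn_continuous ((hF.continuous.pow 2).mul h.continuous_jac)))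
  · refine ⟨_, h.hasWeakPartial (hW.dist_right T) (fun p hp => by rw [hw p hp]; rfl) j, ?_⟩
    refine h.ae_image ?_
    filter_upwards [hspeed' T, ae_restrict_mem (measurableSet_rect a b c d)] with p hp hpR
    simp only [φ]
    rw [h.push_planeMap _ hpR, h.push_planeMap _ hpR]
    exact Real.abs_le_sqrt (hp j)
  · have e1 : ∀ j, ∫⁻ x in Ω, ENNReal.ofReal (φ j x ^ 2)
        = ENNReal.ofReal (∫ p in Ioo a b ×ˢ Ioo c d, A j p * jac P P' p) := by
      intro j
      rw [h.lintegral_eq, ofReal_integral_eq_lintegral_ofReal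
        (IsRectRegular.integrableOn_mul_continuous (hAi j) h.continuous_jac)]
      · refine lintegral_congr_ae ?_
        filter_upwards [hA0, ae_restrict_mem (measurableSet_rect a b c d)] with p hp hpR
        simp only [φ]
        rw [h.push_planeMap _ hpR, Real.sq_sqrt (hp j), mul_comm,
          ENNReal.ofReal_mul (hp j)]
      · filter_upwards [hA0, ae_restrict_mem (measurableSet_rect a b c d)] with p hp hpR
        exact mul_nonneg (hp j) (h.jac_pos p (rect_subset hpR)).le
    have e2 : ∀ j, 0 ≤ ∫ p in Ioo a b ×ˢ Ioo c d, A j p * jac P P' p := fun j => by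
      refine integral_nonneg_of_ae ?_
      filter_upwards [hA0, ae_restrict_mem (measurableSet_rect a b c d)] with p hp hpR
      exact mul_nonneg (hp j) (h.jac_pos p (rect_subset hpR)).le
    refine ⟨Finset.sum_nonneg fun j _ => e2 j, ?_, ?_⟩
    · rw [ENNReal.ofReal_sum_of_nonneg fun j _ => e2 j]
      exact Finset.sum_congr rfl fun j _ => e1 j
    rw [Fin.sum_univ_two, ← integral_add
      (IsRectRegular.integrableOn_mul_continuous (hAi 0) h.continuous_jac)
      (IsRectRegular.integrableOn_mul_continuous (hAi 1) h.continuous_jac)]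
    refine setIntegral_congr_fun (measurableSet_rect a b c d) fun p hpR => ?_
    have hJ := (h.jac_pos p (rect_subset hpR)).ne'
    have hneg : ∀ v, fderiv ℝ (fun p => -P p) p v = -fderiv ℝ P p v := fun v => by
      rw [fderiv_fun_neg]
      rfl
    simp only [A, rotComp, partialFst, partialSnd, Matrix.cons_val_zero, Matrix.cons_val_one,
      Matrix.cons_val_fin_one, hneg]
    field_simp
    ring

end PlaneChart

/-! ### Weak derivatives along volume preserving flows -/

/-- A smooth volume preserving flow with velocity field `V`. -/
structure IsVolumeFlow {E : Type*} [NormedAddCommGroup E] [NormedSpace ℝ E] [MeasureSpace E]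
    (Φ : ℝ → E → E) (V : E → E) : Prop where
  contDiff : ContDiff ℝ ∞ (Function.uncurry Φ)
  zero : ∀ x, Φ 0 x = x
  add : ∀ s t x, Φ (s + t) x = Φ s (Φ t x)
  mp : ∀ s, MeasurePreserving (Φ s)
  hasDerivAt : ∀ x, HasDerivAt (fun s => Φ s x) (V x) 0

namespace IsVolumeFlow

variable {E : Type*} [NormedAddCommGroup E] [NormedSpace ℝ E] [FiniteDimensional ℝ E]
  [MeasureSpace E] [BorelSpace E] {Φ : ℝ → E → E} {V : E → E}

/-- The homeomorphism given by the flow at time `s`. -/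
def homeomorph (h : IsVolumeFlow Φ V) (s : ℝ) : E ≃ₜ E where
  toFun := Φ s
  invFun := Φ (-s)
  left_inv x := by rw [← h.add, neg_add_cancel, h.zero]
  right_inv x := by rw [← h.add, add_neg_cancel, h.zero]
  continuous_toFun := h.contDiff.continuous.comp (continuous_const.prodMk continuous_id)
  continuous_invFun := h.contDiff.continuous.comp (continuous_const.prodMk continuous_id)

theorem integral_comp (h : IsVolumeFlow Φ V) (s : ℝ) (G : E → ℝ) :
    ∫ x, G (Φ s x) = ∫ x, G x :=
  (h.mp s).integral_comp (h.homeomorph s).measurableEmbedding G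

theorem contDiff_apply (h : IsVolumeFlow Φ V) (s : ℝ) : ContDiff ℝ ∞ (Φ s) :=
  h.contDiff.comp (contDiff_const.prodMk contDiff_id)

/-- By the group law `Φ (-s') y = Φ (-s) (Φ (-(s' - s)) y)`. The derivative in time is therefore a
spatial derivative of `η ∘ Φ (-s)` along `-V`, the quantity seen by the weak formulation. -/
theorem hasDerivAt_comp (h : IsVolumeFlow Φ V) {η : E → ℝ} (hη : ContDiff ℝ ∞ η) (s : ℝ) (y : E) :
    HasDerivAt (fun s => η (Φ (-s) y)) (-fderiv ℝ (fun x => η (Φ (-s) x)) y (V y)) s := by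
  have h1 : HasDerivAt (fun s' => Φ (-(s' - s)) y) (-V y) s := by
    have h2 : HasDerivAt (fun s' : ℝ => -(s' - s)) (-1) s :=
      ((hasDerivAt_id s).sub_const s).neg
    have h3 : HasDerivAt (fun s => Φ s y) (V y) (-(s - s)) := by
      rw [sub_self, neg_zero]
      exact h.hasDerivAt y
    have h6 := h3.scomp s h2
    simp only [neg_one_smul] at h6
    exact h6
  have hd : DifferentiableAt ℝ (fun x => η (Φ (-s) x)) (Φ (-(s - s)) y) :=
    (hη.comp (h.contDiff_apply (-s))).differentiable (by simp) _
  have h4 := hd.hasFDerivAt.comp_hasDerivAt s h1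
  have h5 : ∀ s', η (Φ (-s) (Φ (-(s' - s)) y)) = η (Φ (-s') y) := fun s' => by
    rw [← h.add]
    congr 2
    ring
  simp only [sub_self, neg_zero, h.zero, map_neg] at h4
  refine h4.congr_of_eventuallyEq (Eventually.of_forall fun r => ?_)
  exact (h5 r).symm

/-- A function with a weak derivative along a volume preserving flow satisfies the fundamental
theorem of calculus along almost all flow lines. -/
theorem ae_sub_eq_integral [IsLocallyFiniteMeasure (volume : Measure E)]
    (h : IsVolumeFlow Φ V) {Ω U : Set E}
    (hΩ : IsOpen Ω) (hΩb : Bornology.IsBounded Ω) (hU : IsOpen U) {f q : E → ℝ}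
    (hf : IntegrableOn f Ω) (hq : IntegrableOn q Ω) (hqm : Measurable q)
    (hweak : ∀ η : E → ℝ, ContDiff ℝ ∞ η → HasCompactSupport η → tsupport η ⊆ Ω →
      ∫ x in Ω, f x * fderiv ℝ η x (V x) = -∫ x in Ω, q x * η x) {r : ℝ} (hr : 0 ≤ r)
    (hUΩ : ∀ s ∈ Icc 0 r, ∀ x ∈ U, Φ s x ∈ Ω) :
    ∀ᵐ x, x ∈ U → f (Φ r x) - f x = ∫ s in 0..r, q (Φ s x) := by
  have : ProperSpace E := FiniteDimensional.proper_real E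
  -- Extension by zero puts all integrals on the whole space, which the flow preserves. Along the
  -- flow lines that start in `U` nothing changes, since they stay in `Ω` up to time `r`.
  set f' := Ω.indicator f with hf'
  set q' := Ω.indicator q with hq'
  have hf'i : Integrable f' := hf.integrable_indicator hΩ.measurableSet
  have hq'i : Integrable q' := hq.integrable_indicator hΩ.measurableSet
  have hq'm : Measurable q' := hqm.indicator hΩ.measurableSet
  have hΦc : Continuous (Function.uncurry Φ) := h.contDiff.continuous
  have hprod : Integrable (fun z : ℝ × E => q' (Φ z.1 z.2))
      ((volume.restrict (Ioc 0 r)).prod volume) := by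
    have hm : Measurable fun z : ℝ × E => q' (Φ z.1 z.2) := hq'm.comp hΦc.measurable
    rw [integrable_prod_iff hm.aestronglyMeasurable]
    refine ⟨Eventually.of_forall fun s => (h.mp s).integrable_comp_of_integrable hq'i, ?_⟩
    have : ∀ s, ∫ y, ‖q' (Φ s y)‖ = ∫ y, ‖q' y‖ := fun s => h.integral_comp s fun y => ‖q' y‖
    simp only [this]
    exact integrable_const _
  have hIq : Integrable fun x => ∫ s in Ioc 0 r, q' (Φ s x) := hprod.integral_prod_right
  have hfΦ : Integrable fun x => f' (Φ r x) := (h.mp r).integrable_comp_of_integrable hf'i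
  have hD : LocallyIntegrableOn (fun x => f' (Φ r x) - f' x - ∫ s in Ioc 0 r, q' (Φ s x)) U :=
    ((hfΦ.sub hf'i).sub hIq).integrableOn.locallyIntegrableOn
  have key := hU.ae_eq_zero_of_integral_contDiff_smul_eq_zero hD fun η hη hηc hηU => ?_
  · filter_upwards [key] with x hx hxU
    have h1 := hx hxU
    have h2 : ∀ s ∈ Icc 0 r, Φ s x ∈ Ω := fun s hs => hUΩ s hs x hxU
    have h3 : f' (Φ r x) = f (Φ r x) := indicator_of_mem (h2 r ⟨hr, le_rfl⟩) f
    have h4 : f' x = f x := by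
      have := h2 0 ⟨le_rfl, hr⟩
      rw [h.zero] at this
      exact indicator_of_mem this f
    have h5 : ∫ s in Ioc 0 r, q' (Φ s x) = ∫ s in Ioc 0 r, q (Φ s x) :=
      setIntegral_congr_fun measurableSet_Ioc fun s hs =>
        indicator_of_mem (h2 s (Ioc_subset_Icc_self hs)) q
    rw [h3, h4, h5] at h1
    rw [intervalIntegral.integral_of_le hr]
    linarith
  · obtain ⟨Cη, hCη⟩ := hηc.exists_bound_of_continuous hη.continuous
    have hbdη : ∀ F : E → ℝ, Integrable F → ∀ s, Integrable fun x => F x * η (Φ s x) := fun F hF s =>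
      hF.mul_bdd (c := Cη) (hη.continuous.comp (h.contDiff_apply s).continuous).aestronglyMeasurable
        (Eventually.of_forall fun x => hCη _)
    -- the derivative of the test function along the flow
    let k : ℝ → E → ℝ := fun s y => -fderiv ℝ (fun x => η (Φ (-s) x)) y (V y)
    have hk : ∀ s y, HasDerivAt (fun s => η (Φ (-s) y)) (k s y) s := fun s y =>
      h.hasDerivAt_comp hη s y
    have hkc : Continuous (Function.uncurry k) := by
      have hG : ContDiff ℝ ∞ fun z : ℝ × E => η (Φ (-z.1) z.2) :=
        hη.comp (h.contDiff.comp (contDiff_fst.neg.prodMk contDiff_snd))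
      have : Function.uncurry k = fun z : ℝ × E => fderiv ℝ (fun z : ℝ × E => η (Φ (-z.1) z.2)) z (1, 0) := by
        funext z
        have h1 : HasDerivAt (fun s => η (Φ (-s) z.2)) (fderiv ℝ (fun z : ℝ × E => η (Φ (-z.1) z.2)) z (1, 0)) z.1 :=
          (hG.differentiable (by simp) z).hasFDerivAt.comp_hasDerivAt (f := fun s => (s, z.2)) z.1
            ((hasDerivAt_id z.1).prodMk (hasDerivAt_const z.1 z.2))
        exact (hk z.1 z.2).unique h1
      rw [this]
      exact (hG.continuous_fderiv (by simp)).clm_apply continuous_const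
    obtain ⟨K, hK⟩ := ((isCompact_Icc (a := (0 : ℝ)) (b := r)).prod
      (hΩb.isCompact_closure)).exists_bound_of_continuousOn hkc.continuousOn
    have hkint : Integrable (fun z : ℝ × E => f' z.2 * k z.1 z.2)
        ((volume.restrict (Ioc 0 r)).prod volume) := by
      have h1 : Integrable (fun z : ℝ × E => (1 : ℝ) * f' z.2)
          ((volume.restrict (Ioc 0 r)).prod volume) :=
        Integrable.mul_prod (f := fun _ : ℝ => (1 : ℝ)) (integrable_const _) hf'i
      simp only [one_mul] at h1
      refine (h1.norm.mul_const K).mono' (h1.aestronglyMeasurable.mul hkc.aestronglyMeasurable) ?_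
      have h2 : ∀ᵐ z : ℝ × E ∂((volume.restrict (Ioc 0 r)).prod volume), z.1 ∈ Ioc 0 r :=
        Measure.quasiMeasurePreserving_fst.ae (ae_restrict_mem measurableSet_Ioc)
      filter_upwards [h2] with z hz
      rw [norm_mul]
      by_cases hzΩ : z.2 ∈ Ω
      · exact mul_le_mul_of_nonneg_left (hK z ⟨Ioc_subset_Icc_self hz, subset_closure hzΩ⟩)
          (norm_nonneg _)
      · simp [hf', indicator_of_notMem hzΩ]
    -- Invariance of the measure moves the flow from `f` to the smooth test function.
    have e1 : ∫ x, η x * (f' (Φ r x) - f' x) = ∫ y, f' y * (η (Φ (-r) y) - η y) := by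
      have h1 : ∫ x, f' (Φ r x) * η x = ∫ y, f' y * η (Φ (-r) y) := by
        rw [← h.integral_comp r fun y => f' y * η (Φ (-r) y)]
        refine integral_congr_ae (Eventually.of_forall fun x => ?_)
        simp only
        rw [← h.add, neg_add_cancel, h.zero]
      have h2 : ∫ x, f' (Φ r x) * η x - f' x * η x = ∫ y, f' y * η (Φ (-r) y) - f' y * η y := by
        have i1 := hbdη _ hfΦ 0
        have i2 := hbdη _ hf'i 0
        simp only [h.zero] at i1 i2
        rw [integral_sub i1 i2, integral_sub (hbdη _ hf'i _) i2, h1]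
      refine Eq.trans ?_ (h2.trans ?_) <;>
        exact integral_congr_ae (Eventually.of_forall fun x => by simp only; ring)
    have e2 : ∀ y, η (Φ (-r) y) - η y = ∫ s in Ioc 0 r, k s y := by
      intro y
      rw [← intervalIntegral.integral_of_le hr, intervalIntegral.integral_eq_sub_of_hasDerivAt
        (fun s _ => hk s y) ((hkc.comp (continuous_id.prodMk continuous_const)).intervalIntegrable _ _)]
      simp [h.zero]
    -- The weak equation is tested with `η ∘ Φ (-s)`, whose support is the support of `η`
    -- transported by the flow and so lies in `Ω`.
    have e3 : ∀ s ∈ Ioc 0 r, ∫ y, f' y * k s y = ∫ x, q' (Φ s x) * η x := by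
      intro s hs
      have h1 : ∫ y, f' y * k s y = -∫ y in Ω, f y * fderiv ℝ (fun x => η (Φ (-s) x)) y (V y) := by
        rw [← integral_neg, ← integral_indicator hΩ.measurableSet]
        refine integral_congr_ae (Eventually.of_forall fun y => ?_)
        by_cases hy : y ∈ Ω <;> simp [hf', hy, k]
      have hsupp : tsupport (fun x => η (Φ (-s) x)) ⊆ Ω := by
        have := tsupport_comp_eq_preimage η (h.homeomorph (-s))
        intro y hy
        have hy' : Φ (-s) y ∈ tsupport η := by
          change y ∈ tsupport (η ∘ h.homeomorph (-s)) at hy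
          rw [this] at hy
          exact hy
        have := hUΩ s (Ioc_subset_Icc_self hs) _ (hηU hy')
        rwa [← h.add, add_neg_cancel, h.zero] at this
      rw [h1, hweak (fun x => η (Φ (-s) x)) (hη.comp (h.contDiff_apply (-s)))
        (hηc.comp_homeomorph (h.homeomorph (-s))) hsupp, neg_neg,
        ← integral_indicator hΩ.measurableSet, ← h.integral_comp s]
      refine integral_congr_ae (Eventually.of_forall fun x => ?_)
      have : Φ (-s) (Φ s x) = x := by rw [← h.add, neg_add_cancel, h.zero]
      by_cases hy : Φ s x ∈ Ω <;> simp [hq', hy, this]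
    have hprodη : Integrable (fun z : ℝ × E => q' (Φ z.1 z.2) * η z.2)
        ((volume.restrict (Ioc 0 r)).prod volume) :=
      hprod.mul_bdd (c := Cη) (hη.continuous.comp continuous_snd).aestronglyMeasurable
        (Eventually.of_forall fun x => hCη _)
    have e4 : ∫ x, η x * (f' (Φ r x) - f' x) = ∫ x, η x * ∫ s in Ioc 0 r, q' (Φ s x) := by
      rw [e1]
      simp only [e2, ← integral_const_mul]
      rw [← integral_integral_swap hkint]
      rw [setIntegral_congr_fun measurableSet_Ioc e3, integral_integral_swap hprodη]
      refine integral_congr_ae (Eventually.of_forall fun x => ?_)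
      simp only [mul_comm]
    have i1 := hbdη _ (hfΦ.sub hf'i) 0
    have i2 := hbdη _ hIq 0
    simp only [h.zero] at i1 i2
    simp only [smul_eq_mul, mul_sub (η _) (_ - _)]
    have i1' : Integrable fun x => η x * (f' (Φ r x) - f' x) := by
      refine i1.congr (Eventually.of_forall fun x => ?_)
      simp only [Pi.sub_apply, mul_comm]
    have i2' : Integrable fun x => η x * ∫ s in Ioc 0 r, q' (Φ s x) := by
      simpa only [mul_comm] using i2
    rw [integral_sub i1' i2', e4, sub_self]

end IsVolumeFlow

/-! ### Logarithmic polar coordinates -/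

/-- Logarithmic polar coordinates `(t, θ) ↦ eᵗ (cos θ, sin θ)`. -/
def polar (p : ℝ × ℝ) : EuclideanSpace ℝ (Fin 2) :=
  !₂[Real.exp p.1 * Real.cos p.2, Real.exp p.1 * Real.sin p.2]

/-- Under the identification with `ℂ` these coordinates are the exponential map. Openness,
surjectivity onto the punctured plane and periodicity are read off from it. -/
theorem polar_eq_exp (p : ℝ × ℝ) :
    polar p = Complex.orthonormalBasisOneI.repr (Complex.exp (Complex.equivRealProd.symm p)) := by
  ext i
  fin_cases i <;> simp [polar, Complex.exp_re, Complex.exp_im]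

theorem continuous_polar : Continuous polar := by
  have : polar = fun p => Complex.orthonormalBasisOneI.repr
    (Complex.exp (Complex.equivRealProdCLM.symm p)) := funext polar_eq_exp
  rw [this]
  fun_prop

theorem isOpenMap_polar : IsOpenMap polar := by
  have : polar = Complex.orthonormalBasisOneI.repr ∘ Complex.exp ∘ Complex.equivRealProdCLM.symm :=
    funext polar_eq_exp
  rw [this]
  exact Complex.orthonormalBasisOneI.repr.toHomeomorph.isOpenMap.comp
    (Complex.isOpenMap_exp.comp Complex.equivRealProdCLM.symm.toHomeomorph.isOpenMap)

theorem norm_polar (p : ℝ × ℝ) : ‖polar p‖ = Real.exp p.1 := by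
  rw [polar_eq_exp, LinearIsometryEquiv.norm_map, Complex.norm_exp]
  simp

theorem polar_eq_polar_iff {p q : ℝ × ℝ} :
    polar p = polar q ↔ p.1 = q.1 ∧ ∃ k : ℤ, p.2 = q.2 + k * (2 * Real.pi) := by
  rw [polar_eq_exp, polar_eq_exp, EmbeddingLike.apply_eq_iff_eq, Complex.exp_eq_exp_iff_exists_int]
  simp only [Complex.ext_iff]
  simp

theorem exists_polar_eq {x : EuclideanSpace ℝ (Fin 2)} (hx : x ≠ 0) : ∃ p, polar p = x := by
  have h0 : Complex.orthonormalBasisOneI.repr.symm x ≠ 0 :=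
    EmbeddingLike.map_ne_zero_iff.2 hx
  refine ⟨Complex.equivRealProd (Complex.log (Complex.orthonormalBasisOneI.repr.symm x)), ?_⟩
  rw [polar_eq_exp, Equiv.symm_apply_apply, Complex.exp_log h0, LinearIsometryEquiv.apply_symm_apply]

theorem polar_ne_zero (p : ℝ × ℝ) : polar p ≠ 0 := by
  rw [← norm_ne_zero_iff, norm_polar]
  exact (Real.exp_pos _).ne'

theorem eq_of_polar_eq {p q : ℝ × ℝ} {c d : ℝ} (hcd : d - c < 2 * Real.pi)
    (hp : p.2 ∈ Icc c d) (hq : q.2 ∈ Icc c d) (h : polar p = polar q) : p = q := by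
  obtain ⟨h1, k, hk⟩ := polar_eq_polar_iff.1 h
  have hpi := Real.pi_pos
  have : k = 0 := by
    have h2 : (k : ℝ) * (2 * Real.pi) < 1 * (2 * Real.pi) := by linarith [hp.2, hq.1]
    have h3 : (-1 : ℝ) * (2 * Real.pi) < k * (2 * Real.pi) := by linarith [hp.1, hq.2]
    have h4 := lt_of_mul_lt_mul_right h2 (by positivity)
    have h5 := lt_of_mul_lt_mul_right h3 (by positivity)
    have h6 : k < 1 := by exact_mod_cast h4
    have h7 : -1 < k := by exact_mod_cast h5
    omega
  refine Prod.ext h1 ?_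
  rw [hk, this]
  simp

/-- Changes of the angle which leave the edges of a rectangle invariant. -/
structure IsAngleShear (Θ : ℝ × ℝ → ℝ) (a b c d : ℝ) : Prop where
  contDiff : ContDiff ℝ 2 Θ
  pos : ∀ p ∈ Icc a b ×ˢ Icc c d, 0 < partialSnd Θ p
  left : ∀ t ∈ Icc a b, Θ (t, c) = c
  right : ∀ t ∈ Icc a b, Θ (t, d) = d

theorem isAngleShear_snd (a b c d : ℝ) : IsAngleShear Prod.snd a b c d where
  contDiff := contDiff_snd
  pos p _ := by simp [partialSnd, fderiv_snd]
  left _ _ := rfl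
  right _ _ := rfl

def polFst (Θ : ℝ × ℝ → ℝ) (p : ℝ × ℝ) : ℝ := Real.exp p.1 * Real.cos (Θ p)

def polSnd (Θ : ℝ × ℝ → ℝ) (p : ℝ × ℝ) : ℝ := Real.exp p.1 * Real.sin (Θ p)

theorem planeMap_pol (Θ : ℝ × ℝ → ℝ) (p : ℝ × ℝ) :
    planeMap (polFst Θ) (polSnd Θ) p = polar (p.1, Θ p) := rfl

theorem partialFst_eq {F : ℝ × ℝ → ℝ} {p : ℝ × ℝ} {D : ℝ} (hF : DifferentiableAt ℝ F p)
    (h : HasDerivAt (fun t => F (t, p.2)) D p.1) : partialFst F p = D :=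
  (hasDerivAt_fst hF).unique h

theorem partialSnd_eq {F : ℝ × ℝ → ℝ} {p : ℝ × ℝ} {D : ℝ} (hF : DifferentiableAt ℝ F p)
    (h : HasDerivAt (fun y => F (p.1, y)) D p.2) : partialSnd F p = D :=
  (hasDerivAt_snd hF).unique h

section PolarDerivatives

variable {Θ : ℝ × ℝ → ℝ}

theorem contDiff_polFst {k : WithTop ℕ∞} (h : ContDiff ℝ k Θ) : ContDiff ℝ k (polFst Θ) :=
  (Real.contDiff_exp.comp contDiff_fst).mul (Real.contDiff_cos.comp h)

theorem contDiff_polSnd {k : WithTop ℕ∞} (h : ContDiff ℝ k Θ) : ContDiff ℝ k (polSnd Θ) :=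
  (Real.contDiff_exp.comp contDiff_fst).mul (Real.contDiff_sin.comp h)

theorem partialFst_polFst (h : ContDiff ℝ 1 Θ) (p : ℝ × ℝ) : partialFst (polFst Θ) p =
    Real.exp p.1 * Real.cos (Θ p) - Real.exp p.1 * Real.sin (Θ p) * partialFst Θ p := by
  have h1 := hasDerivAt_fst (h.differentiable one_ne_zero p)
  rw [partialFst_eq ((contDiff_polFst h).differentiable one_ne_zero p)
    ((Real.hasDerivAt_exp p.1).mul h1.cos)]
  ring

theorem partialFst_polSnd (h : ContDiff ℝ 1 Θ) (p : ℝ × ℝ) : partialFst (polSnd Θ) p =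
    Real.exp p.1 * Real.sin (Θ p) + Real.exp p.1 * Real.cos (Θ p) * partialFst Θ p := by
  have h1 := hasDerivAt_fst (h.differentiable one_ne_zero p)
  rw [partialFst_eq ((contDiff_polSnd h).differentiable one_ne_zero p)
    ((Real.hasDerivAt_exp p.1).mul h1.sin)]
  ring

theorem partialSnd_polFst (h : ContDiff ℝ 1 Θ) (p : ℝ × ℝ) : partialSnd (polFst Θ) p =
    -(Real.exp p.1 * Real.sin (Θ p) * partialSnd Θ p) := by
  have h1 := hasDerivAt_snd (h.differentiable one_ne_zero p)
  rw [partialSnd_eq ((contDiff_polFst h).differentiable one_ne_zero p)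
    (h1.cos.const_mul (Real.exp p.1))]
  ring

theorem partialSnd_polSnd (h : ContDiff ℝ 1 Θ) (p : ℝ × ℝ) : partialSnd (polSnd Θ) p =
    Real.exp p.1 * Real.cos (Θ p) * partialSnd Θ p := by
  have h1 := hasDerivAt_snd (h.differentiable one_ne_zero p)
  rw [partialSnd_eq ((contDiff_polSnd h).differentiable one_ne_zero p)
    (h1.sin.const_mul (Real.exp p.1))]
  ring

theorem jac_pol (h : ContDiff ℝ 1 Θ) (p : ℝ × ℝ) :
    jac (polFst Θ) (polSnd Θ) p = Real.exp p.1 ^ 2 * partialSnd Θ p := by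
  rw [jac, partialFst_polFst h, partialFst_polSnd h, partialSnd_polFst h, partialSnd_polSnd h]
  linear_combination Real.exp p.1 ^ 2 * partialSnd Θ p * Real.sin_sq_add_cos_sq (Θ p)

end PolarDerivatives

namespace IsAngleShear

variable {Θ : ℝ × ℝ → ℝ} {a b c d : ℝ}

theorem strictMonoOn (h : IsAngleShear Θ a b c d) {t : ℝ} (ht : t ∈ Icc a b) :
    StrictMonoOn (fun y => Θ (t, y)) (Icc c d) := by
  have hd := h.contDiff.differentiable two_ne_zero
  refine strictMonoOn_of_deriv_pos (convex_Icc c d) ?_ fun y hy => ?_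
  · exact (h.contDiff.continuous.comp (Continuous.prodMk_right t)).continuousOn
  · rw [(hasDerivAt_snd (hd (t, y))).deriv]
    exact h.pos _ ⟨ht, interior_subset hy⟩

theorem mem_Ioo_iff (h : IsAngleShear Θ a b c d) (hcd : c < d) {t y : ℝ} (ht : t ∈ Icc a b)
    (hy : y ∈ Icc c d) : Θ (t, y) ∈ Ioo c d ↔ y ∈ Ioo c d := by
  have hm := h.strictMonoOn ht
  have h1 := hm.lt_iff_lt (left_mem_Icc.2 hcd.le) hy
  have h2 := hm.lt_iff_lt hy (right_mem_Icc.2 hcd.le)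
  simp only [h.left t ht, h.right t ht] at h1 h2
  simp only [mem_Ioo, h1, h2]

theorem mem_Icc (h : IsAngleShear Θ a b c d) (hcd : c < d) {t y : ℝ} (ht : t ∈ Icc a b)
    (hy : y ∈ Icc c d) : Θ (t, y) ∈ Icc c d := by
  have hm := (h.strictMonoOn ht).monotoneOn
  have h1 := hm (left_mem_Icc.2 hcd.le) hy hy.1
  have h2 := hm hy (right_mem_Icc.2 hcd.le) hy.2
  simp only [h.left t ht, h.right t ht] at h1 h2
  exact ⟨h1, h2⟩

/-- For each `t` the function `Θ (t, ·)` is an increasing bijection of `[c, d]`, so the sheared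
coordinates parametrize the same sector as `polar`. Injectivity uses that the opening angle is less
than `2π`. -/
theorem planeChart (h : IsAngleShear Θ a b c d) (hab : a < b) (hcd : c < d)
    (hpi : d - c < 2 * Real.pi) :
    PlaneChart (polFst Θ) (polSnd Θ) a b c d (polar '' (Ioo a b ×ˢ Ioo c d)) where
  contDiff_fst := contDiff_polFst h.contDiff
  contDiff_snd := contDiff_polSnd h.contDiff
  injOn := by
    intro p hp q hq hpq
    rw [planeMap_pol, planeMap_pol] at hpq
    have hp' := PlaneChart.rect_subset hp
    have hq' := PlaneChart.rect_subset hq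
    have h1 := eq_of_polar_eq hpi (h.mem_Icc hcd hp'.1 hp'.2) (h.mem_Icc hcd hq'.1 hq'.2) hpq
    obtain ⟨h2, h3⟩ := Prod.ext_iff.1 h1
    simp only at h2 h3
    refine Prod.ext h2 ((h.strictMonoOn hp'.1).injOn hp'.2 hq'.2 ?_)
    change Θ p = Θ (p.1, q.2)
    rw [h2]
    exact h3
  jac_pos p hp := by
    rw [jac_pol (h.contDiff.of_le one_le_two)]
    exact mul_pos (pow_pos (Real.exp_pos _) 2) (h.pos p hp)
  image_eq := by
    refine Subset.antisymm ?_ ?_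
    · rintro _ ⟨p, hp, rfl⟩
      have hp' := PlaneChart.rect_subset hp
      exact ⟨(p.1, Θ p), ⟨hp.1, (h.mem_Ioo_iff hcd hp'.1 hp'.2).2 hp.2⟩, rfl⟩
    · rintro _ ⟨⟨t, θ⟩, ⟨ht, hθ⟩, rfl⟩
      have ht' := Ioo_subset_Icc_self ht
      have hc : ContinuousOn (fun y => Θ (t, y)) (Icc c d) :=
        (h.contDiff.continuous.comp (Continuous.prodMk_right t)).continuousOn
      have hI := intermediate_value_Icc hcd.le hc
      simp only [h.left t ht', h.right t ht'] at hI
      obtain ⟨y, hy, hyθ⟩ := hI (Ioo_subset_Icc_self hθ)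
      simp only at hyθ hθ
      refine ⟨(t, y), ⟨ht, (h.mem_Ioo_iff hcd ht' hy).1 (hyθ ▸ hθ)⟩, ?_⟩
      rw [planeMap_pol, hyθ]
  isOpen := isOpenMap_polar _ (isOpen_Ioo.prod isOpen_Ioo)
  boundary := by
    rintro p hp hpR ⟨q, hq, hpq⟩
    rw [planeMap_pol] at hpq
    have h1 := eq_of_polar_eq hpi (PlaneChart.rect_subset hq).2 (h.mem_Icc hcd hp.1 hp.2) hpq
    obtain ⟨h2, h3⟩ := Prod.ext_iff.1 h1
    simp only at h2 h3
    exact hpR ⟨h2 ▸ hq.1, (h.mem_Ioo_iff hcd hp.1 hp.2).1 (h3 ▸ hq.2)⟩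
  fst_lt := hab
  snd_lt := hcd

/-- The energy of a competitor which is given in sheared polar coordinates. -/
theorem exists_gradientBound (h : IsAngleShear Θ a b c d) (hab : a < b) (hcd : c < d)
    (hpi : d - c < 2 * Real.pi) {Q n : ℕ}
    {W : ℝ × ℝ → SpecialQPoint Q n} {w : EuclideanSpace ℝ (Fin 2) → SpecialQPoint Q n}
    (hw : ∀ p ∈ Ioo a b ×ˢ Ioo c d, w (polar (p.1, Θ p)) = W p) {C : ℝ} {m : ℝ → ℝ}
    (hW : IsRectRegular W a b c d C m) {qa qb qc : ℝ × ℝ → ℝ}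
    (ha : IntegrableOn qa (Ioo a b ×ˢ Ioo c d)) (hb : IntegrableOn qb (Ioo a b ×ˢ Ioo c d))
    (hc : IntegrableOn qc (Ioo a b ×ˢ Ioo c d))
    (hspeed : ∀ T, ∀ᵐ p ∂(volume : Measure (ℝ × ℝ)).restrict (Ioo a b ×ˢ Ioo c d), ∀ v v' : ℝ,
      (IsRectRegular.dFst (fun p => dist (W p) T) p * v
        + IsRectRegular.dSnd (fun p => dist (W p) T) p * v') ^ 2
        ≤ qa p * v ^ 2 + 2 * qb p * v * v' + qc p * v' ^ 2) :
    ∃ φ, SpecialQMap.IsGradientBound w (polar '' (Ioo a b ×ˢ Ioo c d)) φ ∧ ∃ I : ℝ, 0 ≤ I ∧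
      ∑ j, ∫⁻ x in polar '' (Ioo a b ×ˢ Ioo c d), ENNReal.ofReal (φ j x ^ 2) = ENNReal.ofReal I ∧
      I = ∫ p in Ioo a b ×ˢ Ioo c d, (qa p * partialSnd Θ p - 2 * qb p * partialFst Θ p
        + qc p * ((1 + partialFst Θ p ^ 2) / partialSnd Θ p)) := by
  obtain ⟨φ, hφ, I, hI, h1, h2⟩ := (h.planeChart hab hcd hpi).exists_gradientBound
    (fun p hp => hw p hp) hW ha hb hc hspeed
  refine ⟨φ, hφ, I, hI, h1, h2.trans ?_⟩
  have h0 := h.contDiff.of_le one_le_two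
  -- The coordinates `polar` are conformal: the factors `exp p.1 ^ 2` from the derivatives and from
  -- the Jacobian cancel, and only the shear remains.
  refine setIntegral_congr_fun (PlaneChart.measurableSet_rect a b c d) fun p hp => ?_
  have hpos := (h.pos p (PlaneChart.rect_subset hp)).ne'
  have he := (Real.exp_pos p.1).ne'
  have hsc := Real.sin_sq_add_cos_sq (Θ p)
  simp only [jac_pol h0, partialFst_polFst h0, partialFst_polSnd h0, partialSnd_polFst h0,
    partialSnd_polSnd h0]
  field_simp
  linear_combination (qa p * partialSnd Θ p ^ 2 - 2 * qb p * partialFst Θ p * partialSnd Θ p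
    + qc p * (1 + partialFst Θ p ^ 2)) * hsc

end IsAngleShear

/-! ### Speed of maps of the form `λ(t, y) g(y)` -/

theorem hasDerivAt_line (a v : ℝ) : HasDerivAt (fun r => a + r * v) v 0 := by
  simpa using ((hasDerivAt_id (0 : ℝ)).mul_const v).const_add a

/-- Where the distance to `T` vanishes it has a minimum, and the partial derivatives are zero; no
differentiability is needed there. Elsewhere the distance function is differentiable and 1-Lipschitz
along `W`, and its difference quotients are bounded by those of `W`. -/
theorem sq_deriv_dist_le {X : Type*} [MetricSpace X] {W : ℝ × ℝ → X} {T : X} {p : ℝ × ℝ}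
    {qa qb qc : ℝ}
    (hd : dist (W p) T ≠ 0 → DifferentiableAt ℝ (fun p => dist (W p) T) p)
    (hq : ∀ v v' : ℝ, ∃ E : ℝ → ℝ,
      Tendsto E (𝓝[≠] 0) (𝓝 (qa * v ^ 2 + 2 * qb * v * v' + qc * v' ^ 2)) ∧
      ∀ᶠ r in 𝓝[≠] 0, dist (W (p.1 + r * v, p.2 + r * v')) (W p) ^ 2 / r ^ 2 ≤ E r) (v v' : ℝ) :
    (IsRectRegular.dFst (fun p => dist (W p) T) p * v
      + IsRectRegular.dSnd (fun p => dist (W p) T) p * v') ^ 2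
      ≤ qa * v ^ 2 + 2 * qb * v * v' + qc * v' ^ 2 := by
  obtain ⟨E, hE, hWE⟩ := hq v v'
  by_cases h0 : dist (W p) T = 0
  · have e1 : IsRectRegular.dFst (fun p => dist (W p) T) p = 0 := by
      refine IsLocalMin.deriv_eq_zero (Eventually.of_forall fun t => ?_)
      simp only [h0, dist_nonneg]
    have e2 : IsRectRegular.dSnd (fun p => dist (W p) T) p = 0 := by
      refine IsLocalMin.deriv_eq_zero (Eventually.of_forall fun t => ?_)
      simp only [h0, dist_nonneg]
    rw [e1, e2]
    refine ge_of_tendsto hE (hWE.mono fun r hr => le_trans ?_ hr)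
    simp only [zero_mul, add_zero, ne_eq, OfNat.ofNat_ne_zero, not_false_eq_true, zero_pow]
    positivity
  · set F := fun p => dist (W p) T with hF
    have hFd : DifferentiableAt ℝ F p := hd h0
    have e1 : IsRectRegular.dFst F p = partialFst F p := (hasDerivAt_fst hFd).deriv
    have e2 : IsRectRegular.dSnd F p = partialSnd F p := (hasDerivAt_snd hFd).deriv
    rw [e1, e2, ← fderiv_apply_eq_partial F p (v, v')]
    have hl : HasDerivAt (fun r : ℝ => (p.1 + r * v, p.2 + r * v')) (v, v') 0 :=
      (hasDerivAt_line p.1 v).prodMk (hasDerivAt_line p.2 v')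
    have hp : (p.1 + 0 * v, p.2 + 0 * v') = p := by simp
    have hFd' : HasFDerivAt F (fderiv ℝ F p) (p.1 + 0 * v, p.2 + 0 * v') := by
      rw [hp]
      exact hFd.hasFDerivAt
    have hc := (hasDerivAt_iff_tendsto_slope.1 (hFd'.comp_hasDerivAt 0 hl)).pow 2
    refine le_of_tendsto_of_tendsto hc hE ?_
    filter_upwards [hWE, self_mem_nhdsWithin] with r hr hr0
    refine le_trans ?_ hr
    rw [slope_def_field, div_pow, sub_zero]
    refine div_le_div_of_nonneg_right ?_ (sq_nonneg r)
    simp only [Function.comp_apply, hp, hF]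
    exact sq_le_sq' (by linarith [abs_le.1 (abs_dist_sub_le (W (p.1 + r * v, p.2 + r * v'))
      (W p) T)]) (by linarith [abs_le.1 (abs_dist_sub_le (W (p.1 + r * v, p.2 + r * v')) (W p) T)])

theorem tendsto_dist_comp_div_sq {X : Type*} [MetricSpace X] {g : ℝ → X} {y : ℝ → ℝ} {y' s : ℝ}
    (h : Tendsto (fun k => dist (g (y 0 + k)) (g (y 0)) / |k|) (𝓝[≠] 0) (𝓝 s))
    (hy : HasDerivAt y y' 0) :
    Tendsto (fun r => dist (g (y r)) (g (y 0)) ^ 2 / r ^ 2) (𝓝[≠] 0) (𝓝 (y' ^ 2 * s ^ 2)) := by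
  -- The existence of the metric derivative says that this function has derivative zero at `y 0`,
  -- and the ordinary chain rule applies to it.
  let D : ℝ → ℝ := fun x => dist (g x) (g (y 0)) - s * |x - y 0|
  have hD : HasDerivAt D 0 (y 0) := by
    rw [hasDerivAt_iff_tendsto_slope_zero]
    have h1 : Tendsto (fun k => dist (g (y 0 + k)) (g (y 0)) / |k| - s) (𝓝[≠] 0) (𝓝 0) := by
      simpa using h.sub_const s
    rw [tendsto_zero_iff_abs_tendsto_zero]
    refine (tendsto_zero_iff_abs_tendsto_zero _).1 h1 |>.congr' ?_
    filter_upwards [self_mem_nhdsWithin] with k hk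
    have hk' : |k| ≠ 0 := abs_ne_zero.2 hk
    simp only [Function.comp_apply, D, dist_self, sub_self, abs_zero, mul_zero, sub_zero,
      add_sub_cancel_left, smul_eq_mul, abs_mul, abs_inv]
    rw [div_sub' hk', abs_div, abs_abs, mul_comm |k| s, div_eq_inv_mul]
  have h2 := hasDerivAt_iff_tendsto_slope_zero.1 (hD.comp (0 : ℝ) hy)
  have h3 := hasDerivAt_iff_tendsto_slope_zero.1 hy
  have h4 : Tendsto (fun r => |dist (g (y r)) (g (y 0)) / r|) (𝓝[≠] 0) (𝓝 (|s| * |y'|)) := by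
    have h5 := (tendsto_zero_iff_abs_tendsto_zero _).1 (by simpa using h2)
    have h6 := h3.abs.const_mul s
    have hs : 0 ≤ s := ge_of_tendsto h (Eventually.of_forall fun k => by positivity)
    have h7 : Tendsto (fun r => |dist (g (y r)) (g (y 0)) / r| - s * |r⁻¹ • (y (0 + r) - y 0)|)
        (𝓝[≠] 0) (𝓝 0) := by
      rw [tendsto_zero_iff_abs_tendsto_zero]
      refine h5.congr' ?_
      filter_upwards [self_mem_nhdsWithin] with r hr
      have hr' : 0 < |r| := abs_pos.2 hr
      simp only [Function.comp_apply, D, zero_add, smul_eq_mul, abs_mul, abs_inv, abs_div,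
        abs_of_nonneg (dist_nonneg (x := g (y r)) (y := g (y 0))), dist_self, sub_self, abs_zero,
        mul_zero, sub_zero]
      rw [show dist (g (y r)) (g (y 0)) / |r| - s * (|r|⁻¹ * |y r - y 0|)
        = |r|⁻¹ * (dist (g (y r)) (g (y 0)) - s * |y r - y 0|) by ring, abs_mul, abs_inv, abs_abs]
    have h8 := h7.add h6
    simp only [sub_add_cancel, zero_add] at h8
    rwa [abs_of_nonneg hs]
  have h9 := h4.pow 2
  simp only [sq_abs, mul_pow, div_pow] at h9
  rwa [mul_comm (y' ^ 2)]

namespace SpecialQPoint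

variable {Q n : ℕ}

theorem dist_scale_sq' (A B : SpecialQPoint Q n) {a b : ℝ} (ha : 0 ≤ a) (hb : 0 ≤ b) :
    Dist.dist (A.scale a) (B.scale b) ^ 2
      = (a - b) * (a * A.size ^ 2 - b * B.size ^ 2) + a * b * Dist.dist A B ^ 2 := by
  rw [dist_scale_sq A B ha hb]
  ring

/-- Divide the law of cosines by `r²`. Its radial part is a product of two difference quotients, of
`μ` and of `μ |g ∘ y|²`, and the rest is the metric derivative of `g` along `y`. -/
theorem tendsto_dist_scale_div_sq {g : ℝ → SpecialQPoint Q n} {μ y : ℝ → ℝ} {μ' y' h' s : ℝ}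
    (hμ : HasDerivAt μ μ' 0) (hμ0 : ∀ r, 0 ≤ μ r) (hy : HasDerivAt y y' 0)
    (hs : HasDerivAt (fun x => (g x).size ^ 2) h' (y 0))
    (h : Tendsto (fun k => Dist.dist (g (y 0 + k)) (g (y 0)) / |k|) (𝓝[≠] 0) (𝓝 s)) :
    Tendsto (fun r => Dist.dist ((g (y r)).scale (μ r)) ((g (y 0)).scale (μ 0)) ^ 2 / r ^ 2)
      (𝓝[≠] 0) (𝓝 (μ' * (μ' * (g (y 0)).size ^ 2 + μ 0 * (h' * y'))
        + μ 0 ^ 2 * (y' ^ 2 * s ^ 2))) := by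
  have h1 := hasDerivAt_iff_tendsto_slope.1 hμ
  have h2 := hasDerivAt_iff_tendsto_slope.1 (hμ.mul (hs.comp 0 hy))
  have h3 := tendsto_dist_comp_div_sq h hy
  have h4 : Tendsto μ (𝓝[≠] 0) (𝓝 (μ 0)) := hμ.continuousAt.tendsto.mono_left nhdsWithin_le_nhds
  have h5 := (h1.mul h2).add ((h4.mul_const (μ 0)).mul h3)
  rw [sq (μ 0)]
  refine h5.congr' ?_
  filter_upwards [self_mem_nhdsWithin] with r hr
  have hr' : r ≠ 0 := hr
  rw [dist_scale_sq' _ _ (hμ0 r) (hμ0 0), slope_def_field, slope_def_field]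
  simp only [Pi.mul_apply, Function.comp_apply, sub_zero]
  field_simp

end SpecialQPoint

namespace SpecialQPoint

variable {Q n : ℕ}

theorem dist_scale_le (A B : SpecialQPoint Q n) {a b : ℝ} (ha : 0 ≤ a) (hb : 0 ≤ b) :
    Dist.dist (A.scale a) (B.scale b) ≤ |a - b| * A.size + b * Dist.dist A B := by
  refine (_root_.dist_triangle _ (A.scale b) _).trans ?_
  rw [dist_scale_left A ha hb, dist_scale_self A B hb]

theorem continuous_size : Continuous (size : SpecialQPoint Q n → ℝ) := by
  have : (size : SpecialQPoint Q n → ℝ) = fun A => Dist.dist A (origin Q n) :=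
    funext fun A => (dist_origin A).symm
  rw [this]
  exact continuous_id.dist continuous_const

theorem continuous_scale_comp {Y : Type*} [TopologicalSpace Y] {f : Y → SpecialQPoint Q n}
    {l : Y → ℝ} (hf : Continuous f) (hl : Continuous l) (h0 : ∀ y, 0 ≤ l y) :
    Continuous fun y => (f y).scale (l y) := by
  rw [continuous_iff_continuousAt]
  intro y
  rw [ContinuousAt, tendsto_iff_dist_tendsto_zero]
  have hc : Continuous fun y' => |l y' - l y| * (f y').size + l y * Dist.dist (f y') (f y) := by
    have := continuous_size.comp hf
    fun_prop
  have h1 := hc.tendsto y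
  simp only [sub_self, abs_zero, zero_mul, _root_.dist_self, mul_zero, add_zero] at h1
  exact squeeze_zero (fun _ => _root_.dist_nonneg)
    (fun y' => dist_scale_le _ _ (h0 y') (h0 y)) h1

end SpecialQPoint

/-- A curve of special `Q`-points with metric speed `s` in `L²_loc`. -/
structure IsPolarCurve {Q n : ℕ} (g : ℝ → SpecialQPoint Q n) (s : ℝ → ℝ) : Prop where
  speed : IsSpeedBound g s
  limit : ∀ᵐ y, Tendsto (fun k => dist (g (y + k)) (g y) / |k|) (𝓝[≠] 0) (𝓝 (s y))
  sq_int : LocallyIntegrable fun y => s y ^ 2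
  measurable : Measurable s

theorem locallyIntegrable_mul_continuous {f c : ℝ → ℝ} (hf : LocallyIntegrable f)
    (hc : Continuous c) : LocallyIntegrable fun y => f y * c y := by
  rw [locallyIntegrable_iff]
  intro k hk
  exact (hf.integrableOn_isCompact hk).mul_continuousOn hc.continuousOn hk

namespace IsSpeedBound

variable {Q n : ℕ} {g : ℝ → SpecialQPoint Q n} {s : ℝ → ℝ}

theorem size_comp (h : IsSpeedBound g s) : IsSpeedBound (fun y => (g y).size) s := by
  have := h.dist_right (SpecialQPoint.origin Q n)
  simpa only [SpecialQPoint.dist_origin] using this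

theorem continuous_size (h : IsSpeedBound g s) : Continuous fun y => (g y).size :=
  h.size_comp.continuous

theorem ae_hasDerivAt_size_sq (h : IsSpeedBound g s) :
    ∀ᵐ y, HasDerivAt (fun x => (g x).size ^ 2) (deriv (fun x => (g x).size ^ 2) y) y := by
  filter_upwards [h.size_comp.ae_differentiableAt] with y hy
  exact (hy.pow 2).hasDerivAt

theorem ae_abs_deriv_size_sq_le (h : IsSpeedBound g s) :
    ∀ᵐ y, |deriv (fun x => (g x).size ^ 2) y| ≤ s y * (2 * (g y).size) := by
  filter_upwards [h.size_comp.ae_differentiableAt, h.size_comp.ae_abs_deriv_le] with y hy hy'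
  rw [(hy.hasDerivAt.fun_pow 2).deriv]
  have h0 := (g y).size_nonneg
  simp only [Nat.cast_ofNat, Nat.add_one_sub_one, pow_one, abs_mul, Nat.abs_ofNat,
    abs_of_nonneg h0]
  nlinarith

theorem locallyIntegrable_deriv_size_sq (h : IsSpeedBound g s) :
    LocallyIntegrable (deriv fun x => (g x).size ^ 2) := by
  have h1 := locallyIntegrable_mul_continuous h.locallyIntegrable
    (h.continuous_size.const_mul 2)
  refine h1.mono (measurable_deriv _).aestronglyMeasurable ?_
  filter_upwards [h.ae_abs_deriv_size_sq_le] with y hy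
  rw [Real.norm_eq_abs]
  exact hy.trans (le_abs_self _)

theorem absolutelyContinuous_size_sq (h : IsSpeedBound g s) (a b : ℝ) :
    AbsolutelyContinuousOnInterval (fun x => (g x).size ^ 2) a b := by
  have := h.size_comp.absolutelyContinuousOnInterval a b
  simpa only [sq] using this.fun_mul this

/-- Maps of the form `λ(t, y) g(y)` are regular on rectangles. -/
theorem isRectRegular_scale (h : IsSpeedBound g s) {l : ℝ × ℝ → ℝ} (hl : ContDiff ℝ 1 l)
    (h0 : ∀ p, 0 ≤ l p) (a b c d : ℝ) :
    ∃ C m, IsRectRegular (fun p => (g p.2).scale (l p)) a b c d C m := by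
  have hK : IsCompact (Icc a b ×ˢ Icc c d) := isCompact_Icc.prod isCompact_Icc
  have hcf : Continuous (partialFst l) :=
    (hl.continuous_fderiv one_ne_zero).clm_apply continuous_const
  have hcs : Continuous (partialSnd l) :=
    (hl.continuous_fderiv one_ne_zero).clm_apply continuous_const
  obtain ⟨C1, hC1⟩ := hK.exists_bound_of_continuousOn hcf.continuousOn
  obtain ⟨C2, hC2⟩ := hK.exists_bound_of_continuousOn hcs.continuousOn
  obtain ⟨L, hL⟩ := hK.exists_bound_of_continuousOn hl.continuous.continuousOn
  obtain ⟨N, hN⟩ := (isCompact_Icc (a := c) (b := d)).exists_bound_of_continuousOn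
    h.continuous_size.continuousOn
  have hd := hl.differentiable one_ne_zero
  have hNs : ∀ y ∈ Icc c d, (g y).size ≤ |N| := fun y hy =>
    ((le_abs_self _).trans (hN y hy)).trans (le_abs_self _)
  refine ⟨|C1| * |N|, fun y => |C2| * |N| + |L| * s y, ?_, ?_, ?_, by positivity, ?_, ?_⟩
  · exact SpecialQPoint.continuous_scale_comp (h.continuous.comp continuous_snd) hl.continuous h0
  · intro t ht t' ht' y hy
    rw [SpecialQPoint.dist_scale_left _ (h0 _) (h0 _)]
    have h1 : |l (t, y) - l (t', y)| ≤ |C1| * |t - t'| :=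
      (convex_Icc a b).norm_image_sub_le_of_norm_hasDerivWithin_le (f := fun t => l (t, y))
        (f' := fun t => partialFst l (t, y))
        (fun x hx => (hasDerivAt_fst (hd (x, y))).hasDerivWithinAt)
        (fun x hx => (hC1 (x, y) ⟨hx, hy⟩).trans (le_abs_self _)) ht' ht
    calc _ ≤ |C1| * |t - t'| * |N| :=
          mul_le_mul h1 (hNs y hy) (SpecialQPoint.size_nonneg _) (by positivity)
      _ = _ := by ring
  · intro t ht y hy y' hy' hyy
    have h1 : |l (t, y) - l (t, y')| ≤ |C2| * |y - y'| :=
      (convex_Icc c d).norm_image_sub_le_of_norm_hasDerivWithin_le (f := fun y => l (t, y))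
        (f' := fun y => partialSnd l (t, y))
        (fun x hx => (hasDerivAt_snd (hd (t, x))).hasDerivWithinAt)
        (fun x hx => (hC2 (t, x) ⟨ht, hx⟩).trans (le_abs_self _)) hy' hy
    have h2 : l (t, y') ≤ |L| := ((le_abs_self _).trans (hL _ ⟨ht, hy'⟩)).trans (le_abs_self _)
    have h3 := h.dist_le y y' hyy
    have h4 : ∫ x in y..y', (|C2| * |N| + |L| * s x)
        = (y' - y) * (|C2| * |N|) + |L| * ∫ x in y..y', s x := by
      rw [intervalIntegral.integral_add intervalIntegrable_const
        ((h.intervalIntegrable y y').const_mul _), intervalIntegral.integral_const,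
        intervalIntegral.integral_const_mul, smul_eq_mul]
    rw [h4]
    refine (SpecialQPoint.dist_scale_le _ _ (h0 _) (h0 _)).trans (add_le_add ?_ ?_)
    · rw [abs_sub_comm y, abs_of_nonneg (sub_nonneg.2 hyy)] at h1
      calc _ ≤ |C2| * (y' - y) * |N| :=
            mul_le_mul h1 (hNs y hy) (SpecialQPoint.size_nonneg _)
              (mul_nonneg (abs_nonneg _) (sub_nonneg.2 hyy))
        _ = _ := by ring
    · exact mul_le_mul h2 h3 dist_nonneg (abs_nonneg _)
  · exact (locallyIntegrable_const _).add (h.locallyIntegrable.smul |L|)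
  · intro y
    have := h.nonneg y
    positivity

end IsSpeedBound

theorem ae_restrict_snd {P : ℝ → Prop} (hP : ∀ᵐ y, P y) (R : Set (ℝ × ℝ)) :
    ∀ᵐ p ∂(volume : Measure (ℝ × ℝ)).restrict R, P p.2 :=
  ae_restrict_of_ae (Measure.quasiMeasurePreserving_snd.ae hP)

namespace IsPolarCurve

variable {Q n : ℕ} {g : ℝ → SpecialQPoint Q n} {s : ℝ → ℝ}

/-- The quadratic form of the metric speed of `λ(t, y) g(y)`. The coefficients contain only `λ`,
`|g|²`, its derivative and `s²`, so perturbing `λ` yields explicit competitors. -/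
theorem sq_deriv_dist_scale_le (h : IsPolarCurve g s) {l : ℝ × ℝ → ℝ} (hl : ContDiff ℝ 1 l)
    (h0 : ∀ p, 0 ≤ l p) (T : SpecialQPoint Q n) (R : Set (ℝ × ℝ)) :
    ∀ᵐ p ∂(volume : Measure (ℝ × ℝ)).restrict R, ∀ v v' : ℝ,
      (IsRectRegular.dFst (fun p => dist ((g p.2).scale (l p)) T) p * v
        + IsRectRegular.dSnd (fun p => dist ((g p.2).scale (l p)) T) p * v') ^ 2
      ≤ partialFst l p ^ 2 * (g p.2).size ^ 2 * v ^ 2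
        + 2 * (partialFst l p * partialSnd l p * (g p.2).size ^ 2
          + l p * partialFst l p * (deriv (fun x => (g x).size ^ 2) p.2 / 2)) * v * v'
        + (partialSnd l p ^ 2 * (g p.2).size ^ 2
          + l p * partialSnd l p * deriv (fun x => (g x).size ^ 2) p.2
          + l p ^ 2 * s p.2 ^ 2) * v' ^ 2 := by
  have hd := hl.differentiable one_ne_zero
  have hT : ∀ᵐ y, DifferentiableAt ℝ (fun x => dist (g x) T) y :=
    (h.speed.dist_right T).ae_differentiableAt
  filter_upwards [ae_restrict_snd h.limit R, ae_restrict_snd h.speed.ae_hasDerivAt_size_sq R,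
    ae_restrict_snd hT R] with p hp1 hp2 hp3
  refine sq_deriv_dist_le (W := fun p => (g p.2).scale (l p)) ?_ ?_
  · intro hne
    -- The law of cosines writes the distance to `T` as the square root of a differentiable
    -- function, which is differentiable where it does not vanish.
    have e : ∀ p : ℝ × ℝ, dist ((g p.2).scale (l p)) T
        = √((l p - 1) * (l p * (g p.2).size ^ 2 - 1 * T.size ^ 2)
          + l p * 1 * dist (g p.2) T ^ 2) := fun p => by
      rw [← SpecialQPoint.dist_scale_sq' _ _ (h0 p) zero_le_one, SpecialQPoint.scale_one,
        Real.sqrt_sq dist_nonneg]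
    have e' := e p
    simp only [e]
    refine DifferentiableAt.sqrt ?_ ?_
    · have d1 : DifferentiableAt ℝ (fun p : ℝ × ℝ => (g p.2).size ^ 2) p :=
        DifferentiableAt.fun_comp' (f := Prod.snd) (g := fun x => (g x).size ^ 2) p
          hp2.differentiableAt differentiableAt_snd
      have d2 : DifferentiableAt ℝ (fun p : ℝ × ℝ => dist (g p.2) T) p :=
        DifferentiableAt.fun_comp' (f := Prod.snd) (g := fun x => dist (g x) T) p
          hp3 differentiableAt_snd
      have d3 := hd p
      fun_prop
    · intro h0
      rw [h0, Real.sqrt_zero] at e'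
      exact hne e'
  · intro v v'
    have hline : HasDerivAt (fun r : ℝ => (p.1 + r * v, p.2 + r * v')) (v, v') 0 :=
      (hasDerivAt_line p.1 v).prodMk (hasDerivAt_line p.2 v')
    have hp : (p.1 + 0 * v, p.2 + 0 * v') = p := by simp
    have hl' : HasFDerivAt l (fderiv ℝ l p) (p.1 + 0 * v, p.2 + 0 * v') := by
      rw [hp]
      exact (hd p).hasFDerivAt
    have hμ := hl'.comp_hasDerivAt 0 hline
    rw [fderiv_apply_eq_partial] at hμ
    have e0 : p.2 + 0 * v' = p.2 := by simp
    have key := SpecialQPoint.tendsto_dist_scale_div_sq (g := g) hμ (fun r => h0 _)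
      (hasDerivAt_line p.2 v') (by rw [e0]; exact hp2) (by simp only [e0]; exact hp1)
    refine ⟨_, ?_, Eventually.of_forall fun r => le_rfl⟩
    have e1 : p.1 + 0 * v = p.1 := by simp
    simp only [Function.comp_apply, e0, e1] at key
    convert key using 2
    ring

end IsPolarCurve

/-! ### Displacement estimates and difference quotients -/

theorem edist_le_of_forall_denseRange {X ι : Type*} [MetricSpace X] {T : ι → X}
    (hT : DenseRange T) {x y : X} {C : ℝ≥0∞}
    (h : ∀ k, ENNReal.ofReal |dist x (T k) - dist y (T k)| ≤ C) : edist x y ≤ C := by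
  rcases eq_or_ne C ⊤ with rfl | hC
  · exact le_top
  · rw [edist_dist]
    refine ENNReal.ofReal_le_of_le_toReal (dist_le_of_forall_denseRange hT fun k => ?_)
    exact (ENNReal.ofReal_le_iff_le_toReal hC).1 (h k)

/-- Bounds for the weak derivative of all distance functions along a volume preserving flow
control the displacement along almost all flow lines. -/
theorem IsVolumeFlow.ae_edist_le {E : Type*} [NormedAddCommGroup E] [NormedSpace ℝ E]
    [FiniteDimensional ℝ E] [MeasureSpace E] [BorelSpace E]
    [IsLocallyFiniteMeasure (volume : Measure E)] {Φ : ℝ → E → E} {V : E → E}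
    (h : IsVolumeFlow Φ V) {X : Type*} [MetricSpace X] [TopologicalSpace.SeparableSpace X]
    [Nonempty X] {Ω U : Set E} (hΩ : IsOpen Ω) (hΩb : Bornology.IsBounded Ω) (hU : IsOpen U)
    {u : E → X} {φ : E → ℝ≥0∞} (hφ : Measurable φ)
    (hf : ∀ T, IntegrableOn (fun x => dist (u x) T) Ω)
    (hq : ∀ T, ∃ q, IntegrableOn q Ω ∧ (∀ᵐ x ∂volume.restrict Ω, ‖q x‖ₑ ≤ φ x) ∧
      ∀ η : E → ℝ, ContDiff ℝ ∞ η → HasCompactSupport η → tsupport η ⊆ Ω →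
        ∫ x in Ω, dist (u x) T * fderiv ℝ η x (V x) = -∫ x in Ω, q x * η x)
    {r : ℝ} (hr : 0 ≤ r) (hUΩ : ∀ s ∈ Icc 0 r, ∀ x ∈ U, Φ s x ∈ Ω) :
    ∀ᵐ x, x ∈ U → edist (u (Φ r x)) (u x) ≤ ∫⁻ s in Ioc 0 r, φ (Φ s x) := by
  have : ProperSpace E := FiniteDimensional.proper_real E
  have key : ∀ k, ∀ᵐ x, x ∈ U → ENNReal.ofReal |dist (u (Φ r x)) (TopologicalSpace.denseSeq X k)
      - dist (u x) (TopologicalSpace.denseSeq X k)| ≤ ∫⁻ s in Ioc 0 r, φ (Φ s x) := by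
    intro k
    obtain ⟨q, hqi, hqφ, hqw⟩ := hq (TopologicalSpace.denseSeq X k)
    set q' := hqi.aestronglyMeasurable.mk q with hq'
    have hqq : q =ᵐ[volume.restrict Ω] q' := hqi.aestronglyMeasurable.ae_eq_mk
    have hq'm : Measurable q' := hqi.aestronglyMeasurable.stronglyMeasurable_mk.measurable
    have h1 := h.ae_sub_eq_integral hΩ hΩb hU (hf _) (hqi.congr hqq) hq'm
      (fun η h1 h2 h3 => (hqw η h1 h2 h3).trans (congrArg _ (integral_congr_ae
        (hqq.mul (ae_eq_refl η))))) hr hUΩ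
    have hΦm : Measurable fun z : ℝ × E => Φ z.1 z.2 := h.contDiff.continuous.measurable
    have hB : MeasurableSet {x | x ∈ Ω → ‖q' x‖ₑ ≤ φ x} := by
      have : {x | x ∈ Ω → ‖q' x‖ₑ ≤ φ x} = Ωᶜ ∪ {x | ‖q' x‖ₑ ≤ φ x} := by
        ext x
        simp only [mem_ofPred_eq, mem_union, mem_compl_iff, imp_iff_not_or]
      rw [this]
      exact hΩ.measurableSet.compl.union (measurableSet_le hq'm.enorm hφ)
    have hB' : ∀ᵐ x, x ∈ Ω → ‖q' x‖ₑ ≤ φ x := by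
      rw [← ae_restrict_iff' hΩ.measurableSet]
      filter_upwards [hqφ, hqq] with x hx hx'
      rwa [← hx']
    have h2 : ∀ᵐ x, ∀ᵐ s ∂volume.restrict (Ioc 0 r), Φ s x ∈ Ω → ‖q' (Φ s x)‖ₑ ≤ φ (Φ s x) := by
      have h3 : ∀ᵐ s ∂volume.restrict (Ioc 0 r), ∀ᵐ x, Φ s x ∈ Ω →
          ‖q' (Φ s x)‖ₑ ≤ φ (Φ s x) :=
        Eventually.of_forall fun s => (h.mp s).quasiMeasurePreserving.ae hB'
      exact (Measure.ae_ae_comm (p := fun s x => Φ s x ∈ Ω → ‖q' (Φ s x)‖ₑ ≤ φ (Φ s x))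
        (hΦm hB)).1 h3
    filter_upwards [h1, h2] with x hx1 hx2 hxU
    rw [hx1 hxU, intervalIntegral.integral_of_le hr, ← Real.norm_eq_abs, ofReal_norm]
    refine (enorm_integral_le_lintegral_enorm _).trans (lintegral_mono_ae ?_)
    filter_upwards [hx2, ae_restrict_mem measurableSet_Ioc] with s hs hsI
    exact hs (hUΩ s (Ioc_subset_Icc_self hsI) x hxU)
  filter_upwards [ae_all_iff.2 key] with x hx hxU
  exact edist_le_of_forall_denseRange (TopologicalSpace.denseRange_denseSeq X) fun k => hx k hxU

theorem isVolumeFlow_translation {E : Type*} [NormedAddCommGroup E] [NormedSpace ℝ E]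
    [MeasureSpace E] [BorelSpace E] [SecondCountableTopology E]
    [(volume : Measure E).IsAddRightInvariant] (e : E) :
    IsVolumeFlow (fun (s : ℝ) (x : E) => x + s • e) fun _ => e where
  contDiff := contDiff_snd.add (contDiff_fst.smul contDiff_const)
  zero x := by simp
  add s t x := by
    rw [add_smul]
    abel
  mp s := measurePreserving_add_right _ _
  hasDerivAt x := by
    simpa using ((hasDerivAt_id (0 : ℝ)).smul_const e).const_add x

theorem sq_lintegral_le {α : Type*} [MeasurableSpace α] {μ : Measure α} {f : α → ℝ≥0∞}
    (hf : AEMeasurable f μ) : (∫⁻ x, f x ∂μ) ^ 2 ≤ μ univ * ∫⁻ x, f x ^ 2 ∂μ := by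
  have h := ENNReal.lintegral_mul_le_Lp_mul_Lq μ Real.HolderConjugate.two_two
    (aemeasurable_const (b := (1 : ℝ≥0∞))) hf
  simp only [Pi.mul_apply, one_mul, ENNReal.one_rpow, lintegral_const] at h
  have h2 := pow_le_pow_left' h 2
  refine h2.trans (le_of_eq ?_)
  rw [mul_pow, ← ENNReal.rpow_natCast, ← ENNReal.rpow_natCast, ← ENNReal.rpow_mul,
    ← ENNReal.rpow_mul]
  norm_num

namespace SpecialQMap.IsGradientBound

variable {Q n m : ℕ} {u : EuclideanSpace ℝ (Fin m) → SpecialQPoint Q n}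
  {Ω : Set (EuclideanSpace ℝ (Fin m))} {φ : Fin m → EuclideanSpace ℝ (Fin m) → ℝ}

theorem integrableOn_dist (h : IsGradientBound u Ω φ) (hb : Bornology.IsBounded Ω)
    (T : SpecialQPoint Q n) : IntegrableOn (fun x => dist (u x) T) Ω := by
  have : IsFiniteMeasure (volume.restrict Ω) :=
    ⟨by simpa using hb.measure_lt_top⟩
  exact (h.2 T).1.integrable one_le_two

theorem integrableOn_bound (h : IsGradientBound u Ω φ) (hb : Bornology.IsBounded Ω) (j : Fin m) :
    IntegrableOn (φ j) Ω := by
  have : IsFiniteMeasure (volume.restrict Ω) :=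
    ⟨by simpa using hb.measure_lt_top⟩
  exact (h.1 j).integrable one_le_two

theorem exists_weakPartial (h : IsGradientBound u Ω φ)
    (hb : Bornology.IsBounded Ω) (T : SpecialQPoint Q n) (j : Fin m) :
    ∃ q, IntegrableOn q Ω ∧ (∀ᵐ x ∂volume.restrict Ω, |q x| ≤ φ j x) ∧
      ∀ η : EuclideanSpace ℝ (Fin m) → ℝ, ContDiff ℝ ∞ η → HasCompactSupport η → tsupport η ⊆ Ω →
        ∫ x in Ω, dist (u x) T * fderiv ℝ η x (EuclideanSpace.single j 1)
          = -∫ x in Ω, q x * η x := by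
  obtain ⟨q, ⟨-, hq1, hq2⟩, hq3⟩ := (h.2 T).2 j
  refine ⟨q, ?_, hq3, hq2⟩
  have hqm : AEStronglyMeasurable q (volume.restrict Ω) := hq1.aestronglyMeasurable
  exact (h.integrableOn_bound hb j).mono' hqm hq3

/-- The difference quotients of `u` are bounded by `φ` in `L²`. -/
theorem lintegral_edist_sq_le (h : IsGradientBound u Ω φ) (hΩ : IsOpen Ω)
    (hb : Bornology.IsBounded Ω) (j : Fin m) {U : Set (EuclideanSpace ℝ (Fin m))} (hU : IsOpen U)
    {r : ℝ} (hr : 0 ≤ r)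
    (hUΩ : ∀ s ∈ Icc 0 r, ∀ x ∈ U, x + s • EuclideanSpace.single j 1 ∈ Ω) :
    ∫⁻ x in U, edist (u (x + r • EuclideanSpace.single j 1)) (u x) ^ 2
      ≤ ENNReal.ofReal r ^ 2 * ∫⁻ x in Ω, ENNReal.ofReal (φ j x ^ 2) := by
  set e : EuclideanSpace ℝ (Fin m) := EuclideanSpace.single j 1 with he
  have hfl := isVolumeFlow_translation e
  set φ' := (h.1 j).aestronglyMeasurable.mk (φ j) with hφ'
  have hφφ : φ j =ᵐ[volume.restrict Ω] φ' := (h.1 j).aestronglyMeasurable.ae_eq_mk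
  have hφ'm : Measurable φ' := (h.1 j).aestronglyMeasurable.stronglyMeasurable_mk.measurable
  have h1 := hfl.ae_edist_le hΩ hb hU hφ'm.enorm (fun T => h.integrableOn_dist hb T) (fun T => by
    obtain ⟨q, hq1, hq2, hq3⟩ := h.exists_weakPartial hb T j
    refine ⟨q, hq1, ?_, hq3⟩
    filter_upwards [hq2, hφφ] with x hx hx'
    rw [enorm_le_iff_norm_le, Real.norm_eq_abs, ← hx']
    exact hx.trans (le_abs_self _)) hr hUΩ
  have hm : Measurable fun z : EuclideanSpace ℝ (Fin m) × ℝ => ‖φ' (z.1 + z.2 • e)‖ₑ := by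
    have : Continuous fun z : EuclideanSpace ℝ (Fin m) × ℝ => z.1 + z.2 • e := by fun_prop
    exact (hφ'm.comp this.measurable).enorm
  -- Cauchy-Schwarz in time supplies one factor `r`. After exchanging the integrals, translation
  -- invariance makes the inner integral bounded independently of the time, which supplies the
  -- other.
  calc ∫⁻ x in U, edist (u (x + r • e)) (u x) ^ 2
      ≤ ∫⁻ x in U, ENNReal.ofReal r * ∫⁻ s in Ioc 0 r, ‖φ' (x + s • e)‖ₑ ^ 2 := by
        refine lintegral_mono_ae ?_
        filter_upwards [ae_restrict_of_ae h1, ae_restrict_mem hU.measurableSet] with x hx hxU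
        refine (pow_le_pow_left' (hx hxU) 2).trans ((sq_lintegral_le ?_).trans (le_of_eq ?_))
        · exact (hm.comp measurable_prodMk_left).aemeasurable
        · simp
    _ = ENNReal.ofReal r * ∫⁻ s in Ioc 0 r, ∫⁻ x in U, ‖φ' (x + s • e)‖ₑ ^ 2 := by
        rw [lintegral_const_mul, lintegral_lintegral_swap (hm.pow_const 2).aemeasurable]
        exact (hm.pow_const 2).lintegral_prod_right'
    _ ≤ ENNReal.ofReal r * ∫⁻ s in Ioc 0 r, ∫⁻ x in Ω, ENNReal.ofReal (φ j x ^ 2) := by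
        gcongr ENNReal.ofReal r * ?_
        refine setLIntegral_mono' measurableSet_Ioc fun s hs => ?_
        have e1 : ∫⁻ x in Ω, ENNReal.ofReal (φ j x ^ 2) = ∫⁻ x in Ω, ‖φ' x‖ₑ ^ 2 := by
          refine lintegral_congr_ae ?_
          filter_upwards [hφφ] with x hx
          rw [hx, ← enorm_pow, Real.enorm_of_nonneg (sq_nonneg _)]
        rw [e1, ← (hfl.mp s).setLIntegral_comp_preimage hΩ.measurableSet
          (hφ'm.enorm.pow_const 2)]
        exact lintegral_mono_set fun x hx => hUΩ s (Ioc_subset_Icc_self hs) x hx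
    _ = _ := by
        simp only [lintegral_const, MeasurableSet.univ, Measure.restrict_apply, univ_inter,
          Real.volume_Ioc, sub_zero]
        ring

/-- The squared directional derivatives of a map are bounded by the squares of its gradient
bounds in the mean. -/
theorem lintegral_le (h : IsGradientBound u Ω φ) (hΩ : IsOpen Ω)
    (hb : Bornology.IsBounded Ω) (hne : Ωᶜ.Nonempty) (hu : Measurable u) (j : Fin m)
    {A : EuclideanSpace ℝ (Fin m) → ℝ}
    (hA : ∀ᵐ x ∂volume.restrict Ω, Tendsto (fun r : ℝ =>
      dist (u (x + r • EuclideanSpace.single j 1)) (u x) ^ 2 / r ^ 2) (𝓝[≠] 0) (𝓝 (A x))) :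
    ∫⁻ x in Ω, ENNReal.ofReal (A x) ≤ ∫⁻ x in Ω, ENNReal.ofReal (φ j x ^ 2) := by
  set e : EuclideanSpace ℝ (Fin m) := EuclideanSpace.single j 1 with he
  have hen : ‖e‖ = 1 := by simp [he]
  let r : ℕ → ℝ := fun k => 1 / ((k : ℝ) + 1)
  have hr0 : ∀ k, 0 < r k := fun k => by positivity
  have hrt : Tendsto r atTop (𝓝 0) := tendsto_one_div_add_atTop_nhds_zero_nat
  have hrt' : Tendsto r atTop (𝓝[≠] 0) :=
    tendsto_nhdsWithin_iff.2 ⟨hrt, Eventually.of_forall fun k => (hr0 k).ne'⟩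
  -- Points farther than `r k` from the complement: from these the segment of length `r k` stays in
  -- `Ω`. The sets exhaust `Ω` in the limit.
  let U : ℕ → Set (EuclideanSpace ℝ (Fin m)) := fun k => {x | r k < Metric.infDist x Ωᶜ}
  have hUo : ∀ k, IsOpen (U k) := fun k =>
    isOpen_lt continuous_const (Metric.continuous_infDist_pt _)
  have hUΩ : ∀ k, ∀ s ∈ Icc 0 (r k), ∀ x ∈ U k, x + s • e ∈ Ω := by
    intro k s hs x hx
    by_contra hcon
    have h1 := Metric.infDist_le_dist_of_mem (x := x) (mem_compl hcon)
    have h2 : dist x (x + s • e) = s := by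
      rw [dist_self_add_right, norm_smul, hen, mul_one, Real.norm_of_nonneg hs.1]
    have h3 : r k < Metric.infDist x Ωᶜ := hx
    linarith [hs.2]
  let F : ℕ → EuclideanSpace ℝ (Fin m) → ℝ≥0∞ := fun k =>
    (U k).indicator fun x => edist (u (x + r k • e)) (u x) ^ 2 / ENNReal.ofReal (r k) ^ 2
  have hFm : ∀ k, Measurable (F k) := fun k =>
    (((hu.comp (measurable_id.add_const _)).edist hu).pow_const 2 |>.div_const _).indicator
      (hUo k).measurableSet
  -- Fatou's lemma for the squared difference quotients along the steps `1 / (k + 1)`.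
  calc ∫⁻ x in Ω, ENNReal.ofReal (A x) ≤ ∫⁻ x in Ω, liminf (fun k => F k x) atTop := by
        refine lintegral_mono_ae ?_
        filter_upwards [hA, ae_restrict_mem hΩ.measurableSet] with x hx hxΩ
        have h1 : 0 < Metric.infDist x Ωᶜ :=
          (hΩ.isClosed_compl.notMem_iff_infDist_pos hne).1 fun hcon => hcon hxΩ
        have h2 : ∀ᶠ k in atTop, x ∈ U k := hrt.eventually (gt_mem_nhds h1)
        have h3 : Tendsto (fun k => F k x) atTop (𝓝 (ENNReal.ofReal (A x))) := by
          refine (ENNReal.tendsto_ofReal (hx.comp hrt')).congr' ?_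
          filter_upwards [h2] with k hk
          simp only [F, indicator_of_mem hk, Function.comp_apply]
          rw [ENNReal.ofReal_div_of_pos (pow_pos (hr0 k) 2), ENNReal.ofReal_pow dist_nonneg,
            ENNReal.ofReal_pow (hr0 k).le, edist_dist]
        exact h3.liminf_eq.ge
    _ ≤ liminf (fun k => ∫⁻ x in Ω, F k x) atTop := lintegral_liminf_le hFm
    _ ≤ ∫⁻ x in Ω, ENNReal.ofReal (φ j x ^ 2) := by
        refine liminf_le_of_le (by isBoundedDefault) fun b hb' => ?_
        obtain ⟨k, hk⟩ := hb'.exists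
        refine hk.trans ((setLIntegral_le_lintegral _ _).trans ?_)
        rw [lintegral_indicator (hUo k).measurableSet]
        simp only [div_eq_mul_inv]
        rw [lintegral_mul_const']
        · refine (mul_le_mul_left (h.lintegral_edist_sq_le hΩ hb j (hUo k) (hr0 k).le
            (hUΩ k)) _).trans (le_of_eq ?_)
          have h0 : ENNReal.ofReal (r k) ^ 2 ≠ 0 := by
            have := hr0 k
            positivity
          rw [mul_comm, ← mul_assoc, ENNReal.inv_mul_cancel h0 (by finiteness), one_mul]
        · exact ENNReal.inv_ne_top.2 (by have := hr0 k; positivity)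

end SpecialQMap.IsGradientBound

/-! ### Lower bound for the energy of a homogeneous map on a sector -/

/-- Coordinate lines in logarithmic polar coordinates. -/
theorem exists_polar_path (p : ℝ × ℝ) (j : Fin 2) : ∃ t y : ℝ → ℝ, t 0 = p.1 ∧ y 0 = p.2 ∧
    HasDerivAt t (Real.exp (-p.1) * ![Real.cos p.2, Real.sin p.2] j) 0 ∧
    HasDerivAt y (Real.exp (-p.1) * ![-Real.sin p.2, Real.cos p.2] j) 0 ∧
    ∀ᶠ r in 𝓝 0, polar (t r, y r) = polar p + r • EuclideanSpace.single j (1 : ℝ) := by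
  set q : ℂ := Complex.equivRealProd.symm p with hq
  set w : ℂ := ![1, Complex.I] j with hw
  have hew : Complex.orthonormalBasisOneI.repr w = EuclideanSpace.single j (1 : ℝ) := by
    ext i
    fin_cases j <;> fin_cases i <;> simp [hw]
  -- Since `exp q + r w = exp q (1 + r ζ)`, adding `log (1 + r ζ)` to `q` lifts the Cartesian line
  -- to logarithmic coordinates for small `r`.
  let ζ : ℂ := Complex.exp (-q) * w
  have hz : HasDerivAt (fun r : ℝ => 1 + (r : ℂ) * ζ) ζ 0 := by
    have := ((hasDerivAt_id (0 : ℝ)).ofReal_comp.mul_const ζ).const_add 1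
    simpa using this
  have hL : HasDerivAt (fun r : ℝ => Complex.log (1 + (r : ℂ) * ζ)) ζ 0 := by
    have := hz.clog_real (by simp)
    simpa using this
  have hre : HasDerivAt (fun r : ℝ => (Complex.log (1 + (r : ℂ) * ζ)).re) ζ.re 0 :=
    Complex.reCLM.hasFDerivAt.comp_hasDerivAt 0 hL
  have him : HasDerivAt (fun r : ℝ => (Complex.log (1 + (r : ℂ) * ζ)).im) ζ.im 0 :=
    Complex.imCLM.hasFDerivAt.comp_hasDerivAt 0 hL
  refine ⟨fun r => p.1 + (Complex.log (1 + (r : ℂ) * ζ)).re,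
    fun r => p.2 + (Complex.log (1 + (r : ℂ) * ζ)).im, by simp, by simp, ?_, ?_, ?_⟩
  · have e : Real.exp (-p.1) * ![Real.cos p.2, Real.sin p.2] j = ζ.re := by
      fin_cases j <;> simp [ζ, hw, hq, Complex.exp_re, Complex.exp_im]
    rw [e]
    exact hre.const_add p.1
  · have e : Real.exp (-p.1) * ![-Real.sin p.2, Real.cos p.2] j = ζ.im := by
      fin_cases j <;> simp [ζ, hw, hq, Complex.exp_re, Complex.exp_im]
    rw [e]
    exact him.const_add p.2
  · have hne : ∀ᶠ r : ℝ in 𝓝 0, 1 + (r : ℂ) * ζ ≠ 0 :=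
      hz.continuousAt.eventually_ne (by simp)
    filter_upwards [hne] with r hr
    have e1 : (Complex.equivRealProd.symm (p.1 + (Complex.log (1 + (r : ℂ) * ζ)).re,
        p.2 + (Complex.log (1 + (r : ℂ) * ζ)).im)) = q + Complex.log (1 + (r : ℂ) * ζ) := by
      apply Complex.ext <;> simp [hq]
    have e2 : Complex.exp q * (1 + (r : ℂ) * ζ) = Complex.exp q + (r : ℝ) • w := by
      have : Complex.exp q * Complex.exp (-q) = 1 := by
        rw [← Complex.exp_add, add_neg_cancel, Complex.exp_zero]
      simp only [ζ, Complex.real_smul]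
      linear_combination (r : ℂ) * w * this
    rw [polar_eq_exp, polar_eq_exp, e1, Complex.exp_add, Complex.exp_log hr, e2, map_add,
      map_smul, hew]

theorem partialSnd_snd (p : ℝ × ℝ) : partialSnd Prod.snd p = 1 := by
  simp [partialSnd, fderiv_snd]

theorem partialFst_snd (p : ℝ × ℝ) : partialFst Prod.snd p = 0 := by
  simp [partialFst, fderiv_snd]

theorem polarChart {a b c d : ℝ} (hab : a < b) (hcd : c < d) (hpi : d - c < 2 * Real.pi) :
    PlaneChart (polFst Prod.snd) (polSnd Prod.snd) a b c d (polar '' (Ioo a b ×ˢ Ioo c d)) :=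
  (isAngleShear_snd a b c d).planeChart hab hcd hpi

theorem jac_polar (p : ℝ × ℝ) : jac (polFst Prod.snd) (polSnd Prod.snd) p = Real.exp p.1 ^ 2 := by
  rw [jac_pol contDiff_snd, partialSnd_snd, mul_one]

/-- The energy of a homogeneous map on a sector is bounded below by the energy of its restriction
to the circle. -/
theorem SpecialQMap.IsGradientBound.lintegral_polar_le {Q n : ℕ} {g : ℝ → SpecialQPoint Q n}
    {s : ℝ → ℝ} {α : ℝ} (hsp : IsSpeedBound g s)
    (hlim : ∀ᵐ y, Tendsto (fun k => dist (g (y + k)) (g y) / |k|) (𝓝[≠] 0) (𝓝 (s y)))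
    (hsm : Measurable s) {u : EuclideanSpace ℝ (Fin 2) → SpecialQPoint Q n} (hum : Measurable u)
    (hu : ∀ p, u (polar p) = (g p.2).scale (Real.exp (α * p.1)))
    {a b c d : ℝ} (hab : a < b) (hcd : c < d) (hpi : d - c < 2 * Real.pi)
    {φ : Fin 2 → EuclideanSpace ℝ (Fin 2) → ℝ}
    (hφ : IsGradientBound u (polar '' (Ioo a b ×ˢ Ioo c d)) φ) :
    ∫⁻ p in Ioo a b ×ˢ Ioo c d, ENNReal.ofReal
      (Real.exp (2 * α * p.1) * (α ^ 2 * (g p.2).size ^ 2 + s p.2 ^ 2))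
      ≤ ∑ j, ∫⁻ x in polar '' (Ioo a b ×ˢ Ioo c d), ENNReal.ofReal (φ j x ^ 2) := by
  set R := Ioo a b ×ˢ Ioo c d with hR
  have hch := polarChart hab hcd hpi
  let T : Fin 2 → ℝ × ℝ → ℝ := fun j p => Real.exp (-p.1) * ![Real.cos p.2, Real.sin p.2] j
  let Y : Fin 2 → ℝ × ℝ → ℝ := fun j p => Real.exp (-p.1) * ![-Real.sin p.2, Real.cos p.2] j
  let B : Fin 2 → ℝ × ℝ → ℝ := fun j p => Real.exp (2 * α * p.1) *
    (α ^ 2 * T j p ^ 2 * (g p.2).size ^ 2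
      + α * T j p * Y j p * deriv (fun x => (g x).size ^ 2) p.2 + Y j p ^ 2 * s p.2 ^ 2)
  let A : Fin 2 → EuclideanSpace ℝ (Fin 2) → ℝ := fun j =>
    PlaneChart.push (polFst Prod.snd) (polSnd Prod.snd) a b c d (B j)
  have hne : (polar '' R)ᶜ.Nonempty :=
    ⟨0, fun ⟨p, _, hp⟩ => polar_ne_zero p hp⟩
  have hlim' : ∀ j, ∀ᵐ p ∂(volume : Measure (ℝ × ℝ)).restrict R,
      Tendsto (fun r : ℝ => dist (u (polar p + r • EuclideanSpace.single j 1)) (u (polar p)) ^ 2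
        / r ^ 2) (𝓝[≠] 0) (𝓝 (B j p)) := by
    intro j
    filter_upwards [ae_restrict_snd hlim R, ae_restrict_snd hsp.ae_hasDerivAt_size_sq R]
      with p hp1 hp2
    obtain ⟨t, y, ht0, hy0, ht, hy, hty⟩ := exists_polar_path p j
    have hμ : HasDerivAt (fun r => Real.exp (α * t r)) _ 0 := (ht.const_mul α).exp
    have key := SpecialQPoint.tendsto_dist_scale_div_sq (g := g) hμ
      (fun r => (Real.exp_pos _).le) hy (by rw [hy0]; exact hp2) (by rw [hy0]; exact hp1)
    have e : Real.exp (2 * α * p.1) = Real.exp (α * p.1) ^ 2 := by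
      rw [← Real.exp_nat_mul]
      congr 1
      push_cast
      ring
    have hB : B j p = Real.exp (α * t 0) * (α * T j p) * (Real.exp (α * t 0) * (α * T j p)
        * (g (y 0)).size ^ 2 + Real.exp (α * t 0) * (deriv (fun x => (g x).size ^ 2) p.2 * Y j p))
        + Real.exp (α * t 0) ^ 2 * (Y j p ^ 2 * s p.2 ^ 2) := by
      simp only [B, e, ht0, hy0]
      ring
    rw [hB]
    refine key.congr' ?_
    filter_upwards [hty.filter_mono nhdsWithin_le_nhds] with r hr
    rw [← hr, hu, hu, ht0, hy0]
  have h1 : ∀ j, ∫⁻ x in polar '' R, ENNReal.ofReal (A j x)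
      ≤ ∫⁻ x in polar '' R, ENNReal.ofReal (φ j x ^ 2) := by
    intro j
    refine hφ.lintegral_le hch.isOpen hch.isBounded hne hum j (hch.ae_image ?_)
    filter_upwards [hlim' j, ae_restrict_mem (PlaneChart.measurableSet_rect a b c d)] with p hp hpR
    simp only [A]
    rw [hch.push_planeMap _ hpR]
    exact hp
  refine le_trans ?_ (Finset.sum_le_sum fun j _ => h1 j)
  have h2 : ∀ j, ∫⁻ x in polar '' R, ENNReal.ofReal (A j x)
      = ∫⁻ p in R, ENNReal.ofReal (Real.exp p.1 ^ 2) * ENNReal.ofReal (B j p) := by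
    intro j
    rw [hch.lintegral_eq]
    refine setLIntegral_congr_fun (PlaneChart.measurableSet_rect a b c d) fun p hp => ?_
    simp only [A]
    rw [hch.push_planeMap _ hp, jac_polar]
  have hBm : ∀ j, Measurable (B j) := by
    intro j
    have hs1 := hsp.continuous_size
    have m1 : Measurable fun p : ℝ × ℝ => deriv (fun x => (g x).size ^ 2) p.2 :=
      (measurable_deriv _).comp measurable_snd
    have m2 : Measurable fun p : ℝ × ℝ => s p.2 := hsm.comp measurable_snd
    have m3 : Measurable (T j) := by
      fin_cases j <;> simp only [T, Fin.zero_eta, Fin.mk_one, Matrix.cons_val_zero,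
        Matrix.cons_val_one] <;> fun_prop
    have m4 : Measurable (Y j) := by
      fin_cases j <;> simp only [Y, Fin.zero_eta, Fin.mk_one, Matrix.cons_val_zero,
        Matrix.cons_val_one] <;> fun_prop
    have m5 : Measurable fun p : ℝ × ℝ => (g p.2).size := hs1.measurable.comp measurable_snd
    simp only [B]
    fun_prop
  have hm : Measurable fun p : ℝ × ℝ =>
      ENNReal.ofReal (Real.exp p.1 ^ 2) * ENNReal.ofReal (B 0 p) :=
    (by fun_prop : Measurable fun p : ℝ × ℝ => ENNReal.ofReal (Real.exp p.1 ^ 2)).mul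
      (hBm 0).ennreal_ofReal
  rw [Fin.sum_univ_two, h2, h2, ← lintegral_add_left hm]
  -- In the sum over `j` the mixed terms cancel, because the radial and angular directions are
  -- orthogonal. The squares add up to `exp (-2t)`, which the Jacobian compensates.
  refine lintegral_mono fun p => ?_
  simp only
  rw [← mul_add]
  refine le_trans ?_ (mul_le_mul_right ENNReal.ofReal_add_le _)
  rw [← ENNReal.ofReal_mul (by positivity)]
  refine ENNReal.ofReal_le_ofReal (le_of_eq ?_)
  have e1 : Real.exp p.1 * Real.exp (-p.1) = 1 := by rw [← Real.exp_add]; simp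
  have e2 := Real.sin_sq_add_cos_sq p.2
  simp only [B, T, Y, Matrix.cons_val_zero, Matrix.cons_val_one]
  generalize Real.exp p.1 = X at *
  generalize Real.exp (-p.1) = Z at *
  generalize Real.exp (2 * α * p.1) = E at *
  generalize (g p.2).size = h at *
  generalize deriv (fun x => (g x).size ^ 2) p.2 = D at *
  have e3 : X ^ 2 * Z ^ 2 = 1 := by rw [← mul_pow, e1, one_pow]
  linear_combination -(E * (α ^ 2 * h ^ 2 + s p.2 ^ 2)) * e3
    - (X ^ 2 * Z ^ 2 * E * (α ^ 2 * h ^ 2 + s p.2 ^ 2)) * e2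

/-! ### Null sets in polar coordinates -/

/-- A countable family of rectangles which covers the plane. -/
def coverRect (i : ℕ × ℤ) : Set (ℝ × ℝ) := Ioo (-(i.1 + 1 : ℝ)) (i.1 + 1) ×ˢ Ioo (i.2 : ℝ) (i.2 + 2)

theorem exists_int_Ioo (y : ℝ) : ∃ k : ℤ, y ∈ Ioo (k : ℝ) (k + 2) := by
  refine ⟨⌈y⌉ - 1, ?_, ?_⟩ <;> push_cast <;> linarith [Int.ceil_lt_add_one y, Int.le_ceil y]

theorem iUnion_coverRect : ⋃ i, coverRect i = univ := by
  refine eq_univ_of_forall fun p => mem_iUnion.2 ?_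
  obtain ⟨N, hN⟩ := exists_nat_gt |p.1|
  obtain ⟨k, hk⟩ := exists_int_Ioo p.2
  have := abs_lt.1 hN
  exact ⟨(N, k), ⟨by constructor <;> linarith, hk⟩⟩

theorem two_lt_two_pi (c : ℝ) : c + 2 - c < 2 * Real.pi := by
  linarith [Real.pi_gt_three]

theorem coverRect_chart (i : ℕ × ℤ) : PlaneChart (polFst Prod.snd) (polSnd Prod.snd)
    (-(i.1 + 1 : ℝ)) (i.1 + 1) i.2 (i.2 + 2) (polar '' coverRect i) :=
  polarChart (by linarith [(Nat.cast_nonneg i.1 : (0 : ℝ) ≤ i.1)]) (by linarith) (two_lt_two_pi _)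

theorem ae_polar {P : EuclideanSpace ℝ (Fin 2) → Prop} (h : ∀ᵐ x, P x) :
    ∀ᵐ p : ℝ × ℝ, P (polar p) := by
  have h1 := (ae_restrict_iUnion_iff (μ := (volume : Measure (ℝ × ℝ))) coverRect
    fun p => P (polar p)).2 fun i => (coverRect_chart i).ae_comp (ae_restrict_of_ae h)
  rwa [iUnion_coverRect, Measure.restrict_univ] at h1

theorem ae_of_ae_polar {P : EuclideanSpace ℝ (Fin 2) → Prop} (h : ∀ᵐ p : ℝ × ℝ, P (polar p)) :
    ∀ᵐ x, P x := by
  have h1 := (ae_restrict_iUnion_iff (μ := (volume : Measure (EuclideanSpace ℝ (Fin 2))))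
    (fun i => polar '' coverRect i) P).2
    fun i => (coverRect_chart i).ae_image (ae_restrict_of_ae h)
  rw [← image_iUnion, iUnion_coverRect, image_univ, ae_restrict_iff'
    (by simpa using (isOpenMap_polar _ isOpen_univ).measurableSet)] at h1
  have h2 : ∀ᵐ x : EuclideanSpace ℝ (Fin 2), x ≠ 0 := by
    rw [ae_iff]
    simp
  filter_upwards [h1, h2] with x hx hx0
  exact hx (exists_polar_eq hx0)

/-- The distances to a dense sequence define a continuous injection into `ℕ → ℝ`, and this is a
measurable embedding on a complete separable space. -/
theorem aemeasurable_of_forall_dist {E X : Type*} [MeasurableSpace E] {μ : Measure E}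
    [MetricSpace X] [CompleteSpace X] [SecondCountableTopology X] [Nonempty X]
    [MeasurableSpace X] [BorelSpace X] {u : E → X}
    (h : ∀ T, AEMeasurable (fun x => dist (u x) T) μ) : AEMeasurable u μ := by
  let F : X → ℕ → ℝ := fun x k => dist x (TopologicalSpace.denseSeq X k)
  have hFc : Continuous F := by
    refine continuous_pi fun k => ?_
    exact continuous_id.dist continuous_const
  have hFi : Function.Injective F := by
    intro x y hxy
    refine dist_le_zero.1 (dist_le_of_forall_denseRange
      (TopologicalSpace.denseRange_denseSeq X) fun k => ?_)
    rw [show dist x (TopologicalSpace.denseSeq X k) = dist y (TopologicalSpace.denseSeq X k) from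
      congrFun hxy k, sub_self, abs_zero]
  have hF := hFc.measurableEmbedding hFi
  exact hF.aemeasurable_comp_iff.1 (aemeasurable_pi_iff.2 fun k => h _)

theorem aemeasurable_of_forall_ball {E : Type*} [NormedAddCommGroup E] [MeasurableSpace E]
    {μ : Measure E} {f : E → ℝ}
    (h : ∀ k : ℕ, AEMeasurable f (μ.restrict (Metric.ball 0 (k + 1)))) : AEMeasurable f μ := by
  have h1 := (aemeasurable_iUnion_iff (s := fun k : ℕ => Metric.ball (0 : E) (k + 1))).2 h
  have h2 : ⋃ k : ℕ, Metric.ball (0 : E) (k + 1) = univ := by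
    refine eq_univ_of_forall fun x => mem_iUnion.2 ?_
    obtain ⟨k, hk⟩ := exists_nat_gt ‖x‖
    exact ⟨k, by simp only [mem_ball_zero_iff]; linarith⟩
  rwa [h2, Measure.restrict_univ] at h1

/-! ### Continuous representatives of curves -/

/-- A curve with an integrable speed bound at almost all pairs of points agrees almost everywhere
with a curve with that speed bound. -/
theorem exists_isSpeedBound {X : Type*} [MetricSpace X] [CompleteSpace X] {G : ℝ → X}
    {m : ℝ → ℝ} (hm : LocallyIntegrable m) (hm0 : ∀ x, 0 ≤ m x)
    (h : ∀ᵐ a, ∀ᵐ b, a ≤ b → dist (G b) (G a) ≤ ∫ x in a..b, m x) :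
    ∃ g, IsSpeedBound g m ∧ ∀ᵐ a, g a = G a := by
  let M : ℝ → ℝ := fun x => ∫ t in 0..x, m t
  have hmi : ∀ a b, IntervalIntegrable m volume a b := fun a b =>
    (hm.integrableOn_isCompact isCompact_uIcc).intervalIntegrable
  have hM : ∀ a b, ∫ x in a..b, m x = M b - M a := fun a b =>
    (intervalIntegral.integral_interval_sub_left (hmi _ _) (hmi _ _)).symm
  have hMc : Continuous M := intervalIntegral.continuous_primitive hmi 0
  have hMm : Monotone M := fun a b hab => by
    have := intervalIntegral.integral_nonneg (μ := volume) hab fun x _ => hm0 x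
    rw [hM] at this
    linarith
  set D := {a | ∀ᵐ b, a ≤ b → dist (G b) (G a) ≤ ∫ x in a..b, m x} with hD
  have hDd : Dense D := Measure.dense_of_ae h
  have hDD : ∀ a ∈ D, ∀ b ∈ D, dist (G a) (G b) ≤ |M a - M b| := by
    have key : ∀ a ∈ D, ∀ b ∈ D, a ≤ b → dist (G a) (G b) ≤ |M a - M b| := by
      intro a ha b hb hab
      have hab' := hMm hab
      rw [abs_sub_comm, abs_of_nonneg (sub_nonneg.2 hab')]
      refine le_of_forall_pos_le_add fun ε hε => ?_
      have h1 : ∀ᶠ x in 𝓝[>] b, M x < M b + ε / 2 :=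
        (hMc.tendsto b).mono_left nhdsWithin_le_nhds |>.eventually (gt_mem_nhds (by linarith))
      -- The hypothesis need not relate `a` and `b` directly. Almost every point is related to both,
      -- so the comparison passes through some `x` slightly to the right of `b`.
      have h2 : ∃ x, M x < M b + ε / 2 ∧ b < x ∧ (a ≤ x → dist (G x) (G a) ≤ ∫ t in a..x, m t) ∧
          (b ≤ x → dist (G x) (G b) ≤ ∫ t in b..x, m t) := by
        obtain ⟨e, he, hsub⟩ := (mem_nhdsGT_iff_exists_Ioo_subset).1 h1
        have ha' : ∀ᵐ x, a ≤ x → dist (G x) (G a) ≤ ∫ t in a..x, m t := ha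
        have hb' : ∀ᵐ x, b ≤ x → dist (G x) (G b) ≤ ∫ t in b..x, m t := hb
        have h3 : Dense {x | (a ≤ x → dist (G x) (G a) ≤ ∫ t in a..x, m t) ∧
          (b ≤ x → dist (G x) (G b) ≤ ∫ t in b..x, m t)} := Measure.dense_of_ae (ha'.and hb')
        obtain ⟨x, hx1, hx2⟩ := h3.exists_between he
        exact ⟨x, hsub hx2, hx2.1, hx1.1, hx1.2⟩
      obtain ⟨x, hx, hbx, hax, hbx'⟩ := h2
      have h4 := hax (hab.trans hbx.le)
      have h5 := hbx' hbx.le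
      rw [hM] at h4 h5
      have h6 := dist_triangle_left (G a) (G b) (G x)
      linarith
    intro a ha b hb
    rcases le_total a b with hab | hab
    · exact key a ha b hb hab
    · rw [dist_comm, abs_sub_comm]
      exact key b hb a ha hab
  have hlim : ∀ x, ∃ y, Tendsto G (𝓝[D] x) (𝓝 y) := by
    intro x
    have : (𝓝[D] x).NeBot := mem_closure_iff_nhdsWithin_neBot.1 (hDd x)
    refine cauchy_map_iff_exists_tendsto.1 ?_
    rw [Metric.cauchy_iff]
    refine ⟨inferInstance, fun ε hε => ?_⟩
    have h1 : ∀ᶠ y in 𝓝[D] x, |M y - M x| < ε / 2 := by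
      have := (Metric.tendsto_nhds.1 (hMc.tendsto x)) (ε / 2) (half_pos hε)
      exact nhdsWithin_le_nhds this
    have h2 : {y | |M y - M x| < ε / 2} ∩ D ∈ 𝓝[D] x := inter_mem h1 self_mem_nhdsWithin
    refine ⟨G '' _, image_mem_map h2, ?_⟩
    rintro _ ⟨y, ⟨hy, hyD⟩, rfl⟩ _ ⟨z, ⟨hz, hzD⟩, rfl⟩
    refine (hDD y hyD z hzD).trans_lt ?_
    have h3 : |M y - M x| < ε / 2 := hy
    have h4 : |M z - M x| < ε / 2 := hz
    rw [abs_lt] at *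
    constructor <;> linarith
  have hgc := continuous_extendFrom hDd hlim
  have hgD : ∀ a ∈ D, extendFrom D G a = G a := by
    intro a ha
    refine extendFrom_eq (subset_closure ha) ?_
    rw [tendsto_iff_dist_tendsto_zero]
    have h1 : Tendsto (fun x => |M x - M a|) (𝓝[D] a) (𝓝 0) := by
      have : Continuous fun x => |M x - M a| := (hMc.sub continuous_const).abs
      simpa using (this.tendsto a).mono_left (nhdsWithin_le_nhds (s := D))
    refine squeeze_zero' (Eventually.of_forall fun _ => dist_nonneg) ?_ h1
    filter_upwards [self_mem_nhdsWithin] with x hx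
    exact hDD x hx a ha
  refine ⟨extendFrom D G, ⟨hm, hm0, fun a b hab => ?_⟩, ?_⟩
  · have h1 : ∀ z : ℝ × ℝ, dist (extendFrom D G z.1) (extendFrom D G z.2) ≤ |M z.1 - M z.2| := by
      have hcl : IsClosed {z : ℝ × ℝ |
          dist (extendFrom D G z.1) (extendFrom D G z.2) ≤ |M z.1 - M z.2|} :=
        isClosed_le ((hgc.comp continuous_fst).dist (hgc.comp continuous_snd))
          ((hMc.comp continuous_fst).sub (hMc.comp continuous_snd)).abs
      have hsub : D ×ˢ D ⊆ {z : ℝ × ℝ |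
          dist (extendFrom D G z.1) (extendFrom D G z.2) ≤ |M z.1 - M z.2|} := by
        rintro ⟨x, y⟩ ⟨hx, hy⟩
        simp only [mem_ofPred_eq]
        rw [hgD x hx, hgD y hy]
        exact hDD x hx y hy
      intro z
      exact hcl.closure_subset_iff.2 hsub ((hDd.prod hDd) z)
    have h2 := h1 (a, b)
    rw [abs_sub_comm, abs_of_nonneg (sub_nonneg.2 (hMm hab))] at h2
    rw [hM]
    exact h2
  · filter_upwards [h] with a ha
    exact hgD a ha

/-! ### Rotations of the plane -/

/-- The rotation of the plane by the angle `s`. -/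
def planeRotation (s : ℝ) : EuclideanSpace ℝ (Fin 2) ≃ₗᵢ[ℝ] EuclideanSpace ℝ (Fin 2) :=
  (Complex.orthonormalBasisOneI.repr.symm.trans (rotation (Circle.exp s))).trans
    Complex.orthonormalBasisOneI.repr

theorem planeRotation_apply (s : ℝ) (x : EuclideanSpace ℝ (Fin 2)) :
    planeRotation s x = !₂[Real.cos s * x 0 - Real.sin s * x 1,
      Real.sin s * x 0 + Real.cos s * x 1] := by
  ext i
  fin_cases i <;>
  simp [planeRotation, rotation_apply, Circle.coe_exp, Complex.exp_ofReal_mul_I_re,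
    Complex.exp_ofReal_mul_I_im]
  ring

theorem planeRotation_eq (s : ℝ) (x : EuclideanSpace ℝ (Fin 2)) :
    planeRotation s x = (Real.cos s * x 0 - Real.sin s * x 1) • EuclideanSpace.single 0 1
      + (Real.sin s * x 0 + Real.cos s * x 1) • EuclideanSpace.single 1 1 := by
  rw [planeRotation_apply]
  ext i
  fin_cases i <;> simp

theorem planeRotation_polar (s : ℝ) (p : ℝ × ℝ) :
    planeRotation s (polar p) = polar (p.1, p.2 + s) := by
  rw [planeRotation_apply]
  ext i
  fin_cases i <;> simp [polar, Real.cos_add, Real.sin_add] <;> ring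

theorem isVolumeFlow_planeRotation : IsVolumeFlow (fun s x => planeRotation s x)
    fun x => (-x 1) • EuclideanSpace.single 0 1 + (x 0) • EuclideanSpace.single 1 1 where
  contDiff := by
    have h1 : ∀ i : Fin 2, ContDiff ℝ ∞ fun z : ℝ × EuclideanSpace ℝ (Fin 2) => z.2 i := fun i =>
      (EuclideanSpace.proj (𝕜 := ℝ) i).contDiff.comp contDiff_snd
    have h2 : ContDiff ℝ ∞ fun z : ℝ × EuclideanSpace ℝ (Fin 2) => Real.cos z.1 :=
      Real.contDiff_cos.comp contDiff_fst
    have h3 : ContDiff ℝ ∞ fun z : ℝ × EuclideanSpace ℝ (Fin 2) => Real.sin z.1 :=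
      Real.contDiff_sin.comp contDiff_fst
    have : Function.uncurry (fun s x => planeRotation s x) = fun z =>
      (Real.cos z.1 * z.2 0 - Real.sin z.1 * z.2 1) • EuclideanSpace.single 0 1
      + (Real.sin z.1 * z.2 0 + Real.cos z.1 * z.2 1) • EuclideanSpace.single 1 1 :=
      funext fun z => planeRotation_eq z.1 z.2
    rw [this]
    exact (((h2.mul (h1 0)).sub (h3.mul (h1 1))).smul contDiff_const).add
      (((h3.mul (h1 0)).add (h2.mul (h1 1))).smul contDiff_const)
  zero x := by
    ext i
    fin_cases i <;> simp [planeRotation_apply]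
  add s t x := by
    ext i
    fin_cases i <;> simp [planeRotation_apply, Real.cos_add, Real.sin_add] <;> ring
  mp s := (planeRotation s).measurePreserving
  hasDerivAt x := by
    have h1 := Real.hasDerivAt_cos 0
    have h2 := Real.hasDerivAt_sin 0
    simp only [planeRotation_eq]
    have := (((h1.mul_const (x 0)).sub (h2.mul_const (x 1))).smul_const
      (EuclideanSpace.single (0 : Fin 2) (1 : ℝ))).fun_add
      (((h2.mul_const (x 0)).add (h1.mul_const (x 1))).smul_const
      (EuclideanSpace.single (1 : Fin 2) (1 : ℝ)))
    simpa using this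

/-! ### Gradient bounds under null modifications, restriction and rotation -/

namespace SpecialQMap

variable {Q n m : ℕ} {u u' : EuclideanSpace ℝ (Fin m) → SpecialQPoint Q n}
  {Ω Ω' : Set (EuclideanSpace ℝ (Fin m))} {φ : Fin m → EuclideanSpace ℝ (Fin m) → ℝ}

theorem IsGradientBound.congr_ae (h : IsGradientBound u Ω φ) (hu : ∀ᵐ x, u x = u' x) :
    IsGradientBound u' Ω φ := by
  have hT : ∀ T, ∀ᵐ x, (u x).dist T = (u' x).dist T := fun T => by
    filter_upwards [hu] with x hx
    rw [hx]
  refine ⟨h.1, fun T => ⟨(h.2 T).1.ae_eq (ae_restrict_of_ae (hT T)), fun j => ?_⟩⟩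
  obtain ⟨q, ⟨hq1, hq2, hq3⟩, hq4⟩ := (h.2 T).2 j
  refine ⟨q, ⟨fun x hx => ?_, hq2, fun η h1 h2 h3 => ?_⟩, hq4⟩
  · obtain ⟨s, hs, hi⟩ := hq1 x hx
    exact ⟨s, hs, hi.congr (ae_restrict_of_ae (hT T))⟩
  · rw [← hq3 η h1 h2 h3]
    refine integral_congr_ae (ae_restrict_of_ae ?_)
    filter_upwards [hT T] with x hx
    rw [hx]

theorem IsGradientBound.mono (h : IsGradientBound u Ω φ) (hΩ : IsOpen Ω) (hΩ' : Ω' ⊆ Ω) :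
    IsGradientBound u Ω' φ := by
  refine ⟨fun j => (h.1 j).mono_measure (Measure.restrict_mono hΩ' le_rfl), fun T =>
    ⟨(h.2 T).1.mono_measure (Measure.restrict_mono hΩ' le_rfl), fun j => ?_⟩⟩
  obtain ⟨q, ⟨hq1, hq2, hq3⟩, hq4⟩ := (h.2 T).2 j
  refine ⟨q, ⟨hq1.mono_set hΩ', hq2.mono_set hΩ', fun η h1 h2 h3 => ?_⟩,
    ae_restrict_of_ae_restrict_of_subset hΩ' hq4⟩
  rw [← setIntegral_eq_of_subset_of_forall_sdiff_eq_zero hΩ.measurableSet hΩ',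
    ← setIntegral_eq_of_subset_of_forall_sdiff_eq_zero hΩ.measurableSet hΩ']
  · exact hq3 η h1 h2 (h3.trans hΩ')
  · intro x hx
    rw [image_eq_zero_of_notMem_tsupport fun hcon => hx.2 (h3 hcon), mul_zero]
  · intro x hx
    have : fderiv ℝ η x = 0 := by
      refine image_eq_zero_of_notMem_tsupport fun hcon => hx.2 (h3 ?_)
      exact tsupport_fderiv_subset ℝ hcon
    rw [this]
    simp

/-- A gradient bound controls the displacement along circles. -/
theorem IsGradientBound.exists_rotation_bound {u : EuclideanSpace ℝ (Fin 2) → SpecialQPoint Q n}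
    {φ : Fin 2 → EuclideanSpace ℝ (Fin 2) → ℝ} (h : IsGradientBound u (Metric.ball 0 1) φ) :
    ∃ ψ : EuclideanSpace ℝ (Fin 2) → ℝ≥0∞, Measurable ψ ∧ ∫⁻ x in Metric.ball 0 1, ψ x ≠ ⊤ ∧
      ∀ r, 0 ≤ r → ∀ᵐ x, x ∈ Metric.ball 0 1 →
        edist (u (planeRotation r x)) (u x) ≤ ∫⁻ s in Ioc 0 r, ψ (planeRotation s x) := by
  set B : Set (EuclideanSpace ℝ (Fin 2)) := Metric.ball 0 1 with hB
  have hBb : Bornology.IsBounded B := Metric.isBounded_ball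
  have hBo : IsOpen B := Metric.isOpen_ball
  have hφi := fun j => h.integrableOn_bound hBb j
  let φ' : Fin 2 → EuclideanSpace ℝ (Fin 2) → ℝ := fun j => (hφi j).aestronglyMeasurable.mk (φ j)
  have hφφ : ∀ j, φ j =ᵐ[volume.restrict B] φ' j := fun j => (hφi j).aestronglyMeasurable.ae_eq_mk
  have hφm : ∀ j, Measurable (φ' j) := fun j =>
    (hφi j).aestronglyMeasurable.stronglyMeasurable_mk.measurable
  refine ⟨fun x => ‖φ' 0 x‖ₑ + ‖φ' 1 x‖ₑ, (hφm 0).enorm.add (hφm 1).enorm, ?_, fun r hr => ?_⟩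
  · rw [lintegral_add_left (hφm 0).enorm]
    exact ENNReal.add_ne_top.2 ⟨((hφi 0).congr (hφφ 0)).2.ne, ((hφi 1).congr (hφφ 1)).2.ne⟩
  · refine isVolumeFlow_planeRotation.ae_edist_le hBo hBb hBo
      ((hφm 0).enorm.add (hφm 1).enorm) (fun T => h.integrableOn_dist hBb T) (fun T => ?_) hr ?_
    · obtain ⟨q0, hq0, hqφ0, hqw0⟩ := h.exists_weakPartial hBb T 0
      obtain ⟨q1, hq1, hqφ1, hqw1⟩ := h.exists_weakPartial hBb T 1
      have hcoord : ∀ (i : Fin 2) x, x ∈ B → |x i| ≤ 1 := fun i x hx =>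
        (PiLp.norm_apply_le x i).trans (mem_ball_zero_iff.1 hx).le
      have hci : ∀ i : Fin 2, ContDiff ℝ ∞ fun x : EuclideanSpace ℝ (Fin 2) => x i := fun i =>
        (EuclideanSpace.proj (𝕜 := ℝ) i).contDiff
      have hmul : ∀ (i : Fin 2) (q : EuclideanSpace ℝ (Fin 2) → ℝ), IntegrableOn q B →
          IntegrableOn (fun x => q x * x i) B := fun i q hq => by
        refine Integrable.mul_bdd (c := 1) hq (hci i).continuous.aestronglyMeasurable ?_
        filter_upwards [ae_restrict_mem hBo.measurableSet] with x hx
        exact hcoord i x hx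
      -- This is the weak derivative along the rotation field. The coefficients are absorbed in the
      -- test functions `x i * η x`; the extra terms of the product rule vanish, since each
      -- coordinate is constant in the direction concerned.
      refine ⟨fun x => q1 x * x 0 - q0 x * x 1, (hmul 0 q1 hq1).sub (hmul 1 q0 hq0), ?_, ?_⟩
      · filter_upwards [hqφ0, hqφ1, hφφ 0, hφφ 1, ae_restrict_mem hBo.measurableSet]
          with x h0 h1 h2 h3 hx
        refine (enorm_sub_le).trans ?_
        rw [add_comm, enorm_mul, enorm_mul]
        have e : ∀ i : Fin 2, ‖x i‖ₑ ≤ 1 := fun i => by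
          refine (enorm_le_iff_norm_le (y := (1 : ℝ)).2 ?_).trans_eq enorm_one
          rw [norm_one]
          exact hcoord i x hx
        refine add_le_add ((mul_le_of_le_one_right' (e 1)).trans ?_)
          ((mul_le_of_le_one_right' (e 0)).trans ?_)
        · rw [enorm_le_iff_norm_le, ← h2]
          exact h0.trans (le_abs_self _)
        · rw [enorm_le_iff_norm_le, ← h3]
          exact h1.trans (le_abs_self _)
      · intro η hη hηc hηB
        have hηi : ∀ i : Fin 2, ContDiff ℝ ∞ fun x => x i * η x := fun i => (hci i).mul hη
        have hηic : ∀ i : Fin 2, HasCompactSupport fun x => x i * η x := fun i =>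
          hηc.mul_left (f := fun x : EuclideanSpace ℝ (Fin 2) => x i)
        have hηiB : ∀ i : Fin 2, tsupport (fun x => x i * η x) ⊆ B := fun i =>
          (tsupport_mul_subset_right (f := fun x : EuclideanSpace ℝ (Fin 2) => x i)).trans hηB
        have w0 := hqw0 _ (hηi 1) (hηic 1) (hηiB 1)
        have w1 := hqw1 _ (hηi 0) (hηic 0) (hηiB 0)
        have hfd : ∀ (i : Fin 2) x v, fderiv ℝ (fun x : EuclideanSpace ℝ (Fin 2) => x i * η x) x v
            = x i * fderiv ℝ η x v + η x * v i := by
          intro i x v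
          have h1 : HasFDerivAt (fun x : EuclideanSpace ℝ (Fin 2) => x i)
              (EuclideanSpace.proj (𝕜 := ℝ) i) x := (EuclideanSpace.proj (𝕜 := ℝ) i).hasFDerivAt
          have h2 := h1.fun_mul ((hη.differentiable (by simp)) x).hasFDerivAt
          rw [HasFDerivAt.fderiv h2]
          simp
        simp only [hfd] at w0 w1
        simp only [PiLp.single_apply, zero_ne_one, one_ne_zero, if_false, mul_zero,
          add_zero] at w0 w1
        have hbd : ∀ κ : EuclideanSpace ℝ (Fin 2) → ℝ, Continuous κ → HasCompactSupport κ →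
            ∀ f, IntegrableOn f B → IntegrableOn (fun x => f x * κ x) B := by
          intro κ hκ hκc f hf
          obtain ⟨C, hC⟩ := hκc.exists_bound_of_continuous hκ
          exact Integrable.mul_bdd (c := C) hf hκ.aestronglyMeasurable
            (Eventually.of_forall hC)
        have hdc : ∀ i j : Fin 2, IntegrableOn (fun x => dist (u x) T *
            (x i * fderiv ℝ η x (EuclideanSpace.single j 1))) B := fun i j => by
          refine hbd _ ((hci i).continuous.mul ((hη.continuous_fderiv (by simp)).clm_apply
            continuous_const)) (HasCompactSupport.mul_left ?_) _ (h.integrableOn_dist hBb T)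
          exact hηc.fderiv_apply ℝ _
        have e1 : ∫ x in B, dist (u x) T * fderiv ℝ η x
            ((-x 1) • EuclideanSpace.single 0 1 + (x 0) • EuclideanSpace.single 1 1)
            = (∫ x in B, dist (u x) T * (x 0 * fderiv ℝ η x (EuclideanSpace.single 1 1)))
              - ∫ x in B, dist (u x) T * (x 1 * fderiv ℝ η x (EuclideanSpace.single 0 1)) := by
          rw [← integral_sub (hdc 0 1) (hdc 1 0)]
          refine integral_congr_ae (Eventually.of_forall fun x => ?_)
          simp only [map_add, map_smul, smul_eq_mul]
          ring
        have e2 : ∫ x in B, (q1 x * x 0 - q0 x * x 1) * η x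
            = (∫ x in B, q1 x * (x 0 * η x)) - ∫ x in B, q0 x * (x 1 * η x) := by
          rw [← integral_sub (hbd _ (hηi 0).continuous (hηic 0) _ hq1)
            (hbd _ (hηi 1).continuous (hηic 1) _ hq0)]
          refine integral_congr_ae (Eventually.of_forall fun x => ?_)
          simp only
          ring
        rw [e1, e2, w0, w1]
        ring
    · intro s hs x hx
      rw [hB, mem_ball_zero_iff, LinearIsometryEquiv.norm_map]
      exact mem_ball_zero_iff.1 hx

end SpecialQMap

/-! ### The homogeneous map as a periodic curve -/

namespace SpecialQMap

variable {Q n : ℕ}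

theorem continuous_scale_exp (α : ℝ) : Continuous fun z : ℝ × SpecialQPoint Q n =>
    z.2.scale (Real.exp (α * z.1)) :=
  SpecialQPoint.continuous_scale_comp continuous_snd (by fun_prop) fun _ => (Real.exp_pos _).le

theorem exp_smul_polar (τ : ℝ) (p : ℝ × ℝ) : Real.exp τ • polar p = polar (p.1 + τ, p.2) := by
  ext i
  fin_cases i <;> simp [polar, Real.exp_add] <;> ring

theorem aemeasurable_of_memW12 {u : EuclideanSpace ℝ (Fin 2) → SpecialQPoint Q n}
    (hu : ∀ k : ℕ, MemW12 u (Metric.ball 0 (k + 1))) : AEMeasurable u :=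
  aemeasurable_of_forall_dist fun T => aemeasurable_of_forall_ball fun k => by
    obtain ⟨φ, hφ⟩ := hu k
    exact (hφ.2 T).1.aestronglyMeasurable.aemeasurable

/-- A homogeneous Sobolev map is determined by a Sobolev curve on the circle. -/
theorem exists_polar_slice {u : EuclideanSpace ℝ (Fin 2) → SpecialQPoint Q n} {α : ℝ}
    (hu : ∀ k : ℕ, MemW12 u (Metric.ball 0 (k + 1))) (hhom : IsRadiallyHomogeneous u α) :
    ∃ (g : ℝ → SpecialQPoint Q n) (m : ℝ → ℝ), IsSpeedBound g m ∧
      (∀ θ, g (θ + 2 * Real.pi) = g θ) ∧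
      ∀ᵐ p : ℝ × ℝ, u (polar p) = (g p.2).scale (Real.exp (α * p.1)) := by
  have hmeas := aemeasurable_of_memW12 hu
  set u' := hmeas.mk u with hu'def
  have huu : ∀ᵐ x, u x = u' x := hmeas.ae_eq_mk
  have hu'm : Measurable u' := hmeas.measurable_mk
  let U : ℝ × ℝ → SpecialQPoint Q n := fun p => u' (polar p)
  have hUm : Measurable U := hu'm.comp continuous_polar.measurable
  have hUu : ∀ᵐ p : ℝ × ℝ, u (polar p) = U p := ae_polar huu
  have hhomU : ∀ τ, ∀ᵐ p : ℝ × ℝ, U (p.1 + τ, p.2) = (U p).scale (Real.exp (α * τ)) := by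
    intro τ
    have hsh := (measurePreserving_add_right (volume : Measure (ℝ × ℝ))
      (τ, 0)).quasiMeasurePreserving.ae hUu
    filter_upwards [hUu, hsh, ae_polar (hhom (Real.exp τ) (Real.exp_pos τ))] with p h1 h2 h3
    rw [exp_smul_polar, ← Real.exp_mul, mul_comm τ, h1] at h3
    simp only [add_zero, Prod.add_def] at h2
    rw [← h2, h3]
  -- Homogeneity holds for each ratio outside a null set that depends on the ratio. Fubini, for a
  -- measurable representative, turns this into a statement along almost every ray for almost every
  -- ratio.
  have hA : ∀ᵐ t, ∀ᵐ θ, ∀ᵐ τ, U (t + τ, θ) = (U (t, θ)).scale (Real.exp (α * τ)) := by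
    have h1 : MeasurableSet {z : ℝ × (ℝ × ℝ) |
        U (z.2.1 + z.1, z.2.2) = (U z.2).scale (Real.exp (α * z.1))} := by
      refine measurableSet_eq_fun (hUm.comp (by fun_prop)) ?_
      exact (continuous_scale_exp α).measurable.comp
        (measurable_fst.prodMk (hUm.comp measurable_snd))
    have h2 := (Measure.ae_ae_comm (μ := (volume : Measure ℝ)) (ν := (volume : Measure (ℝ × ℝ)))
      (p := fun τ p => U (p.1 + τ, p.2) = (U p).scale (Real.exp (α * τ))) h1).1
      (Eventually.of_forall hhomU)
    exact Measure.ae_ae_of_ae_prod h2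
  obtain ⟨φ, hφ⟩ := hu 0
  simp only [Nat.cast_zero, zero_add] at hφ
  obtain ⟨ψ, hψm, hψi, hψ⟩ := (hφ.congr_ae huu).exists_rotation_bound
  let Ψ : ℝ × ℝ → ℝ≥0∞ := fun p => ψ (polar p)
  have hΨm : Measurable Ψ := hψm.comp continuous_polar.measurable
  have hball : ∀ p : ℝ × ℝ, p.1 < 0 → polar p ∈ Metric.ball (0 : EuclideanSpace ℝ (Fin 2)) 1 := by
    intro p hp
    rw [mem_ball_zero_iff, norm_polar]
    exact Real.exp_lt_one_iff.2 hp
  have hB : ∀ᵐ t, ∀ᵐ θ, ∀ᵐ r, 0 ≤ r → t < 0 →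
      edist (U (t, θ + r)) (U (t, θ)) ≤ ∫⁻ s in Ioc 0 r, Ψ (t, θ + s) := by
    have hL : Measurable fun z : ℝ × (ℝ × ℝ) => ∫⁻ s in Ioc 0 z.1, Ψ (z.2.1, z.2.2 + s) := by
      have h1 : Measurable fun w : (ℝ × (ℝ × ℝ)) × ℝ =>
          {w : (ℝ × (ℝ × ℝ)) × ℝ | w.2 ∈ Ioc 0 w.1.1}.indicator
            (fun w => Ψ (w.1.2.1, w.1.2.2 + w.2)) w := by
        refine (hΨm.comp (by fun_prop)).indicator ?_
        exact (measurableSet_lt measurable_const measurable_snd).inter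
          (measurableSet_le measurable_snd (by fun_prop))
      have h2 := h1.lintegral_prod_right' (ν := (volume : Measure ℝ))
      refine (congrArg Measurable (funext fun z => ?_)).mp h2
      rw [← lintegral_indicator measurableSet_Ioc]
      rfl
    have h1 : MeasurableSet {z : ℝ × (ℝ × ℝ) | 0 ≤ z.1 → z.2.1 < 0 →
        edist (U (z.2.1, z.2.2 + z.1)) (U z.2) ≤ ∫⁻ s in Ioc 0 z.1, Ψ (z.2.1, z.2.2 + s)} := by
      refine measurableSet_setOfPred.2 (Measurable.imp ?_ (Measurable.imp ?_ ?_))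
      · exact measurableSet_setOfPred.1 (measurableSet_le measurable_const measurable_fst)
      · exact measurableSet_setOfPred.1 (measurableSet_lt (by fun_prop) measurable_const)
      · exact measurableSet_setOfPred.1 (measurableSet_le
          ((hUm.comp (by fun_prop)).edist (hUm.comp measurable_snd)) hL)
    have h2 : ∀ r : ℝ, ∀ᵐ p : ℝ × ℝ, 0 ≤ r → p.1 < 0 →
        edist (U (p.1, p.2 + r)) (U p) ≤ ∫⁻ s in Ioc 0 r, Ψ (p.1, p.2 + s) := by
      intro r
      by_cases hr : 0 ≤ r
      · filter_upwards [ae_polar (hψ r hr)] with p hp _ hp0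
        have := hp (hball p hp0)
        simpa only [planeRotation_polar] using this
      · exact Eventually.of_forall fun p h => absurd h hr
    have h3 := (Measure.ae_ae_comm (μ := (volume : Measure ℝ)) (ν := (volume : Measure (ℝ × ℝ)))
      (p := fun r p => 0 ≤ r → p.1 < 0 →
        edist (U (p.1, p.2 + r)) (U p) ≤ ∫⁻ s in Ioc 0 r, Ψ (p.1, p.2 + s)) h1).1
      (Eventually.of_forall h2)
    exact Measure.ae_ae_of_ae_prod h3
  -- The bound is integrable over the unit disk, hence over arcs of almost every circle inside it.
  -- Windows of length 2 keep the polar chart injective.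
  have hC : ∀ k : ℤ, ∀ᵐ t, t ∈ Ioo (-1 : ℝ) 0 → ∫⁻ θ in Ioo (k : ℝ) (k + 2), Ψ (t, θ) ≠ ⊤ := by
    intro k
    have hch := polarChart (a := -1) (b := 0) (c := k) (d := k + 2) (by norm_num) (by linarith)
      (two_lt_two_pi _)
    have h1 : ∫⁻ x in polar '' (Ioo (-1 : ℝ) 0 ×ˢ Ioo (k : ℝ) (k + 2)), ψ x ≠ ⊤ := by
      refine ne_top_of_le_ne_top hψi (lintegral_mono_set ?_)
      rintro _ ⟨p, hp, rfl⟩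
      exact hball p hp.1.2
    rw [hch.lintegral_eq, Measure.volume_eq_prod, ← Measure.prod_restrict, lintegral_prod] at h1
    · have h2 : ∀ t : ℝ, ∫⁻ θ in Ioo (k : ℝ) (k + 2), ENNReal.ofReal (jac (polFst Prod.snd)
          (polSnd Prod.snd) (t, θ)) * ψ (planeMap (polFst Prod.snd) (polSnd Prod.snd) (t, θ))
          = ENNReal.ofReal (Real.exp t ^ 2) * ∫⁻ θ in Ioo (k : ℝ) (k + 2), Ψ (t, θ) := by
        intro t
        simp only [jac_polar]
        rw [lintegral_const_mul']
        · rfl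
        · finiteness
      simp only [h2] at h1
      have h3 := ae_lt_top (by
        have : Measurable fun t => ∫⁻ θ in Ioo (k : ℝ) (k + 2), Ψ (t, θ) :=
          hΨm.lintegral_prod_right'
        fun_prop) h1
      rw [ae_restrict_iff' measurableSet_Ioo] at h3
      filter_upwards [h3] with t ht htI hcon
      have h4 := ht htI
      rw [hcon, ENNReal.mul_top] at h4
      · exact lt_irrefl _ h4
      · have := Real.exp_pos t
        positivity
    · simp only [jac_polar]
      exact ((by fun_prop : Measurable fun p : ℝ × ℝ => ENNReal.ofReal (Real.exp p.1 ^ 2)).mul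
        hΨm).aemeasurable
  -- One circle on which all the exceptional sets are negligible; `t0 < 0` places it inside the unit
  -- disk. Scaling by `exp (-(α t0))` below normalizes its trace to radius one.
  obtain ⟨t0, ht0, ht0I⟩ := (Measure.dense_of_ae (hA.and (hB.and (ae_all_iff.2 hC)))).exists_between
    (by norm_num : (-1 : ℝ) < 0)
  obtain ⟨hA0, hB0, hC0⟩ := ht0
  let G : ℝ → SpecialQPoint Q n := fun θ => (U (t0, θ)).scale (Real.exp (-(α * t0)))
  let m : ℝ → ℝ := fun x => Real.exp (-(α * t0)) * (Ψ (t0, x)).toReal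
  have hΨ0 : Measurable fun x => Ψ (t0, x) := hΨm.comp measurable_prodMk_left
  have hmI : LocallyIntegrable fun x => (Ψ (t0, x)).toReal := by
    intro x
    obtain ⟨k, hk⟩ := exists_int_Ioo x
    exact ⟨_, Ioo_mem_nhds hk.1 hk.2,
      integrable_toReal_of_lintegral_ne_top hΨ0.aemeasurable (hC0 k ht0I)⟩
  have hΨfin : ∀ᵐ x, Ψ (t0, x) < ⊤ := by
    have h1 : ∀ k : ℤ, ∀ᵐ x ∂volume.restrict (Ioo (k : ℝ) (k + 2)), Ψ (t0, x) < ⊤ := fun k =>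
      ae_lt_top hΨ0 (hC0 k ht0I)
    have h2 := (ae_restrict_iUnion_iff _ _).2 h1
    have h3 : ⋃ k : ℤ, Ioo (k : ℝ) (k + 2) = univ :=
      eq_univ_of_forall fun x => mem_iUnion.2 (exists_int_Ioo x)
    rwa [h3, Measure.restrict_univ] at h2
  have hmloc : LocallyIntegrable m := hmI.smul (Real.exp (-(α * t0)))
  have hm0 : ∀ x, 0 ≤ m x := fun x => mul_nonneg (Real.exp_pos _).le ENNReal.toReal_nonneg
  have hG : ∀ᵐ a, ∀ᵐ b, a ≤ b → dist (G b) (G a) ≤ ∫ x in a..b, m x := by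
    filter_upwards [hB0] with θ hθ
    have h1 := (measurePreserving_sub_right volume θ).quasiMeasurePreserving.ae hθ
    filter_upwards [h1] with θ' h2 hle
    have h3 := h2 (sub_nonneg.2 hle) ht0I.2
    have h4 : ∫⁻ s in Ioc 0 (θ' - θ), Ψ (t0, θ + s) = ∫⁻ x in Ioc θ θ', Ψ (t0, x) := by
      rw [← (measurePreserving_add_left volume θ).setLIntegral_comp_preimage measurableSet_Ioc hΨ0,
        preimage_const_add_Ioc, sub_self]
    have h5 : ∫ x in θ..θ', m x
        = Real.exp (-(α * t0)) * (∫⁻ x in Ioc θ θ', Ψ (t0, x)).toReal := by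
      rw [intervalIntegral.integral_const_mul, intervalIntegral.integral_of_le hle,
        integral_toReal hΨ0.aemeasurable (ae_restrict_of_ae hΨfin)]
    have h6 : ∫⁻ x in Ioc θ θ', Ψ (t0, x) ≠ ⊤ := by
      have h7 : IntegrableOn (fun x => (Ψ (t0, x)).toReal) (Icc θ θ') :=
        hmI.integrableOn_isCompact isCompact_Icc
      have h8 := (h7.mono_set Ioc_subset_Icc_self).2
      have h9 : ∫⁻ x in Ioc θ θ', Ψ (t0, x) = ∫⁻ x in Ioc θ θ', ‖(Ψ (t0, x)).toReal‖ₑ := by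
        refine lintegral_congr_ae (ae_restrict_of_ae ?_)
        filter_upwards [hΨfin] with x hx
        rw [Real.enorm_of_nonneg ENNReal.toReal_nonneg, ENNReal.ofReal_toReal hx.ne]
      rw [h9]
      exact h8.ne
    rw [h4, add_sub_cancel] at h3
    rw [SpecialQPoint.dist_scale_self _ _ (Real.exp_pos _).le, h5]
    refine mul_le_mul_of_nonneg_left ?_ (Real.exp_pos _).le
    rw [dist_edist]
    exact ENNReal.toReal_mono h6 h3
  obtain ⟨g, hg, hgG⟩ := exists_isSpeedBound hmloc hm0 hG
  refine ⟨g, m, hg, fun θ => ?_, ?_⟩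
  -- The trace `G` is periodic by construction. Its continuous modification inherits this, since
  -- continuous functions that agree almost everywhere agree.
  · have hGper : ∀ θ, G (θ + 2 * Real.pi) = G θ := fun θ => by
      have : polar (t0, θ + 2 * Real.pi) = polar (t0, θ) :=
        polar_eq_polar_iff.2 ⟨rfl, 1, by simp⟩
      simp only [G, U, this]
    have h1 := (measurePreserving_add_right volume (2 * Real.pi)).quasiMeasurePreserving.ae hgG
    have h2 : (fun θ => g (θ + 2 * Real.pi)) =ᵐ[volume] g := by
      filter_upwards [h1, hgG] with x hx1 hx2
      rw [hx1, hx2, hGper]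
    exact congrFun ((hg.continuous.comp (continuous_add_const _)).ae_eq_iff_eq volume
      hg.continuous |>.1 h2) θ
  · have h1 : ∀ᵐ θ, ∀ᵐ t, U (t, θ) = (G θ).scale (Real.exp (α * t)) := by
      filter_upwards [hA0] with θ hθ
      have h2 := (measurePreserving_sub_right volume t0).quasiMeasurePreserving.ae hθ
      filter_upwards [h2] with t ht
      simp only [G]
      rw [add_sub_cancel] at ht
      rw [ht, SpecialQPoint.scale_scale, ← Real.exp_add]
      congr 2
      ring
    have h2 : MeasurableSet {z : ℝ × ℝ | U (z.2, z.1) = (G z.1).scale (Real.exp (α * z.2))} := by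
      have hGm : Measurable G := by
        have h3 := (continuous_scale_exp (Q := Q) (n := n) (-α)).measurable.comp
          ((measurable_const (a := t0)).prodMk (hUm.comp (measurable_prodMk_left (x := t0))))
        have h4 : G = (fun z : ℝ × SpecialQPoint Q n => z.2.scale (Real.exp (-α * z.1))) ∘
            fun a => (t0, (U ∘ Prod.mk t0) a) := by
          funext θ
          simp [G]
        rwa [h4]
      refine measurableSet_eq_fun (hUm.comp (by fun_prop)) ?_
      exact (continuous_scale_exp α).measurable.comp
        (measurable_snd.prodMk (hGm.comp measurable_fst))
    have h3 : ∀ᵐ z : ℝ × ℝ, U (z.2, z.1) = (G z.1).scale (Real.exp (α * z.2)) := by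
      rw [Measure.volume_eq_prod]
      exact (Measure.ae_prod_iff_ae_ae h2).2 h1
    have h4 : ∀ᵐ p : ℝ × ℝ, U p = (G p.2).scale (Real.exp (α * p.1)) :=
      (Measure.measurePreserving_swap (μ := (volume : Measure ℝ))
        (ν := (volume : Measure ℝ))).quasiMeasurePreserving.ae h3
    filter_upwards [h4, hUu, Measure.quasiMeasurePreserving_snd.ae hgG] with p hp1 hp2 hp3
    rw [hp2, hp1, hp3]

end SpecialQMap

/-! ### Barycenters and the continuous representative -/

namespace SpecialQPoint

variable {Q n : ℕ}

/-- For equal signs the difference of the two sides is at least the square of the difference of the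
centered sizes; for opposite signs it is the sum of their squares. -/
theorem norm_center_sub_le (A B : SpecialQPoint Q n) :
    (Q : ℝ) * ‖A.center - B.center‖ ^ 2 ≤ Dist.dist A B ^ 2 := by
  obtain ⟨S, ε, rfl⟩ := exists_mk A
  obtain ⟨T, δ, rfl⟩ := exists_mk B
  rw [← dist_eq]
  by_cases h : ε = δ
  · subst h
    rw [dist_mk_self]
    have h1 := dist_sq_sub S T
    have h2 := (abs_le.1 (QPoint.abs_pairing_sub_le S T)).2
    simp only [center_mk]
    nlinarith [sq_nonneg ((S.translate S.center).size - (T.translate T.center).size)]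
  · rw [dist_mk_of_ne S T h, oppDist, Real.sq_sqrt (by positivity)]
    simp only [center_mk]
    nlinarith [sq_nonneg (S.translate S.center).size, sq_nonneg (T.translate T.center).size]

theorem isClosed_center_eq_zero : IsClosed {A : SpecialQPoint Q n | A.center = 0} := by
  rcases Nat.eq_zero_or_pos Q with rfl | hQ
  · have : ∀ A : SpecialQPoint 0 n, A.center = 0 := fun A => by
      simp [center, QPoint.center]
    simp [this]
  · have hc : Continuous (center : SpecialQPoint Q n → _) := by
      rw [continuous_iff_continuousAt]
      intro A
      rw [ContinuousAt, tendsto_iff_norm_sub_tendsto_zero]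
      have h1 : Tendsto (fun B : SpecialQPoint Q n => Dist.dist B A) (𝓝 A) (𝓝 0) := by
        simpa using (continuous_id.dist (continuous_const (y := A))).tendsto A
      refine squeeze_zero (fun _ => norm_nonneg _) (fun B => ?_) h1
      have h2 := norm_center_sub_le B A
      have h3 : (1 : ℝ) ≤ Q := by exact_mod_cast hQ
      refine abs_le_of_sq_le_sq' (a := ‖B.center - A.center‖) ?_ _root_.dist_nonneg |>.2
      nlinarith [sq_nonneg ‖B.center - A.center‖]
    exact isClosed_eq hc continuous_const

theorem scale_origin (c : ℝ) : (origin Q n).scale c = origin Q n := by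
  rw [origin, scale_mk, ← QPoint.ofTuple_const, QPoint.scale_ofTuple]
  simp

theorem scale_zero (A : SpecialQPoint Q n) : A.scale 0 = origin Q n := by
  rw [← size_eq_zero_iff, size_scale _ le_rfl, zero_mul]

end SpecialQPoint

namespace SpecialQMap

theorem energy_congr {Q n m : ℕ} {u u' : EuclideanSpace ℝ (Fin m) → SpecialQPoint Q n}
    (h : ∀ᵐ x, u x = u' x) (Ω : Set (EuclideanSpace ℝ (Fin m))) : energy u Ω = energy u' Ω := by
  have h' : ∀ᵐ x, u' x = u x := h.mono fun x hx => hx.symm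
  have : ∀ φ, IsGradientBound u Ω φ ↔ IsGradientBound u' Ω φ := fun φ =>
    ⟨fun hφ => hφ.congr_ae h, fun hφ => hφ.congr_ae h'⟩
  simp only [energy, this]

theorem IsDirMinimizer.congr_ae {Q n m : ℕ}
    {u u' : EuclideanSpace ℝ (Fin m) → SpecialQPoint Q n} (hu : IsDirMinimizer u)
    (h : ∀ᵐ x, u x = u' x) : IsDirMinimizer u' := by
  intro Ω hΩ hb
  obtain ⟨⟨φ, hφ⟩, h2⟩ := hu Ω hΩ hb
  refine ⟨⟨φ, hφ.congr_ae h⟩, fun w hw ⟨K, hK, hKΩ, hwK⟩ => ?_⟩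
  rw [← energy_congr h]
  refine h2 w hw ⟨K, hK, hKΩ, ?_⟩
  filter_upwards [hwK, h] with x h1 h3 h4
  rw [h1 h4, h3]

/-- The homogeneous extension of a curve. -/
def polarExtension {Q n : ℕ} (α : ℝ) (g : ℝ → SpecialQPoint Q n) (x : EuclideanSpace ℝ (Fin 2)) :
    SpecialQPoint Q n :=
  (g (Complex.arg (Complex.orthonormalBasisOneI.repr.symm x))).scale (‖x‖ ^ α)

section PolarExtension

variable {Q n : ℕ} {α : ℝ} {g : ℝ → SpecialQPoint Q n}

/-- The branch of the argument in `polarExtension` does not matter, because `g` is periodic. -/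
theorem polarExtension_polar (hper : ∀ θ, g (θ + 2 * Real.pi) = g θ) (p : ℝ × ℝ) :
    polarExtension α g (polar p) = (g p.2).scale (Real.exp (α * p.1)) := by
  have hper' : Function.Periodic g (2 * Real.pi) := hper
  rw [polarExtension, norm_polar, ← Real.exp_mul, mul_comm p.1, polar_eq_exp,
    LinearIsometryEquiv.symm_apply_apply, Complex.arg_exp, toIocMod]
  congr 1
  rw [hper'.sub_zsmul_eq]
  simp

theorem continuousAt_of_comp_polar {X : Type*} [TopologicalSpace X]
    {v : EuclideanSpace ℝ (Fin 2) → X} {p : ℝ × ℝ} (h : ContinuousAt (fun p => v (polar p)) p) :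
    ContinuousAt v (polar p) :=
  (tendsto_map'_iff.2 h).mono_left (isOpenMap_polar.nhds_le p)

theorem continuousAt_polarExtension (hper : ∀ θ, g (θ + 2 * Real.pi) = g θ) (hg : Continuous g)
    {x : EuclideanSpace ℝ (Fin 2)} (hx : x ≠ 0) : ContinuousAt (polarExtension α g) x := by
  obtain ⟨p, rfl⟩ := exists_polar_eq hx
  refine continuousAt_of_comp_polar ?_
  simp only [polarExtension_polar hper]
  exact ((continuous_scale_exp α).comp
    (continuous_fst.prodMk (hg.comp continuous_snd))).continuousAt

theorem measurable_polarExtension (hper : ∀ θ, g (θ + 2 * Real.pi) = g θ) (hg : Continuous g) :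
    Measurable (polarExtension α g) :=
  measurable_of_continuousOn_compl_singleton 0 fun _ hx =>
    (continuousAt_polarExtension hper hg hx).continuousWithinAt

theorem continuous_polarExtension (hα : 0 < α) (hper : ∀ θ, g (θ + 2 * Real.pi) = g θ)
    (hg : Continuous g) : Continuous (polarExtension α g) := by
  rw [continuous_iff_continuousAt]
  intro x
  rcases eq_or_ne x 0 with rfl | hx
  · obtain ⟨N, hN⟩ := (isCompact_Icc (a := -Real.pi) (b := Real.pi)).exists_bound_of_continuousOn
      (SpecialQPoint.continuous_size.comp hg).continuousOn
    have h0 : polarExtension α g 0 = SpecialQPoint.origin Q n := by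
      rw [polarExtension, norm_zero, Real.zero_rpow hα.ne', SpecialQPoint.scale_zero]
    rw [ContinuousAt, h0, tendsto_iff_dist_tendsto_zero]
    have h1 : Tendsto (fun x : EuclideanSpace ℝ (Fin 2) => ‖x‖ ^ α * N) (𝓝 0) (𝓝 0) := by
      have h2 : Continuous fun x : EuclideanSpace ℝ (Fin 2) => ‖x‖ ^ α * N :=
        (continuous_norm.rpow_const fun _ => Or.inr hα.le).mul continuous_const
      simpa [Real.zero_rpow hα.ne'] using h2.tendsto 0
    refine squeeze_zero (fun _ => dist_nonneg) (fun x => ?_) h1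
    rw [SpecialQPoint.dist_origin, polarExtension, SpecialQPoint.size_scale _ (by positivity)]
    refine mul_le_mul_of_nonneg_left ?_ (by positivity)
    exact (le_abs_self _).trans (hN _ ⟨(Complex.neg_pi_lt_arg _).le, Complex.arg_le_pi _⟩)
  · exact continuousAt_polarExtension hper hg hx

end PolarExtension

theorem ae_of_forall_Ioo {P : ℝ → Prop}
    (h : ∀ k : ℤ, ∀ᵐ x ∂volume.restrict (Ioo (k : ℝ) (k + 2)), P x) : ∀ᵐ x, P x := by
  have h2 := (ae_restrict_iUnion_iff (μ := volume) (fun k : ℤ => Ioo (k : ℝ) (k + 2)) P).2 h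
  have h3 : ⋃ k : ℤ, Ioo (k : ℝ) (k + 2) = univ :=
    eq_univ_of_forall fun x => mem_iUnion.2 (exists_int_Ioo x)
  rwa [h3, Measure.restrict_univ] at h2

/-- The energy in the unit disk bounds the integral of `exp (2αt)` over `t < 0` times that of `α²
|g|² + s²`. The first factor diverges if `α ≤ 0`, so the second vanishes: for `α < 0` the map is
then trivial, and for `α = 0` the curve has speed zero and the map is constant. For `α > 0` the
bound gives `s ∈ L²_loc`, and the factor `‖x‖ ^ α` gives continuity at the origin. -/
theorem exists_representative {Q n : ℕ} {u : EuclideanSpace ℝ (Fin 2) → SpecialQPoint Q n} {α : ℝ}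
    (hmin : IsDirMinimizer u) (hhom : IsRadiallyHomogeneous u α)
    (hne : ¬ ∀ᵐ x, u x = SpecialQPoint.origin Q n) :
    ∃ v, (∀ᵐ x, v x = u x) ∧ Continuous v ∧ IsDirMinimizer v ∧
      ((∃ A, ∀ x, v x = A) ∨ (0 < α ∧ v 0 = SpecialQPoint.origin Q n ∧ ∃ g s, IsPolarCurve g s ∧
        (∀ θ, g (θ + 2 * Real.pi) = g θ) ∧
        ∀ p, v (polar p) = (g p.2).scale (Real.exp (α * p.1)))) := by
  obtain ⟨g, m, hgm, hper, hug⟩ := exists_polar_slice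
    (fun k => (hmin _ Metric.isOpen_ball Metric.isBounded_ball).1) hhom
  obtain ⟨s, hsm, hgs, -, hlim⟩ := hgm.exists_metric_speed
  set v := polarExtension α g with hv
  have hvp := polarExtension_polar (α := α) hper
  have hvu : ∀ᵐ x, v x = u x := ae_of_ae_polar (by
    filter_upwards [hug] with p hp
    rw [hp, hv, hvp])
  have huv : ∀ᵐ x, u x = v x := hvu.mono fun x hx => hx.symm
  have hvmin : IsDirMinimizer v := hmin.congr_ae huv
  have hvm : Measurable v := measurable_polarExtension hper hgs.continuous
  obtain ⟨φ, hφ⟩ := (hvmin (Metric.ball 0 1) Metric.isOpen_ball Metric.isBounded_ball).1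
  let E := ∑ j, ∫⁻ x in Metric.ball 0 1, ENNReal.ofReal (φ j x ^ 2)
  have hE : E ≠ ⊤ := by
    refine ENNReal.sum_ne_top.2 fun j _ => ?_
    have h1 := (hφ.1 j).integrable_sq
    exact ((lintegral_ofReal_le_lintegral_enorm _).trans_lt h1.2).ne
  let D : ℝ → ℝ≥0∞ := fun y => ENNReal.ofReal (α ^ 2 * (g y).size ^ 2 + s y ^ 2)
  have hDm : Measurable D := by
    have := hgs.continuous_size.measurable
    fun_prop
  have hLB : ∀ N : ℝ, 0 < N → ∀ c : ℝ, (∫⁻ t in Ioo (-N) 0, ENNReal.ofReal (Real.exp (2 * α * t)))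
      * ∫⁻ y in Ioo c (c + 2), D y ≤ E := by
    intro N hN c
    have h1 : polar '' (Ioo (-N) 0 ×ˢ Ioo c (c + 2)) ⊆ Metric.ball 0 1 := by
      rintro _ ⟨p, hp, rfl⟩
      rw [mem_ball_zero_iff, norm_polar]
      exact Real.exp_lt_one_iff.2 hp.1.2
    have h2 := (hφ.mono Metric.isOpen_ball h1).lintegral_polar_le hgs hlim hsm hvm hvp
      (neg_lt_zero.2 hN) (by linarith) (two_lt_two_pi c)
    refine le_trans (le_of_eq ?_) (h2.trans (Finset.sum_le_sum fun j _ => lintegral_mono_set h1))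
    rw [Measure.volume_eq_prod, ← Measure.prod_restrict, ← lintegral_prod_mul
      (by fun_prop) hDm.aemeasurable]
    refine lintegral_congr fun p => ?_
    rw [ENNReal.ofReal_mul (Real.exp_pos _).le]
  have hDfin : ∀ c, ∫⁻ y in Ioo c (c + 2), D y ≠ ⊤ := by
    intro c hcon
    have h1 := hLB 1 one_pos c
    rw [hcon, ENNReal.mul_top] at h1
    · exact hE (top_le_iff.1 h1)
    · refine (setLIntegral_pos_iff (by fun_prop)).2 ?_ |>.ne'
      have : Function.support (fun t => ENNReal.ofReal (Real.exp (2 * α * t))) = univ :=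
        eq_univ_of_forall fun t => by simp [Real.exp_pos]
      rw [this]
      simp
  have hsq : LocallyIntegrable fun y => s y ^ 2 := by
    intro y
    obtain ⟨k, hk⟩ := exists_int_Ioo y
    refine ⟨_, Ioo_mem_nhds hk.1 hk.2, (hsm.pow_const 2).aestronglyMeasurable, ?_⟩
    refine lt_of_le_of_lt (lintegral_mono fun y => ?_) (hDfin k).lt_top
    rw [Real.enorm_of_nonneg (sq_nonneg _)]
    exact ENNReal.ofReal_le_ofReal (by nlinarith [sq_nonneg (α * (g y).size)])
  rcases lt_or_ge 0 α with hα | hα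
  · refine ⟨v, hvu, continuous_polarExtension hα hper hgs.continuous, hvmin,
      Or.inr ⟨hα, ?_, g, s, ⟨hgs, hlim, hsq, hsm⟩, hper, hvp⟩⟩
    rw [hv, polarExtension, norm_zero, Real.zero_rpow hα.ne', SpecialQPoint.scale_zero]
  · have hD0 : ∀ c, ∫⁻ y in Ioo c (c + 2), D y = 0 := by
      intro c
      by_contra hcon
      -- For `α ≤ 0` the weight `exp (2αt)` is at least one on `(-N, 0)`, and `N` is arbitrary.
      have h1 : ∀ N : ℝ, 0 < N → N * (∫⁻ y in Ioo c (c + 2), D y).toReal ≤ E.toReal := by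
        intro N hN
        rw [← ENNReal.toReal_ofReal hN.le, ← ENNReal.toReal_mul]
        refine ENNReal.toReal_mono hE (le_trans ?_ (hLB N hN c))
        gcongr
        calc ENNReal.ofReal N = ∫⁻ t in Ioo (-N) 0, 1 := by simp
          _ ≤ _ := by
            refine setLIntegral_mono' measurableSet_Ioo fun t ht => ?_
            rw [← ENNReal.ofReal_one]
            exact ENNReal.ofReal_le_ofReal (Real.one_le_exp (by nlinarith [ht.2]))
      have h2 : 0 < (∫⁻ y in Ioo c (c + 2), D y).toReal := ENNReal.toReal_pos hcon (hDfin c)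
      have h3 := h1 (E.toReal / (∫⁻ y in Ioo c (c + 2), D y).toReal + 1) (by positivity)
      rw [add_mul, div_mul_cancel₀ _ h2.ne'] at h3
      linarith
    have hD0' : ∀ᵐ y, α ^ 2 * (g y).size ^ 2 + s y ^ 2 ≤ 0 := by
      refine ae_of_forall_Ioo fun k => ?_
      filter_upwards [(lintegral_eq_zero_iff hDm).1 (hD0 k)] with y hy
      exact ENNReal.ofReal_eq_zero.1 hy
    rcases hα.lt_or_eq with hα | hα
    · exfalso
      refine hne ?_
      have h1 : ∀ᵐ y, g y = SpecialQPoint.origin Q n := by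
        filter_upwards [hD0'] with y hy
        rw [← SpecialQPoint.size_eq_zero_iff]
        have h2 : 0 < α ^ 2 := by nlinarith
        have h3 : (g y).size ^ 2 ≤ 0 := by nlinarith [sq_nonneg (s y)]
        exact pow_eq_zero_iff two_ne_zero |>.1 (le_antisymm h3 (sq_nonneg _))
      refine ae_of_ae_polar ?_
      filter_upwards [hug, Measure.quasiMeasurePreserving_snd.ae h1] with p hp1 hp2
      rw [hp1, hp2, SpecialQPoint.scale_origin]
    · have hs0 : ∀ᵐ y, s y = 0 := by
        filter_upwards [hD0'] with y hy
        have h3 : s y ^ 2 ≤ 0 := by nlinarith [sq_nonneg (α * (g y).size)]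
        exact pow_eq_zero_iff two_ne_zero |>.1 (le_antisymm h3 (sq_nonneg _))
      have hconst : ∀ y, g y = g 0 := fun y => by
        have h1 := hgs.dist_le_abs y 0
        rw [intervalIntegral.integral_congr_ae (g := fun _ => (0 : ℝ))
          (hs0.mono fun x hx _ => hx)] at h1
        simpa using h1
      have hvA : ∀ x, v x = g 0 := fun x => by
        rw [hv, polarExtension, hα, Real.rpow_zero, SpecialQPoint.scale_one, hconst]
      refine ⟨v, hvu, ?_, hvmin, Or.inl ⟨g 0, hvA⟩⟩
      rw [show v = fun _ => g 0 from funext hvA]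
      exact continuous_const

end SpecialQMap

/-! ### Comparison with competitors on a sector -/

namespace SpecialQMap

/-- A homogeneous map which is minimizing has less energy than every competitor which is given in
sheared polar coordinates. -/
theorem IsDirMinimizer.integral_le {Q n : ℕ} {v : EuclideanSpace ℝ (Fin 2) → SpecialQPoint Q n}
    {α : ℝ} {g : ℝ → SpecialQPoint Q n} {s : ℝ → ℝ} (hv : IsDirMinimizer v)
    (hvm : Measurable v) (hg : IsPolarCurve g s)
    (hvp : ∀ p, v (polar p) = (g p.2).scale (Real.exp (α * p.1)))
    {Θ : ℝ × ℝ → ℝ} {a b c d : ℝ} (hΘ : IsAngleShear Θ a b c d) (hab : a < b) (hcd : c < d)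
    (hpi : d - c < 2 * Real.pi) {W : ℝ × ℝ → SpecialQPoint Q n} {C : ℝ} {m : ℝ → ℝ}
    (hW : IsRectRegular W a b c d C m) {qa qb qc : ℝ × ℝ → ℝ}
    (ha : IntegrableOn qa (Ioo a b ×ˢ Ioo c d)) (hb : IntegrableOn qb (Ioo a b ×ˢ Ioo c d))
    (hc : IntegrableOn qc (Ioo a b ×ˢ Ioo c d))
    (hspeed : ∀ T, ∀ᵐ p ∂(volume : Measure (ℝ × ℝ)).restrict (Ioo a b ×ˢ Ioo c d), ∀ v v' : ℝ,
      (IsRectRegular.dFst (fun p => dist (W p) T) p * v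
        + IsRectRegular.dSnd (fun p => dist (W p) T) p * v') ^ 2
        ≤ qa p * v ^ 2 + 2 * qb p * v * v' + qc p * v' ^ 2)
    {K : Set (ℝ × ℝ)} (hK : IsCompact K) (hKR : K ⊆ Ioo a b ×ˢ Ioo c d)
    (hout : ∀ p ∉ K, Θ p = p.2 ∧ W p = (g p.2).scale (Real.exp (α * p.1))) :
    ∫ p in Ioo a b ×ˢ Ioo c d, Real.exp (2 * α * p.1) * (α ^ 2 * (g p.2).size ^ 2 + s p.2 ^ 2)
      ≤ ∫ p in Ioo a b ×ˢ Ioo c d, (qa p * partialSnd Θ p - 2 * qb p * partialFst Θ p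
        + qc p * ((1 + partialFst Θ p ^ 2) / partialSnd Θ p)) := by
  classical
  set R := Ioo a b ×ˢ Ioo c d with hR
  have hch := hΘ.planeChart hab hcd hpi
  let F := planeMap (polFst Θ) (polSnd Θ)
  let w : EuclideanSpace ℝ (Fin 2) → SpecialQPoint Q n := fun x =>
    if x ∈ polar '' R then W (Function.invFunOn F R x) else v x
  have hFR : ∀ p ∈ R, F p ∈ polar '' R := fun p hp => by
    rw [← hch.image_eq]
    exact mem_image_of_mem _ hp
  have hw : ∀ p ∈ R, w (polar (p.1, Θ p)) = W p := by
    intro p hp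
    have h1 : polar (p.1, Θ p) ∈ polar '' R := hFR p hp
    simp only [w, if_pos h1]
    exact congrArg W (hch.injOn.leftInvOn_invFunOn hp)
  obtain ⟨φ, hφ, I, hI, h1, h2⟩ := hΘ.exists_gradientBound hab hcd hpi hw hW ha hb hc hspeed
  rw [← h2, ← ENNReal.ofReal_le_ofReal_iff hI, ← h1]
  have hout' : ∃ K', IsCompact K' ∧ K' ⊆ polar '' R ∧ ∀ᵐ x, x ∈ polar '' R \ K' → w x = v x := by
    refine ⟨F '' K, hK.image (contDiff_planeMap hch.contDiff_fst hch.contDiff_snd).continuous,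
      ?_, ?_⟩
    · rintro _ ⟨p, hp, rfl⟩
      exact hFR p (hKR hp)
    · refine Eventually.of_forall fun x hx => ?_
      obtain ⟨p, hp, rfl⟩ : ∃ p ∈ R, F p = x := by
        have := hx.1
        rwa [← hch.image_eq] at this
      have hpK : p ∉ K := fun h => hx.2 (mem_image_of_mem _ h)
      obtain ⟨e1, e2⟩ := hout p hpK
      have h3 : F p = polar (p.1, Θ p) := rfl
      rw [h3, hw p hp, e1, e2]
      exact (hvp p).symm
  have h3 := (hv _ hch.isOpen hch.isBounded).2 w ⟨φ, hφ⟩ hout'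
  have h4 : energy w (polar '' R)
      ≤ ∑ j, ∫⁻ x in polar '' R, ENNReal.ofReal (φ j x ^ 2) := iInf₂_le φ hφ
  refine le_trans ?_ (h3.trans h4)
  -- The energy is an infimum over gradient bounds, and the polar lower bound holds for each of
  -- them.
  refine le_iInf₂ fun φ' hφ' => le_trans (le_of_eq ?_)
    (hφ'.lintegral_polar_le hg.speed hg.limit hg.measurable hvm hvp hab hcd hpi)
  refine ofReal_integral_eq_lintegral_ofReal ?_ (Eventually.of_forall fun p => by positivity)
  have i1 : IntegrableOn (fun p : ℝ × ℝ => s p.2 ^ 2) R :=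
    IsRectRegular.integrableOn_snd hg.sq_int
  have i2 : Continuous fun p : ℝ × ℝ => (g p.2).size := hg.speed.continuous_size.comp continuous_snd
  have i3 := (IsRectRegular.integrableOn_continuous (a := a) (b := b) (c := c) (d := d)
    ((i2.pow 2).const_mul (α ^ 2))).add i1
  have i4 : Continuous fun p : ℝ × ℝ => Real.exp (2 * α * p.1) := by fun_prop
  refine (IsRectRegular.integrableOn_mul_continuous i3 i4).congr ?_
  refine Eventually.of_forall fun p => ?_
  simp only [Pi.add_apply, Pi.pow_apply]
  ring

end SpecialQMap

/-! ### Outer and inner variations -/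

theorem eq_zero_of_forall_small {L M δ : ℝ} (hδ : 0 < δ)
    (h : ∀ τ : ℝ, |τ| < δ → 0 ≤ τ * L + τ ^ 2 * M) : L = 0 := by
  have h1 : HasDerivAt (fun τ => τ * L + τ ^ 2 * M) L 0 := by
    have := ((hasDerivAt_id (0 : ℝ)).mul_const L).fun_add
      (((hasDerivAt_id (0 : ℝ)).fun_pow 2).mul_const M)
    simpa using this
  have h2 : IsLocalMin (fun τ => τ * L + τ ^ 2 * M) 0 := by
    filter_upwards [Metric.ball_mem_nhds (0 : ℝ) hδ] with τ hτ
    have := h τ (by simpa using hτ)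
    simpa using this
  exact h2.hasDerivAt_eq_zero h1

/-- A smooth cut-off function on `(-1, 1)` which is positive in the mean. -/
structure IsCutoff (α : ℝ) (χ : ℝ → ℝ) : Prop where
  contDiff : ContDiff ℝ ∞ χ
  compact : HasCompactSupport χ
  support : tsupport χ ⊆ Ioo (-1) 1
  integral_pos : 0 < ∫ t in Ioo (-1 : ℝ) 1, Real.exp (2 * α * t) * χ t

theorem exists_isCutoff (α : ℝ) : ∃ χ, IsCutoff α χ := by
  let χ : ContDiffBump (0 : ℝ) := ⟨1 / 4, 1 / 2, by norm_num, by norm_num⟩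
  have hs : tsupport χ ⊆ Ioo (-1) 1 := by
    rw [χ.tsupport_eq, Real.closedBall_eq_Icc]
    intro t ht
    have h1 := ht.1
    have h2 := ht.2
    simp only [χ] at h1 h2
    constructor <;> linarith
  refine ⟨χ, χ.contDiff, χ.hasCompactSupport, hs, ?_⟩
  have hc : Continuous fun t => Real.exp (2 * α * t) * χ t := by
    have := χ.continuous
    fun_prop
  rw [setIntegral_eq_integral_of_forall_compl_eq_zero]
  · refine hc.integral_pos_of_hasCompactSupport_nonneg_nonzero (χ.hasCompactSupport.mul_left)
      (fun t => mul_nonneg (Real.exp_pos _).le χ.nonneg) (x := 0) ?_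
    simp [χ.one_of_mem_closedBall (Metric.mem_closedBall_self χ.rIn_pos.le)]
  · intro t ht
    rw [image_eq_zero_of_notMem_tsupport fun h => ht (hs h), mul_zero]

namespace IsCutoff

variable {α : ℝ} {χ : ℝ → ℝ}

theorem integral_deriv (h : IsCutoff α χ) :
    ∫ t in Ioo (-1 : ℝ) 1, Real.exp (2 * α * t) * deriv χ t
      = -(2 * α) * ∫ t in Ioo (-1 : ℝ) 1, Real.exp (2 * α * t) * χ t := by
  have h0 : ∀ t, t ∉ Ioo (-1 : ℝ) 1 → χ t = 0 := fun t ht =>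
    image_eq_zero_of_notMem_tsupport fun hc => ht (h.support hc)
  have hd := h.contDiff.differentiable (by simp)
  have he : ∀ t, HasDerivAt (fun t => Real.exp (2 * α * t)) (Real.exp (2 * α * t) * (2 * α)) t :=
    fun t => by simpa using ((hasDerivAt_id t).const_mul (2 * α)).exp
  have h1 := intervalIntegral.integral_mul_deriv_eq_deriv_mul (a := -1) (b := 1)
    (u := fun t => Real.exp (2 * α * t)) (v := χ) (fun t _ => he t) (fun t _ => (hd t).hasDerivAt)
    (by apply Continuous.intervalIntegrable; fun_prop)
    ((h.contDiff.continuous_deriv (by simp)).intervalIntegrable _ _)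
  rw [h0 1 (by simp), h0 (-1) (by simp)] at h1
  simp only [mul_zero, sub_zero, zero_sub] at h1
  rw [← integral_Ioc_eq_integral_Ioo, ← integral_Ioc_eq_integral_Ioo,
    ← intervalIntegral.integral_of_le (by norm_num), ← intervalIntegral.integral_of_le
    (by norm_num), h1, ← intervalIntegral.integral_const_mul, ← intervalIntegral.integral_neg]
  refine intervalIntegral.integral_congr fun t _ => ?_
  ring

end IsCutoff

/-- The product of a cut-off function and a test function. -/
def cutProd (χ ζ : ℝ → ℝ) (p : ℝ × ℝ) : ℝ := χ p.1 * ζ p.2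

section CutProd

variable {χ ζ : ℝ → ℝ}

theorem contDiff_cutProd (hχ : ContDiff ℝ ∞ χ) (hζ : ContDiff ℝ ∞ ζ) :
    ContDiff ℝ ∞ (cutProd χ ζ) :=
  (hχ.comp contDiff_fst).mul (hζ.comp contDiff_snd)

theorem hasDerivAt_cutProd_fst (hχ : ContDiff ℝ ∞ χ) (p : ℝ × ℝ) :
    HasDerivAt (fun t => cutProd χ ζ (t, p.2)) (deriv χ p.1 * ζ p.2) p.1 :=
  ((hχ.differentiable (by simp) p.1).hasDerivAt).mul_const (ζ p.2)

theorem hasDerivAt_cutProd_snd (hζ : ContDiff ℝ ∞ ζ) (p : ℝ × ℝ) :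
    HasDerivAt (fun y => cutProd χ ζ (p.1, y)) (χ p.1 * deriv ζ p.2) p.2 :=
  ((hζ.differentiable (by simp) p.2).hasDerivAt).const_mul (χ p.1)

theorem exists_bound_cutProd (hχ : ContDiff ℝ ∞ χ) (hζ : ContDiff ℝ ∞ ζ)
    (hχc : HasCompactSupport χ) (hζc : HasCompactSupport ζ) :
    ∃ M, 0 < M ∧ ∀ p, |cutProd χ ζ p| ≤ M ∧ |χ p.1 * deriv ζ p.2| ≤ M := by
  obtain ⟨A, hA⟩ := hχc.exists_bound_of_continuous hχ.continuous
  obtain ⟨B, hB⟩ := hζc.exists_bound_of_continuous hζ.continuous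
  obtain ⟨C, hC⟩ := hζc.deriv.exists_bound_of_continuous (hζ.continuous_deriv (by simp))
  have hA0 : 0 ≤ A := (norm_nonneg _).trans (hA 0)
  have hB0 : 0 ≤ B := (norm_nonneg _).trans (hB 0)
  have hC0 : 0 ≤ C := (norm_nonneg _).trans (hC 0)
  refine ⟨A * B + A * C + 1, by positivity, fun p => ⟨?_, ?_⟩⟩
  · rw [cutProd, abs_mul]
    have := mul_le_mul (hA p.1) (hB p.2) (norm_nonneg _) hA0
    simp only [Real.norm_eq_abs] at this
    nlinarith [mul_nonneg hA0 hC0]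
  · rw [abs_mul]
    have := mul_le_mul (hA p.1) (hC p.2) (norm_nonneg _) hA0
    simp only [Real.norm_eq_abs] at this
    nlinarith [mul_nonneg hA0 hB0]

theorem cutProd_eq_zero {p : ℝ × ℝ} (h : p ∉ tsupport χ ×ˢ tsupport ζ) : cutProd χ ζ p = 0 := by
  by_contra hne
  have h1 := left_ne_zero_of_mul hne
  have h2 := right_ne_zero_of_mul hne
  exact h ⟨subset_tsupport _ h1, subset_tsupport _ h2⟩

end CutProd

theorem setIntegral_rect_mul (f k : ℝ → ℝ) (a b c d : ℝ) :
    ∫ p in Ioo a b ×ˢ Ioo c d, f p.1 * k p.2 = (∫ t in Ioo a b, f t) * ∫ y in Ioo c d, k y := by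
  rw [Measure.volume_eq_prod, setIntegral_prod_mul]

theorem integrable_add_quadratic {Y : Type*} [MeasurableSpace Y] {μ : Measure Y} {B L N : Y → ℝ}
    (hB : Integrable B μ) (hL : Integrable L μ) (hN : Integrable N μ) (τ : ℝ) :
    Integrable (fun p => B p + (τ * L p + τ ^ 2 * N p)) μ :=
  hB.add ((hL.const_mul τ).add (hN.const_mul (τ ^ 2)))

theorem integral_add_quadratic {Y : Type*} [MeasurableSpace Y] {μ : Measure Y} {B L N : Y → ℝ}
    (hB : Integrable B μ) (hL : Integrable L μ) (hN : Integrable N μ) (τ : ℝ) :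
    ∫ p, B p + (τ * L p + τ ^ 2 * N p) ∂μ
      = (∫ p, B p ∂μ) + (τ * (∫ p, L p ∂μ) + τ ^ 2 * ∫ p, N p ∂μ) := by
  have h1 : Integrable (fun p => τ * L p + τ ^ 2 * N p) μ :=
    (hL.const_mul τ).add (hN.const_mul (τ ^ 2))
  rw [integral_add hB h1, integral_add (hL.const_mul τ) (hN.const_mul (τ ^ 2)),
    integral_const_mul, integral_const_mul]

namespace SpecialQMap

section Variations

variable {Q n : ℕ} {v : EuclideanSpace ℝ (Fin 2) → SpecialQPoint Q n}
  {α : ℝ} {g : ℝ → SpecialQPoint Q n} {s : ℝ → ℝ}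

theorem rect_sq_speed_integrable (hg : IsPolarCurve g s) {κ : ℝ × ℝ → ℝ} (hκ : Continuous κ)
    {a b c d : ℝ} : IntegrableOn (fun p => κ p * s p.2 ^ 2) (Ioo a b ×ˢ Ioo c d) := by
  simpa only [mul_comm] using IsRectRegular.integrableOn_mul_continuous
    (IsRectRegular.integrableOn_snd hg.sq_int) hκ

theorem rect_deriv_integrable (hg : IsPolarCurve g s) {κ : ℝ × ℝ → ℝ} (hκ : Continuous κ)
    {a b c d : ℝ} : IntegrableOn (fun p => κ p * deriv (fun x => (g x).size ^ 2) p.2)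
      (Ioo a b ×ˢ Ioo c d) := by
  simpa only [mul_comm] using IsRectRegular.integrableOn_mul_continuous
    (IsRectRegular.integrableOn_snd hg.speed.locallyIntegrable_deriv_size_sq) hκ

theorem rect_size_integrable (hg : IsPolarCurve g s) {κ : ℝ × ℝ → ℝ} (hκ : Continuous κ)
    {a b c d : ℝ} : IntegrableOn (fun p => κ p * (g p.2).size ^ 2) (Ioo a b ×ˢ Ioo c d) :=
  IsRectRegular.integrableOn_continuous
    (hκ.mul ((hg.speed.continuous_size.comp continuous_snd).pow 2))

/-- The competitors are `(1 + τξ) v` with `ξ = χ(t) ζ(y)`; their energy is a quadratic polynomial in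
`τ`, whose linear coefficient must vanish. This is the weak form of `(|g|²)'' = 2s² - 2α² |g|²`. -/
theorem IsDirMinimizer.outer_variation (hv : IsDirMinimizer v) (hvm : Measurable v)
    (hg : IsPolarCurve g s) (hvp : ∀ p, v (polar p) = (g p.2).scale (Real.exp (α * p.1)))
    {c d : ℝ} (hcd : c < d) (hpi : d - c < 2 * Real.pi) {ζ : ℝ → ℝ} (hζ : ContDiff ℝ ∞ ζ)
    (hζc : HasCompactSupport ζ) (hζs : tsupport ζ ⊆ Ioo c d) :
    ∫ y in Ioo c d, (deriv ζ y * deriv (fun x => (g x).size ^ 2) y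
      - 2 * α ^ 2 * ζ y * (g y).size ^ 2 + 2 * ζ y * s y ^ 2) = 0 := by
  obtain ⟨χ, hχ⟩ := exists_isCutoff α
  obtain ⟨M, hM, hMb⟩ := exists_bound_cutProd hχ.contDiff hζ hχ.compact hζc
  set ξ := cutProd χ ζ with hξ
  have hξd := contDiff_cutProd hχ.contDiff hζ
  have hχ' := hχ.contDiff.continuous_deriv (by simp)
  have hζ' := hζ.continuous_deriv (by simp)
  have hχc := hχ.contDiff.continuous
  have hζc' := hζ.continuous
  set h' := deriv fun x => (g x).size ^ 2 with hh'
  let B : ℝ × ℝ → ℝ := fun p =>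
    Real.exp (2 * α * p.1) * (α ^ 2 * (g p.2).size ^ 2 + s p.2 ^ 2)
  let L : ℝ × ℝ → ℝ := fun p =>
    (Real.exp (2 * α * p.1) * (2 * α ^ 2 * ξ p + 2 * α * (deriv χ p.1 * ζ p.2))) * (g p.2).size ^ 2
      + (Real.exp (2 * α * p.1) * (χ p.1 * deriv ζ p.2)) * h' p.2
      + (Real.exp (2 * α * p.1) * (2 * ξ p)) * s p.2 ^ 2
  let N : ℝ × ℝ → ℝ := fun p =>
    (Real.exp (2 * α * p.1) * ((α * ξ p + deriv χ p.1 * ζ p.2) ^ 2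
      + (χ p.1 * deriv ζ p.2) ^ 2)) * (g p.2).size ^ 2
      + (Real.exp (2 * α * p.1) * (ξ p * (χ p.1 * deriv ζ p.2))) * h' p.2
      + (Real.exp (2 * α * p.1) * ξ p ^ 2) * s p.2 ^ 2
  have hξc : Continuous ξ := hξd.continuous
  have hBi : IntegrableOn B (Ioo (-1 : ℝ) 1 ×ˢ Ioo c d) := by
    refine ((rect_size_integrable hg (κ := fun p => Real.exp (2 * α * p.1) * α ^ 2)
      (by fun_prop)).add (rect_sq_speed_integrable hg (κ := fun p => Real.exp (2 * α * p.1))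
      (by fun_prop))).congr (Eventually.of_forall fun p => ?_)
    simp only [B, Pi.add_apply]
    ring
  have hLi : IntegrableOn L (Ioo (-1 : ℝ) 1 ×ˢ Ioo c d) :=
    ((rect_size_integrable hg (by fun_prop)).add (rect_deriv_integrable hg (by fun_prop))).add
      (rect_sq_speed_integrable hg (by fun_prop))
  have hNi : IntegrableOn N (Ioo (-1 : ℝ) 1 ×ˢ Ioo c d) :=
    ((rect_size_integrable hg (by fun_prop)).add (rect_deriv_integrable hg (by fun_prop))).add
      (rect_sq_speed_integrable hg (by fun_prop))
  have key : ∀ τ : ℝ, |τ| < 1 / M → 0 ≤ τ * (∫ p in Ioo (-1 : ℝ) 1 ×ˢ Ioo c d, L p)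
      + τ ^ 2 * ∫ p in Ioo (-1 : ℝ) 1 ×ˢ Ioo c d, N p := by
    intro τ hτ
    have hpos : ∀ p, 0 < 1 + τ * ξ p := by
      intro p
      have h1 : |τ * ξ p| < 1 := by
        rw [abs_mul]
        calc |τ| * |ξ p| ≤ |τ| * M := mul_le_mul_of_nonneg_left (hMb p).1 (abs_nonneg _)
          _ < 1 / M * M := mul_lt_mul_of_pos_right hτ hM
          _ = 1 := by field_simp
      linarith [(abs_lt.1 h1).1]
    let l : ℝ × ℝ → ℝ := fun p => Real.exp (α * p.1) * (1 + τ * ξ p)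
    have hl : ContDiff ℝ 1 l := by
      have h1 : ContDiff ℝ 1 ξ := hξd.of_le (by simp)
      exact ((Real.contDiff_exp.comp (contDiff_const.mul contDiff_fst))).mul
        (contDiff_const.add (contDiff_const.mul h1))
    have hl0 : ∀ p, 0 ≤ l p := fun p => mul_nonneg (Real.exp_pos _).le (hpos p).le
    have hld := hl.differentiable one_ne_zero
    have hlf : ∀ p, partialFst l p = Real.exp (α * p.1) *
        (α * (1 + τ * ξ p) + τ * (deriv χ p.1 * ζ p.2)) := fun p => by
      have he : HasDerivAt (fun t => Real.exp (α * t)) (Real.exp (α * p.1) * α) p.1 := by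
        simpa using ((hasDerivAt_id p.1).const_mul α).exp
      rw [partialFst_eq (hld p) (he.mul (((hasDerivAt_cutProd_fst hχ.contDiff p).const_mul
        τ).const_add 1))]
      simp only [hξ]
      ring
    have hls : ∀ p, partialSnd l p = Real.exp (α * p.1) * (τ * (χ p.1 * deriv ζ p.2)) := fun p =>
      partialSnd_eq (hld p) ((((hasDerivAt_cutProd_snd hζ p).const_mul τ).const_add 1).const_mul
        (Real.exp (α * p.1)))
    have hlc : Continuous l := hl.continuous
    have hlfc : Continuous (partialFst l) :=
      (hl.continuous_fderiv one_ne_zero).clm_apply continuous_const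
    have hlsc : Continuous (partialSnd l) :=
      (hl.continuous_fderiv one_ne_zero).clm_apply continuous_const
    obtain ⟨C, m, hW⟩ := hg.speed.isRectRegular_scale hl hl0 (-1) 1 c d
    have hmin := hv.integral_le hvm hg hvp (isAngleShear_snd (-1) 1 c d) (by norm_num) hcd hpi hW
      (qa := fun p => partialFst l p ^ 2 * (g p.2).size ^ 2)
      (qb := fun p => partialFst l p * partialSnd l p * (g p.2).size ^ 2
          + l p * partialFst l p * (h' p.2 / 2))
      (qc := fun p => partialSnd l p ^ 2 * (g p.2).size ^ 2
          + l p * partialSnd l p * h' p.2 + l p ^ 2 * s p.2 ^ 2)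
      (rect_size_integrable hg (by fun_prop))
      ((rect_size_integrable hg (by fun_prop)).add
        ((rect_deriv_integrable hg (κ := fun p => l p * partialFst l p / 2) (by fun_prop)).congr
          (Eventually.of_forall fun p => by simp only [hh']; ring)))
      (((rect_size_integrable hg (by fun_prop)).add
        (rect_deriv_integrable hg (by fun_prop))).add (rect_sq_speed_integrable hg (by fun_prop)))
      (fun T => hg.sq_deriv_dist_scale_le hl hl0 T _)
      (hχ.compact.isCompact.prod hζc.isCompact) (prod_mono hχ.support hζs)
      (fun p hp => ⟨rfl, by simp only [l, hξ, cutProd_eq_zero hp, mul_zero, add_zero, mul_one]⟩)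
    have heq : ∀ p : ℝ × ℝ, partialFst l p ^ 2 * (g p.2).size ^ 2 * partialSnd Prod.snd p
        - 2 * (partialFst l p * partialSnd l p * (g p.2).size ^ 2
          + l p * partialFst l p * (h' p.2 / 2)) * partialFst Prod.snd p
        + (partialSnd l p ^ 2 * (g p.2).size ^ 2
          + l p * partialSnd l p * h' p.2 + l p ^ 2 * s p.2 ^ 2)
          * ((1 + partialFst Prod.snd p ^ 2) / partialSnd Prod.snd p)
        = B p + (τ * L p + τ ^ 2 * N p) := by
      intro p
      have e : Real.exp (2 * α * p.1) = Real.exp (α * p.1) ^ 2 := by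
        rw [← Real.exp_nat_mul]
        congr 1
        push_cast
        ring
      rw [partialSnd_snd, partialFst_snd, hlf, hls]
      simp only [l, B, L, N, e]
      ring
    simp only [heq] at hmin
    rw [integral_add_quadratic hBi hLi hNi] at hmin
    linarith
  have hL0 := eq_zero_of_forall_small (by positivity) key
  have hi1 : IntegrableOn (fun y => 2 * α ^ 2 * ζ y * (g y).size ^ 2) (Ioo c d) := by
    have h1 := hg.speed.continuous_size
    have h2 : Continuous fun y => 2 * α ^ 2 * ζ y * (g y).size ^ 2 := by fun_prop
    exact (h2.integrableOn_Icc (a := c) (b := d)).mono_set Ioo_subset_Icc_self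
  have hi2 : IntegrableOn (fun y => deriv ζ y * h' y) (Ioo c d) := by
    have h1 := locallyIntegrable_mul_continuous hg.speed.locallyIntegrable_deriv_size_sq hζ'
    simpa only [mul_comm] using
      (h1.integrableOn_isCompact isCompact_Icc).mono_set Ioo_subset_Icc_self
  have hi3 : IntegrableOn (fun y => 2 * ζ y * s y ^ 2) (Ioo c d) := by
    have h1 := locallyIntegrable_mul_continuous hg.sq_int (hζc'.const_mul 2)
    simpa only [mul_comm] using
      (h1.integrableOn_isCompact isCompact_Icc).mono_set Ioo_subset_Icc_self
  -- The `t`-integrals separate, and integrating by parts against `exp (2αt)` expresses the one with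
  -- `χ'` through the one with `χ`, which is positive and cancels. This turns the coefficient `2α²`
  -- into `2α² - 4α² = -2α²`.
  have hsplit : ∫ p in Ioo (-1 : ℝ) 1 ×ˢ Ioo c d, L p
      = (∫ t in Ioo (-1 : ℝ) 1, Real.exp (2 * α * t) * χ t)
        * (∫ y in Ioo c d, (deriv ζ y * h' y + 2 * α ^ 2 * ζ y * (g y).size ^ 2
          + 2 * ζ y * s y ^ 2))
      + (∫ t in Ioo (-1 : ℝ) 1, Real.exp (2 * α * t) * deriv χ t)
        * (∫ y in Ioo c d, 2 * α * ζ y * (g y).size ^ 2) := by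
    rw [← setIntegral_rect_mul, ← setIntegral_rect_mul, ← integral_add]
    · refine integral_congr_ae (Eventually.of_forall fun p => ?_)
      simp only [L, hξ, cutProd]
      ring
    · refine (((rect_size_integrable hg (κ := fun p => Real.exp (2 * α * p.1) * χ p.1 *
        (2 * α ^ 2 * ζ p.2)) (by fun_prop)).add (rect_deriv_integrable hg
        (κ := fun p => Real.exp (2 * α * p.1) * χ p.1 * deriv ζ p.2) (by fun_prop))).add
        (rect_sq_speed_integrable hg (κ := fun p => Real.exp (2 * α * p.1) * χ p.1 * (2 * ζ p.2))
        (by fun_prop))).congr (Eventually.of_forall fun p => ?_)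
      simp only [Pi.add_apply, hh']
      ring
    · refine (rect_size_integrable hg (κ := fun p => Real.exp (2 * α * p.1) * deriv χ p.1 *
        (2 * α * ζ p.2)) (by fun_prop)).congr (Eventually.of_forall fun p => ?_)
      ring
  rw [hsplit, hχ.integral_deriv] at hL0
  have hfin : (∫ t in Ioo (-1 : ℝ) 1, Real.exp (2 * α * t) * χ t)
      * ∫ y in Ioo c d, (deriv ζ y * h' y - 2 * α ^ 2 * ζ y * (g y).size ^ 2
        + 2 * ζ y * s y ^ 2) = 0 := by
    have i1 : IntegrableOn (fun y => deriv ζ y * h' y + 2 * α ^ 2 * ζ y * (g y).size ^ 2)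
      (Ioo c d) := hi2.add hi1
    have i2 : IntegrableOn (fun y => deriv ζ y * h' y - 2 * α ^ 2 * ζ y * (g y).size ^ 2)
      (Ioo c d) := hi2.sub hi1
    rw [← hL0, integral_add i1 hi3, integral_add hi2 hi1,
      integral_add i2 hi3, integral_sub hi2 hi1]
    have e : ∫ y in Ioo c d, 2 * α ^ 2 * ζ y * (g y).size ^ 2
        = α * ∫ y in Ioo c d, 2 * α * ζ y * (g y).size ^ 2 := by
      rw [← integral_const_mul]
      refine integral_congr_ae (Eventually.of_forall fun y => ?_)
      ring
    rw [e]
    ring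
  exact (mul_eq_zero.1 hfin).resolve_left hχ.integral_pos.ne'

/-- An upper bound that is exact to first order is enough: it replaces the rational dependence on
the shear by a quadratic polynomial without changing the first variation. -/
theorem one_add_sq_div_le {x y : ℝ} (hx : |x| ≤ 1 / 2) :
    (1 + y ^ 2) / (1 + x) ≤ 1 - x + 2 * x ^ 2 + 2 * y ^ 2 := by
  have h1 := abs_le.1 hx
  rw [div_le_iff₀ (by linarith)]
  nlinarith [sq_nonneg x, sq_nonneg y, mul_nonneg (sq_nonneg x) (by linarith : 0 ≤ 1 + 2 * x),
    mul_nonneg (sq_nonneg y) (by linarith : 0 ≤ 1 + 2 * x)]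

/-- The competitors carry the values of `v` along the sheared angle `y + τ χ(t) ζ(y)`. The vanishing
first variation is the weak form of `(α² |g|² + s²)' = 0`. -/
theorem IsDirMinimizer.inner_variation (hv : IsDirMinimizer v) (hvm : Measurable v)
    (hg : IsPolarCurve g s) (hvp : ∀ p, v (polar p) = (g p.2).scale (Real.exp (α * p.1)))
    {c d : ℝ} (hcd : c < d) (hpi : d - c < 2 * Real.pi) {ζ : ℝ → ℝ} (hζ : ContDiff ℝ ∞ ζ)
    (hζc : HasCompactSupport ζ) (hζs : tsupport ζ ⊆ Ioo c d) :
    ∫ y in Ioo c d, (α ^ 2 * (g y).size ^ 2 + s y ^ 2) * deriv ζ y = 0 := by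
  obtain ⟨χ, hχ⟩ := exists_isCutoff α
  obtain ⟨M, hM, hMb⟩ := exists_bound_cutProd hχ.contDiff hζ hχ.compact hζc
  set ξ := cutProd χ ζ with hξ
  have hξd := contDiff_cutProd hχ.contDiff hζ
  have hχ' := hχ.contDiff.continuous_deriv (by simp)
  have hζ' := hζ.continuous_deriv (by simp)
  have hχc := hχ.contDiff.continuous
  have hζc' := hζ.continuous
  set h' := deriv fun x => (g x).size ^ 2 with hh'
  let X : ℝ × ℝ → ℝ := fun p => deriv χ p.1 * ζ p.2
  let Y : ℝ × ℝ → ℝ := fun p => χ p.1 * deriv ζ p.2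
  have hX : Continuous X := by fun_prop
  have hY : Continuous Y := by fun_prop
  let B : ℝ × ℝ → ℝ := fun p =>
    Real.exp (2 * α * p.1) * (α ^ 2 * (g p.2).size ^ 2 + s p.2 ^ 2)
  let L : ℝ × ℝ → ℝ := fun p =>
    (Real.exp (2 * α * p.1) * (α ^ 2 * Y p)) * (g p.2).size ^ 2
      + (Real.exp (2 * α * p.1) * (-(α * X p))) * h' p.2
      + (Real.exp (2 * α * p.1) * (-Y p)) * s p.2 ^ 2
  let N : ℝ × ℝ → ℝ := fun p =>
    (Real.exp (2 * α * p.1) * (2 * Y p ^ 2 + 2 * X p ^ 2)) * s p.2 ^ 2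
  have hBi : IntegrableOn B (Ioo (-1 : ℝ) 1 ×ˢ Ioo c d) := by
    refine ((rect_size_integrable hg (κ := fun p => Real.exp (2 * α * p.1) * α ^ 2)
      (by fun_prop)).add (rect_sq_speed_integrable hg (κ := fun p => Real.exp (2 * α * p.1))
      (by fun_prop))).congr (Eventually.of_forall fun p => ?_)
    simp only [B, Pi.add_apply]
    ring
  have hLi : IntegrableOn L (Ioo (-1 : ℝ) 1 ×ˢ Ioo c d) :=
    ((rect_size_integrable hg (by fun_prop)).add (rect_deriv_integrable hg (by fun_prop))).add
      (rect_sq_speed_integrable hg (by fun_prop))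
  have hNi : IntegrableOn N (Ioo (-1 : ℝ) 1 ×ˢ Ioo c d) :=
    rect_sq_speed_integrable hg (by fun_prop)
  have key : ∀ τ : ℝ, |τ| < 1 / (2 * M) → 0 ≤ τ * (∫ p in Ioo (-1 : ℝ) 1 ×ˢ Ioo c d, L p)
      + τ ^ 2 * ∫ p in Ioo (-1 : ℝ) 1 ×ˢ Ioo c d, N p := by
    intro τ hτ
    have hsmall : ∀ p, |τ * Y p| ≤ 1 / 2 := by
      intro p
      rw [abs_mul]
      calc |τ| * |Y p| ≤ |τ| * M := mul_le_mul_of_nonneg_left (hMb p).2 (abs_nonneg _)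
        _ ≤ 1 / (2 * M) * M := mul_le_mul_of_nonneg_right hτ.le hM.le
        _ = 1 / 2 := by field_simp
    have hpos : ∀ p, 0 < 1 + τ * Y p := fun p => by linarith [(abs_le.1 (hsmall p)).1]
    let Θ : ℝ × ℝ → ℝ := fun p => p.2 + τ * ξ p
    have hΘd : ContDiff ℝ 2 Θ :=
      contDiff_snd.add (contDiff_const.mul (contDiff_infty.1 hξd 2))
    have hΘf : ∀ p, partialFst Θ p = τ * X p := fun p =>
      partialFst_eq (hΘd.differentiable two_ne_zero p)
        (((hasDerivAt_cutProd_fst hχ.contDiff p).const_mul τ).const_add p.2)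
    have hΘs : ∀ p, partialSnd Θ p = 1 + τ * Y p := fun p =>
      partialSnd_eq (hΘd.differentiable two_ne_zero p)
        ((hasDerivAt_id p.2).fun_add ((hasDerivAt_cutProd_snd hζ p).const_mul τ))
    have hζ0 : ∀ y, y ∉ Ioo c d → ζ y = 0 := fun y hy =>
      image_eq_zero_of_notMem_tsupport fun hcon => hy (hζs hcon)
    have hΘ : IsAngleShear Θ (-1) 1 c d :=
      { contDiff := hΘd
        pos := fun p _ => by rw [hΘs]; exact hpos p
        left := fun t _ => by simp [Θ, hξ, cutProd, hζ0 c (by simp)]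
        right := fun t _ => by simp [Θ, hξ, cutProd, hζ0 d (by simp)] }
    let l : ℝ × ℝ → ℝ := fun p => Real.exp (α * p.1)
    have hl : ContDiff ℝ 1 l := Real.contDiff_exp.comp (contDiff_const.mul contDiff_fst)
    have hl0 : ∀ p, 0 ≤ l p := fun p => (Real.exp_pos _).le
    have hld := hl.differentiable one_ne_zero
    have hlf : ∀ p, partialFst l p = Real.exp (α * p.1) * α := fun p => by
      have he : HasDerivAt (fun t => Real.exp (α * t)) (Real.exp (α * p.1) * α) p.1 := by
        simpa using ((hasDerivAt_id p.1).const_mul α).exp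
      exact partialFst_eq (hld p) he
    have hls : ∀ p, partialSnd l p = 0 := fun p =>
      partialSnd_eq (hld p) (hasDerivAt_const p.2 (Real.exp (α * p.1)))
    have hlc : Continuous l := hl.continuous
    have hlfc : Continuous (partialFst l) :=
      (hl.continuous_fderiv one_ne_zero).clm_apply continuous_const
    have hlsc : Continuous (partialSnd l) :=
      (hl.continuous_fderiv one_ne_zero).clm_apply continuous_const
    obtain ⟨C, m, hW⟩ := hg.speed.isRectRegular_scale hl hl0 (-1) 1 c d
    have hmin := hv.integral_le hvm hg hvp hΘ (by norm_num) hcd hpi hW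
      (qa := fun p => partialFst l p ^ 2 * (g p.2).size ^ 2)
      (qb := fun p => partialFst l p * partialSnd l p * (g p.2).size ^ 2
          + l p * partialFst l p * (h' p.2 / 2))
      (qc := fun p => partialSnd l p ^ 2 * (g p.2).size ^ 2
          + l p * partialSnd l p * h' p.2 + l p ^ 2 * s p.2 ^ 2)
      (rect_size_integrable hg (by fun_prop))
      ((rect_size_integrable hg (by fun_prop)).add
        ((rect_deriv_integrable hg (κ := fun p => l p * partialFst l p / 2) (by fun_prop)).congr
          (Eventually.of_forall fun p => by simp only [hh']; ring)))
      (((rect_size_integrable hg (by fun_prop)).add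
        (rect_deriv_integrable hg (by fun_prop))).add (rect_sq_speed_integrable hg (by fun_prop)))
      (fun T => hg.sq_deriv_dist_scale_le hl hl0 T _)
      (hχ.compact.isCompact.prod hζc.isCompact) (prod_mono hχ.support hζs)
      (fun p hp => ⟨by simp only [Θ, hξ, cutProd_eq_zero hp, mul_zero, add_zero], rfl⟩)
    have e : ∀ p : ℝ × ℝ, Real.exp (2 * α * p.1) = Real.exp (α * p.1) ^ 2 := fun p => by
      rw [← Real.exp_nat_mul]
      congr 1
      push_cast
      ring
    have heq : ∀ p : ℝ × ℝ, partialFst l p ^ 2 * (g p.2).size ^ 2 * partialSnd Θ p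
        - 2 * (partialFst l p * partialSnd l p * (g p.2).size ^ 2
          + l p * partialFst l p * (h' p.2 / 2)) * partialFst Θ p
        + (partialSnd l p ^ 2 * (g p.2).size ^ 2
          + l p * partialSnd l p * h' p.2 + l p ^ 2 * s p.2 ^ 2)
          * ((1 + partialFst Θ p ^ 2) / partialSnd Θ p)
        = (Real.exp (2 * α * p.1) * (α ^ 2 * (1 + τ * Y p))) * (g p.2).size ^ 2
          + (Real.exp (2 * α * p.1) * (-(α * (τ * X p)))) * h' p.2
          + (Real.exp (2 * α * p.1) * ((1 + (τ * X p) ^ 2) / (1 + τ * Y p))) * s p.2 ^ 2 := by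
      intro p
      rw [hΘf, hΘs, hlf, hls]
      simp only [l, e]
      ring
    simp only [heq] at hmin
    have hdc : Continuous fun p : ℝ × ℝ => (1 + (τ * X p) ^ 2) / (1 + τ * Y p) :=
      Continuous.div (by fun_prop) (by fun_prop) fun p => (hpos p).ne'
    -- Only the factor of `s²` depends on `τ` in a non-polynomial way; it is replaced by its
    -- quadratic majorant.
    have hmin2 := hmin.trans (setIntegral_mono_on
      (((rect_size_integrable hg (by fun_prop)).add (rect_deriv_integrable hg
        (by fun_prop))).add (rect_sq_speed_integrable hg (by fun_prop)))
      (integrable_add_quadratic hBi hLi hNi τ)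
      (PlaneChart.measurableSet_rect _ _ _ _) fun p _ => ?_)
    · rw [integral_add_quadratic hBi hLi hNi] at hmin2
      linarith
    · have h1 := mul_le_mul_of_nonneg_right (mul_le_mul_of_nonneg_left
        (one_add_sq_div_le (y := τ * X p) (hsmall p)) (Real.exp_pos (2 * α * p.1)).le)
        (sq_nonneg (s p.2))
      refine (add_le_add_right h1 _).trans (le_of_eq ?_)
      simp only [B, L, N]
      ring
  have hL0 := eq_zero_of_forall_small (by positivity) key
  have hi1 : IntegrableOn (fun y => α ^ 2 * (g y).size ^ 2 * deriv ζ y) (Ioo c d) := by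
    have h1 := hg.speed.continuous_size
    have h2 : Continuous fun y => α ^ 2 * (g y).size ^ 2 * deriv ζ y := by fun_prop
    exact (h2.integrableOn_Icc (a := c) (b := d)).mono_set Ioo_subset_Icc_self
  have hi3 : IntegrableOn (fun y => s y ^ 2 * deriv ζ y) (Ioo c d) := by
    have h1 := locallyIntegrable_mul_continuous hg.sq_int hζ'
    exact (h1.integrableOn_isCompact isCompact_Icc).mono_set Ioo_subset_Icc_self
  have hsplit : ∫ p in Ioo (-1 : ℝ) 1 ×ˢ Ioo c d, L p
      = (∫ t in Ioo (-1 : ℝ) 1, Real.exp (2 * α * t) * χ t)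
        * (∫ y in Ioo c d, (α ^ 2 * (g y).size ^ 2 * deriv ζ y - s y ^ 2 * deriv ζ y))
      + (∫ t in Ioo (-1 : ℝ) 1, Real.exp (2 * α * t) * deriv χ t)
        * (∫ y in Ioo c d, -α * (h' y * ζ y)) := by
    rw [← setIntegral_rect_mul, ← setIntegral_rect_mul, ← integral_add]
    · refine integral_congr_ae (Eventually.of_forall fun p => ?_)
      simp only [L, X, Y]
      ring
    · refine ((rect_size_integrable hg (κ := fun p => Real.exp (2 * α * p.1) * χ p.1 *
        (α ^ 2 * deriv ζ p.2)) (by fun_prop)).sub (rect_sq_speed_integrable hg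
        (κ := fun p => Real.exp (2 * α * p.1) * χ p.1 * deriv ζ p.2)
        (by fun_prop))).congr (Eventually.of_forall fun p => ?_)
      simp only [Pi.sub_apply]
      ring
    · refine (rect_deriv_integrable hg (κ := fun p => Real.exp (2 * α * p.1) * deriv χ p.1 *
        (-α * ζ p.2)) (by fun_prop)).congr (Eventually.of_forall fun p => ?_)
      simp only [hh']
      ring
  have hζ0 : ∀ y, y ∉ Ioo c d → ζ y = 0 := fun y hy =>
    image_eq_zero_of_notMem_tsupport fun hcon => hy (hζs hcon)
  -- The term with `ζ` and the derivative of `|g|²` becomes one with `ζ'`; this reverses the sign of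
  -- the contribution of `|g|²`, so that it joins that of `s²`.
  have hparts := integral_mul_deriv_eq_neg hcd.le (hg.speed.absolutelyContinuous_size_sq c d)
    (hζ.of_le (by simp)) (hζ0 c (by simp)) (hζ0 d (by simp))
  rw [hsplit, hχ.integral_deriv, integral_sub hi1 hi3, integral_const_mul] at hL0
  have e1 : ∫ y in Ioo c d, α ^ 2 * (g y).size ^ 2 * deriv ζ y
      = α ^ 2 * -∫ y in Ioo c d, h' y * ζ y := by
    rw [hh', ← hparts, ← integral_const_mul]
    refine integral_congr_ae (Eventually.of_forall fun y => ?_)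
    ring
  have e2 : ∫ y in Ioo c d, (α ^ 2 * (g y).size ^ 2 + s y ^ 2) * deriv ζ y
      = (∫ y in Ioo c d, α ^ 2 * (g y).size ^ 2 * deriv ζ y)
        + ∫ y in Ioo c d, s y ^ 2 * deriv ζ y := by
    rw [← integral_add hi1 hi3]
    refine integral_congr_ae (Eventually.of_forall fun y => ?_)
    ring
  have hfin : (∫ t in Ioo (-1 : ℝ) 1, Real.exp (2 * α * t) * χ t)
      * ∫ y in Ioo c d, (α ^ 2 * (g y).size ^ 2 + s y ^ 2) * deriv ζ y = 0 := by
    rw [e2]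
    rw [e1] at hL0 ⊢
    linear_combination -hL0
  exact (mul_eq_zero.1 hfin).resolve_left hχ.integral_pos.ne'

end Variations

end SpecialQMap

/-! ### The conservation law and the equation for the squared size -/

theorem exists_ae_eq_const_of_forall_short {f : ℝ → ℝ} (hf : LocallyIntegrable f)
    (h : ∀ c d, c < d → d - c < 2 * Real.pi → ∀ ζ : ℝ → ℝ, ContDiff ℝ ∞ ζ → HasCompactSupport ζ →
      tsupport ζ ⊆ Ioo c d → ∫ x in Ioo c d, f x * deriv ζ x = 0) :
    ∃ K, ∀ᵐ x, f x = K := by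
  -- The variations are available only on intervals shorter than `2π`. Those of length 2 centered at
  -- the integers overlap, and the constants match on the overlaps.
  have hloc : ∀ j : ℤ, ∃ K, ∀ᵐ x, x ∈ Ioo ((j : ℝ) - 1) (j + 1) → f x = K := fun j =>
    exists_ae_eq_const_of_integral_mul_deriv_eq_zero (by linarith)
      ((hf.integrableOn_isCompact isCompact_Icc).mono_set Ioo_subset_Icc_self)
      (h _ _ (by linarith) (by linarith [Real.pi_gt_three]))
  choose K hK using hloc
  have hstep : ∀ j : ℤ, K (j + 1) = K j := by
    intro j
    have hpos : (0 : ℝ≥0∞) < volume (Ioo (j : ℝ) (j + 1)) := by simp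
    have hne : ∃ x ∈ Ioo (j : ℝ) (j + 1), (x ∈ Ioo ((j : ℝ) - 1) (j + 1) → f x = K j) ∧
        (x ∈ Ioo (((j + 1 : ℤ) : ℝ) - 1) ((j + 1 : ℤ) + 1) → f x = K (j + 1)) := by
      by_contra! hcon
      have : volume (Ioo (j : ℝ) (j + 1)) = 0 := by
        refine measure_mono_null ?_ ((hK j).and (hK (j + 1)))
        intro x hx hcc
        exact absurd (hcc.2) (fun hc2 => (hcon x hx hcc.1).2 (hc2 (hcon x hx hcc.1).1))
      exact hpos.ne' this
    obtain ⟨x, hx, h1, h2⟩ := hne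
    rw [← h1 ⟨by linarith [hx.1], hx.2⟩, ← h2 ?_]
    push_cast
    exact ⟨by linarith [hx.1], by linarith [hx.2]⟩
  have hconst : ∀ j : ℤ, K j = K 0 := by
    intro j
    induction j using Int.induction_on with
    | zero => rfl
    | succ i ih => rw [hstep, ih]
    | pred i ih => rw [← ih, ← hstep, sub_add_cancel]
  refine ⟨K 0, ?_⟩
  filter_upwards [ae_all_iff.2 hK] with x hx
  rw [hx ⌊x⌋ ⟨by linarith [Int.floor_le x], Int.lt_floor_add_one x⟩, hconst]

/-- A zero of the nonnegative function `h` is a minimum, so `p θ = 0` as well. The Cauchy problem at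
`θ` is then solved by the right-hand side. -/
theorem eq_sin_sq_of_hasDerivAt {h p : ℝ → ℝ} {α K θ : ℝ} (hα : α ≠ 0) (h0 : ∀ y, 0 ≤ h y)
    (hh : ∀ y, HasDerivAt h (p y) y) (hp : ∀ y, HasDerivAt p (2 * K - 4 * α ^ 2 * h y) y)
    (hθ : h θ = 0) (y : ℝ) : h y = K / α ^ 2 * Real.sin (α * (y - θ)) ^ 2 := by
  -- `D` is the difference to the claimed solution and `E` is its derivative. They satisfy the
  -- harmonic oscillator equation, so `E² + 4α² D²` is conserved; it is zero at `θ`.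
  let D : ℝ → ℝ := fun y => h y - K / (2 * α ^ 2) * (1 - Real.cos (2 * α * (y - θ)))
  let E : ℝ → ℝ := fun y => p y - K / α * Real.sin (2 * α * (y - θ))
  have hlin : ∀ y, HasDerivAt (fun y => 2 * α * (y - θ)) (2 * α) y := fun y => by
    simpa using ((hasDerivAt_id y).sub_const θ).const_mul (2 * α)
  have hD : ∀ y, HasDerivAt D (E y) y := fun y => by
    refine ((hh y).fun_sub ((((hlin y).cos).const_sub 1).const_mul (K / (2 * α ^ 2)))).congr_deriv ?_
    simp only [E]
    field_simp
  have hE : ∀ y, HasDerivAt E (-(4 * α ^ 2) * D y) y := fun y => by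
    refine ((hp y).fun_sub (((hlin y).sin).const_mul (K / α))).congr_deriv ?_
    simp only [D]
    field_simp
    ring
  have hp0 : p θ = 0 := by
    have : IsLocalMin h θ := Eventually.of_forall fun y => by simpa [hθ] using h0 y
    exact this.hasDerivAt_eq_zero (hh θ)
  have hcst : ∀ y, E y ^ 2 + 4 * α ^ 2 * D y ^ 2 = E θ ^ 2 + 4 * α ^ 2 * D θ ^ 2 := by
    intro y
    have hd : ∀ y, HasDerivAt (fun y => E y ^ 2 + 4 * α ^ 2 * D y ^ 2) 0 y := fun y => by
      refine (((hE y).fun_pow 2).fun_add (((hD y).fun_pow 2).const_mul (4 * α ^ 2))).congr_deriv ?_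
      ring
    exact is_const_of_deriv_eq_zero (fun y => (hd y).differentiableAt) (fun y => (hd y).deriv) y θ
  have hy := hcst y
  have h1 : E θ = 0 := by simp [E, hp0]
  have h2 : D θ = 0 := by simp [D, hθ]
  rw [h1, h2] at hy
  have hα2 : 0 < α ^ 2 := by positivity
  have h5 : α ^ 2 * D y ^ 2 ≤ 0 := by linarith [sq_nonneg (E y)]
  have h3 : D y = 0 := by
    by_contra hne
    exact absurd h5 (not_le.2 (by positivity))
  have h4 : h y = K / (2 * α ^ 2) * (1 - Real.cos (2 * α * (y - θ))) := by
    simpa [D, sub_eq_zero] using h3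
  rw [h4, mul_assoc 2 α, Real.cos_two_mul, Real.cos_sq']
  field_simp
  ring

namespace SpecialQMap

variable {Q n : ℕ} {v : EuclideanSpace ℝ (Fin 2) → SpecialQPoint Q n}
  {α : ℝ} {g : ℝ → SpecialQPoint Q n} {s : ℝ → ℝ}

theorem IsDirMinimizer.exists_conservation (hv : IsDirMinimizer v) (hvm : Measurable v)
    (hg : IsPolarCurve g s) (hvp : ∀ p, v (polar p) = (g p.2).scale (Real.exp (α * p.1))) :
    ∃ K, ∀ᵐ y, α ^ 2 * (g y).size ^ 2 + s y ^ 2 = K :=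
  exists_ae_eq_const_of_forall_short
    (((continuous_const.mul (hg.speed.continuous_size.pow 2)).locallyIntegrable).add hg.sq_int)
    fun _ _ hcd hpi _ hζ hζc hζs => hv.inner_variation hvm hg hvp hcd hpi hζ hζc hζs

/-- Insert the conservation law in the outer variation: the derivative of `|g|²` plus a primitive of
`4α² |g|² - 2K` is constant almost everywhere. As that primitive is of class `C¹`, the squared size
is twice differentiable everywhere. -/
theorem IsDirMinimizer.exists_hasDerivAt_size_sq (hv : IsDirMinimizer v) (hvm : Measurable v)
    (hg : IsPolarCurve g s) (hvp : ∀ p, v (polar p) = (g p.2).scale (Real.exp (α * p.1)))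
    {K : ℝ} (hK : ∀ᵐ y, α ^ 2 * (g y).size ^ 2 + s y ^ 2 = K) :
    ∃ p : ℝ → ℝ, ∀ y, HasDerivAt (fun x => (g x).size ^ 2) (p y) y ∧
      HasDerivAt p (2 * K - 4 * α ^ 2 * (g y).size ^ 2) y := by
  have hkc : Continuous fun y => 4 * α ^ 2 * (g y).size ^ 2 - 2 * K :=
    (continuous_const.mul (hg.speed.continuous_size.pow 2)).sub continuous_const
  let H : ℝ → ℝ := fun y => ∫ x in (0 : ℝ)..y, (4 * α ^ 2 * (g x).size ^ 2 - 2 * K)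
  have hH : ∀ y, HasDerivAt H (4 * α ^ 2 * (g y).size ^ 2 - 2 * K) y := fun y =>
    intervalIntegral.integral_hasDerivAt_right (hkc.intervalIntegrable _ _)
      (hkc.stronglyMeasurableAtFilter _ _) hkc.continuousAt
  have hHc : Continuous H := continuous_iff_continuousAt.2 fun y => (hH y).continuousAt
  have hdi := hg.speed.locallyIntegrable_deriv_size_sq
  obtain ⟨c₀, hc₀⟩ : ∃ c₀, ∀ᵐ y, deriv (fun x => (g x).size ^ 2) y + H y = c₀ := by
    refine exists_ae_eq_const_of_forall_short (hdi.add hHc.locallyIntegrable) ?_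
    intro c d hcd hpi ζ hζ hζc hζs
    have hout := hv.outer_variation hvm hg hvp hcd hpi hζ hζc hζs
    have hζ' : Continuous (deriv ζ) := (hζ.continuous_deriv (by simp))
    have hInt : ∀ {f : ℝ → ℝ}, LocallyIntegrable f → IntegrableOn f (Ioo c d) := fun hf =>
      (hf.integrableOn_isCompact isCompact_Icc).mono_set Ioo_subset_Icc_self
    have hζ0 : ∀ y, y ∉ Ioo c d → ζ y = 0 := fun y hy =>
      image_eq_zero_of_notMem_tsupport fun hcon => hy (hζs hcon)
    have hparts : ∫ y in Ioo c d, H y * deriv ζ y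
        = -∫ y in Ioo c d, (4 * α ^ 2 * (g y).size ^ 2 - 2 * K) * ζ y := by
      have hi := intervalIntegral.integral_mul_deriv_eq_deriv_mul (a := c) (b := d)
        (u := H) (v := ζ) (fun y _ => hH y)
        (fun y _ => ((hζ.differentiable (by simp)) y).hasDerivAt)
        (hkc.intervalIntegrable _ _) (hζ'.intervalIntegrable _ _)
      rw [hζ0 c (by simp), hζ0 d (by simp)] at hi
      rw [intervalIntegral.integral_of_le hcd.le, intervalIntegral.integral_of_le hcd.le,
        integral_Ioc_eq_integral_Ioo, integral_Ioc_eq_integral_Ioo] at hi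
      rw [hi]; ring
    have hi1 : IntegrableOn (fun y => deriv (fun x => (g x).size ^ 2) y * deriv ζ y) (Ioo c d) :=
      hInt (locallyIntegrable_mul_continuous hdi hζ')
    have hi2 : IntegrableOn (fun y => H y * deriv ζ y) (Ioo c d) :=
      hInt (hHc.mul hζ').locallyIntegrable
    have hi3 : IntegrableOn (fun y => (4 * α ^ 2 * (g y).size ^ 2 - 2 * K) * ζ y) (Ioo c d) :=
      hInt (hkc.mul hζ.continuous).locallyIntegrable
    have hout' : ∫ y in Ioo c d, (deriv (fun x => (g x).size ^ 2) y * deriv ζ y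
        - (4 * α ^ 2 * (g y).size ^ 2 - 2 * K) * ζ y) = 0 := by
      rw [← hout]
      refine integral_congr_ae ?_
      filter_upwards [ae_restrict_of_ae hK] with y hy
      rw [← hy]
      ring
    rw [integral_sub hi1 hi3] at hout'
    simp only [add_mul]
    rw [integral_add hi1 hi2, hparts]
    linarith
  have hcc : Continuous fun y => c₀ - H y := continuous_const.sub hHc
  refine ⟨fun y => c₀ - H y, fun y => ⟨?_, ((hH y).const_sub c₀).congr_deriv (by ring)⟩⟩
  -- Absolute continuity recovers `|g|²` from its almost everywhere derivative, which agrees with a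
  -- continuous function.
  have hrep : ∀ y, (g y).size ^ 2 = (g 0).size ^ 2 + ∫ x in (0 : ℝ)..y, (c₀ - H x) := by
    intro y
    have h1 := (hg.speed.absolutelyContinuous_size_sq 0 y).integral_deriv_eq_sub
    have h2 : ∫ x in (0 : ℝ)..y, (c₀ - H x)
        = ∫ x in (0 : ℝ)..y, deriv (fun x => (g x).size ^ 2) x :=
      intervalIntegral.integral_congr_ae (by
        filter_upwards [hc₀] with x hx _
        rw [← hx]; ring)
    rw [h2, h1]; ring
  rw [show (fun x => (g x).size ^ 2) = fun y => (g 0).size ^ 2 + ∫ x in (0 : ℝ)..y, (c₀ - H x)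
    from funext hrep]
  exact (intervalIntegral.integral_hasDerivAt_right (hcc.intervalIntegrable _ _)
      (hcc.stronglyMeasurableAtFilter _ _) hcc.continuousAt).const_add _

theorem IsDirMinimizer.size_sq_eq_sin_sq (hv : IsDirMinimizer v) (hvm : Measurable v)
    (hg : IsPolarCurve g s) (hvp : ∀ p, v (polar p) = (g p.2).scale (Real.exp (α * p.1)))
    {K θ : ℝ} (hα : α ≠ 0) (hK : ∀ᵐ y, α ^ 2 * (g y).size ^ 2 + s y ^ 2 = K)
    (hθ : g θ = SpecialQPoint.origin Q n) (y : ℝ) :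
    (g y).size ^ 2 = K / α ^ 2 * Real.sin (α * (y - θ)) ^ 2 := by
  obtain ⟨p, hp⟩ := hv.exists_hasDerivAt_size_sq hvm hg hvp hK
  refine eq_sin_sq_of_hasDerivAt (h := fun x => (g x).size ^ 2) hα (fun y => sq_nonneg _)
    (fun y => (hp y).1) (fun y => (hp y).2) ?_ y
  simp [(SpecialQPoint.size_eq_zero_iff _).2 hθ]

end SpecialQMap

/-! ### Consecutive arcs carry opposite signs -/

namespace QPoint

variable {Q n : ℕ}

/-- Average over the cyclic shifts of the second ordering: the mean of the inner products is a
multiple of the inner product of the two sums, which is zero. Some shift is therefore nonnegative.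
-/
theorem exists_matching_nonneg (S T : QPoint Q n) (hS : S.center = 0) :
    ∃ x y, ofTuple x = S ∧ ofTuple y = T ∧ 0 ≤ ∑ i, inner ℝ (x i) (y i) := by
  obtain ⟨x, rfl⟩ := exists_ofTuple S
  obtain ⟨y, rfl⟩ := exists_ofTuple T
  rcases Nat.eq_zero_or_pos Q with rfl | hQ
  · exact ⟨x, y, rfl, rfl, by simp⟩
  have : NeZero Q := ⟨hQ.ne'⟩
  have hsum : ∑ i, x i = 0 := by rw [← nsmul_center, hS, smul_zero]
  have hav : ∑ k : Fin Q, ∑ i, inner ℝ (x i) (y (i + k)) = 0 := by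
    rw [Finset.sum_comm]
    have : ∀ i, ∑ k, inner ℝ (x i) (y (i + k)) = inner ℝ (x i) (∑ k, y k) := fun i => by
      rw [inner_sum]
      exact Equiv.sum_comp (Equiv.addLeft i) fun k => inner ℝ (x i) (y k)
    simp only [this]
    rw [← sum_inner, hsum, inner_zero_left]
  obtain ⟨k, -, hk⟩ := Finset.exists_le_of_sum_le (s := Finset.univ) (f := fun _ : Fin Q => (0 : ℝ))
    (g := fun k => ∑ i, inner ℝ (x i) (y (i + k))) Finset.univ_nonempty (by rw [hav]; simp)
  exact ⟨x, fun i => y (i + k), rfl, ofTuple_comp y (Equiv.addRight k), hk⟩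

end QPoint

theorem SpecialQPoint.dist_combination_sq_le {Q n : ℕ} {x y : Fin Q → EuclideanSpace ℝ (Fin n)}
    (hx : ∑ i, ‖x i‖ ^ 2 = 1) (hy : ∑ i, ‖y i‖ ^ 2 = 1) (ε : ℤˣ) (a b a' b' : ℝ) :
    Dist.dist (mk (QPoint.ofTuple fun i => a • x i + b • y i) ε)
      (mk (QPoint.ofTuple fun i => a' • x i + b' • y i) ε) ^ 2
    ≤ (a - a') ^ 2 + (b - b') ^ 2 + 2 * (∑ i, inner ℝ (x i) (y i)) * (a - a') * (b - b') := by
  have h := dist_mk_ofTuple_le (fun i => a • x i + b • y i) (fun i => a' • x i + b' • y i) ε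
  have h2 := pow_le_pow_left₀ dist_nonneg h 2
  rw [Real.sq_sqrt (by positivity)] at h2
  refine h2.trans (le_of_eq ?_)
  have : ∀ i, ‖a • x i + b • y i - (a' • x i + b' • y i)‖ ^ 2 = (a - a') ^ 2 * ‖x i‖ ^ 2
      + (b - b') ^ 2 * ‖y i‖ ^ 2 + 2 * (a - a') * (b - b') * inner ℝ (x i) (y i) := fun i => by
    rw [show a • x i + b • y i - (a' • x i + b' • y i) = (a - a') • x i + (b - b') • y i by module,
      norm_add_sq_real, norm_smul, norm_smul, inner_smul_left, inner_smul_right, mul_pow, mul_pow,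
      Real.norm_eq_abs, Real.norm_eq_abs, sq_abs, sq_abs]
    simp only [conj_trivial]
    ring
  simp only [this, Finset.sum_add_distrib, ← Finset.mul_sum, hx, hy]
  ring

theorem IsRectRegular.of_dist_le {X : Type*} [MetricSpace X] {W : ℝ × ℝ → X} {a b c d : ℝ}
    {L : ℝ} (hL : 0 ≤ L) (hW : Continuous W)
    (h : ∀ p ∈ Icc a b ×ˢ Icc c d, ∀ q ∈ Icc a b ×ˢ Icc c d, dist (W p) (W q) ≤ L * dist p q) :
    IsRectRegular W a b c d L fun _ => L where
  continuous := hW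
  lip t ht t' ht' y hy := by
    refine (h (t, y) ⟨ht, hy⟩ (t', y) ⟨ht', hy⟩).trans (le_of_eq ?_)
    rw [Prod.dist_eq, dist_self, max_eq_left dist_nonneg, Real.dist_eq]
  speed t ht y hy y' hy' hyy := by
    refine (h (t, y) ⟨ht, hy⟩ (t, y') ⟨ht, hy'⟩).trans (le_of_eq ?_)
    rw [Prod.dist_eq, dist_self, max_eq_right dist_nonneg, dist_comm, Real.dist_eq,
      abs_of_nonneg (sub_nonneg.2 hyy), intervalIntegral.integral_const, smul_eq_mul, mul_comm]
  nonneg := hL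
  intg := locallyIntegrable_const L
  m_nonneg _ := hL

theorem ae_differentiableAt_of_lipschitz_rect {F : ℝ × ℝ → ℝ} {a b c d L : ℝ} (hL : 0 ≤ L)
    (h : ∀ p ∈ Icc a b ×ˢ Icc c d, ∀ q ∈ Icc a b ×ˢ Icc c d, dist (F p) (F q) ≤ L * dist p q) :
    ∀ᵐ p ∂(volume : Measure (ℝ × ℝ)).restrict (Ioo a b ×ˢ Ioo c d), DifferentiableAt ℝ F p := by
  have hl : LipschitzOnWith L.toNNReal F (Ioo a b ×ˢ Ioo c d) :=
    LipschitzOnWith.of_dist_le_mul fun p hp q hq => by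
      rw [Real.coe_toNNReal _ hL]
      exact h p (prod_mono Ioo_subset_Icc_self Ioo_subset_Icc_self hp) q
        (prod_mono Ioo_subset_Icc_self Ioo_subset_Icc_self hq)
  have ho : IsOpen (Ioo a b ×ˢ Ioo c d) := isOpen_Ioo.prod isOpen_Ioo
  filter_upwards [hl.ae_differentiableWithinAt ho.measurableSet, ae_restrict_mem ho.measurableSet]
    with p hp hpm
  exact hp.differentiableAt (ho.mem_nhds hpm)

theorem exists_lipschitz_rect_of_contDiff {F : ℝ × ℝ → ℝ} (hF : ContDiff ℝ 1 F) (a b c d : ℝ) :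
    ∃ L, 0 ≤ L ∧ ∀ p ∈ Icc a b ×ˢ Icc c d, ∀ q ∈ Icc a b ×ˢ Icc c d,
      |F p - F q| ≤ L * dist p q := by
  obtain ⟨C, hC⟩ := (isCompact_Icc.prod isCompact_Icc : IsCompact (Icc a b ×ˢ Icc c d)
    ).exists_bound_of_continuousOn (hF.continuous_fderiv one_ne_zero).continuousOn
  refine ⟨|C|, abs_nonneg C, fun p hp q hq => ?_⟩
  rw [dist_eq_norm, ← Real.norm_eq_abs]
  exact ((convex_Icc a b).prod (convex_Icc c d)).norm_image_sub_le_of_norm_fderiv_le (𝕜 := ℝ)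
    (fun x _ => hF.differentiable one_ne_zero x) (fun x hx => (hC x hx).trans (le_abs_self C))
    hq hp

/-- The quadratic form of the speed of `A x + B y`: the Gram form of `x` and `y` applied to the
directional derivatives of the coefficients. It enters the energy estimate through
`sq_deriv_dist_le`. -/
theorem SpecialQPoint.exists_tendsto_dist_combination {Q n : ℕ}
    {x y : Fin Q → EuclideanSpace ℝ (Fin n)} (hx : ∑ i, ‖x i‖ ^ 2 = 1) (hy : ∑ i, ‖y i‖ ^ 2 = 1)
    {ε : ℤˣ} {W : ℝ × ℝ → SpecialQPoint Q n} {A B : ℝ × ℝ → ℝ} {p : ℝ × ℝ}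
    (hA : DifferentiableAt ℝ A p) (hB : DifferentiableAt ℝ B p)
    (hW : W =ᶠ[𝓝 p] fun q => mk (QPoint.ofTuple fun i => A q • x i + B q • y i) ε) (v v' : ℝ) :
    ∃ E : ℝ → ℝ,
      Tendsto E (𝓝[≠] 0) (𝓝 (
        (partialFst A p ^ 2 + partialFst B p ^ 2
          + 2 * (∑ i, inner ℝ (x i) (y i)) * partialFst A p * partialFst B p) * v ^ 2
        + 2 * (partialFst A p * partialSnd A p + partialFst B p * partialSnd B p
          + (∑ i, inner ℝ (x i) (y i)) * (partialFst A p * partialSnd B p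
            + partialSnd A p * partialFst B p)) * v * v'
        + (partialSnd A p ^ 2 + partialSnd B p ^ 2
          + 2 * (∑ i, inner ℝ (x i) (y i)) * partialSnd A p * partialSnd B p) * v' ^ 2)) ∧
      ∀ᶠ r in 𝓝[≠] 0, Dist.dist (W (p.1 + r * v, p.2 + r * v')) (W p) ^ 2 / r ^ 2 ≤ E r := by
  set κ := ∑ i, inner ℝ (x i) (y i) with hκ
  have hline : HasDerivAt (fun r : ℝ => (p.1 + r * v, p.2 + r * v')) (v, v') 0 :=
    (hasDerivAt_line p.1 v).prodMk (hasDerivAt_line p.2 v')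
  have hp : (p.1 + 0 * v, p.2 + 0 * v') = p := by simp
  have hslope : ∀ {F : ℝ × ℝ → ℝ}, DifferentiableAt ℝ F p →
      Tendsto (fun r => r⁻¹ * (F (p.1 + r * v, p.2 + r * v') - F p)) (𝓝[≠] 0)
        (𝓝 (partialFst F p * v + partialSnd F p * v')) := by
    intro F hF
    have hF' : HasFDerivAt F (fderiv ℝ F p) (p.1 + 0 * v, p.2 + 0 * v') := by
      rw [hp]
      exact hF.hasFDerivAt
    have h := hF'.comp_hasDerivAt 0 hline
    rw [fderiv_apply_eq_partial, hasDerivAt_iff_tendsto_slope_zero] at h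
    simpa only [Function.comp_apply, zero_add, hp, smul_eq_mul] using h
  have tA := hslope hA
  have tB := hslope hB
  have hL := ((tA.pow 2).add (tB.pow 2)).add ((tA.mul tB).const_mul (2 * κ))
  refine ⟨_, by convert hL using 2; ring, ?_⟩
  have hW' : ∀ᶠ r in 𝓝[≠] (0 : ℝ), W (p.1 + r * v, p.2 + r * v')
      = mk (QPoint.ofTuple fun i => A (p.1 + r * v, p.2 + r * v') • x i
        + B (p.1 + r * v, p.2 + r * v') • y i) ε := by
    refine Filter.Eventually.filter_mono nhdsWithin_le_nhds ?_
    have hc : Tendsto (fun r : ℝ => (p.1 + r * v, p.2 + r * v')) (𝓝 0) (𝓝 p) := by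
      have := hline.continuousAt.tendsto
      rwa [hp] at this
    exact hc.eventually hW
  filter_upwards [hW', self_mem_nhdsWithin] with r hr hr0
  rw [hr, hW.self_of_nhds]
  have hr0' : r ≠ 0 := hr0
  have h := dist_combination_sq_le hx hy ε (A (p.1 + r * v, p.2 + r * v'))
    (B (p.1 + r * v, p.2 + r * v')) (A p) (B p)
  rw [div_le_iff₀ (by positivity)]
  refine h.trans (le_of_eq ?_)
  field_simp
  ring

theorem exists_smooth_bump (c : ℝ) {δ : ℝ} (hδ : 0 < δ) : ∃ ζ : ℝ → ℝ, ContDiff ℝ ∞ ζ ∧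
    HasCompactSupport ζ ∧ tsupport ζ ⊆ Ioo (c - δ) (c + δ) ∧ ζ c = 1 := by
  let f : ContDiffBump c := ⟨δ / 4, δ / 2, by positivity, by linarith⟩
  refine ⟨f, f.contDiff, f.hasCompactSupport, ?_, f.one_of_mem_closedBall (by simp [f.rIn_pos.le])⟩
  rw [f.tsupport_eq, Real.closedBall_eq_Icc]
  exact Icc_subset_Ioo (by simp [f]; linarith) (by simp [f]; linarith)

/-- The sign of `y - c` -/
def sideSign (c y : ℝ) : ℝ := if c < y then 1 else -1

theorem measurable_sideSign (c : ℝ) : Measurable (sideSign c) :=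
  Measurable.ite measurableSet_Ioi measurable_const measurable_const

theorem sideSign_sq (c y : ℝ) : sideSign c y ^ 2 = 1 := by
  unfold sideSign
  split_ifs <;> norm_num

/-- Integrate on each side of `c`; the value at `c` enters twice with the same sign. This is the
jump term which obstructs a first variation equal to zero. -/
theorem integral_sideSign_mul_deriv {F F' : ℝ → ℝ} {c δ : ℝ} (hδ : 0 < δ)
    (hF : ∀ y, HasDerivAt F (F' y) y) (hF' : Continuous F') (h1 : F (c - δ) = 0)
    (h2 : F (c + δ) = 0) :
    ∫ y in Ioo (c - δ) (c + δ), sideSign c y * F' y = -2 * F c := by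
  have hi : ∀ a b, IntervalIntegrable (fun y => sideSign c y * F' y) volume a b := fun a b => by
    refine (hF'.intervalIntegrable a b).mono_fun
      ((measurable_sideSign c).aestronglyMeasurable.mul hF'.aestronglyMeasurable)
      (Eventually.of_forall fun y => ?_)
    change ‖sideSign c y * F' y‖ ≤ ‖F' y‖
    rw [norm_mul, Real.norm_eq_abs (sideSign c y), ← Real.sqrt_sq_eq_abs, sideSign_sq, Real.sqrt_one, one_mul]
  have e1 : ∫ y in (c - δ)..c, sideSign c y * F' y = -(F c) := by
    rw [intervalIntegral.integral_congr_ae (g := fun y => -F' y), intervalIntegral.integral_neg,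
      intervalIntegral.integral_eq_sub_of_hasDerivAt (fun y _ => hF y)
        (hF'.intervalIntegrable _ _), h1, sub_zero]
    refine Eventually.of_forall fun y hy => ?_
    rw [uIoc_of_le (by linarith)] at hy
    simp [sideSign, not_lt.2 hy.2]
  have e2 : ∫ y in c..(c + δ), sideSign c y * F' y = -(F c) := by
    rw [intervalIntegral.integral_congr_ae (g := F'),
      intervalIntegral.integral_eq_sub_of_hasDerivAt (fun y _ => hF y)
        (hF'.intervalIntegrable _ _), h2, zero_sub]
    refine Eventually.of_forall fun y hy => ?_
    rw [uIoc_of_le (by linarith)] at hy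
    simp [sideSign, hy.1]
  rw [← integral_Ioc_eq_integral_Ioo, ← intervalIntegral.integral_of_le (by linarith),
    ← intervalIntegral.integral_add_adjacent_intervals (hi _ c) (hi c _), e1, e2]
  ring

section Competitor

variable {α β c τ : ℝ} {ξ : ℝ × ℝ → ℝ}

/-- The harmonic function `β r^α sin (α(θ - c))` in logarithmic polar coordinates. Its positive and
negative parts are the sizes of the map on the two arcs that meet at `c`. -/
def sineWave (α β c : ℝ) (p : ℝ × ℝ) : ℝ := Real.exp (α * p.1) * (β * Real.sin (α * (p.2 - c)))

theorem contDiff_sineWave {m : ℕ∞} : ContDiff ℝ m (sineWave α β c) := by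
  unfold sineWave
  fun_prop

theorem partialFst_sineWave (p : ℝ × ℝ) :
    partialFst (sineWave α β c) p = Real.exp (α * p.1) * (α * β * Real.sin (α * (p.2 - c))) := by
  have he : HasDerivAt (fun t => Real.exp (α * t)) (Real.exp (α * p.1) * α) p.1 := by
    simpa using ((hasDerivAt_id p.1).const_mul α).exp
  rw [partialFst_eq ((contDiff_sineWave (m := 1)).differentiable one_ne_zero p)
    (he.mul_const (β * Real.sin (α * (p.2 - c))))]
  ring

theorem partialSnd_sineWave (p : ℝ × ℝ) :
    partialSnd (sineWave α β c) p = Real.exp (α * p.1) * (α * β * Real.cos (α * (p.2 - c))) := by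
  have he : HasDerivAt (fun y => α * (y - c)) α p.2 := by
    simpa using ((hasDerivAt_id p.2).sub_const c).const_mul α
  rw [partialSnd_eq ((contDiff_sineWave (m := 1)).differentiable one_ne_zero p)
    ((he.sin.const_mul β).const_mul (Real.exp (α * p.1)))]
  ring

theorem sineWave_nonneg (hα : 0 < α) (hβ : 0 ≤ β) {p : ℝ × ℝ} (h : p.2 ∈ Icc c (c + Real.pi / α)) :
    0 ≤ sineWave α β c p := by
  have h1 : α * (p.2 - c) ≤ Real.pi := by
    have := h.2
    calc _ ≤ α * (Real.pi / α) := by gcongr; linarith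
      _ = _ := by field_simp
  exact mul_nonneg (Real.exp_pos _).le (mul_nonneg hβ (Real.sin_nonneg_of_nonneg_of_le_pi
    (mul_nonneg hα.le (sub_nonneg.2 h.1)) h1))

theorem sineWave_nonpos (hα : 0 < α) (hβ : 0 ≤ β) {p : ℝ × ℝ} (h : p.2 ∈ Icc (c - Real.pi / α) c) :
    sineWave α β c p ≤ 0 := by
  have h1 : -Real.pi ≤ α * (p.2 - c) := by
    have := h.1
    calc -Real.pi = α * (-(Real.pi / α)) := by field_simp
      _ ≤ _ := by gcongr; linarith
  exact mul_nonpos_of_nonneg_of_nonpos (Real.exp_pos _).le (mul_nonpos_of_nonneg_of_nonpos hβ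
    (Real.sin_nonpos_of_nonpos_of_neg_pi_le
      (mul_nonpos_of_nonneg_of_nonpos hα.le (sub_nonpos.2 h.2)) h1))

end Competitor

namespace SpecialQMap

section Alternation

variable {Q n : ℕ} {v : EuclideanSpace ℝ (Fin 2) → SpecialQPoint Q n}
  {α : ℝ} {g : ℝ → SpecialQPoint Q n} {s : ℝ → ℝ}

theorem partialFst_const_mul_add {F G : ℝ × ℝ → ℝ} {p : ℝ × ℝ} (hF : DifferentiableAt ℝ F p)
    (hG : DifferentiableAt ℝ G p) (a b : ℝ) :
    partialFst (fun q => a * F q + b * G q) p = a * partialFst F p + b * partialFst G p :=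
  partialFst_eq (by fun_prop) (((hasDerivAt_fst hF).const_mul a).fun_add
    ((hasDerivAt_fst hG).const_mul b))

theorem partialSnd_const_mul_add {F G : ℝ × ℝ → ℝ} {p : ℝ × ℝ} (hF : DifferentiableAt ℝ F p)
    (hG : DifferentiableAt ℝ G p) (a b : ℝ) :
    partialSnd (fun q => a * F q + b * G q) p = a * partialSnd F p + b * partialSnd G p :=
  partialSnd_eq (by fun_prop) (((hasDerivAt_snd hF).const_mul a).fun_add
    ((hasDerivAt_snd hG).const_mul b))

theorem continuous_partialFst {F : ℝ × ℝ → ℝ} (hF : ContDiff ℝ 1 F) : Continuous (partialFst F) :=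
  (hF.continuous_fderiv one_ne_zero).clm_apply continuous_const

theorem continuous_partialSnd {F : ℝ × ℝ → ℝ} (hF : ContDiff ℝ 1 F) : Continuous (partialSnd F) :=
  (hF.continuous_fderiv one_ne_zero).clm_apply continuous_const

/-- Near `c` the map is `φ⁻ x + φ⁺ y`, all in one copy of the space of `Q`-points, so `(φ⁻ + τξ) x +
(φ⁺ + τξ) y` is an admissible competitor. With `κ` the inner product of `x` and `y`, the first
variation of its energy is `2(1 + κ)` times the displayed integral. -/
theorem IsDirMinimizer.integral_sideSign_eq_zero (hv : IsDirMinimizer v) (hvm : Measurable v)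
    (hg : IsPolarCurve g s) (hvp : ∀ p, v (polar p) = (g p.2).scale (Real.exp (α * p.1)))
    (hα : 0 < α) {β c δ : ℝ} (hβ : 0 ≤ β) (hδ : 0 < δ) (hδπ : δ ≤ Real.pi / α) (hδ1 : δ ≤ 1)
    (hs : ∀ᵐ y, s y ^ 2 = (α * β * Real.cos (α * (y - c))) ^ 2)
    {x y : Fin Q → EuclideanSpace ℝ (Fin n)} (hx : ∑ i, ‖x i‖ ^ 2 = 1) (hy : ∑ i, ‖y i‖ ^ 2 = 1)
    (hxy : 0 ≤ ∑ i, inner ℝ (x i) (y i)) {ε : ℤˣ}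
    (hl : ∀ z ∈ Icc (c - Real.pi / α) c, g z
      = (SpecialQPoint.mk (QPoint.ofTuple x) ε).scale (-(β * Real.sin (α * (z - c)))))
    (hr : ∀ z ∈ Icc c (c + Real.pi / α), g z
      = (SpecialQPoint.mk (QPoint.ofTuple y) ε).scale (β * Real.sin (α * (z - c))))
    {ξ : ℝ × ℝ → ℝ} (hξ : ContDiff ℝ 1 ξ) {K : Set (ℝ × ℝ)} (hK : IsCompact K)
    (hKR : K ⊆ Ioo (-1) 1 ×ˢ Ioo (c - δ) (c + δ)) (hξK : ∀ p ∉ K, ξ p = 0) :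
    ∫ p in Ioo (-1 : ℝ) 1 ×ˢ Ioo (c - δ) (c + δ), sideSign c p.2
      * (partialFst (sineWave α β c) p * partialFst ξ p
        + partialSnd (sineWave α β c) p * partialSnd ξ p) = 0 := by
  set φ := sineWave α β c with hφ
  set κ := ∑ i, inner ℝ (x i) (y i) with hκ
  set R := Ioo (-1 : ℝ) 1 ×ˢ Ioo (c - δ) (c + δ) with hR
  have hφd : ContDiff ℝ 1 φ := contDiff_sineWave (m := 1)
  have hφc := hφd.continuous
  have hξc := hξ.continuous
  have d1 := continuous_partialFst hφd
  have d2 := continuous_partialSnd hφd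
  have d3 := continuous_partialFst hξ
  have d4 := continuous_partialSnd hξ
  have hrect : ∀ {f : ℝ × ℝ → ℝ}, Continuous f → IntegrableOn f R := fun hf =>
    (hf.continuousOn.integrableOn_compact (isCompact_Icc.prod isCompact_Icc)).mono_set
      (prod_mono Ioo_subset_Icc_self Ioo_subset_Icc_self)
  have hRm : MeasurableSet R := measurableSet_Ioo.prod measurableSet_Ioo
  let σ : ℝ × ℝ → ℝ := fun p => sideSign c p.2
  have hσm : Measurable σ := (measurable_sideSign c).comp measurable_snd
  have hσ2 : ∀ p, σ p ^ 2 = 1 := fun p => sideSign_sq c p.2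
  have hrectσ : ∀ {f : ℝ × ℝ → ℝ}, Continuous f → IntegrableOn (fun p => σ p * f p) R := by
    intro f hf
    refine Integrable.mono (hrect hf) (hσm.aestronglyMeasurable.mul hf.aestronglyMeasurable)
      (Eventually.of_forall fun p => ?_)
    rw [norm_mul, Real.norm_eq_abs (σ p), ← Real.sqrt_sq_eq_abs, hσ2, Real.sqrt_one, one_mul]
  let L : ℝ × ℝ → ℝ := fun p => (1 + κ) * (2 * (σ p * (partialFst φ p * partialFst ξ p
    + partialSnd φ p * partialSnd ξ p)))
  let N : ℝ × ℝ → ℝ := fun p => 2 * (1 + κ) * (partialFst ξ p ^ 2 + partialSnd ξ p ^ 2)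
  let B : ℝ × ℝ → ℝ := fun p => partialFst φ p ^ 2 + partialSnd φ p ^ 2
  have hLi : IntegrableOn L R := ((hrectσ (by fun_prop)).const_mul 2).const_mul (1 + κ)
  have hNi : IntegrableOn N R := hrect (by fun_prop)
  have hBi : IntegrableOn B R := hrect (by fun_prop)
  have hsplit : ∀ p : ℝ × ℝ, |p.2 - c| ≤ δ →
      (p.2 ≤ c ∧ p.2 ∈ Icc (c - Real.pi / α) c ∧ φ p ≤ 0) ∨
      (c ≤ p.2 ∧ p.2 ∈ Icc c (c + Real.pi / α) ∧ 0 ≤ φ p) := by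
    intro p hp
    have h1 := abs_le.1 hp
    rcases le_total p.2 c with h | h
    · have h2 : p.2 ∈ Icc (c - Real.pi / α) c := ⟨by linarith, h⟩
      exact Or.inl ⟨h, h2, sineWave_nonpos hα hβ h2⟩
    · have h2 : p.2 ∈ Icc c (c + Real.pi / α) := ⟨h, by linarith⟩
      exact Or.inr ⟨h, h2, sineWave_nonneg hα hβ h2⟩
  obtain ⟨Lφ, hLφ0, hLφ⟩ := exists_lipschitz_rect_of_contDiff hφd (-1) 1 (c - δ) (c + δ)
  obtain ⟨Lξ, hLξ0, hLξ⟩ := exists_lipschitz_rect_of_contDiff hξ (-1) 1 (c - δ) (c + δ)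
  have key : ∀ τ : ℝ, |τ| < 1 → 0 ≤ τ * (∫ p in R, L p) + τ ^ 2 * ∫ p in R, N p := by
    intro τ hτ
    -- Both coefficients are raised by the same `τξ`. Either sign of `τ` is allowed, since
    -- combinations with negative coefficients are also `Q`-points of the sign `ε`.
    let A : ℝ × ℝ → ℝ := fun p => max (-φ p) 0 + τ * ξ p
    let A' : ℝ × ℝ → ℝ := fun p => max (φ p) 0 + τ * ξ p
    let V : ℝ × ℝ → SpecialQPoint Q n := fun p =>
      SpecialQPoint.mk (QPoint.ofTuple fun i => A p • x i + A' p • y i) ε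
    -- The formula is valid only near `c`. Continuing by the original map makes `W` globally
    -- continuous, because `ξ` vanishes on the seam `|p.2 - c| = δ`.
    let W : ℝ × ℝ → SpecialQPoint Q n := fun p =>
      if |p.2 - c| ≤ δ then V p else (g p.2).scale (Real.exp (α * p.1))
    have hVd : ∀ p q, dist (V p) (V q) ^ 2 ≤ (A p - A q) ^ 2 + (A' p - A' q) ^ 2
        + 2 * κ * (A p - A q) * (A' p - A' q) := fun p q =>
      SpecialQPoint.dist_combination_sq_le hx hy ε _ _ _ _
    have hAc : Continuous A := (hφc.neg.max continuous_const).add (hξc.const_mul τ)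
    have hAc' : Continuous A' := (hφc.max continuous_const).add (hξc.const_mul τ)
    have hVc : Continuous V := by
      refine continuous_iff_continuousAt.2 fun q => ?_
      rw [ContinuousAt, tendsto_iff_dist_tendsto_zero]
      have ht : Tendsto (fun p => √((A p - A q) ^ 2 + (A' p - A' q) ^ 2
          + 2 * κ * (A p - A q) * (A' p - A' q))) (𝓝 q) (𝓝 0) := by
        have : Continuous fun p => √((A p - A q) ^ 2 + (A' p - A' q) ^ 2
          + 2 * κ * (A p - A q) * (A' p - A' q)) := by fun_prop
        simpa using this.tendsto q
      exact squeeze_zero (fun _ => dist_nonneg) (fun p => Real.le_sqrt_of_sq_le (hVd p q)) ht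
    have hVg : ∀ p : ℝ × ℝ, |p.2 - c| ≤ δ → ξ p = 0 →
        V p = (g p.2).scale (Real.exp (α * p.1)) := by
      intro p hp h0
      simp only [V, A, A', h0, mul_zero, add_zero]
      rcases hsplit p hp with ⟨-, h1, h2⟩ | ⟨-, h1, h2⟩
      · rw [hl _ h1, max_eq_left (by linarith), max_eq_right h2, SpecialQPoint.scale_scale,
          SpecialQPoint.scale_mk, QPoint.scale_ofTuple]
        simp only [zero_smul, add_zero, hφ, sineWave, mul_neg]
      · rw [hr _ h1, max_eq_right (by linarith), max_eq_left h2, SpecialQPoint.scale_scale,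
          SpecialQPoint.scale_mk, QPoint.scale_ofTuple]
        simp only [zero_smul, zero_add, hφ, sineWave]
    have hWc : Continuous W := by
      refine Continuous.if_le hVc (SpecialQPoint.continuous_scale_comp
        (hg.speed.continuous.comp continuous_snd) (by fun_prop) fun p => (Real.exp_pos _).le)
        (by fun_prop) continuous_const fun p hp => hVg p hp.le (hξK p fun hpK => ?_)
      have h1 := (hKR hpK).2
      have h2 : |p.2 - c| < δ := abs_lt.2 ⟨by linarith [h1.1], by linarith [h1.2]⟩
      exact h2.ne hp
    have hWV : ∀ p : ℝ × ℝ, p.2 ∈ Icc (c - δ) (c + δ) → W p = V p := fun p hp =>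
      if_pos (abs_le.2 ⟨by linarith [hp.1], by linarith [hp.2]⟩)
    have hWl : ∀ p ∈ Icc (-1 : ℝ) 1 ×ˢ Icc (c - δ) (c + δ),
        ∀ q ∈ Icc (-1 : ℝ) 1 ×ˢ Icc (c - δ) (c + δ),
        dist (W p) (W q) ≤ ((2 + 2 * κ) * (Lφ + Lξ)) * dist p q := by
      intro p hp q hq
      rw [hWV p hp.2, hWV q hq.2]
      have hdpq : 0 ≤ dist p q := dist_nonneg
      have hξb : |τ * ξ p - τ * ξ q| ≤ Lξ * dist p q := by
        rw [← mul_sub, abs_mul]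
        calc _ ≤ 1 * |ξ p - ξ q| := mul_le_mul_of_nonneg_right hτ.le (abs_nonneg _)
          _ ≤ _ := by rw [one_mul]; exact hLξ p hp q hq
      have hb1 : |A p - A q| ≤ (Lφ + Lξ) * dist p q := by
        have h1 := abs_max_sub_max_le_abs (-φ p) (-φ q) 0
        have h2 := hLφ p hp q hq
        rw [neg_sub_neg, abs_sub_comm (φ q)] at h1
        calc _ = |(max (-φ p) 0 - max (-φ q) 0) + (τ * ξ p - τ * ξ q)| := by
              simp only [A]; ring_nf
          _ ≤ _ := (abs_add_le _ _).trans (by linarith)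
      have hb2 : |A' p - A' q| ≤ (Lφ + Lξ) * dist p q := by
        have h1 := abs_max_sub_max_le_abs (φ p) (φ q) 0
        have h2 := hLφ p hp q hq
        calc _ = |(max (φ p) 0 - max (φ q) 0) + (τ * ξ p - τ * ξ q)| := by
              simp only [A']; ring_nf
          _ ≤ _ := (abs_add_le _ _).trans (by linarith)
      set M := (Lφ + Lξ) * dist p q
      have hM0 : 0 ≤ M := (abs_nonneg _).trans hb1
      have h3 : (A p - A q) * (A' p - A' q) ≤ M * M :=
        (le_abs_self _).trans (by rw [abs_mul]; exact mul_le_mul hb1 hb2 (abs_nonneg _) hM0)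
      have h4 := sq_le_sq' (abs_le.1 hb1).1 (abs_le.1 hb1).2
      have h5 := sq_le_sq' (abs_le.1 hb2).1 (abs_le.1 hb2).2
      have h6 := mul_le_mul_of_nonneg_left h3 hxy
      have h7 : dist (V p) (V q) ^ 2 ≤ ((2 + 2 * κ) * M) ^ 2 := by
        have h8 : 0 ≤ κ * M ^ 2 := mul_nonneg hxy (sq_nonneg _)
        have h9 : 0 ≤ κ ^ 2 * M ^ 2 := by positivity
        have := hVd p q
        nlinarith
      rw [mul_assoc]
      exact le_of_sq_le_sq h7 (mul_nonneg (by linarith) hM0)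
    have hL0 : 0 ≤ (2 + 2 * κ) * (Lφ + Lξ) := mul_nonneg (by linarith) (by linarith)
    have hW := IsRectRegular.of_dist_le hL0 hWc hWl
    let P1 : ℝ × ℝ → ℝ := fun p => σ p * partialFst φ p + τ * partialFst ξ p
    let P2 : ℝ × ℝ → ℝ := fun p => σ p * partialSnd φ p + τ * partialSnd ξ p
    let q1 : ℝ × ℝ → ℝ := fun p => partialFst φ p ^ 2
      + (2 * τ * (1 + κ)) * (σ p * (partialFst φ p * partialFst ξ p))
      + τ ^ 2 * (2 + 2 * κ) * partialFst ξ p ^ 2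
    let q2 : ℝ × ℝ → ℝ := fun p => σ p * (τ * (1 + κ) * (partialFst φ p * partialSnd ξ p
        + partialSnd φ p * partialFst ξ p))
      + (partialFst φ p * partialSnd φ p
        + τ ^ 2 * (2 + 2 * κ) * (partialFst ξ p * partialSnd ξ p))
    let q3 : ℝ × ℝ → ℝ := fun p => partialSnd φ p ^ 2
      + (2 * τ * (1 + κ)) * (σ p * (partialSnd φ p * partialSnd ξ p))
      + τ ^ 2 * (2 + 2 * κ) * partialSnd ξ p ^ 2
    have hspeed : ∀ T, ∀ᵐ p ∂(volume : Measure (ℝ × ℝ)).restrict R, ∀ v v' : ℝ,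
        (IsRectRegular.dFst (fun p => dist (W p) T) p * v
          + IsRectRegular.dSnd (fun p => dist (W p) T) p * v') ^ 2
          ≤ q1 p * v ^ 2 + 2 * q2 p * v * v' + q3 p * v' ^ 2 := by
      intro T
      have hd := ae_differentiableAt_of_lipschitz_rect (F := fun p => dist (W p) T) hL0
        fun p hp q hq => (abs_dist_sub_le _ _ _).trans (hWl p hp q hq)
      -- Off the null line `y = c` one of `φ⁺`, `φ⁻` is locally zero and the other is locally `± φ`,
      -- so both coefficients are smooth there.
      have hne : ∀ᵐ z : ℝ, z ≠ c := by
        simp [ae_iff]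
      filter_upwards [hd, ae_restrict_mem hRm, ae_restrict_snd hne R] with p hp hpR hpc
      have hφp := hφd.differentiable one_ne_zero p
      have hξp := hξ.differentiable one_ne_zero p
      refine sq_deriv_dist_le (fun _ => hp) fun v v' => ?_
      have hnhd : ∀ᶠ q : ℝ × ℝ in 𝓝 p, q.2 ∈ Icc (c - δ) (c + δ) :=
        continuous_snd.continuousAt.eventually (Icc_mem_nhds hpR.2.1 hpR.2.2)
      rcases lt_or_gt_of_ne hpc with hlt | hlt
      · have hW1 : W =ᶠ[𝓝 p] fun q => SpecialQPoint.mk (QPoint.ofTuple fun i =>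
            (((-1) * φ q + τ * ξ q) • x i + (0 * φ q + τ * ξ q) • y i)) ε := by
          filter_upwards [hnhd, continuous_snd.continuousAt.eventually (gt_mem_nhds hlt)]
            with q hq1 hq2
          have hq3 : φ q ≤ 0 := by
            rcases hsplit q (abs_le.2 ⟨by linarith [hq1.1], by linarith [hq1.2]⟩) with h | h
            · exact h.2.2
            · exact absurd h.1 (not_le.2 hq2)
          rw [hWV q hq1]
          simp only [V, A, A', max_eq_left (neg_nonneg.2 hq3), max_eq_right hq3, neg_one_mul,
            zero_mul]
        obtain ⟨E, hE, hE'⟩ := SpecialQPoint.exists_tendsto_dist_combination hx hy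
          (A := fun q => (-1) * φ q + τ * ξ q) (B := fun q => 0 * φ q + τ * ξ q)
          (by fun_prop) (by fun_prop) hW1 v v'
        refine ⟨E, ?_, hE'⟩
        rw [partialFst_const_mul_add hφp hξp, partialFst_const_mul_add hφp hξp,
          partialSnd_const_mul_add hφp hξp, partialSnd_const_mul_add hφp hξp] at hE
        convert hE using 2
        simp only [q1, q2, q3, σ, sideSign, if_neg (not_lt.2 hlt.le)]
        ring
      · have hW1 : W =ᶠ[𝓝 p] fun q => SpecialQPoint.mk (QPoint.ofTuple fun i =>
            ((0 * φ q + τ * ξ q) • x i + (1 * φ q + τ * ξ q) • y i)) ε := by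
          filter_upwards [hnhd, continuous_snd.continuousAt.eventually (lt_mem_nhds hlt)]
            with q hq1 hq2
          have hq3 : 0 ≤ φ q := by
            rcases hsplit q (abs_le.2 ⟨by linarith [hq1.1], by linarith [hq1.2]⟩) with h | h
            · exact absurd h.1 (not_le.2 hq2)
            · exact h.2.2
          rw [hWV q hq1]
          simp only [V, A, A', max_eq_right (neg_nonpos.2 hq3), max_eq_left hq3, one_mul,
            zero_mul]
        obtain ⟨E, hE, hE'⟩ := SpecialQPoint.exists_tendsto_dist_combination hx hy
          (A := fun q => 0 * φ q + τ * ξ q) (B := fun q => 1 * φ q + τ * ξ q)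
          (by fun_prop) (by fun_prop) hW1 v v'
        refine ⟨E, ?_, hE'⟩
        rw [partialFst_const_mul_add hφp hξp, partialFst_const_mul_add hφp hξp,
          partialSnd_const_mul_add hφp hξp, partialSnd_const_mul_add hφp hξp] at hE
        convert hE using 2
        simp only [q1, q2, q3, σ, sideSign, if_pos (show c < p.2 from hlt)]
        ring
    have hmin := hv.integral_le hvm hg hvp (isAngleShear_snd (-1) 1 (c - δ) (c + δ)) (by norm_num)
      (by linarith) (by linarith [Real.pi_gt_three]) hW (qa := q1) (qb := q2) (qc := q3)
      (((hrect (by fun_prop)).add ((hrectσ (by fun_prop)).const_mul (2 * τ * (1 + κ)))).add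
        (hrect (by fun_prop)))
      ((hrectσ (by fun_prop)).add (hrect (by fun_prop)))
      (((hrect (by fun_prop)).add ((hrectσ (by fun_prop)).const_mul (2 * τ * (1 + κ)))).add
        (hrect (by fun_prop)))
      hspeed hK hKR (fun p hp => ⟨rfl, by
        by_cases hpc : |p.2 - c| ≤ δ
        · rw [show W p = V p from if_pos hpc, hVg p hpc (hξK p hp)]
        · exact if_neg hpc⟩)
    have heq : ∀ p : ℝ × ℝ, q1 p * partialSnd Prod.snd p - 2 * q2 p * partialFst Prod.snd p
        + q3 p * ((1 + partialFst Prod.snd p ^ 2) / partialSnd Prod.snd p)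
        = B p + (τ * L p + τ ^ 2 * N p) := by
      intro p
      rw [partialSnd_snd, partialFst_snd]
      simp only [q1, q3, B, L, N]
      ring
    have hB : ∫ p in R, Real.exp (2 * α * p.1) * (α ^ 2 * (g p.2).size ^ 2 + s p.2 ^ 2)
        = ∫ p in R, B p := by
      refine integral_congr_ae ?_
      filter_upwards [ae_restrict_mem hRm, ae_restrict_snd hs R] with p hpR hps
      have hgs : (g p.2).size ^ 2 = (β * Real.sin (α * (p.2 - c))) ^ 2 := by
        rcases hsplit p (abs_le.2 ⟨by linarith [hpR.2.1], by linarith [hpR.2.2]⟩) with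
          ⟨-, h1, h2⟩ | ⟨-, h1, h2⟩
        · rw [hl _ h1, SpecialQPoint.scale_mk, QPoint.scale_ofTuple]
          simp only [SpecialQPoint.size, SpecialQPoint.toQPoint_mk]
          rw [QPoint.size_sq_ofTuple]
          simp only [norm_smul, mul_pow, Real.norm_eq_abs, sq_abs, ← Finset.mul_sum, hx]
          ring
        · rw [hr _ h1, SpecialQPoint.scale_mk, QPoint.scale_ofTuple]
          simp only [SpecialQPoint.size, SpecialQPoint.toQPoint_mk]
          rw [QPoint.size_sq_ofTuple]
          simp only [norm_smul, mul_pow, Real.norm_eq_abs, sq_abs, ← Finset.mul_sum, hy]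
          ring
      have e : Real.exp (2 * α * p.1) = Real.exp (α * p.1) ^ 2 := by
        rw [← Real.exp_nat_mul]
        congr 1
        push_cast
        ring
      simp only [B, hφ, partialFst_sineWave, partialSnd_sineWave]
      rw [hgs, hps, e]
      ring
    simp only [heq] at hmin
    rw [hB, integral_add_quadratic hBi hLi hNi] at hmin
    linarith
  -- The factor `1 + κ` is positive by the choice of the matching and can be divided out.
  have hfin := eq_zero_of_forall_small one_pos key
  simp only [L] at hfin
  rw [integral_const_mul, integral_const_mul] at hfin
  rcases mul_eq_zero.1 hfin with h | h
  · linarith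
  · linarith

end Alternation

end SpecialQMap

/-- With barycenter zero, `Q⟦p⟧` has `p = 0` or `Q = 0`, and in both cases its size vanishes. Thus
the sign of a nonzero centered point is well determined. -/
theorem QPoint.ne_diag_of_center_eq_zero {Q n : ℕ} {A : QPoint Q n} (h : A.center = 0)
    (hA : A.size ≠ 0) (p : EuclideanSpace ℝ (Fin n)) : A ≠ diag Q p := by
  rintro rfl
  have h1 := center_diag_smul (Q := Q) p
  rw [h, smul_zero, eq_comm, smul_eq_zero] at h1
  have h2 := size_sq_diag (Q := Q) p
  apply hA
  rw [← sq_eq_zero_iff, h2]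
  rcases h1 with h1 | h1 <;> simp [h1]

namespace SpecialQMap

section Sectors

variable {Q n : ℕ} {v : EuclideanSpace ℝ (Fin 2) → SpecialQPoint Q n}
  {α : ℝ} {g : ℝ → SpecialQPoint Q n} {s : ℝ → ℝ}

/-- The first variation computed above vanishes for every test function, while integrating by parts
across `c` leaves `-2αβ` times the values of the test function on the line `y = c`, weighted by `exp
(αt)`. A product bump with positive weighted mean contradicts this. -/
theorem IsDirMinimizer.not_same_sign (hv : IsDirMinimizer v) (hvm : Measurable v)
    (hg : IsPolarCurve g s) (hvp : ∀ p, v (polar p) = (g p.2).scale (Real.exp (α * p.1)))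
    (hα : 0 < α) {β c : ℝ} (hβ : 0 < β)
    (hs : ∀ᵐ y, s y ^ 2 = (α * β * Real.cos (α * (y - c))) ^ 2)
    {A A' : QPoint Q n} (hA : A.size = 1) (hA' : A'.size = 1) (hAc : A.center = 0) {ε : ℤˣ}
    (hl : ∀ z ∈ Icc (c - Real.pi / α) c, g z
      = (SpecialQPoint.mk A ε).scale (-(β * Real.sin (α * (z - c)))))
    (hr : ∀ z ∈ Icc c (c + Real.pi / α), g z
      = (SpecialQPoint.mk A' ε).scale (β * Real.sin (α * (z - c)))) : False := by
  obtain ⟨x, y, rfl, rfl, hxy⟩ := QPoint.exists_matching_nonneg A A' hAc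
  have hx : ∑ i, ‖x i‖ ^ 2 = 1 := by rw [← QPoint.size_sq_ofTuple, hA, one_pow]
  have hy : ∑ i, ‖y i‖ ^ 2 = 1 := by rw [← QPoint.size_sq_ofTuple, hA', one_pow]
  have hpos : 0 < min 1 (Real.pi / α) := lt_min one_pos (div_pos Real.pi_pos hα)
  set δ := min 1 (Real.pi / α)
  -- The first variation is linear in `sineWave`, so its weight is `exp (αt)` and not `exp (2αt)`.
  obtain ⟨χ, hχ⟩ := exists_isCutoff (α / 2)
  obtain ⟨ζ, hζ, hζc, hζs, hζ1⟩ := exists_smooth_bump c hpos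
  have h0 := hv.integral_sideSign_eq_zero hvm hg hvp hα hβ.le hpos (min_le_right _ _)
    (min_le_left _ _) hs hx hy hxy hl hr
    ((contDiff_cutProd hχ.contDiff hζ).of_le (by simp) : ContDiff ℝ 1 (cutProd χ ζ))
    (hχ.compact.isCompact.prod hζc.isCompact) (prod_mono hχ.support hζs)
    fun p hp => cutProd_eq_zero hp
  have hξd : Differentiable ℝ (cutProd χ ζ) :=
    (contDiff_cutProd hχ.contDiff hζ).differentiable (by simp)
  have hχ' := hχ.contDiff.continuous_deriv (by simp)
  have hζ' := hζ.continuous_deriv (by simp)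
  have hχc := hχ.contDiff.continuous
  have hζc' := hζ.continuous
  have hsm : Measurable fun p : ℝ × ℝ => sideSign c p.2 :=
    (measurable_sideSign c).comp measurable_snd
  have hInt : ∀ {f : ℝ × ℝ → ℝ}, Continuous f → IntegrableOn (fun p => sideSign c p.2 * f p)
      (Ioo (-1 : ℝ) 1 ×ˢ Ioo (c - δ) (c + δ)) := by
    intro f hf
    have hf' : IntegrableOn f (Ioo (-1 : ℝ) 1 ×ˢ Ioo (c - δ) (c + δ)) :=
      (hf.continuousOn.integrableOn_compact (isCompact_Icc.prod isCompact_Icc)).mono_set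
        (prod_mono Ioo_subset_Icc_self Ioo_subset_Icc_self)
    refine Integrable.mono hf' (hsm.aestronglyMeasurable.mul hf.aestronglyMeasurable)
      (Eventually.of_forall fun p => ?_)
    rw [norm_mul, Real.norm_eq_abs (sideSign c p.2), ← Real.sqrt_sq_eq_abs, sideSign_sq,
      Real.sqrt_one, one_mul]
  have hF : ∀ z, HasDerivAt (fun z => Real.cos (α * (z - c)) * ζ z)
      (Real.cos (α * (z - c)) * deriv ζ z - α * (Real.sin (α * (z - c)) * ζ z)) z := by
    intro z
    have he : HasDerivAt (fun y => α * (y - c)) α z := by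
      simpa using ((hasDerivAt_id z).sub_const c).const_mul α
    refine (he.cos.mul ((hζ.differentiable (by simp)) z).hasDerivAt).congr_deriv ?_
    ring
  have hζ0 : ∀ z, z ∉ Ioo (c - δ) (c + δ) → ζ z = 0 := fun z hz =>
    image_eq_zero_of_notMem_tsupport fun hcon => hz (hζs hcon)
  have hJ := integral_sideSign_mul_deriv (c := c) hpos hF (by fun_prop)
    (by rw [hζ0 _ (by simp), mul_zero]) (by rw [hζ0 _ (by simp), mul_zero])
  have hsplit : ∫ p in Ioo (-1 : ℝ) 1 ×ˢ Ioo (c - δ) (c + δ), sideSign c p.2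
      * (partialFst (sineWave α β c) p * partialFst (cutProd χ ζ) p
        + partialSnd (sineWave α β c) p * partialSnd (cutProd χ ζ) p)
      = (∫ t in Ioo (-1 : ℝ) 1, Real.exp (2 * (α / 2) * t) * deriv χ t)
        * (∫ z in Ioo (c - δ) (c + δ), sideSign c z * (α * β * (Real.sin (α * (z - c)) * ζ z)))
      + (∫ t in Ioo (-1 : ℝ) 1, Real.exp (2 * (α / 2) * t) * χ t)
        * (∫ z in Ioo (c - δ) (c + δ),
            sideSign c z * (α * β * (Real.cos (α * (z - c)) * deriv ζ z))) := by
    have e : ∀ t : ℝ, 2 * (α / 2) * t = α * t := fun t => by ring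
    simp only [e]
    rw [← setIntegral_rect_mul, ← setIntegral_rect_mul, ← integral_add]
    · refine integral_congr_ae (Eventually.of_forall fun p => ?_)
      simp only
      rw [partialFst_sineWave, partialSnd_sineWave,
        partialFst_eq (hξd p) (hasDerivAt_cutProd_fst hχ.contDiff p),
        partialSnd_eq (hξd p) (hasDerivAt_cutProd_snd hζ p)]
      ring
    · refine (hInt (f := fun p => Real.exp (α * p.1) * deriv χ p.1
        * (α * β * (Real.sin (α * (p.2 - c)) * ζ p.2))) (by fun_prop)).congr
        (Eventually.of_forall fun p => ?_)
      simp only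
      ring
    · refine (hInt (f := fun p => Real.exp (α * p.1) * χ p.1
        * (α * β * (Real.cos (α * (p.2 - c)) * deriv ζ p.2))) (by fun_prop)).congr
        (Eventually.of_forall fun p => ?_)
      simp only
      ring
  have hint1 : ∀ {f : ℝ → ℝ}, Continuous f → IntegrableOn (fun z => sideSign c z * f z)
      (Ioo (c - δ) (c + δ)) := by
    intro f hf
    refine Integrable.mono ((hf.integrableOn_Icc).mono_set Ioo_subset_Icc_self)
      ((measurable_sideSign c).aestronglyMeasurable.mul hf.aestronglyMeasurable)
      (Eventually.of_forall fun p => ?_)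
    rw [norm_mul, Real.norm_eq_abs (sideSign c p), ← Real.sqrt_sq_eq_abs, sideSign_sq,
      Real.sqrt_one, one_mul]
  -- The interior terms combine to the derivative of `cos (α(z - c)) ζ z`, as `φ` is harmonic. Only
  -- the jump at `c` survives.
  have hJ' : (∫ z in Ioo (c - δ) (c + δ),
        sideSign c z * (α * β * (Real.cos (α * (z - c)) * deriv ζ z)))
      - α * ∫ z in Ioo (c - δ) (c + δ), sideSign c z * (α * β * (Real.sin (α * (z - c)) * ζ z))
      = α * β * (-2) := by
    rw [← integral_const_mul, ← integral_sub (hint1 (by fun_prop))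
      ((hint1 (by fun_prop)).const_mul α)]
    have : α * β * (-2) = α * β * (-2 * (Real.cos (α * (c - c)) * ζ c)) := by
      rw [hζ1, sub_self, mul_zero, Real.cos_zero, mul_one, mul_one]
    rw [this, ← hJ, ← integral_const_mul]
    refine integral_congr_ae (Eventually.of_forall fun z => ?_)
    simp only
    ring
  rw [hsplit, hχ.integral_deriv] at h0
  have hI := hχ.integral_pos
  set I := ∫ t in Ioo (-1 : ℝ) 1, Real.exp (2 * (α / 2) * t) * χ t
  have h1 : I * (α * β * (-2)) = 0 := by
    rw [← hJ', ← h0]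
    ring
  have h2 : 0 < I * (α * β) := by positivity
  linarith

end Sectors

end SpecialQMap

/-! ### Radial arcs, sectors and the integrality of the exponent -/

theorem SpecialQPoint.scale_inv_size_eq {Q n : ℕ} {A B : SpecialQPoint Q n} (hA : 0 < A.size)
    (hB : 0 < B.size) (h : dist A B ≤ |A.size - B.size|) :
    A.scale A.size⁻¹ = B.scale B.size⁻¹ := by
  -- After normalization the radial part of the law of cosines is zero. Equality of the distance
  -- with the difference of the sizes kills the remaining part, so the two points lie on one ray.
  have h1 := dist_scale_sq A B (inv_nonneg.2 hA.le) (inv_nonneg.2 hB.le)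
  rw [inv_mul_cancel₀ hA.ne', inv_mul_cancel₀ hB.ne'] at h1
  have h2 : Dist.dist A B ^ 2 ≤ (A.size - B.size) ^ 2 := by
    rw [← sq_abs (A.size - B.size)]
    exact pow_le_pow_left₀ dist_nonneg h 2
  have h3 : A.size⁻¹ * B.size⁻¹ * (Dist.dist A B ^ 2 - (A.size - B.size) ^ 2) ≤ 0 :=
    mul_nonpos_of_nonneg_of_nonpos (by positivity) (by linarith)
  refine dist_le_zero.1 (le_of_sq_le_sq (b := 0) ?_ le_rfl)
  linarith

/-- The speed equals the absolute value of the derivative of the size, so the length from any point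
of the arc to its midpoint is the difference of the sizes. The curve therefore stays on the ray
through the midpoint. -/
theorem IsPolarCurve.exists_arc {Q n : ℕ} {g : ℝ → SpecialQPoint Q n} {s : ℝ → ℝ}
    (hg : IsPolarCurve g s) {α β c : ℝ} (hα : 0 < α) (hβ : 0 < β)
    (hs : ∀ᵐ y, s y ^ 2 = (α * β * Real.cos (α * (y - c))) ^ 2)
    (hh : ∀ y, (g y).size ^ 2 = (β * Real.sin (α * (y - c))) ^ 2) :
    ∃ C : SpecialQPoint Q n, C.size = 1 ∧
      ∀ z ∈ Icc c (c + Real.pi / α), g z = C.scale (β * Real.sin (α * (z - c))) := by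
  have hαπ : α * (Real.pi / α) = Real.pi := by field_simp
  have harg : ∀ z ∈ Icc c (c + Real.pi / α), 0 ≤ α * (z - c) ∧ α * (z - c) ≤ Real.pi := by
    intro z hz
    refine ⟨mul_nonneg hα.le (sub_nonneg.2 hz.1), ?_⟩
    rw [← hαπ]
    exact mul_le_mul_of_nonneg_left (by linarith [hz.2]) hα.le
  have hsize : ∀ z ∈ Icc c (c + Real.pi / α), (g z).size = β * Real.sin (α * (z - c)) := by
    intro z hz
    have h1 := harg z hz
    exact (sq_eq_sq₀ (SpecialQPoint.size_nonneg _) (mul_nonneg hβ.le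
      (Real.sin_nonneg_of_nonneg_of_le_pi h1.1 h1.2))).1 (hh z)
  have hder : ∀ y, HasDerivAt (fun y => β * Real.sin (α * (y - c)))
      (α * β * Real.cos (α * (y - c))) y := by
    intro y
    have he : HasDerivAt (fun y => α * (y - c)) α y := by
      simpa using ((hasDerivAt_id y).sub_const c).const_mul α
    refine (he.sin.const_mul β).congr_deriv ?_
    ring
  have hcc : Continuous fun y => α * β * Real.cos (α * (y - c)) := by fun_prop
  have hftc : ∀ a b, ∫ y in a..b, α * β * Real.cos (α * (y - c))
      = β * Real.sin (α * (b - c)) - β * Real.sin (α * (a - c)) := fun a b =>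
    intervalIntegral.integral_eq_sub_of_hasDerivAt (fun y _ => hder y)
      (hcc.intervalIntegrable _ _)
  -- The midpoint of the arc, where the size is maximal: the cosine has a constant sign on either
  -- half, so the speed integrates to a difference of sizes.
  set m := c + Real.pi / (2 * α) with hm
  have hαm : α * (m - c) = Real.pi / 2 := by
    rw [hm]
    field_simp
    ring
  have hπα : 0 < Real.pi / α := div_pos Real.pi_pos hα
  have hm2 : Real.pi / (2 * α) = Real.pi / α / 2 := by field_simp
  have hmI : m ∈ Icc c (c + Real.pi / α) := ⟨by rw [hm, hm2]; linarith, by rw [hm, hm2]; linarith⟩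
  have hsm : (g m).size = β := by
    rw [hsize m hmI, hαm, Real.sin_pi_div_two, mul_one]
  have hd : ∀ z ∈ Icc c (c + Real.pi / α), dist (g z) (g m) ≤ |(g z).size - (g m).size| := by
    intro z hz
    have hz' := harg z hz
    rw [hsize z hz, hsize m hmI]
    rcases le_total z m with hzm | hzm
    · refine (hg.speed.dist_le z m hzm).trans ?_
      rw [intervalIntegral.integral_congr_ae (g := fun y => α * β * Real.cos (α * (y - c))), hftc,
        abs_sub_comm]
      · exact le_abs_self _
      filter_upwards [hs] with y hy hyI
      rw [uIoc_of_le hzm] at hyI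
      refine (sq_eq_sq₀ (hg.speed.nonneg y) (mul_nonneg (by positivity)
        (Real.cos_nonneg_of_mem_Icc ⟨?_, ?_⟩))).1 hy
      · have : 0 ≤ α * (y - c) := mul_nonneg hα.le (by linarith [hz.1, hyI.1])
        linarith [Real.pi_pos]
      · rw [← hαm]
        exact mul_le_mul_of_nonneg_left (by linarith [hyI.2]) hα.le
    · rw [dist_comm]
      refine (hg.speed.dist_le m z hzm).trans ?_
      rw [intervalIntegral.integral_congr_ae (g := fun y => -(α * β * Real.cos (α * (y - c)))),
        intervalIntegral.integral_neg, hftc, neg_sub, abs_sub_comm]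
      · exact le_abs_self _
      filter_upwards [hs] with y hy hyI
      rw [uIoc_of_le hzm] at hyI
      refine (sq_eq_sq₀ (hg.speed.nonneg y) ?_).1 (hy.trans (neg_sq _).symm)
      rw [← mul_neg, ← Real.cos_pi_sub]
      have h1 : Real.pi / 2 ≤ α * (y - c) := by
        rw [← hαm]
        exact mul_le_mul_of_nonneg_left (by linarith [hyI.1]) hα.le
      have h2 : α * (y - c) ≤ Real.pi :=
        (mul_le_mul_of_nonneg_left (by linarith [hyI.2]) hα.le).trans hz'.2
      exact mul_nonneg (by positivity) (Real.cos_nonneg_of_mem_Icc ⟨by linarith, by linarith⟩)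
  refine ⟨(g m).scale (g m).size⁻¹, ?_, fun z hz => ?_⟩
  · rw [SpecialQPoint.size_scale _ (by rw [hsm]; positivity), hsm, inv_mul_cancel₀ hβ.ne']
  · rcases (SpecialQPoint.size_nonneg (g z)).eq_or_lt with h0 | h0
    · rw [← hsize z hz, ← h0, SpecialQPoint.scale_zero]
      · exact (SpecialQPoint.size_eq_zero_iff _).1 h0.symm
    · rw [← SpecialQPoint.scale_inv_size_eq h0 (by rw [hsm]; exact hβ) (hd z hz), ← hsize z hz,
        SpecialQPoint.scale_scale, mul_inv_cancel₀ h0.ne', SpecialQPoint.scale_one]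

theorem Int.units_eq_mul_neg_one_zpow {e : ℤ → ℤˣ} (h : ∀ j, e (j + 1) ≠ e j) (j : ℤ) :
    e j = e 0 * (-1) ^ j := by
  have hs : ∀ j, e (j + 1) = e j * (-1) := fun j => by
    rw [mul_neg_one]
    exact Int.units_ne_iff_eq_neg.1 (h j)
  induction j using Int.induction_on with
  | zero => simp
  | succ i ih => rw [hs, ih, mul_assoc, zpow_add_one]
  | pred i ih =>
    have h1 := hs (-(i : ℤ) - 1)
    rw [sub_add_cancel, ih] at h1
    rw [zpow_sub_one, ← mul_assoc, h1]
    simp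

namespace SpecialQMap

section Sectors

variable {Q n : ℕ} {v : EuclideanSpace ℝ (Fin 2) → SpecialQPoint Q n}
  {α : ℝ} {g : ℝ → SpecialQPoint Q n} {s : ℝ → ℝ}

/-- The squared size vanishes exactly at the multiples of `π/α` after `c`, and each arc is radial.
Periodicity gives `2α` arcs, and the alternation of their signs makes this number even. The factor
`(-1)^j` in front of the sine makes the scaling factor nonnegative on the `j`-th arc. -/
theorem IsDirMinimizer.exists_sectors (hv : IsDirMinimizer v) (hvm : Measurable v)
    (hg : IsPolarCurve g s) (hvp : ∀ p, v (polar p) = (g p.2).scale (Real.exp (α * p.1)))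
    (hα : 0 < α) (hper : ∀ θ, g (θ + 2 * Real.pi) = g θ) (hcen : ∀ θ, (g θ).center = 0)
    {c : ℝ} (hc : g c = SpecialQPoint.origin Q n) (hne : ∃ y, g y ≠ SpecialQPoint.origin Q n) :
    ∃ k : ℕ, 0 < k ∧ α = k ∧ ∃ β : ℝ, 0 < β ∧ ∃ (A : ℤ → QPoint Q n) (ε : ℤˣ),
      (∀ j, (A j).size = 1 ∧ (A j).center = 0) ∧
      ∀ j : ℤ, ∀ z ∈ Icc (c + j * (Real.pi / α)) (c + j * (Real.pi / α) + Real.pi / α),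
        g z = (SpecialQPoint.mk (A j) (ε * (-1) ^ j)).scale
          ((-1) ^ j * (β * Real.sin (α * (z - c)))) := by
  obtain ⟨K, hK⟩ := hv.exists_conservation hvm hg hvp
  have hsin := hv.size_sq_eq_sin_sq hvm hg hvp hα.ne' hK hc
  have hKpos : 0 < K := by
    obtain ⟨y, hy⟩ := hne
    by_contra hK0
    apply hy
    rw [← SpecialQPoint.size_eq_zero_iff, ← sq_eq_zero_iff]
    refine le_antisymm ?_ (sq_nonneg _)
    rw [hsin y]
    exact mul_nonpos_of_nonpos_of_nonneg (div_nonpos_of_nonpos_of_nonneg (not_lt.1 hK0)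
      (sq_nonneg α)) (sq_nonneg _)
  set β := √K / α with hβdef
  have hβ : 0 < β := div_pos (Real.sqrt_pos.2 hKpos) hα
  have hβK : β ^ 2 * α ^ 2 = K := by
    rw [hβdef, div_pow, Real.sq_sqrt hKpos.le]
    field_simp
  have hshift : ∀ (j : ℤ) z, α * (z - (c + j * (Real.pi / α))) = α * (z - c) - j * Real.pi :=
    fun j z => by field_simp; ring
  have hm1 : ∀ j : ℤ, ((-1 : ℝ) ^ j) ^ 2 = 1 := fun j => by
    rw [← zpow_natCast, ← zpow_mul, mul_comm, zpow_mul]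
    simp
  have hh : ∀ (j : ℤ) y, (g y).size ^ 2
      = (β * Real.sin (α * (y - (c + j * (Real.pi / α))))) ^ 2 := by
    intro j y
    rw [hsin y, hshift, Real.sin_sub_int_mul_pi, mul_pow, mul_pow, hm1, ← hβK]
    field_simp
  have hs : ∀ j : ℤ, ∀ᵐ y, s y ^ 2
      = (α * β * Real.cos (α * (y - (c + j * (Real.pi / α))))) ^ 2 := by
    intro j
    filter_upwards [hK] with y hy
    have h1 := hh j y
    have h2 := Real.sin_sq_add_cos_sq (α * (y - (c + j * (Real.pi / α))))
    rw [h1, ← hβK] at hy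
    linear_combination hy - β ^ 2 * α ^ 2 * h2
  choose C hC1 hC using fun j : ℤ => hg.exists_arc hα hβ (hs j) (hh j)
  choose A e hAe using fun j : ℤ => SpecialQPoint.exists_mk (C j)
  have hA1 : ∀ j, (A j).size = 1 := fun j => by
    have := hC1 j
    rwa [← hAe j] at this
  have hαπ : α * (Real.pi / α) = Real.pi := by field_simp
  have hπα : 0 < Real.pi / α := div_pos Real.pi_pos hα
  -- At the midpoints the factor is `β ≠ 0`, so barycenter and sign of the direction can be read off
  -- from `g`.
  have hmid : ∀ j : ℤ, g (c + j * (Real.pi / α) + Real.pi / α / 2) = (C j).scale β := by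
    intro j
    rw [hC j _ ⟨by linarith, by linarith⟩]
    have : α * (c + j * (Real.pi / α) + Real.pi / α / 2 - (c + j * (Real.pi / α)))
        = Real.pi / 2 := by
      rw [add_sub_cancel_left, ← mul_div_assoc, hαπ]
    rw [this, Real.sin_pi_div_two, mul_one]
  have hAc : ∀ j, (A j).center = 0 := fun j => by
    have h1 := hcen (c + j * (Real.pi / α) + Real.pi / α / 2)
    rw [hmid, SpecialQPoint.center_scale, smul_eq_zero, ← hAe j] at h1
    exact h1.resolve_left hβ.ne'
  have hnd : ∀ j p, A j ≠ QPoint.diag Q p := fun j =>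
    QPoint.ne_diag_of_center_eq_zero (hAc j) (by rw [hA1]; exact one_ne_zero)
  have halt : ∀ j, e (j + 1) ≠ e j := by
    intro j hej
    have hcj : c + ((j + 1 : ℤ) : ℝ) * (Real.pi / α) = c + j * (Real.pi / α) + Real.pi / α := by
      push_cast; ring
    refine hv.not_same_sign hvm hg hvp hα hβ (hs (j + 1)) (hA1 j) (hA1 (j + 1)) (hAc j) (ε := e j)
      (fun z hz => ?_) (fun z hz => ?_)
    · rw [hC j z ⟨by linarith [hz.1], by linarith [hz.2]⟩, hAe j]
      have : α * (z - (c + j * (Real.pi / α)))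
          = α * (z - (c + ((j + 1 : ℤ) : ℝ) * (Real.pi / α))) + Real.pi := by
        rw [hcj]
        linear_combination hαπ
      rw [this, Real.sin_add_pi, mul_neg]
    · rw [hC (j + 1) z hz, ← hej, hAe (j + 1)]
  have hee := Int.units_eq_mul_neg_one_zpow halt
  -- The zero at `c` recurs at `c + 2π`, hence `sin (2πα) = 0`.
  obtain ⟨N, hN⟩ : ∃ N : ℤ, (N : ℝ) = 2 * α := by
    have h1 : (g (c + 2 * Real.pi)).size = 0 := by
      rw [hper, hc]
      exact (SpecialQPoint.size_eq_zero_iff _).2 rfl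
    have h2 := hsin (c + 2 * Real.pi)
    rw [h1, add_sub_cancel_left, eq_comm, zero_pow two_ne_zero, mul_eq_zero] at h2
    have h3 := h2.resolve_left (by positivity)
    rw [sq_eq_zero_iff, Real.sin_eq_zero_iff] at h3
    obtain ⟨N, hN⟩ := h3
    exact ⟨N, mul_right_cancel₀ Real.pi_pos.ne' (by linarith)⟩
  have hNe : e N = e 0 := by
    have h1 := hmid 0
    have h2 := hmid N
    have e1 : c + (N : ℝ) * (Real.pi / α) + Real.pi / α / 2
        = c + ((0 : ℤ) : ℝ) * (Real.pi / α) + Real.pi / α / 2 + 2 * Real.pi := by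
      rw [hN]
      field_simp
      push_cast
      ring
    rw [e1, hper, h1] at h2
    have h3 := congrArg (SpecialQPoint.scale β⁻¹) h2
    rw [SpecialQPoint.scale_scale, SpecialQPoint.scale_scale, inv_mul_cancel₀ hβ.ne',
      SpecialQPoint.scale_one, SpecialQPoint.scale_one, ← hAe, ← hAe,
      SpecialQPoint.mk_eq_mk_iff] at h3
    rcases h3.2 with h | ⟨p, hp⟩
    · exact h.symm
    · exact absurd hp (hnd _ _)
  -- The arcs `0` and `N` differ by a full turn, so they carry the same sign; an odd number of
  -- alternations would reverse it.
  have hNeven : Even N := by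
    by_contra hodd
    rw [Int.not_even_iff_odd] at hodd
    obtain ⟨m, rfl⟩ := hodd
    have h1 := hee (2 * m + 1)
    rw [hNe, zpow_add_one, zpow_mul] at h1
    have h2 : ((-1 : ℤˣ) ^ (2 : ℤ)) = 1 := by decide
    rw [h2, one_zpow, one_mul, mul_neg_one] at h1
    exact absurd h1 (by rcases Int.units_eq_one_or (e 0) with h | h <;> rw [h] <;> decide)
  obtain ⟨m, hm⟩ := hNeven
  have hmα : (m : ℝ) = α := by
    rw [hm] at hN
    push_cast at hN
    linarith
  have hm0 : 0 < m := by
    rw [← hmα] at hα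
    exact_mod_cast hα
  obtain ⟨k, rfl⟩ := Int.eq_ofNat_of_zero_le hm0.le
  refine ⟨k, by exact_mod_cast hm0, by rw [← hmα]; simp, β, hβ, A, e 0,
    fun j => ⟨hA1 j, hAc j⟩, fun j z hz => ?_⟩
  rw [hC j z hz, hshift, Real.sin_sub_int_mul_pi, ← hee j, hAe]
  congr 1
  ring

end Sectors

end SpecialQMap

/-! ### The harmonic polynomial -/

/-- The identification of the Euclidean plane with `ℂ`. -/
def planeToComplex : EuclideanSpace ℝ (Fin 2) →L[ℝ] ℂ :=
  (Complex.orthonormalBasisOneI.repr.symm.toContinuousLinearEquiv :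
    EuclideanSpace ℝ (Fin 2) →L[ℝ] ℂ)

theorem planeToComplex_apply (x : EuclideanSpace ℝ (Fin 2)) :
    planeToComplex x = x 0 + x 1 * Complex.I := by
  simp [planeToComplex]

theorem planeToComplex_polar (p : ℝ × ℝ) :
    planeToComplex (polar p) = Complex.exp (p.1 + p.2 * Complex.I) := by
  rw [polar_eq_exp]
  simp [planeToComplex, Complex.equivRealProd_symm_apply]

/-- The function `Im (w z ^ k)` on the Euclidean plane. -/
def planeWave (w : ℂ) (k : ℕ) (x : EuclideanSpace ℝ (Fin 2)) : ℝ := (w * planeToComplex x ^ k).im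

theorem analyticAt_planeWave (w : ℂ) (k : ℕ) (x : EuclideanSpace ℝ (Fin 2)) :
    AnalyticAt ℝ (planeWave w k) x :=
  (Complex.imCLM.analyticAt _).comp (analyticAt_const.mul ((planeToComplex.analyticAt x).pow k))

theorem hasFDerivAt_mul_planeToComplex_pow (w : ℂ) (k : ℕ) (x : EuclideanSpace ℝ (Fin 2)) :
    HasFDerivAt (fun x => w * planeToComplex x ^ k)
      ((w * (k * planeToComplex x ^ (k - 1))) • planeToComplex) x := by
  refine (((planeToComplex.hasFDerivAt (x := x)).pow k).const_mul w).congr_fderiv ?_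
  ext v
  simp
  ring

/-- The derivative is multiplication by a complex number. The second derivatives in the directions
`1` and `I` then differ by the factor `I² = -1` and cancel in the Laplacian. -/
theorem harmonicOnNhd_planeWave (w : ℂ) (k : ℕ) :
    InnerProductSpace.HarmonicOnNhd (planeWave w k) univ := by
  suffices h : InnerProductSpace.HarmonicOnNhd (fun x => w * planeToComplex x ^ k) univ from
    h.comp_CLM Complex.imCLM
  have hL : ∀ x, Laplacian.laplacian (fun x => w * planeToComplex x ^ k) x = 0 := by
    intro x
    have h1 : fderiv ℝ (fun x => w * planeToComplex x ^ k)
        = fun x => ((w * k) * planeToComplex x ^ (k - 1)) • planeToComplex := by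
      funext y
      rw [(hasFDerivAt_mul_planeToComplex_pow w k y).fderiv, mul_assoc]
    have h2 := (hasFDerivAt_mul_planeToComplex_pow (w * k) (k - 1) x).smul_const planeToComplex
    rw [InnerProductSpace.laplacian_eq_iteratedFDeriv_orthonormalBasis _
      (EuclideanSpace.basisFun (Fin 2) ℝ)]
    simp only [iteratedFDeriv_two_apply, h1, h2.fderiv, Fin.sum_univ_two]
    simp [planeToComplex_apply]
    rw [mul_assoc _ Complex.I Complex.I, Complex.I_mul_I]
    ring
  refine fun x _ => ⟨?_, Eventually.of_forall hL⟩
  exact (contDiff_const.mul (planeToComplex.contDiff.pow k)).contDiffAt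

/-- Carry the real and imaginary parts of `w z^k` together through the induction, multiplying by `X
0 + X 1 · I`. -/
theorem exists_polynomial_planeWave (w : ℂ) (k : ℕ) : ∃ P : MvPolynomial (Fin 2) ℝ,
    P.IsHomogeneous k ∧ ∀ x : EuclideanSpace ℝ (Fin 2),
      MvPolynomial.eval (fun i => x i) P = planeWave w k x := by
  suffices h : ∃ A B : MvPolynomial (Fin 2) ℝ, A.IsHomogeneous k ∧ B.IsHomogeneous k ∧
      ∀ x : EuclideanSpace ℝ (Fin 2), (MvPolynomial.eval (fun i => x i) A : ℂ)
        + (MvPolynomial.eval (fun i => x i) B : ℝ) * Complex.I = w * planeToComplex x ^ k by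
    obtain ⟨A, B, -, hB, h⟩ := h
    exact ⟨B, hB, fun x => by rw [planeWave, ← h]; simp⟩
  induction k with
  | zero =>
    exact ⟨MvPolynomial.C w.re, MvPolynomial.C w.im, MvPolynomial.isHomogeneous_C _ _,
      MvPolynomial.isHomogeneous_C _ _, fun x => by simp⟩
  | succ k ih =>
    obtain ⟨A, B, hA, hB, h⟩ := ih
    have hX := fun i => MvPolynomial.isHomogeneous_X ℝ (σ := Fin 2) i
    refine ⟨MvPolynomial.X 0 * A - MvPolynomial.X 1 * B,
      MvPolynomial.X 0 * B + MvPolynomial.X 1 * A, ?_, ?_, fun x => ?_⟩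
    · rw [add_comm k]
      exact ((hX 0).mul hA).sub ((hX 1).mul hB)
    · rw [add_comm k]
      exact ((hX 0).mul hB).add ((hX 1).mul hA)
    · rw [pow_succ, ← mul_assoc, ← h, planeToComplex_apply]
      simp only [map_sub, map_add, map_mul, MvPolynomial.eval_X]
      push_cast
      linear_combination (-(MvPolynomial.eval (fun i => x i) B : ℝ) * (x 1 : ℂ)) * Complex.I_sq

/-- The phase `-kc` of the coefficient rotates the nodal lines to the angles at which `g` vanishes.
-/
theorem planeWave_polar (b c : ℝ) (k : ℕ) (p : ℝ × ℝ) :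
    planeWave (b * Complex.exp (-(k * c) * Complex.I)) k (polar p)
      = b * (Real.exp (k * p.1) * Real.sin (k * (p.2 - c))) := by
  have e : -(k * c) * Complex.I + k * (p.1 + p.2 * Complex.I)
      = ((k * p.1 : ℝ) : ℂ) + ((k * (p.2 - c) : ℝ) : ℂ) * Complex.I := by
    push_cast
    ring
  rw [planeWave, planeToComplex_polar, mul_assoc, ← Complex.exp_nat_mul, ← Complex.exp_add, e,
    Complex.im_ofReal_mul, Complex.exp_im]
  simp

theorem planeWave_zero (w : ℂ) {k : ℕ} (hk : 0 < k) : planeWave w k 0 = 0 := by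
  simp [planeWave, hk.ne']

/-! ### The signed size -/

namespace SpecialQPoint

variable {Q n : ℕ}

/-- `|A⁺| - |A⁻|` -/
def signedSize (A : SpecialQPoint Q n) : ℝ := (A.part 1).size - (A.part (-1)).size

theorem size_part_mk {S : QPoint Q n} (hS : S.center = 0) (ε δ : ℤˣ) :
    ((mk S ε).part δ).size = if ε = δ then S.size else 0 := by
  have hd : (QPoint.diag Q (0 : EuclideanSpace ℝ (Fin n))).size = 0 := by
    rw [← sq_eq_zero_iff, QPoint.size_sq_diag]
    simp
  unfold part
  by_cases h : ε = δ
  · rw [if_pos h, if_pos (hasSign_mk.2 (Or.inl h)), toQPoint_mk]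
  · rw [if_neg h]
    split_ifs with h'
    -- A point with both signs is of the form `Q⟦p⟧`; being centered, it has size zero.
    · obtain ⟨p, hp⟩ := (hasSign_mk.1 h').resolve_left h
      by_contra hne
      exact QPoint.ne_diag_of_center_eq_zero hS hne p hp
    · rw [center_mk, hS, hd]

theorem signedSize_mk {S : QPoint Q n} (hS : S.center = 0) (ε : ℤˣ) :
    (mk S ε).signedSize = ((ε : ℤ) : ℝ) * S.size := by
  rw [signedSize, size_part_mk hS, size_part_mk hS]
  rcases Int.units_eq_one_or ε with rfl | rfl
  · simp
  · rw [if_neg (by decide), if_pos rfl]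
    simp

theorem signedSize_scale {A : SpecialQPoint Q n} (hA : A.center = 0) {a : ℝ} (ha : 0 ≤ a) :
    (A.scale a).signedSize = a * A.signedSize := by
  obtain ⟨S, ε, rfl⟩ := exists_mk A
  rw [center_mk] at hA
  rw [scale_mk, signedSize_mk hA, signedSize_mk (by rw [QPoint.center_scale, hA, smul_zero]),
    QPoint.size_scale _ ha]
  ring

/-- For opposite signs and zero barycenters the squared distance is `|S|² + |T|²`, which controls
`(|S| + |T|)²`. Only continuity is needed, so the constant is not optimal. -/
theorem abs_signedSize_sub_le {A B : SpecialQPoint Q n} (hA : A.center = 0) (hB : B.center = 0) :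
    |A.signedSize - B.signedSize| ≤ 2 * Dist.dist A B := by
  obtain ⟨S, ε, rfl⟩ := exists_mk A
  obtain ⟨T, δ, rfl⟩ := exists_mk B
  have h0 : 0 ≤ Dist.dist (mk S ε) (mk T δ) := dist_nonneg
  rw [center_mk] at hA hB
  rw [signedSize_mk hA, signedSize_mk hB]
  by_cases h : ε = δ
  · subst h
    have h1 := abs_size_sub_le (mk S ε) (mk T ε)
    rw [← mul_sub, abs_mul]
    have h2 : |((ε : ℤ) : ℝ)| = 1 := by
      rcases Int.units_eq_one_or ε with rfl | rfl <;> simp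
    rw [h2, one_mul]
    refine h1.trans (by linarith)
  · have h1 : Dist.dist (mk S ε) (mk T δ) ^ 2 = S.size ^ 2 + T.size ^ 2 := by
      rw [← dist_eq, dist_mk_of_ne S T h, oppDist_sq, hA, inner_zero_left]
      ring
    have h2 : |((ε : ℤ) : ℝ) * S.size - ((δ : ℤ) : ℝ) * T.size| ≤ S.size + T.size := by
      have hs := S.size_nonneg
      have ht := T.size_nonneg
      rcases Int.units_eq_one_or ε with rfl | rfl <;>
      rcases Int.units_eq_one_or δ with rfl | rfl <;>
      simp <;> rw [abs_le] <;> constructor <;> linarith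
    refine h2.trans (le_of_sq_le_sq ?_ (by linarith))
    rw [mul_pow, h1]
    nlinarith [sq_nonneg (S.size - T.size), sq_nonneg S.size, sq_nonneg T.size]

theorem IsProper.signedSize_pos {A : SpecialQPoint Q n} {ε : ℤˣ} (h : A.IsProper ε)
    (hA : A.center = 0) : 0 < ((ε : ℤ) : ℝ) * A.signedSize := by
  obtain ⟨⟨S, rfl⟩, hd⟩ := h
  rw [center_mk] at hA
  rw [signedSize_mk hA, ← mul_assoc]
  have h1 : ((ε : ℤ) : ℝ) * ((ε : ℤ) : ℝ) = 1 := by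
    rcases Int.units_eq_one_or ε with rfl | rfl <;> simp
  rw [h1, one_mul]
  refine S.size_nonneg.lt_of_ne fun h0 => hd 0 ?_
  have h2 := (size_eq_zero_iff (mk S ε)).1 h0.symm
  rw [h2, origin, toQPoint_mk]

theorem eq_origin_of_signedSize_eq_zero {A : SpecialQPoint Q n} (hA : A.center = 0)
    (h : A.signedSize = 0) : A = origin Q n := by
  obtain ⟨S, ε, rfl⟩ := exists_mk A
  rw [center_mk] at hA
  rw [signedSize_mk hA] at h
  refine (size_eq_zero_iff _).1 ((mul_eq_zero.1 h).resolve_left ?_)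
  rcases Int.units_eq_one_or ε with rfl | rfl <;> simp

end SpecialQPoint

theorem Int.cast_units_neg_one_zpow (j : ℤ) : (((-1 : ℤˣ) ^ j : ℤˣ) : ℤ) = ((-1 : ℝ) ^ j) := by
  rcases Int.even_or_odd j with ⟨m, rfl⟩ | ⟨m, rfl⟩
  · rw [← two_mul, zpow_mul, zpow_mul]
    simp
  · rw [zpow_add_one, zpow_mul, zpow_add_one₀ (by norm_num), zpow_mul]
    simp

/-! ### Zeros of the signed size and the singular set -/

namespace SpecialQMap

variable {Q n : ℕ} {v : EuclideanSpace ℝ (Fin 2) → SpecialQPoint Q n}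

theorem center_eq_zero_of_ae (hv : Continuous v) (h : ∀ᵐ x, (v x).center = 0) (x) :
    (v x).center = 0 := by
  have hc : IsClosed {x | (v x).center = 0} := SpecialQPoint.isClosed_center_eq_zero.preimage hv
  have h1 : {x | (v x).center = 0} =ᵐ[volume] univ := eventuallyEq_univ.2 h
  exact eq_univ_iff_forall.1 ((hc.ae_eq_univ_iff_eq).1 h1) x

/-- The signed size is continuous and changes sign, and its zeros are zeros of the curve. -/
theorem exists_eq_origin {g : ℝ → SpecialQPoint Q n} (hg : Continuous g)
    (hcen : ∀ θ, (g θ).center = 0) (h1 : ∃ a, 0 < (g a).signedSize)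
    (h2 : ∃ b, (g b).signedSize < 0) : ∃ c, g c = SpecialQPoint.origin Q n := by
  have hc : Continuous fun θ => (g θ).signedSize := by
    refine continuous_iff_continuousAt.2 fun θ => ?_
    rw [ContinuousAt, tendsto_iff_dist_tendsto_zero]
    have h3 := ((tendsto_iff_dist_tendsto_zero.1 (hg.tendsto θ)).const_mul 2)
    rw [mul_zero] at h3
    exact squeeze_zero (fun _ => dist_nonneg)
      (fun y => SpecialQPoint.abs_signedSize_sub_le (hcen y) (hcen θ)) h3
  obtain ⟨a, ha⟩ := h1
  obtain ⟨b, hb⟩ := h2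
  obtain ⟨c, hc⟩ := mem_range_of_exists_le_of_exists_ge hc ⟨b, hb.le⟩ ⟨a, ha.le⟩
  exact ⟨c, SpecialQPoint.eq_origin_of_signedSize_eq_zero (hcen c) hc⟩

theorem exists_mem_Ico_sector (c : ℝ) {l : ℝ} (hl : 0 < l) (z : ℝ) :
    ∃ j : ℤ, z ∈ Ico (c + j * l) (c + j * l + l) := by
  refine ⟨⌊(z - c) / l⌋, ?_, ?_⟩
  · have h := (le_div_iff₀ hl).1 (Int.floor_le ((z - c) / l))
    linarith
  · have h := (div_lt_iff₀ hl).1 (Int.lt_floor_add_one ((z - c) / l))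
    linarith

section Sectors

variable {k : ℕ} {β c : ℝ} {A : ℤ → QPoint Q n} {ε : ℤˣ}

/-- A point off the zero set lies inside one open sector, where the sign is constant and the map is
a fixed tuple times `± f`. The sheets are analytic since `f` is, and as `f` has no zero there, two
of them coincide or are disjoint. -/
theorem isRegularPoint_of_ne_zero (hk : 0 < k) {f : EuclideanSpace ℝ (Fin 2) → ℝ}
    (hf : ∀ x, AnalyticAt ℝ f x) (hf0 : f 0 = 0)
    (hfp : ∀ p : ℝ × ℝ, f (polar p)
      = ((ε : ℤ) : ℝ) * (Real.exp (k * p.1) * (β * Real.sin (k * (p.2 - c)))))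
    (hβ : 0 < β)
    (hv : ∀ (j : ℤ) (p : ℝ × ℝ), p.2 ∈ Icc (c + j * (Real.pi / k)) (c + j * (Real.pi / k)
        + Real.pi / k) →
      v (polar p) = (SpecialQPoint.mk (A j) (ε * (-1) ^ j)).scale
        (Real.exp (k * p.1) * ((-1) ^ j * (β * Real.sin (k * (p.2 - c))))))
    {x : EuclideanSpace ℝ (Fin 2)} (hx : f x ≠ 0) : IsRegularPoint v x := by
  have hx0 : x ≠ 0 := fun h => hx (by rw [h, hf0])
  obtain ⟨p, rfl⟩ := exists_polar_eq hx0
  have hk' : (0 : ℝ) < k := by exact_mod_cast hk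
  have hl : 0 < Real.pi / k := div_pos Real.pi_pos hk'
  have hkl : (k : ℝ) * (Real.pi / k) = Real.pi := by field_simp
  have hε : ((ε : ℤ) : ℝ) ^ 2 = 1 := by
    rcases Int.units_eq_one_or ε with rfl | rfl <;> simp
  have hε0 : ((ε : ℤ) : ℝ) ≠ 0 := fun h => by rw [h] at hε; norm_num at hε
  obtain ⟨j, hj⟩ := exists_mem_Ico_sector c hl p.2
  have hj' : p.2 ∈ Ioo (c + j * (Real.pi / k)) (c + j * (Real.pi / k) + Real.pi / k) := by
    refine ⟨hj.1.lt_of_ne fun h => hx ?_, hj.2⟩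
    have : (k : ℝ) * (p.2 - c) = j * Real.pi := by
      rw [← h]
      linear_combination (j : ℝ) * hkl
    rw [hfp, this, Real.sin_int_mul_pi]
    simp
  obtain ⟨a, ha⟩ := QPoint.exists_ofTuple (A j)
  have hne : ∀ z ∈ Ioo (c + j * (Real.pi / k)) (c + j * (Real.pi / k) + Real.pi / k),
      Real.sin (k * (z - c)) ≠ 0 := by
    intro z hz h
    have e : (k : ℝ) * (z - c) = k * (z - (c + j * (Real.pi / k))) + j * Real.pi := by
      linear_combination (j : ℝ) * hkl
    rw [e, Real.sin_add_int_mul_pi] at h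
    have hpos : 0 < Real.sin (k * (z - (c + j * (Real.pi / k)))) := by
      refine Real.sin_pos_of_pos_of_lt_pi (mul_pos hk' (by linarith [hz.1])) ?_
      exact (mul_lt_mul_of_pos_left (by linarith [hz.2]) hk').trans_eq hkl
    exact (mul_ne_zero (zpow_ne_zero _ (by norm_num)) hpos.ne') h
  refine ⟨polar '' (univ ×ˢ Ioo (c + j * (Real.pi / k)) (c + j * (Real.pi / k) + Real.pi / k)),
    isOpenMap_polar _ (isOpen_univ.prod isOpen_Ioo), ⟨p, ⟨mem_univ _, hj'⟩, rfl⟩, ε * (-1) ^ j,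
    fun i y => (((ε : ℤ) : ℝ) * (-1) ^ j * f y) • a i, fun i y _ => ?_, ?_, fun i i' => ?_⟩
  · exact (analyticAt_const.mul (hf y)).smul analyticAt_const
  · rintro _ ⟨q, ⟨-, hq⟩, rfl⟩
    rw [hv j q (Ioo_subset_Icc_self hq), ← ha, SpecialQPoint.scale_mk, QPoint.scale_ofTuple]
    simp only [hfp]
    congr 2
    funext i
    congr 1
    linear_combination (-(Real.exp (k * q.1) * ((-1) ^ j * (β * Real.sin (k * (q.2 - c)))))) * hε
  · by_cases h : a i = a i'
    · exact Or.inl fun y _ => by simp only [h]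
    · refine Or.inr ?_
      rintro _ ⟨q, ⟨-, hq⟩, rfl⟩ heq
      refine h (smul_right_injective _ ?_ heq)
      rw [hfp]
      have := hne q.2 hq
      positivity

/-- In a regular neighborhood the sign is constant, so `f` would not change sign near the point. But
the zeros of the sine are simple, and `f` changes sign across each nodal line. -/
theorem not_isRegularPoint_of_eq_zero (hk : 0 < k) {f : EuclideanSpace ℝ (Fin 2) → ℝ}
    (hfp : ∀ p : ℝ × ℝ, f (polar p)
      = ((ε : ℤ) : ℝ) * (Real.exp (k * p.1) * (β * Real.sin (k * (p.2 - c)))))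
    (hβ : 0 < β) (hvc : ∀ x, (v x).center = 0) (hvf : ∀ x, (v x).signedSize = f x)
    {x : EuclideanSpace ℝ (Fin 2)} (hx : f x = 0) : ¬ IsRegularPoint v x := by
  rintro ⟨B, hB, hxB, δ, F, -, hF, -⟩
  have hk' : (0 : ℝ) < k := by exact_mod_cast hk
  -- At the origin polar coordinates are not available; a nearby point of the nodal ray `θ = c`
  -- takes its place.
  obtain ⟨p, hpB, hp0⟩ : ∃ p : ℝ × ℝ, polar p ∈ B ∧ Real.sin (k * (p.2 - c)) = 0 := by
    rcases eq_or_ne x 0 with rfl | hx0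
    · obtain ⟨r, hr, hrB⟩ := Metric.isOpen_iff.1 hB 0 hxB
      refine ⟨(Real.log (r / 2), c), hrB ?_, by simp⟩
      rw [mem_ball_zero_iff, norm_polar, Real.exp_log (by positivity)]
      linarith
    · obtain ⟨p, rfl⟩ := exists_polar_eq hx0
      refine ⟨p, hxB, ?_⟩
      have hε : ((ε : ℤ) : ℝ) ≠ 0 := by
        rcases Int.units_eq_one_or ε with rfl | rfl <;> simp
      rw [hfp] at hx
      have h1 := (mul_eq_zero.1 hx).resolve_left hε
      have h2 := (mul_eq_zero.1 h1).resolve_left (Real.exp_pos _).ne'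
      exact (mul_eq_zero.1 h2).resolve_left hβ.ne'
  -- The signed size multiplied by the constant sign is a size.
  have hsgn : ∀ y ∈ B, 0 ≤ ((δ : ℤ) : ℝ) * f y := by
    intro y hy
    have h1 := hvc y
    rw [hF y hy, SpecialQPoint.center_mk] at h1
    rw [← hvf, hF y hy, SpecialQPoint.signedSize_mk h1, ← mul_assoc]
    have h2 : ((δ : ℤ) : ℝ) * ((δ : ℤ) : ℝ) = 1 := by
      rcases Int.units_eq_one_or δ with rfl | rfl <;> simp
    rw [h2, one_mul]
    exact QPoint.size_nonneg _
  let C : ℝ := ((δ : ℤ) : ℝ) * (((ε : ℤ) : ℝ) * (Real.exp (k * p.1) * β))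
  have hC : C ≠ 0 := by
    have h1 : ((δ : ℤ) : ℝ) ≠ 0 := by
      rcases Int.units_eq_one_or δ with rfl | rfl <;> simp
    have h2 : ((ε : ℤ) : ℝ) ≠ 0 := by
      rcases Int.units_eq_one_or ε with rfl | rfl <;> simp
    positivity
  have hmin : IsLocalMin (fun z => C * Real.sin (k * (z - c))) p.2 := by
    have hcont : Continuous fun z : ℝ => polar (p.1, z) := continuous_polar.comp (by fun_prop)
    filter_upwards [hcont.continuousAt.eventually (hB.mem_nhds hpB)] with z hz
    rw [hp0, mul_zero]
    have h1 := hsgn _ hz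
    rw [hfp] at h1
    refine h1.trans_eq ?_
    simp only [C]
    ring
  have hd : HasDerivAt (fun z => C * Real.sin (k * (z - c)))
      (C * (Real.cos (k * (p.2 - c)) * k)) p.2 := by
    have he : HasDerivAt (fun y => (k : ℝ) * (y - c)) k p.2 := by
      simpa using ((hasDerivAt_id p.2).sub_const c).const_mul (k : ℝ)
    exact he.sin.const_mul C
  have h0 := hmin.hasDerivAt_eq_zero hd
  have hcos : Real.cos (k * (p.2 - c)) = 0 :=
    (mul_eq_zero.1 ((mul_eq_zero.1 h0).resolve_left hC)).resolve_right hk'.ne'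
  have := Real.sin_sq_add_cos_sq (k * (p.2 - c))
  rw [hp0, hcos] at this
  norm_num at this

end Sectors

end SpecialQMap

end

/-! ### The theorem -/

theorem theorem3p1 (Q n : ℕ) (α : ℝ) (u : EuclideanSpace ℝ (Fin 2) → SpecialQPoint Q n)
    (hmin : SpecialQMap.IsDirMinimizer u)
    (hhom : SpecialQMap.IsRadiallyHomogeneous u α)
    (hη : ∀ᵐ x, (u x).center = 0)
    (hne : ¬ ∀ᵐ x, u x = SpecialQPoint.origin Q n) :
    ∃ v : EuclideanSpace ℝ (Fin 2) → SpecialQPoint Q n,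
      SpecialQMap.IsContinuous v ∧ (∀ᵐ x, v x = u x) ∧
      ((SpecialQMap.region v 1).Nonempty → (SpecialQMap.region v (-1)).Nonempty →
        ∃ k : ℕ, 0 < k ∧ α = k ∧
          ∃ P : MvPolynomial (Fin 2) ℝ, P.IsHomogeneous k ∧
            InnerProductSpace.HarmonicOnNhd
              (fun x : EuclideanSpace ℝ (Fin 2) => MvPolynomial.eval (fun i => x i) P) univ ∧
            (∀ x, ((v x).part 1).size - ((v x).part (-1)).size
              = MvPolynomial.eval (fun i => x i) P) ∧
            {x : EuclideanSpace ℝ (Fin 2) | MvPolynomial.eval (fun i => x i) P = 0}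
              = SpecialQMap.singularSet v) := by
  obtain ⟨v, hvu, hvc, hvmin, hv⟩ := SpecialQMap.exists_representative hmin hhom hne
  refine ⟨v, fun x => ?_, hvu, fun ⟨x₁, h₁⟩ ⟨x₂, h₂⟩ => ?_⟩
  · exact tendsto_iff_dist_tendsto_zero.1 (hvc.tendsto x)
  have hcen : ∀ x, (v x).center = 0 := SpecialQMap.center_eq_zero_of_ae hvc (by
    filter_upwards [hvu, hη] with x hx hx'
    rw [hx, hx'])
  have hs₁ := SpecialQPoint.IsProper.signedSize_pos h₁ (hcen x₁)
  have hs₂ := SpecialQPoint.IsProper.signedSize_pos h₂ (hcen x₂)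
  simp only [Units.val_one, Int.cast_one, one_mul, Units.val_neg, Int.cast_neg, neg_mul,
    Left.neg_pos_iff] at hs₁ hs₂
  -- A constant map cannot meet both regions, so the exponent is positive.
  rcases hv with ⟨A, hA⟩ | ⟨hα, hv0, g, s, hg, hper, hvp⟩
  · rw [hA] at hs₁ hs₂
    exact absurd hs₁ hs₂.not_gt
  have horigin : (SpecialQPoint.origin Q n).signedSize = 0 := by
    have hc : (SpecialQPoint.origin Q n).center = 0 := by rw [← hv0, hcen]
    rw [SpecialQPoint.origin] at hc ⊢
    rw [SpecialQPoint.signedSize_mk (S := QPoint.diag Q 0) hc, mul_eq_zero]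
    exact Or.inr ((SpecialQPoint.size_eq_zero_iff (SpecialQPoint.origin Q n)).2 rfl)
  have hgcen : ∀ θ, (g θ).center = 0 := fun θ => by
    have := hcen (polar (0, θ))
    rwa [hvp, mul_zero, Real.exp_zero, SpecialQPoint.scale_one] at this
  have hsv : ∀ p, (v (polar p)).signedSize = Real.exp (α * p.1) * (g p.2).signedSize := fun p => by
    rw [hvp, SpecialQPoint.signedSize_scale (hgcen _) (Real.exp_pos _).le]
  have hx₁ : x₁ ≠ 0 := fun h => by rw [h, hv0, horigin] at hs₁; exact lt_irrefl _ hs₁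
  have hx₂ : x₂ ≠ 0 := fun h => by rw [h, hv0, horigin] at hs₂; exact lt_irrefl _ hs₂
  obtain ⟨p₁, rfl⟩ := exists_polar_eq hx₁
  obtain ⟨p₂, rfl⟩ := exists_polar_eq hx₂
  rw [hsv] at hs₁ hs₂
  have hg₁ : 0 < (g p₁.2).signedSize := pos_of_mul_pos_right hs₁ (Real.exp_pos _).le
  have hg₂ : (g p₂.2).signedSize < 0 := by
    by_contra hcon
    exact absurd hs₂ (not_lt.2 (mul_nonneg (Real.exp_pos _).le (not_lt.1 hcon)))
  obtain ⟨c, hc⟩ := SpecialQMap.exists_eq_origin hg.speed.continuous hgcen ⟨_, hg₁⟩ ⟨_, hg₂⟩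
  obtain ⟨k, hk, rfl, β, hβ, A, ε, hA, hsec⟩ := hvmin.exists_sectors hvc.measurable hg hvp hα hper
    hgcen hc ⟨p₁.2, fun h => by rw [h, horigin] at hg₁; exact lt_irrefl _ hg₁⟩
  have hk' : (0 : ℝ) < k := by exact_mod_cast hk
  have hl : 0 < Real.pi / k := div_pos Real.pi_pos hk'
  have hkl : (k : ℝ) * (Real.pi / k) = Real.pi := by field_simp
  obtain ⟨P, hP, hPe⟩ := exists_polynomial_planeWave
    (((((ε : ℤ) : ℝ) * β : ℝ) : ℂ) * Complex.exp (-(k * c) * Complex.I)) k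
  set f := planeWave (((((ε : ℤ) : ℝ) * β : ℝ) : ℂ) * Complex.exp (-(k * c) * Complex.I)) k with hf
  have hf0 : f 0 = 0 := planeWave_zero _ hk
  have hfp : ∀ p : ℝ × ℝ, f (polar p)
      = ((ε : ℤ) : ℝ) * (Real.exp (k * p.1) * (β * Real.sin (k * (p.2 - c)))) := fun p => by
    rw [hf, planeWave_polar]
    ring
  have hvsec : ∀ (j : ℤ) (p : ℝ × ℝ), p.2 ∈ Icc (c + j * (Real.pi / k)) (c + j * (Real.pi / k)
        + Real.pi / k) →
      v (polar p) = (SpecialQPoint.mk (A j) (ε * (-1) ^ j)).scale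
        (Real.exp (k * p.1) * ((-1) ^ j * (β * Real.sin (k * (p.2 - c))))) := fun j p hp => by
    rw [hvp, hsec j _ hp, SpecialQPoint.scale_scale]
  -- On the `j`-th sector the sign of the direction and the sign that makes the sine nonnegative are
  -- both alternating. Their product does not depend on `j`, and one formula holds on all sectors.
  have hvf : ∀ x, (v x).signedSize = f x := by
    intro x
    rcases eq_or_ne x 0 with rfl | hx
    · rw [hv0, horigin, hf0]
    · obtain ⟨p, rfl⟩ := exists_polar_eq hx
      obtain ⟨j, hj⟩ := SpecialQMap.exists_mem_Ico_sector c hl p.2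
      have e : (k : ℝ) * (p.2 - c) = k * (p.2 - (c + j * (Real.pi / k))) + j * Real.pi := by
        linear_combination (j : ℝ) * hkl
      have hm : ((-1 : ℝ) ^ j) * (-1) ^ j = 1 := by
        rw [← zpow_add₀ (by norm_num), ← two_mul, zpow_mul]
        simp
      have hn : 0 ≤ (-1 : ℝ) ^ j * (β * Real.sin (k * (p.2 - c))) := by
        rw [e, Real.sin_add_int_mul_pi]
        have h1 : 0 ≤ Real.sin (k * (p.2 - (c + j * (Real.pi / k)))) := by
          refine Real.sin_nonneg_of_nonneg_of_le_pi (mul_nonneg hk'.le (by linarith [hj.1])) ?_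
          exact (mul_le_mul_of_nonneg_left (by linarith [hj.2]) hk'.le).trans_eq hkl
        calc (0 : ℝ) ≤ β * Real.sin (k * (p.2 - (c + j * (Real.pi / k)))) := mul_nonneg hβ.le h1
          _ = _ := by linear_combination (-(β * Real.sin (k * (p.2 - (c + j * (Real.pi / k)))))) * hm
      rw [hvsec j p ⟨hj.1, hj.2.le⟩, SpecialQPoint.signedSize_scale (by exact (hA j).2)
        (mul_nonneg (Real.exp_pos _).le hn), SpecialQPoint.signedSize_mk (hA j).2, (hA j).1, hfp]
      rw [Units.val_mul, Int.cast_mul, Int.cast_units_neg_one_zpow]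
      linear_combination (Real.exp (k * p.1) * (β * Real.sin (k * (p.2 - c)))
        * ((ε : ℤ) : ℝ)) * hm
  refine ⟨k, hk, rfl, P, hP, ?_, fun x => ?_, ?_⟩
  · rw [show (fun x : EuclideanSpace ℝ (Fin 2) => MvPolynomial.eval (fun i => x i) P) = f from
      funext hPe]
    exact harmonicOnNhd_planeWave _ _
  · rw [hPe, ← hvf]
    rfl
  · ext x
    rw [mem_ofPred_eq, hPe]
    refine ⟨fun hx => SpecialQMap.not_isRegularPoint_of_eq_zero hk hfp hβ hcen hvf hx,
      fun hx => ?_⟩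
    by_contra hcon
    exact hx (SpecialQMap.isRegularPoint_of_ne_zero hk (analyticAt_planeWave _ _) hf0 hfp
      hβ hvsec hcon)
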